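/- Let $\varepsilon\in\{1,-1\}$, let $k\in(1/2,4/7)$, and let $\chi:\mathbb R\to\mathbb R$ be $C^\infty$ with $\chi(\xi)=0$ for $\xi<1$ and $\chi(\xi)=1$ for $\xi>2$. **The space.** $Z^k$ is the set of $z\in L^\infty(\mathbb R;\mathbb C)$ with $z(-\xi)=\overline{z(\xi)}$ for $\xi>0$, weakly differentiable on each open half-line, and with finite norm $$\|z\|_{Z^k}=\|(1+|\xi|^k)z\|_{L^\infty(\mathbb R)}+\|(1+|\xi|^{k+1})z'\|_{L^\infty(0,\infty)}+\|(1+|\xi|^{k+1})z'\|_{L^\infty(-\infty,0)} .$$ For $\gamma\in\mathbb C$ the modified weighted norm is $$|z|_{k,\gamma}=\||\eta|^{-1}(z-\gamma)\|_{L^\infty(0,1)}+\||\eta|^{k}z\|_{L^\infty(1,\infty)}+\|(1+|\eta|^{k+1})z'\|_{L^\infty(0,\infty)} .$$ **The operators.** Put $\Phi(\xi,\eta)=\eta\xi^2-\xi\eta^2+\tfrac14\eta^3$ and, as improper integrals, $$K(v)(\eta)=\int_{\mathbb R} e^{\frac{3i}{4}\eta\nu^2}v\!\left(\tfrac{\eta+\nu}2\right)v\!\left(\tfrac{\eta-\nu}2\right)d\nu,\qquad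 \tilde I(v)(\xi)=\frac12\int_{\mathbb R} e^{-3i\Phi(\xi,\eta)}\,\overline{v(\eta-\xi)}\,K(v)(\eta)\,d\eta ,$$ which is $e^{-i\xi^3}\iint_{\eta_1+\eta_2+\eta_3=\xi}e^{i(\eta_1^3+\eta_2^3+\eta_3^3)}v(\eta_1)v(\eta_2)\overline{v(-\eta_3)}\,d\eta_1d\eta_2$ in the variables $\eta=\eta_1+\eta_2$, $\nu=\eta_1-\eta_2$. For $c,\alpha\in\mathbb R$ let $$\Psi_{c,\alpha}(v)(\xi)=c+\frac{3i}{2\pi}\alpha-\frac{3i\varepsilon}{4\pi^2}\int_0^\xi\tilde I(v)(\eta)\,d\eta\quad(\xi>0),\qquad \Psi_{c,\alpha}(v)(\xi)=\overline{\Psi_{c,\alpha}(v)(-\xi)}\quad(\xi<0).$$ **The ansatz.** For $A\in\mathbb C$ let $$a=-\frac{3\varepsilon}{4\pi}|A|^2,\quad E=\pi|A|^2A,\quad F=\frac{i\pi}{\sqrt3}\,e^{-3ia\ln3}A^3,\quad B=\frac{9\varepsilon}{32\pi^2}F,$$ $$S_A(\xi)=\chi(\xi)e^{ia\ln\xi}\Bigl(A+Be^{2ia\ln\xi}\,\frac{e^{-\frac{8i}{9}\xi^3}}{\xi^3}\Bigr)\quad(\xi>0),\qquad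 S_A(-\xi)=\overline{S_A(\xi)} .$$ **The constants.** For $z\in Z^k$ let $$\mathcal I(A,z)=\int_0^1\tilde I(S_A+z)(\eta)\,d\eta+\int_1^\infty\Bigl(\tilde I(S_A+z)(\eta)-E\,\frac{e^{ia\ln\eta}}{\eta}\Bigr)d\eta$$ (the second integral is improper), and $$c(A,z)=\operatorname{Re}A-\frac{3\varepsilon}{4\pi^2}\operatorname{Im}\mathcal I(A,z),\qquad \alpha(A,z)=\frac{2\pi}{3}\operatorname{Im}A+\frac{\varepsilon}{2\pi}\operatorname{Re}\mathcal I(A,z).$$ **Theorem.** There is $r>0$ such that for all real $M>\|1-\chi(|\cdot|)\|_{Z^k}$ and $C>|1-\chi|_{k,1}$ there is $\epsilon_1>0$ such that the following holds for every $A\in\mathbb C$ with $|A|<\epsilon_1$. All the integrals above converge for $v=S_A+z$ with any $z\in Z^k$, and the map $$\tilde\Psi_A:\ z\mapsto\Psi_{c(A,z),\alpha(A,z)}(S_A+z)-S_A$$ has exactly one fixed point $z_A$ in the ball $\{z\in Z^k:\|z\|_{Z^k}\le r\}$. Moreover $\|z_A\|_{Z^k}\le M|A|$ and $$|z_A|_{k,\;c(A,z_A)+\frac{3i}{2\pi}\alpha(A,z_A)}\le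 C|A|,$$ with strict inequality in the last bound if $A\ne0$. Thus $v=S_A+z_A$ satisfies, for every $\xi>0$, $$v(\xi)=c(A,z_A)+\frac{3i}{2\pi}\alpha(A,z_A)-\frac{3i\varepsilon}{4\pi^2}\int_0^\xi\tilde I(v)(\eta)\,d\eta\qquad\text{and}\qquad v(-\xi)=\overline{v(\xi)} .$$ -/

import Mathlib

open Filter Topology MeasureTheory Set
open scoped ENNReal ComplexConjugate

noncomputable section

namespace SelfSimilar

/-! ### Improper integrals

The oscillatory integrals below do not converge absolutely; they are improper integrals, that is,
limits of integrals over bounded intervals whose two ends tend to infinity independently. -/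

/-- The improper integral of `f` over the real line converges. -/
def ImproperConverges (f : ℝ → ℂ) : Prop :=
  LocallyIntegrable f volume ∧
    ∃ l : ℂ, Tendsto (fun p : ℝ × ℝ => ∫ x in p.1..p.2, f x) (atBot ×ˢ atTop) (𝓝 l)

/-- The improper integral of `f` over the real line (meaningful if `ImproperConverges f`). -/
def improperIntegral (f : ℝ → ℂ) : ℂ :=
  limUnder (atBot ×ˢ atTop) (fun p : ℝ × ℝ => ∫ x in p.1..p.2, f x)

/-- The improper integral of `f` over `[b, ∞)` converges. -/
def ImproperConvergesFrom (b : ℝ) (f : ℝ → ℂ) : Prop :=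
  (∀ R : ℝ, b ≤ R → IntervalIntegrable f volume b R) ∧
    ∃ l : ℂ, Tendsto (fun R : ℝ => ∫ x in b..R, f x) atTop (𝓝 l)

/-- The improper integral of `f` over `[b, ∞)` (meaningful if `ImproperConvergesFrom b f`). -/
def improperIntegralFrom (b : ℝ) (f : ℝ → ℂ) : ℂ :=
  limUnder atTop (fun R : ℝ => ∫ x in b..R, f x)

/-! ### The trilinear operator

`triI f g h (ξ) = e^{-iξ³} ∬_{η₁+η₂+η₃=ξ} e^{i(η₁³+η₂³+η₃³)} f(η₁) g(η₂) conj(h(-η₃)) dη₁ dη₂`,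
written as an iterated integral in the variables `η = η₁ + η₂` and `ν = η₁ - η₂`. -/

/-- The phase `Φ(ξ, η)`. -/
def phase (ξ η : ℝ) : ℝ := η * ξ ^ 2 - ξ * η ^ 2 + η ^ 3 / 4

/-- The integrand of `opK`. -/
def integrandK (f g : ℝ → ℂ) (η ν : ℝ) : ℂ :=
  Complex.exp (((3 / 4 * η * ν ^ 2 : ℝ) : ℂ) * Complex.I) * f ((η + ν) / 2) * g ((η - ν) / 2)

/-- The bilinear operator `K(f, g)`. -/
def opK (f g : ℝ → ℂ) (η : ℝ) : ℂ := improperIntegral (integrandK f g η)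

/-- The integrand of `opJ`. -/
def integrandJ (f g : ℝ → ℂ) (ξ η : ℝ) : ℂ :=
  Complex.exp (((-3 * phase ξ η : ℝ) : ℂ) * Complex.I) * conj (f (η - ξ)) * g η

/-- The operator `J(f, g)`. -/
def opJ (f g : ℝ → ℂ) (ξ : ℝ) : ℂ := improperIntegral (integrandJ f g ξ)

/-- The trilinear operator `I(f, g, h)`. -/
def triI (f g h : ℝ → ℂ) (ξ : ℝ) : ℂ := (1 / 2 : ℂ) * opJ h (opK f g) ξ

/-- `Ĩ(v) = I(v, v, v)`. -/
def cubicI (v : ℝ → ℂ) : ℝ → ℂ := triI v v v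

/-- The map `Ψ_{c,α}`: the given formula on `ξ > 0`, extended to `ξ < 0` by conjugation. The value
at the single point `0` plays no role. -/
def Psi (ε c α : ℝ) (v : ℝ → ℂ) (ξ : ℝ) : ℂ :=
  let onPos : ℝ → ℂ := fun x =>
    (c : ℂ) + 3 * Complex.I / (2 * Real.pi) * α
      - 3 * Complex.I * ε / (4 * Real.pi ^ 2) * ∫ η in (0 : ℝ)..x, cubicI v η
  if 0 < ξ then onPos ξ else conj (onPos (-ξ))

/-! ### The ansatz -/

/-- `χ` is a smooth cut-off function, equal to `0` for `ξ < 1` and to `1` for `ξ > 2`. -/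
structure IsCutoff (χ : ℝ → ℝ) : Prop where
  smooth : ContDiff ℝ (⊤ : ℕ∞) χ
  eq_zero : ∀ ξ : ℝ, ξ < 1 → χ ξ = 0
  eq_one : ∀ ξ : ℝ, 2 < ξ → χ ξ = 1

/-- The real frequency `a = a(A)`. -/
def coefa (ε : ℝ) (A : ℂ) : ℝ := -(3 * ε / (4 * Real.pi)) * ‖A‖ ^ 2

/-- `e^{i s a ln|ξ|}`. -/
def logOsc (a s ξ : ℝ) : ℂ := Complex.exp (((s * a * Real.log |ξ| : ℝ) : ℂ) * Complex.I)

/-- `E(A) = π |A|² A`: the coefficient of `e^{ia ln ξ} / ξ` in the expansion of `Ĩ(S_A)` at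
`+∞`. -/
def coefE (A : ℂ) : ℂ := Real.pi * (‖A‖ : ℂ) ^ 2 * A

/-- `F(A) = (iπ/√3) e^{-3ia ln 3} A³`: the coefficient of `e^{3ia ln ξ} e^{-8iξ³/9} / ξ` in the
expansion of `Ĩ(S_A)` at `+∞` (contribution of the stationary point `η₁ = η₂ = η₃ = ξ/3`). -/
def coefF (ε : ℝ) (A : ℂ) : ℂ :=
  Complex.I * Real.pi / (Real.sqrt 3 : ℂ) * logOsc (coefa ε A) (-3) 3 * A ^ 3

/-- `B = B(A)`, fixed by the matching condition `3iβB = -(3iε/(4π²)) F` with `β = -8/9`, that is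
`B = (9ε/(32π²)) F`. -/
def coefB (ε : ℝ) (A : ℂ) : ℂ := 9 * ε / (32 * Real.pi ^ 2) * coefF ε A

/-- The ansatz `S_A`: the given formula on `ξ ≥ 0`, extended by conjugation. -/
def ansatz (ε : ℝ) (χ : ℝ → ℝ) (A : ℂ) (ξ : ℝ) : ℂ :=
  let onPos : ℝ → ℂ := fun x =>
    (χ x : ℂ) * logOsc (coefa ε A) 1 x *
      (A + coefB ε A * logOsc (coefa ε A) 2 x *
        (Complex.exp (((-(8 / 9) * x ^ 3 : ℝ) : ℂ) * Complex.I) / (x : ℂ) ^ 3))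
  if 0 ≤ ξ then onPos ξ else conj (onPos (-ξ))

/-! ### The constants `c(A, z)` and `α(A, z)` -/

/-- The integrand, on `[1, ∞)`, of the second integral in `𝓘(A, z)`. -/
def integrandTail (ε : ℝ) (χ : ℝ → ℝ) (A : ℂ) (z : ℝ → ℂ) (η : ℝ) : ℂ :=
  cubicI (ansatz ε χ A + z) η - coefE A * (logOsc (coefa ε A) 1 η / (|η| : ℝ))

/-- `𝓘(A, z)`. -/
def calI (ε : ℝ) (χ : ℝ → ℝ) (A : ℂ) (z : ℝ → ℂ) : ℂ :=
  (∫ η in (0 : ℝ)..1, cubicI (ansatz ε χ A + z) η)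
    + improperIntegralFrom 1 (integrandTail ε χ A z)

/-- `c(A, z)`. Together with `constAlpha` this says
`c + (3i/2π) α = A + (3iε/(4π²)) 𝓘(A, z)`. -/
def constC (ε : ℝ) (χ : ℝ → ℝ) (A : ℂ) (z : ℝ → ℂ) : ℝ :=
  A.re - 3 * ε / (4 * Real.pi ^ 2) * (calI ε χ A z).im

/-- `α(A, z)`. -/
def constAlpha (ε : ℝ) (χ : ℝ → ℝ) (A : ℂ) (z : ℝ → ℂ) : ℝ :=
  2 * Real.pi / 3 * A.im + ε / (2 * Real.pi) * (calI ε χ A z).re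

/-- `c(A, z) + (3i/2π) α(A, z)`. -/
def constZero (ε : ℝ) (χ : ℝ → ℝ) (A : ℂ) (z : ℝ → ℂ) : ℂ :=
  (constC ε χ A z : ℂ) + 3 * Complex.I / (2 * Real.pi) * (constAlpha ε χ A z : ℂ)

/-- The map `z ↦ Ψ_{c(A,z), α(A,z)}(S_A + z) - S_A`. -/
def PsiTilde (ε : ℝ) (χ : ℝ → ℝ) (A : ℂ) (z : ℝ → ℂ) (ξ : ℝ) : ℂ :=
  Psi ε (constC ε χ A z) (constAlpha ε χ A z) (ansatz ε χ A + z) ξ - ansatz ε χ A ξ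

/-- All integrals that enter `PsiTilde ε χ A z` converge. -/
structure Converges (ε : ℝ) (χ : ℝ → ℝ) (A : ℂ) (z : ℝ → ℂ) : Prop where
  convK : ∀ η : ℝ, η ≠ 0 →
    ImproperConverges (integrandK (ansatz ε χ A + z) (ansatz ε χ A + z) η)
  convJ : ∀ ξ : ℝ, 0 < ξ →
    ImproperConverges
      (integrandJ (ansatz ε χ A + z) (opK (ansatz ε χ A + z) (ansatz ε χ A + z)) ξ)
  integrable : ∀ ξ : ℝ, 0 < ξ → IntervalIntegrable (cubicI (ansatz ε χ A + z)) volume 0 ξ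
  convTail : ImproperConvergesFrom 1 (integrandTail ε χ A z)

/-! ### The space `Z^k` -/

/-- The norm of `Z^k`, with values in `[0, ∞]`. -/
def zNorm (k : ℝ) (z : ℝ → ℂ) : ℝ≥0∞ :=
  eLpNorm (fun ξ : ℝ => (1 + |ξ| ^ k) • z ξ) ⊤ volume
    + eLpNorm (fun ξ : ℝ => (1 + |ξ| ^ (k + 1)) • deriv z ξ) ⊤ (volume.restrict (Ioi 0))
    + eLpNorm (fun ξ : ℝ => (1 + |ξ| ^ (k + 1)) • deriv z ξ) ⊤ (volume.restrict (Iio 0))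

/-- The space `Z^k`. A class in `L^∞` whose weak derivatives on the two open half-lines are
bounded has exactly one representative, up to the value at `0`, that is locally Lipschitz on each
open half-line, and the classical derivative of this representative, which exists almost
everywhere, is the weak derivative. The elements of `Z^k` are given by these representatives; so two
of them are the same element if and only if they agree on `ξ ≠ 0`. -/
def Zspace (k : ℝ) : Set (ℝ → ℂ) :=
  {z | LocallyLipschitzOn (Ioi 0) z ∧ LocallyLipschitzOn (Iio 0) z ∧
    (∀ ξ : ℝ, 0 < ξ → z (-ξ) = conj (z ξ)) ∧ zNorm k z < ⊤}

/-- The modified norm `|z|_{k,γ}`, with values in `[0, ∞]`. -/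
def modNorm (k : ℝ) (γ : ℂ) (z : ℝ → ℂ) : ℝ≥0∞ :=
  eLpNorm (fun η : ℝ => (|η|⁻¹ : ℝ) • (z η - γ)) ⊤ (volume.restrict (Ioo 0 1))
    + eLpNorm (fun η : ℝ => (|η| ^ k) • z η) ⊤ (volume.restrict (Ioi 1))
    + eLpNorm (fun η : ℝ => (1 + |η| ^ (k + 1)) • deriv z η) ⊤ (volume.restrict (Ioi 0))

/-- The function `ξ ↦ 1 - χ(|ξ|)`. -/
def lowPart (χ : ℝ → ℝ) (ξ : ℝ) : ℂ := ((1 - χ |ξ| : ℝ) : ℂ)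

end SelfSimilar

end

open SelfSimilar

noncomputable section

namespace SelfSimilar

open Filter Topology MeasureTheory Set
open scoped ENNReal ComplexConjugate Real
open Complex (I exp norm_real norm_exp_ofReal_mul_I continuous_ofReal norm_ofNat norm_I exp_add
  real_smul conj_ofReal I_sq conj_conj continuous_conj ofReal_mul normSq_eq_norm_sq mul_conj
  ofReal_add)
open Real (norm_eq_abs log rpow_add sqrt_pos rpow_neg rpow_neg_one
  sq_sqrt rpow_le_rpow_of_nonpos sqrt_eq_rpow rpow_one rpow_two rpow_sub rpow_le_rpow
  mul_self_sqrt one_le_sqrt div_rpow hasDerivAt_rpow_const norm_of_nonneg rpow_zero rpow_natCast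
  sqrt_sq one_le_rpow log_le_log sqrt_mul rpow_mul pi_gt_three pi_pos pi_ne_zero)
open Real renaming rpow_le_rpow_of_exponent_le → rpow_mono
open intervalIntegral renaming integral_add_adjacent_intervals → ii_split,
  integral_const_mul → ii_const_mul, integral_mul_const → ii_mul_const, integral_add → ii_add,
  integral_sub → ii_sub, integral_of_le → ii_of_le, integral_congr_ae → ii_congr_ae,
  norm_integral_le_of_norm_le_const → norm_ii_le_const
open intervalIntegral (integral_congr integral_interval_sub_left
  integral_comp_neg integral_Ioi_sub_Ioi' tendsto_integral_filter_of_dominated_convergence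
  integral_eq_sub_of_hasDerivAt)

local notation "cis(" t ")" => exp (((t : ℝ) : ℂ)*I)

variable {C D K L M N Nf Ng Nh N₁ R S V a b c k m m₀ p q x x₀ y α δ ε η θ ν ξ ρ σ : ℝ} {D₁ D₂ F F' G
  G' H H' b' d' f f' f'' f₁ g g' g'' g₁ h h' u u' y' z z' κ κ' : ℝ → ℂ} {Γ γ χ ψ ψ' : ℝ → ℝ} {A l :
  ℂ} {s t : Set ℝ}

lemma mul_mono (h : b ≤ c) (ha : 0 ≤ a) : a*b ≤ a*c := by gcongr

/-! ### Absolutely continuous functions given with a derivative -/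

/-- On the set `s`, the function `f` is a primitive of `f'`. -/
structure ACOn (f f' : ℝ → ℂ) (s : Set ℝ) : Prop where
  int : ∀ x ∈ s, ∀ y ∈ s, x ≤ y → IntervalIntegrable f' volume x y
  ftc : ∀ x ∈ s, ∀ y ∈ s, x ≤ y → f y - f x = ∫ t in x..y, f' t

lemma ACOn.mono (h : ACOn f f' s) (hts : t ⊆ s) : ACOn f f' t :=
  ⟨fun x hx y hy => h.int x (hts hx) y (hts hy), fun x hx y hy => h.ftc x (hts hx) y (hts hy)⟩

lemma ACOn.continuousOn_Icc (h : ACOn f f' s) [hs : OrdConnected s] (hx : x ∈ s) (hy : y ∈ s)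
    (hxy : x ≤ y) : ContinuousOn f (Icc x y) := by
  have h1 : ContinuousOn (fun z => f x + ∫ t in x..z, f' t) (Icc x y) := by
    have := intervalIntegral.continuousOn_primitive_interval' (h.int x hx y hy hxy) (left_mem_uIcc)
    rw [uIcc_of_le hxy] at this
    exact continuousOn_const.add this
  refine h1.congr fun z hz => ?_
  have := h.ftc x hx z (hs.out hx hy hz) hz.1
  grind

lemma ACOn.congr [hs : OrdConnected s] (h : ACOn f f' s) (hg : ∀ x ∈ s, g x = f x)
    (hg' : ∀ x ∈ s, g' x = f' x) : ACOn g g' s := by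
  have key : ∀ x ∈ s, ∀ y ∈ s, x ≤ y → EqOn f' g' (uIoc x y) := by
    intro x hx y hy hxy t ht
    rw [uIoc_of_le hxy] at ht
    exact (hg' t (hs.out hx hy ⟨ht.1.le, ht.2⟩)).symm
  refine ⟨fun x hx y hy hxy => (h.int x hx y hy hxy).congr (key x hx y hy hxy), ?_⟩
  intro x hx y hy hxy
  rw [hg x hx, hg y hy, h.ftc x hx y hy hxy]
  refine ii_congr_ae (.of_forall fun t ht => key x hx y hy hxy ht)

lemma ACOn.of_hasDerivAt [hs : OrdConnected s] (h : ∀ x ∈ s, HasDerivAt f (f' x) x)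
    (hc : ContinuousOn f' s) : ACOn f f' s := by
  have hi : ∀ x ∈ s, ∀ y ∈ s, x ≤ y → IntervalIntegrable f' volume x y := by
    intro x hx y hy hxy
    apply ContinuousOn.intervalIntegrable
    rw [uIcc_of_le hxy]
    exact hc.mono (hs.out hx hy)
  refine ⟨hi, fun x hx y hy hxy => ?_⟩
  rw [integral_eq_sub_of_hasDerivAt _ (hi x hx y hy hxy)]
  intro t ht
  rw [uIcc_of_le hxy] at ht
  exact h t (hs.out hx hy ht)

lemma ACOn.const (c : ℂ) (s : Set ℝ) : ACOn (fun _ => c) (fun _ => 0) s :=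
  ⟨fun _ _ _ _ _ => by simp, fun _ _ _ _ _ => by simp⟩

lemma ACOn.add (hf : ACOn f f' s) (hg : ACOn g g' s) :
    ACOn (fun x => f x + g x) (fun x => f' x + g' x) s := by
  refine ⟨fun x hx y hy hxy => (hf.int x hx y hy hxy).add (hg.int x hx y hy hxy),
    fun x hx y hy hxy => ?_⟩
  rw [ii_add (hf.int x hx y hy hxy) (hg.int x hx y hy hxy),
    ← hf.ftc x hx y hy hxy, ← hg.ftc x hx y hy hxy]
  ring

lemma ACOn.const_mul (c : ℂ) (hf : ACOn f f' s) : ACOn (fun x => c*f x) (fun x => c*f' x) s := by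
  refine ⟨fun x hx y hy hxy => (hf.int x hx y hy hxy).const_mul c, fun x hx y hy hxy => ?_⟩
  rw [ii_const_mul, ← hf.ftc x hx y hy hxy]
  ring

lemma ACOn.sub (hf : ACOn f f' s) (hg : ACOn g g' s) :
    ACOn (fun x => f x - g x) (fun x => f' x - g' x) s := by
  have := hf.add (hg.const_mul (-1))
  grind

lemma ACOn.conj (hf : ACOn f f' s) : ACOn (fun x => conj (f x)) (fun x => conj (f' x)) s := by
  refine ⟨fun x hx y hy hxy => ?_, fun x hx y hy hxy => ?_⟩
  · have := hf.int x hx y hy hxy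
    rw [intervalIntegrable_iff] at this ⊢
    exact (Complex.conjLIE.toContinuousLinearEquiv.toContinuousLinearMap).integrable_comp this
  · rw [← map_sub, hf.ftc x hx y hy hxy, ii_of_le hxy, ii_of_le hxy, integral_conj]

lemma ACOn.comp_affine (hf : ACOn f f' s) (hc : c ≠ 0) (d : ℝ) :
    ACOn (fun x => f (c*x + d)) (fun x => (c : ℂ)*f' (c*x + d)) {x | c*x + d ∈ s} := by
  refine ⟨fun x hx y hy hxy => ?_, fun x hx y hy hxy => ?_⟩
  · apply IntervalIntegrable.const_mul
    have h0 : IntervalIntegrable f' volume (c*x + d) (c*y + d) := by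
      rcases le_total (c*x + d) (c*y + d) with h | h
      · exact hf.int _ hx _ hy h
      · exact (hf.int _ hy _ hx h).symm
    have h1 := h0.comp_add_right d
    have h2 := h1.comp_mul_left (c := c)
    grind
  · rw [ii_const_mul, intervalIntegral.integral_comp_mul_add _ hc]
    have hc' : (c : ℂ) ≠ 0 := by exact_mod_cast hc
    rw [real_smul, ← mul_assoc]
    push_cast
    rw [mul_inv_cancel₀ hc', one_mul]
    rcases le_total (c*x + d) (c*y + d) with h | h
    · exact hf.ftc _ hx _ hy h
    · rw [intervalIntegral.integral_symm, ← hf.ftc _ hy _ hx h]; ring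

lemma ACOn.mul [hs : OrdConnected s] (hf : ACOn f f' s) (hg : ACOn g g' s) :
    ACOn (fun x => f x*g x) (fun x => f' x*g x + f x*g' x) s := by
  have hi1 : ∀ x ∈ s, ∀ y ∈ s, x ≤ y → IntervalIntegrable (fun t => f' t*g t) volume x y := by
    intro x hx y hy hxy
    refine (hf.int x hx y hy hxy).mul_continuousOn ?_
    rw [uIcc_of_le hxy]; exact hg.continuousOn_Icc hx hy hxy
  have hi2 : ∀ x ∈ s, ∀ y ∈ s, x ≤ y → IntervalIntegrable (fun t => f t*g' t) volume x y := by
    intro x hx y hy hxy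
    refine (hg.int x hx y hy hxy).continuousOn_mul ?_
    rw [uIcc_of_le hxy]; exact hf.continuousOn_Icc hx hy hxy
  refine ⟨fun x hx y hy hxy => (hi1 x hx y hy hxy).add (hi2 x hx y hy hxy), fun x hx y hy hxy => ?_⟩
  have key : ∫ t in x..y, f' t*(g t - g x) = ∫ u in x..y, (f y - f u)*g' u := by
    have e1 : ∫ t in x..y, f' t*(g t - g x)
        = ∫ t in Ioc x y, ∫ u in Ioc x y, (if u ≤ t then f' t*g' u else 0) := by
      rw [ii_of_le hxy]
      refine setIntegral_congr_fun measurableSet_Ioc fun t ht => ?_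
      have ht' : t ∈ s := hs.out hx hy ⟨ht.1.le, ht.2⟩
      rw [hg.ftc x hx t ht' ht.1.le, ii_of_le ht.1.le, ← integral_const_mul]
      have : Ioc x t = Ioc x y ∩ Iic t := by grind
      rw [this, ← setIntegral_indicator measurableSet_Iic]
      rfl
    have e2 : ∫ u in x..y, (f y - f u)*g' u
        = ∫ u in Ioc x y, ∫ t in Ioc x y, (if u ≤ t then f' t*g' u else 0) := by
      rw [ii_of_le hxy]
      refine setIntegral_congr_fun measurableSet_Ioc fun u hu => ?_
      have hu' : u ∈ s := hs.out hx hy ⟨hu.1.le, hu.2⟩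
      rw [hf.ftc u hu' y hy hu.2, ii_of_le hu.2, ← integral_mul_const,
        ← integral_Icc_eq_integral_Ioc]
      have : Icc u y = Ioc x y ∩ Ici u := by grind
      rw [this, ← setIntegral_indicator measurableSet_Ici]
      rfl
    rw [e1, e2]
    apply integral_integral_swap
    have hF : Integrable (fun p : ℝ × ℝ => f' p.1*g' p.2)
        ((volume.restrict (Ioc x y)).prod (volume.restrict (Ioc x y))) := by
      apply Integrable.mul_prod
      · exact (intervalIntegrable_iff_integrableOn_Ioc_of_le hxy).1 (hf.int x hx y hy hxy)
      · exact (intervalIntegrable_iff_integrableOn_Ioc_of_le hxy).1 (hg.int x hx y hy hxy)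
    have := hF.indicator (s := {p : ℝ × ℝ | p.2 ≤ p.1})
      (measurableSet_le measurable_snd measurable_fst)
    refine this.congr (.of_forall fun p => ?_)
    simp [indicator, Function.uncurry]
  have e3 : ∫ t in x..y, f' t*(g t - g x) = (∫ t in x..y, f' t*g t) - (f y - f x)*g x := by
    rw [hf.ftc x hx y hy hxy, ← ii_mul_const,
      ← ii_sub (hi1 x hx y hy hxy) ((hf.int x hx y hy hxy).mul_const _)]
    simp only [mul_sub]
  have e4 : ∫ t in x..y, (f y - f t)*g' t = f y*(g y - g x) - (∫ t in x..y, f t*g' t) := by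
    rw [hg.ftc x hx y hy hxy, ← ii_const_mul,
      ← ii_sub ((hg.int x hx y hy hxy).const_mul _) (hi2 x hx y hy hxy)]
    simp only [sub_mul]
  rw [ii_add (hi1 x hx y hy hxy) (hi2 x hx y hy hxy)]
  grind

/-- Integration by parts. -/
lemma ACOn.integral_mul [OrdConnected s] (hf : ACOn f f' s) (hg : ACOn g g' s) (hx : x ∈ s)
    (hy : y ∈ s) (hxy : x ≤ y) : IntervalIntegrable (fun t => f t*g' t) volume x y ∧ ∫ t in x..y, f'
    t*g t = f y*g y - f x*g x - ∫ t in x..y, f t*g' t := by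
  have i1 : IntervalIntegrable (fun t => f' t*g t) volume x y :=
    (hf.int x hx y hy hxy).mul_continuousOn (by
      rw [uIcc_of_le hxy]; exact hg.continuousOn_Icc hx hy hxy)
  have i2 : IntervalIntegrable (fun t => f t*g' t) volume x y :=
    (hg.int x hx y hy hxy).continuousOn_mul (by
      rw [uIcc_of_le hxy]; exact hf.continuousOn_Icc hx hy hxy)
  have e := (hf.mul hg).ftc x hx y hy hxy
  rw [ii_add i1 i2] at e
  exact ⟨i2, by rw [e]; ring⟩

/-! ### Oscillatory integrals -/

lemma norm_intervalIntegral_le_of_Ioo (hab : a ≤ b) (hM : 0 ≤ M)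
    (h : ∀ x ∈ Ioo a b, ∀ y ∈ Ioo a b, x ≤ y → ‖∫ t in x..y, F t‖ ≤ M) :
    ‖∫ t in a..b, F t‖ ≤ M := by
  rcases hab.eq_or_lt with rfl | hab
  · simpa using hM
  by_cases hF : IntervalIntegrable F volume a b
  swap
  · rw [intervalIntegral.integral_undef hF]; simpa using hM
  set c := (a + b)/2 with hc
  have hca : a < c := by rw [hc]; linarith
  have hcb : c < b := by rw [hc]; linarith
  have hcont : ContinuousOn (fun z => ∫ t in c..z, F t) (Icc a b) := by
    have := intervalIntegral.continuousOn_primitive_interval' (a := c) hF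
      (by rw [uIcc_of_le hab.le]; grind)
    rwa [uIcc_of_le hab.le] at this
  have hA : Tendsto (fun z => ∫ t in c..z, F t) (𝓝[>] a) (𝓝 (∫ t in c..a, F t)) :=
    ((hcont a (left_mem_Icc.2 hab.le)).mono_of_mem_nhdsWithin
      (mem_of_superset (Ioo_mem_nhdsGT hab) Ioo_subset_Icc_self))
  have hB : Tendsto (fun z => ∫ t in c..z, F t) (𝓝[<] b) (𝓝 (∫ t in c..b, F t)) :=
    ((hcont b (right_mem_Icc.2 hab.le)).mono_of_mem_nhdsWithin
      (mem_of_superset (Ioo_mem_nhdsLT hab) Ioo_subset_Icc_self))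
  have hlim : Tendsto (fun p : ℝ × ℝ => ‖(∫ t in c..p.2, F t) - ∫ t in c..p.1, F t‖)
      (𝓝[>] a ×ˢ 𝓝[<] b) (𝓝 ‖(∫ t in c..b, F t) - ∫ t in c..a, F t‖) :=
    ((hB.comp tendsto_snd).sub (hA.comp tendsto_fst)).norm
  have hsub : ∀ x ∈ Icc a b, IntervalIntegrable F volume c x := fun x hx => hF.mono_set (by
      rw [uIcc_of_le hab.le]
      exact uIcc_subset_Icc ⟨hca.le, hcb.le⟩ hx)
  have e : ∫ t in a..b, F t = (∫ t in c..b, F t) - ∫ t in c..a, F t := by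
    rw [integral_interval_sub_left (hsub b (right_mem_Icc.2 hab.le))
      (hsub a (left_mem_Icc.2 hab.le))]
  rw [e]
  refine le_of_tendsto hlim ?_
  filter_upwards [prod_mem_prod (Ioo_mem_nhdsGT hca) (Ioo_mem_nhdsLT hcb)] with p hp
  have h1 : p.1 ∈ Ioo a b := ⟨hp.1.1, hp.1.2.trans hcb⟩
  have h2 : p.2 ∈ Ioo a b := ⟨hca.trans hp.2.1, hp.2.2⟩
  rw [integral_interval_sub_left (hsub _ (Ioo_subset_Icc_self h2))
      (hsub _ (Ioo_subset_Icc_self h1))]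
  grind

lemma norm_integral_le_of_antideriv_Icc (hxy : x ≤ y) (hΓ : ∀ t ∈ Icc x y, HasDerivAt Γ (γ t) t)
    (hγ : ∀ t ∈ Icc x y, ‖F t‖ ≤ γ t) : ‖∫ t in x..y, F t‖ ≤ Γ y - Γ x := by
  have hc : ContinuousOn Γ (Icc x y) := HasDerivAt.continuousOn hΓ
  by_cases hF : IntervalIntegrable F volume x y
  swap
  · rw [intervalIntegral.integral_undef hF, norm_zero, sub_nonneg]
    refine monotoneOn_of_deriv_nonneg (convex_Icc x y) hc ?_ ?_ (left_mem_Icc.2 hxy)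
      (right_mem_Icc.2 hxy) hxy
    · exact fun t ht => (hΓ t (interior_subset ht)).differentiableAt.differentiableWithinAt
    · intro t ht
      rw [(hΓ t (interior_subset ht)).deriv]
      exact (norm_nonneg _).trans (hγ t (interior_subset ht))
  refine (intervalIntegral.norm_integral_le_integral_norm hxy).trans ?_
  refine intervalIntegral.integral_le_sub_of_hasDeriv_right_of_le hxy hc
    (fun t ht => (hΓ t (Ioo_subset_Icc_self ht)).hasDerivWithinAt) ?_
    (fun t ht => hγ t (Ioo_subset_Icc_self ht))
  exact (intervalIntegrable_iff_integrableOn_Icc_of_le hxy).1 hF.norm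

/-- An absolute bound by means of an explicit antiderivative of a majorant. -/
lemma norm_integral_le_of_antideriv (hab : a ≤ b) (hV0 : 0 ≤ V)
    (hΓ : ∀ x ∈ Ioo a b, HasDerivAt Γ (γ x) x) (hγ : ∀ x ∈ Ioo a b, ‖F x‖ ≤ γ x)
    (hV : ∀ x ∈ Ioo a b, ∀ y ∈ Ioo a b, x ≤ y → Γ y - Γ x ≤ V) : ‖∫ t in a..b, F t‖ ≤ V := by
  refine norm_intervalIntegral_le_of_Ioo hab hV0 fun x hx y hy hxy => ?_
  have hsub : Icc x y ⊆ Ioo a b := Icc_subset_Ioo hx.1 hy.2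
  exact (norm_integral_le_of_antideriv_Icc hxy (fun t ht => hΓ t (hsub ht))
    (fun t ht => hγ t (hsub ht))).trans (hV x hx y hy hxy)

/-- Integration by parts in an oscillatory integral, with an absolutely continuous amplitude
whose derivative is controlled by an explicit antiderivative. -/
lemma norm_integral_osc_le {B B' : ℝ → ℂ} (hab : a ≤ b) (hS0 : 0 ≤ S) (hV0 : 0 ≤ V)
    (hψ : ∀ x ∈ Ioo a b, HasDerivAt ψ (ψ' x) x) (hψ' : ContinuousOn ψ' (Ioo a b))
    (hB : ACOn B B' (Ioo a b)) (hS : ∀ x ∈ Ioo a b, ‖B x‖ ≤ S)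
    (hΓ : ∀ x ∈ Ioo a b, HasDerivAt Γ (γ x) x) (hγ : ∀ x ∈ Ioo a b, ‖B' x‖ ≤ γ x)
    (hV : ∀ x ∈ Ioo a b, ∀ y ∈ Ioo a b, x ≤ y → Γ y - Γ x ≤ V)
    (hF : ∀ x ∈ Ioo a b, F x = cis(ψ x)*(ψ' x*B x)) : ‖∫ t in a..b, F t‖ ≤ 2*S + V := by
  refine norm_intervalIntegral_le_of_Ioo hab (by positivity) fun x hx y hy hxy => ?_
  have hsub : Icc x y ⊆ Ioo a b := Icc_subset_Ioo hx.1 hy.2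
  have hE : ACOn (fun t => cis(ψ t)) (fun t => cis(ψ t)*(ψ' t*I)) (Ioo a b) := by
    refine ACOn.of_hasDerivAt (fun t ht => ?_) ?_
    · exact (((hψ t ht).ofReal_comp).mul_const I).cexp
    · have hψc : ContinuousOn ψ (Ioo a b) := HasDerivAt.continuousOn hψ
      fun_prop
  have e2 : ∫ t in x..y, F t = -I*∫ t in x..y, cis(ψ t)*(ψ' t*I)*B t := by
    rw [← ii_const_mul]
    refine integral_congr fun t ht => ?_
    rw [uIcc_of_le hxy] at ht
    rw [hF t (hsub ht)]
    linear_combination (cis(ψ t)*ψ' t*B t)*I_sq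
  have hexp : ∀ t, ‖cis(ψ t)‖ = 1 := fun t => norm_exp_ofReal_mul_I _
  rw [e2, norm_mul, norm_neg, norm_I, one_mul, (hE.integral_mul hB hx hy hxy).2, two_mul]
  refine norm_sub_le_of_le (norm_sub_le_of_le ?_ ?_)
    ((norm_integral_le_of_antideriv_Icc hxy (fun t ht => hΓ t (hsub ht)) fun t ht => ?_).trans
      (hV x hx y hy hxy)) <;> rw [norm_mul, hexp, one_mul]
  exacts [hS y hy, hS x hx, hγ t (hsub ht)]

/-! ### Quadratic phases -/

/-- The quadratic oscillation `e^{(3i/4) η ν²}`. -/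
def quadOsc (η ν : ℝ) : ℂ := cis(3/4*η*ν^2)

lemma norm_quadOsc (η ν : ℝ) : ‖quadOsc η ν‖ = 1 := norm_exp_ofReal_mul_I _

lemma continuous_quadOsc (η : ℝ) : Continuous (quadOsc η) := by
  unfold quadOsc; fun_prop

lemma quadOsc_neg_right (η ν : ℝ) : quadOsc η (-ν) = quadOsc η ν := by
  simp [quadOsc]

lemma norm_integral_quadOsc_le (hη : 0 < η) (ha : 0 ≤ a) (hab : a ≤ b) (hS0 : 0 ≤ S) (hV0 : 0 ≤ V)
    (hG : ACOn G G' (Ioo a b)) (hS : ∀ ν ∈ Ioo a b, ‖G ν‖ ≤ S*ν)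
    (hΓ : ∀ ν ∈ Ioo a b, HasDerivAt Γ (γ ν) ν) (hγ : ∀ ν ∈ Ioo a b, ‖G' ν‖/ν + ‖G ν‖/ν^2 ≤ γ ν)
    (hV : ∀ x ∈ Ioo a b, ∀ y ∈ Ioo a b, x ≤ y → Γ y - Γ x ≤ V) :
    ‖∫ ν in a..b, quadOsc η ν*G ν‖ ≤ (2*S + V)/η := by
  have hc : (0 : ℝ) ≤ 2/(3*η) := by positivity
  have h23 : 2/(3*η) ≤ 1/η := by rw [div_le_div_iff₀ (by positivity) hη]; linarith
  have hinv : ACOn (fun ν : ℝ => ((ν⁻¹ : ℝ) : ℂ)) (fun ν : ℝ => ((-(ν^2)⁻¹ : ℝ) : ℂ))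
      (Ioo a b) := by
    refine ACOn.of_hasDerivAt (fun ν hν => ?_) ?_
    · exact (hasDerivAt_inv (ha.trans_lt hν.1).ne').ofReal_comp
    · refine continuous_ofReal.comp_continuousOn (ContinuousOn.neg ?_)
      exact (continuousOn_id.pow 2).inv₀ fun ν hν => (pow_pos (ha.trans_lt hν.1) 2).ne'
  have hB := (hG.mul hinv).const_mul ((2/(3*η) : ℝ) : ℂ)
  have := norm_integral_osc_le (ψ := fun ν => 3/4*η*ν^2) (ψ' := fun ν => 3/2*η*ν)
    (F := fun ν => quadOsc η ν*G ν) (Γ := fun ν => 2/(3*η)*Γ ν)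
    (γ := fun ν => 2/(3*η)*γ ν) (S := 2/(3*η)*S) (V := 2/(3*η)*V)
    hab (by positivity) (by positivity) (fun ν _ => ?_) (by fun_prop) hB (fun ν hν => ?_)
    (fun ν hν => (hΓ ν hν).const_mul _) (fun ν hν => ?_) (fun x hx y hy hxy => ?_)
    (fun ν hν => ?_)
  · refine this.trans ?_
    calc 2*(2/(3*η)*S) + 2/(3*η)*V = 2/(3*η)*(2*S + V) := by ring
      _ ≤ 1/η*(2*S + V) := by gcongr
      _ = _ := by ring
  · have := (hasDerivAt_pow 2 ν).const_mul (3/4*η)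
    grind
  · have hν0 := ha.trans_lt hν.1
    rw [norm_mul, norm_mul, norm_real, norm_real, norm_of_nonneg hc,
      norm_of_nonneg (inv_pos.2 hν0).le]
    refine mul_mono ?_ hc
    rw [← div_eq_mul_inv, div_le_iff₀ hν0]; exact hS ν hν
  · have hν0 := ha.trans_lt hν.1
    rw [norm_mul, norm_real, norm_of_nonneg hc]
    refine mul_mono (le_trans ?_ (hγ ν hν)) hc
    refine (norm_add_le _ _).trans ?_
    rw [norm_mul, norm_mul, norm_real, norm_real, norm_neg,
      norm_of_nonneg (inv_pos.2 hν0).le, norm_of_nonneg (inv_pos.2 (pow_pos hν0 2)).le,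
      div_eq_mul_inv, div_eq_mul_inv]
  · rw [← mul_sub]; exact mul_mono (hV x hx y hy hxy) hc
  · have hν0 : (ν : ℂ) ≠ 0 := by exact_mod_cast (ha.trans_lt hν.1).ne'
    have hη0 : (η : ℂ) ≠ 0 := by exact_mod_cast hη.ne'
    rw [quadOsc]
    push_cast
    field_simp

lemma norm_integral_quadOsc_piece_le (hη : 0 < η) (hN : 0 ≤ N) (ha : 1 ≤ √η*a) (hab : a ≤ b)
    (hside : b ≤ η ∨ η ≤ a) (hG : ACOn G G' (Ioo a b))
    (hb : ∀ ν ∈ Ioo a b, ‖G ν‖ ≤ N*(1 + ν/(1 + |η - ν|/2))) (hb' : ∀ ν ∈ Ioo a b, ‖G' ν‖ ≤ N*((1 +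
    ν/(1 + |η - ν|/2))/(1 + |η - ν|/2))) : ‖∫ ν in a..b, quadOsc η ν*G ν‖ ≤ 15*N/√η := by
  have hq : 0 < √η := sqrt_pos.2 hη
  have hqq : √η*√η = η := mul_self_sqrt hη.le
  have ha0 : 0 < a := by
    by_contra h
    have := mul_nonpos_of_nonneg_of_nonpos hq.le (not_lt.1 h)
    linarith
  have hainv : a⁻¹ ≤ √η := by rw [inv_le_iff_one_le_mul₀ ha0]; exact ha
  have hinvle : ∀ ν ∈ Ioo a b, 1 ≤ √η*ν := fun ν hν => ha.trans (mul_mono hν.1.le hq.le)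
  have hmaj : ∀ ν ∈ Ioo a b, ‖G' ν‖/ν + ‖G ν‖/ν^2 ≤
      N*(2*(1 + |η - ν|/2)⁻¹*ν⁻¹ + ((1 + |η - ν|/2)⁻¹)^2 + (ν⁻¹)^2) := by
    intro ν hν
    have hν0 := ha0.trans hν.1
    calc ‖G' ν‖/ν + ‖G ν‖/ν^2
        ≤ N*((1 + ν/(1 + |η - ν|/2))/(1 + |η - ν|/2))/ν
          + N*(1 + ν/(1 + |η - ν|/2))/ν^2 := by
            gcongr
            · exact hb' ν hν
            · exact hb ν hν
      _ = _ := by field_simp; ring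
  have hT : ∀ ν ∈ Ioo a b, ν/(1 + |η - ν|/2) ≤ 2*(√η*ν) ∧ (1 + |η - ν|/2)⁻¹ ≤ 2*√η := by
    intro ν hν
    have hν0 := ha0.trans hν.1
    have h2 := hinvle ν hν
    have h3 := neg_abs_le (η - ν)
    rw [div_le_iff₀ (by positivity), inv_le_iff_one_le_mul₀ (by positivity)]
    rcases le_total η 1 with h1 | h1
    · constructor <;> nlinarith
    · have hq1 : 1 ≤ √η := one_le_sqrt.2 h1
      constructor <;> nlinarith [abs_nonneg (η - ν), mul_nonneg hq.le (abs_nonneg (η - ν)),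
        mul_nonneg (mul_nonneg hq.le hν0.le) (abs_nonneg (η - ν))]
  have main : ∀ σ : ℝ, |σ| = 1 → (∀ ν ∈ Ioo a b, |η - ν| = σ*(η - ν)) →
      ‖∫ ν in a..b, quadOsc η ν*G ν‖ ≤ 15*N/√η := by
    intro σ hσ habs
    have hσ2 : σ^2 = 1 := by rw [← sq_abs, hσ, one_pow]
    have := norm_integral_quadOsc_le (η := η) (S := 3*N*√η) (V := 9*N*√η)
      (Γ := fun ν => N*(-3*ν⁻¹ + 3*(σ*(1 + σ*(η - ν)/2)⁻¹)))
      (γ := fun ν => N*(3*(ν^2)⁻¹ + 3/2*((1 + σ*(η - ν)/2)^2)⁻¹)) hη ha0.le hab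
      (by positivity) (by positivity) hG ?_ ?_ ?_ ?_
    · refine this.trans_eq ?_
      rw [div_eq_div_iff hη.ne' hq.ne']
      grind
    · intro ν hν
      calc ‖G ν‖ ≤ N*(1 + ν/(1 + |η - ν|/2)) := hb ν hν
        _ ≤ N*(√η*ν + 2*(√η*ν)) := by gcongr; exacts [hinvle ν hν, (hT ν hν).1]
        _ = _ := by ring
    · intro ν hν
      have hν0 := ha0.trans hν.1
      have hpos : 0 < 1 + σ*(η - ν)/2 := by rw [← habs ν hν]; positivity
      have hd : HasDerivAt (fun ν : ℝ => 1 + σ*(η - ν)/2) (-(σ/2)) ν := by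
        have := ((((hasDerivAt_id ν).const_sub η).const_mul σ).div_const 2).const_add 1
        exact this.congr_deriv (by ring)
      have h1 := (hasDerivAt_inv hν0.ne').const_mul (-3)
      have h2 := ((hd.inv hpos.ne').const_mul σ).const_mul 3
      refine ((h1.add h2).const_mul N).congr_deriv ?_
      grind
    · intro ν hν
      refine (hmaj ν hν).trans ?_
      rw [← habs ν hν, ← inv_pow, ← inv_pow]
      nlinarith [sq_nonneg ((1 + |η - ν|/2)⁻¹ - 2*ν⁻¹)]
    · intro x hx y hy _
      have h5 : x⁻¹ ≤ √η := (inv_anti₀ ha0 hx.1.le).trans hainv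
      have h7 : 0 < y⁻¹ := inv_pos.2 (ha0.trans hy.1)
      have hb1 : ∀ ν ∈ Ioo a b, 0 ≤ (1 + σ*(η - ν)/2)⁻¹ ∧
          (1 + σ*(η - ν)/2)⁻¹ ≤ 2*√η := fun ν hν => by
        rw [← habs ν hν]; exact ⟨by positivity, (hT ν hν).2⟩
      have hby := hb1 y hy
      have hbx := hb1 x hx
      rw [← mul_sub, show 9*N*√η = N*(9*√η) by ring]
      refine mul_mono ?_ hN
      rcases eq_or_eq_neg_of_abs_eq hσ with h | h <;> simp only [h] at hby hbx ⊢ <;> linarith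
  rcases hside with hs | hs
  · refine main 1 (by simp) fun ν hν => ?_
    rw [one_mul, abs_of_nonneg]; linarith [hν.2]
  · refine main (-1) (by simp) fun ν hν => ?_
    rw [abs_of_nonpos]; · ring
    linarith [hν.1]

/-- The bound `O(η^{-1/2})` for quadratic oscillatory integrals. -/
lemma norm_integral_quadOsc_le_rsqrt (hη : 0 < η) (hN : 0 ≤ N) (hm : 0 ≤ m)
    (hG1 : ACOn G G' (Ioo 0 η)) (hG2 : ACOn G G' (Ioi η)) (hint : IntervalIntegrable G volume 0 m)
    (hb : ∀ ν, 0 < ν → ν ≠ η → ‖G ν‖ ≤ N*(1 + ν/(1 + |η - ν|/2)))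
    (hb' : ∀ ν, 0 < ν → ν ≠ η → ‖G' ν‖ ≤ N*((1 + ν/(1 + |η - ν|/2))/(1 + |η - ν|/2))) :
    ‖∫ ν in 0..m, quadOsc η ν*G ν‖ ≤ 33*N/√η := by
  have hq : 0 < √η := sqrt_pos.2 hη
  have hδ0 : 0 < (√η)⁻¹ := inv_pos.2 hq
  set δ := (√η)⁻¹ with hδ
  have hqδ : √η*δ = 1 := mul_inv_cancel₀ hq.ne'
  have hi : IntervalIntegrable (fun ν => quadOsc η ν*G ν) volume 0 m :=
    hint.continuousOn_mul (continuous_quadOsc η).continuousOn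
  have first : ∀ c, 0 ≤ c → c ≤ δ → ‖∫ ν in 0..c, quadOsc η ν*G ν‖ ≤ 3*N/√η := by
    intro c hc hcδ
    have : ‖∫ ν in 0..c, quadOsc η ν*G ν‖ ≤ 3*N*|c - 0| := by
      refine intervalIntegral.norm_integral_le_of_norm_le_const_ae ?_
      have hne : ∀ᵐ ν : ℝ, ν ≠ η := by simp [ae_iff, measure_singleton]
      filter_upwards [hne] with ν hν hmem
      rw [uIoc_of_le hc] at hmem
      rw [norm_mul, norm_quadOsc, one_mul]
      refine (hb ν hmem.1 hν).trans ?_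
      rw [mul_comm 3 N]
      refine mul_mono ?_ hN
      have : ν/(1 + |η - ν|/2) ≤ 2 := by
        rw [div_le_iff₀ (by positivity)]
        rcases le_total η 1 with h1 | h1
        · grind
        · have hq1 : 1 ≤ √η := one_le_sqrt.2 h1
          have : δ ≤ 1 := inv_le_one_of_one_le₀ hq1
          have := abs_nonneg (η - ν)
          linarith [hmem.2]
      linarith
    refine this.trans ?_
    rw [sub_zero, abs_of_nonneg hc, div_eq_mul_inv]
    gcongr
  have bound0 : 0 ≤ 15*N/√η := by positivity
  have hsub : ∀ x y, 0 ≤ x → x ≤ y → y ≤ m →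
      IntervalIntegrable (fun ν => quadOsc η ν*G ν) volume x y := fun x y hx hxy hy =>
    hi.mono_set (by rw [uIcc_of_le hm, uIcc_of_le hxy]; exact Icc_subset_Icc hx hy)
  obtain ⟨p, hp⟩ : ∃ p, p = min m δ := ⟨_, rfl⟩
  obtain ⟨q, hq'⟩ : ∃ q, q = min m (max δ η) := ⟨_, rfl⟩
  have hpq : 0 ≤ p ∧ p ≤ δ ∧ p ≤ q ∧ q ≤ m := by grind
  have e33 : 33*N/√η = 3*N/√η + (15*N/√η + 15*N/√η) := by ring
  rw [← ii_split (hsub 0 p le_rfl (by grind) (by grind))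
    (hsub p m (by grind) (by grind) le_rfl), ← ii_split
    (hsub p q (by grind) (by grind) (by grind)) (hsub q m (by grind) (by grind) le_rfl), e33]
  refine norm_add_le_of_le (first p hpq.1 hpq.2.1) (norm_add_le_of_le ?_ ?_)
  · rcases (by grind : p = q ∨ p = δ ∧ q ≤ η) with h | ⟨h, h'⟩
    · simpa [h] using bound0
    · rw [h]
      exact norm_integral_quadOsc_piece_le hη hN hqδ.ge (by grind) (.inl h')
        (hG1.mono (Ioo_subset_Ioo hδ0.le h')) (fun ν hν => hb ν (hδ0.trans hν.1) (hν.2.trans_le h').ne)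
        fun ν hν => hb' ν (hδ0.trans hν.1) (hν.2.trans_le h').ne
  · rcases le_total m (max δ η) with h | h
    · simpa [hq', min_eq_left h] using bound0
    · have hq : max δ η ≤ q := (hq'.trans (min_eq_right h)).ge
      have h' := (le_max_left δ η).trans hq
      have h := (le_max_right δ η).trans hq
      refine norm_integral_quadOsc_piece_le hη hN ?_ hpq.2.2.2 (.inr h)
        (hG2.mono fun ν hν => h.trans_lt hν.1)
        (fun ν hν => hb ν (hδ0.trans_le (h'.trans hν.1.le)) (h.trans_lt hν.1).ne')
        fun ν hν => hb' ν (hδ0.trans_le (h'.trans hν.1.le)) (h.trans_lt hν.1).ne'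
      rw [← hqδ]; gcongr

/-! ### Weighted classes of functions -/

/-- Functions that are bounded by `N (1 + |x|)^{-p}` and absolutely continuous on each open
half-line, with a derivative bounded by `N (1 + |x|)^{-q}`. A jump at `0` is allowed. -/
structure Adm (p q N : ℝ) (f f' : ℝ → ℂ) : Prop where
  nonneg : 0 ≤ N
  meas : Measurable f
  meas' : Measurable f'
  bd : ∀ x, x ≠ 0 → ‖f x‖ ≤ N*(1 + |x|)^(-p)
  bd' : ∀ x, x ≠ 0 → ‖f' x‖ ≤ N*(1 + |x|)^(-q)
  pos : ACOn f f' (Ioi 0)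
  neg : ACOn f f' (Iio 0)

lemma wt_le_one (hp : 0 ≤ p) : (1 + |x|)^(-p) ≤ 1 :=
  Real.rpow_le_one_of_one_le_of_nonpos (by linarith [abs_nonneg x]) (by linarith)

lemma wt_mono (h : q ≤ p) : (1 + |x|)^(-p) ≤ (1 + |x|)^(-q) :=
  rpow_mono (by linarith [abs_nonneg x]) (by linarith)

lemma wt_nonneg (p x : ℝ) : 0 ≤ (1 + |x|)^(-p) := by positivity

lemma wt_le_of_le (hp : 0 ≤ p) (hc : 0 < c) (h : c ≤ 1 + |x|) : (1 + |x|)^(-p) ≤ c^(-p) :=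
  rpow_le_rpow_of_nonpos hc h (by linarith)

lemma Adm.mono {p₁ q₁ : ℝ} (h : Adm p q N f f') (hp : p₁ ≤ p) (hq : q₁ ≤ q) (hN : N ≤ N₁) :
    Adm p₁ q₁ N₁ f f' :=
  { h with
    nonneg := h.nonneg.trans hN
    bd := fun x hx => (h.bd x hx).trans
      (mul_le_mul hN (wt_mono hp) (wt_nonneg _ _) (h.nonneg.trans hN))
    bd' := fun x hx => (h.bd' x hx).trans
      (mul_le_mul hN (wt_mono hq) (wt_nonneg _ _) (h.nonneg.trans hN)) }

lemma Adm.zero (h : Adm p (1 + p) N f f') (hp : 0 ≤ p) : Adm 0 1 N f f' :=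
  h.mono hp (by linarith) le_rfl

lemma Adm.le (h : Adm p q N f f') (hp : 0 ≤ p) (hx : x ≠ 0) : ‖f x‖ ≤ N :=
  (h.bd x hx).trans (mul_le_of_le_one_right h.nonneg (wt_le_one hp))

lemma Adm.le' (h : Adm p q N f f') (hq : 0 ≤ q) (hx : x ≠ 0) : ‖f' x‖ ≤ N :=
  (h.bd' x hx).trans (mul_le_of_le_one_right h.nonneg (wt_le_one hq))

/-- The reflection `x ↦ conj (f (-x))`. -/
def refl (f : ℝ → ℂ) (x : ℝ) : ℂ := conj (f (-x))

lemma refl_refl (f : ℝ → ℂ) : refl (refl f) = f := by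
  funext x; simp [refl]

protected lemma Adm.refl (h : Adm p q N f f') : Adm p q N (refl f) (fun x => -refl f' x) where
  nonneg := h.nonneg
  meas := continuous_conj.measurable.comp (h.meas.comp measurable_neg)
  meas' := (continuous_conj.measurable.comp (h.meas'.comp measurable_neg)).neg
  bd := fun x hx => by
    have := h.bd (-x) (neg_ne_zero.2 hx)
    simpa [refl] using this
  bd' := fun x hx => by
    have := h.bd' (-x) (neg_ne_zero.2 hx)
    simpa [refl] using this
  pos := by
    have := (h.neg.comp_affine (c := -1) (by norm_num) 0).conj.mono (t := Ioi 0)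
      (fun x hx => by simpa using hx)
    refine this.congr (fun x _ => by simp [refl])
      (fun x _ => by simp [refl])
  neg := by
    have := (h.pos.comp_affine (c := -1) (by norm_num) 0).conj.mono (t := Iio 0)
      (fun x hx => by simpa using hx)
    refine this.congr (fun x _ => by simp [refl])
      (fun x _ => by simp [refl])

lemma adm_const (c : ℂ) : Adm 0 1 ‖c‖ (fun _ => c) (fun _ => 0) where
  nonneg := norm_nonneg _
  meas := measurable_const
  meas' := measurable_const
  bd := fun x _ => by simp
  bd' := fun x _ => by simp; positivity
  pos := ACOn.const _ _
  neg := ACOn.const _ _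

/-! ### The amplitude of `opK` -/

/-- The amplitude of `integrandK`. -/
def ampK (f g : ℝ → ℂ) (η ν : ℝ) : ℂ := f ((η + ν)/2)*g ((η - ν)/2)

/-- The derivative of `ampK` in `ν`. -/
def ampK' (f f' g g' : ℝ → ℂ) (η ν : ℝ) : ℂ :=
  (1/2 : ℂ)*(f' ((η + ν)/2)*g ((η - ν)/2) - f ((η + ν)/2)*g' ((η - ν)/2))

lemma integrandK_eq (f g : ℝ → ℂ) (η ν : ℝ) : integrandK f g η ν = quadOsc η ν*ampK f g η ν := by
  rw [integrandK, quadOsc, ampK, mul_assoc]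

lemma ampK_neg (f g : ℝ → ℂ) (η ν : ℝ) : ampK f g η (-ν) = ampK g f η ν := by
  simp only [ampK, sub_neg_eq_add]
  grind

lemma acOn_ampK {u : Set ℝ} [OrdConnected u] (hf : ACOn f f' s) (hg : ACOn g g' t)
    (h1 : ∀ ν ∈ u, (η + ν)/2 ∈ s) (h2 : ∀ ν ∈ u, (η - ν)/2 ∈ t) :
    ACOn (ampK f g η) (ampK' f f' g g' η) u := by
  have a1 := (hf.comp_affine (c := 1/2) (by norm_num) (η/2)).mono (t := u) (fun ν hν => by
    have := h1 ν hν
    simp only [mem_ofPred_eq]; grind)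
  have a2 := (hg.comp_affine (c := -1/2) (by norm_num) (η/2)).mono (t := u) (fun ν hν => by
    have := h2 ν hν
    simp only [mem_ofPred_eq]; grind)
  have e1 : ∀ ν : ℝ, 1/2*ν + η/2 = (η + ν)/2 := fun ν => by ring
  have e2 : ∀ ν : ℝ, -1/2*ν + η/2 = (η - ν)/2 := fun ν => by ring
  refine (a1.mul a2).congr (fun ν _ => ?_) (fun ν _ => ?_)
  · simp only [ampK, e1, e2]
  · simp only [ampK', e1, e2]; push_cast; ring

lemma measurable_ampK (hf : Measurable f) (hg : Measurable g) :
    Measurable (fun x : ℝ × ℝ => ampK f g x.1 x.2) := by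
  exact (hf.comp (by fun_prop)).mul (hg.comp (by fun_prop))

lemma measurable_ampK_right (hf : Measurable f) (hg : Measurable g) (η : ℝ) :
    Measurable (ampK f g η) :=
  (measurable_ampK hf hg).comp (measurable_const.prodMk measurable_id)

lemma norm_ampK_le (hp : 0 ≤ p) (hf : Adm p q Nf f f') (hg : Adm p q Ng g g') (h1 : ν ≠ η)
    (h2 : ν ≠ -η) : ‖ampK f g η ν‖ ≤ Nf*Ng := by
  rw [ampK, norm_mul]
  refine mul_le_mul (hf.le hp ?_) (hg.le hp ?_) (norm_nonneg _) hf.nonneg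
  · grind
  positivity

lemma ae_ne (a : ℝ) : ∀ᵐ x : ℝ, x ≠ a := by simp [ae_iff, measure_singleton]

lemma locallyIntegrable_of_bounded (hF : AEStronglyMeasurable F volume) (h : ∀ᵐ x, ‖F x‖ ≤ C) :
    LocallyIntegrable F volume := by
  have : LocallyIntegrable (fun _ : ℝ => C) volume := locallyIntegrable_const C
  exact this.mono hF (h.mono fun x hx => hx.trans (le_abs_self C))

lemma ii_of_loc (h : LocallyIntegrable F volume) (a b : ℝ) : IntervalIntegrable F volume a b :=
  (h.integrableOn_isCompact isCompact_uIcc).intervalIntegrable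

lemma locallyIntegrable_ampK (hp : 0 ≤ p) (hf : Adm p q Nf f f') (hg : Adm p q Ng g g') (η : ℝ) :
    LocallyIntegrable (ampK f g η) volume := by
  refine locallyIntegrable_of_bounded (C := Nf*Ng)
    (measurable_ampK_right hf.meas hg.meas η).aestronglyMeasurable ?_
  filter_upwards [ae_ne η, ae_ne (-η)] with ν h1 h2 using norm_ampK_le hp hf hg h1 h2

lemma locallyIntegrable_quadOsc_ampK (hp : 0 ≤ p) (hf : Adm p q Nf f f') (hg : Adm p q Ng g g')
    (η : ℝ) : LocallyIntegrable (fun ν => quadOsc η ν*ampK f g η ν) volume := by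
  refine locallyIntegrable_of_bounded (C := Nf*Ng) ?_ ?_
  · exact (continuous_quadOsc η).aestronglyMeasurable.mul
      (measurable_ampK_right hf.meas hg.meas η).aestronglyMeasurable
  · filter_upwards [ae_ne η, ae_ne (-η)] with ν h1 h2
    rw [norm_mul, norm_quadOsc, one_mul]
    exact norm_ampK_le hp hf hg h1 h2

/-- A bound for the derivative of the amplitude. -/
lemma norm_ampK'_le (hf : Adm p (1 + p) Nf f f') (hg : Adm p (1 + p) Ng g g') (hη : 0 < η)
    (hν : 0 < ν) (hne : ν ≠ η) :
    ‖ampK' f f' g g' η ν‖ ≤ Nf*Ng*((1 + |(η + ν)/2|)^(-p)*(1 + |(η - ν)/2|)^(-(1 + p))) := by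
  have hs0 : (η + ν)/2 ≠ 0 := by positivity
  have ht0 : (η - ν)/2 ≠ 0 := by positivity
  have hN := mul_nonneg hf.nonneg hg.nonneg
  have hst : |(η - ν)/2| ≤ |(η + ν)/2| := by grind
  set s := (η + ν)/2
  set t := (η - ν)/2
  have hs1 : 0 < 1 + |s| := by positivity
  have ht1 : 0 < 1 + |t| := by positivity
  have key : (1 + |s|)^(-(1 + p))*(1 + |t|)^(-p)
      ≤ (1 + |s|)^(-p)*(1 + |t|)^(-(1 + p)) := by
    rw [neg_add, rpow_add hs1, rpow_add ht1, rpow_neg_one, rpow_neg_one]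
    calc (1 + |s|)⁻¹*(1 + |s|)^(-p)*(1 + |t|)^(-p)
        ≤ (1 + |t|)⁻¹*(1 + |s|)^(-p)*(1 + |t|)^(-p) := by gcongr
      _ = _ := by ring
  have b1 : ‖f' s*g t‖ ≤ Nf*Ng*((1 + |s|)^(-p)*(1 + |t|)^(-(1 + p))) := by
    rw [norm_mul]
    calc ‖f' s‖*‖g t‖ ≤ (Nf*(1 + |s|)^(-(1 + p)))*(Ng*(1 + |t|)^(-p)) :=
          mul_le_mul (hf.bd' s hs0) (hg.bd t ht0) (norm_nonneg _)
            (mul_nonneg hf.nonneg (wt_nonneg _ _))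
      _ = Nf*Ng*((1 + |s|)^(-(1 + p))*(1 + |t|)^(-p)) := by ring
      _ ≤ _ := mul_mono key hN
  have b2 : ‖f s*g' t‖ ≤ Nf*Ng*((1 + |s|)^(-p)*(1 + |t|)^(-(1 + p))) := by
    rw [norm_mul]
    calc ‖f s‖*‖g' t‖ ≤ (Nf*(1 + |s|)^(-p))*(Ng*(1 + |t|)^(-(1 + p))) :=
          mul_le_mul (hf.bd s hs0) (hg.bd' t ht0) (norm_nonneg _)
            (mul_nonneg hf.nonneg (wt_nonneg _ _))
      _ = _ := by ring
  rw [ampK', norm_mul]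
  have : ‖(1/2 : ℂ)‖ = 1/2 := by norm_num
  rw [this]
  have := norm_sub_le (f' s*g t) (f s*g' t)
  linarith

lemma acOn_ampK_left (hf : Adm p q Nf f f') (hg : Adm p q Ng g g') :
    ACOn (ampK f g η) (ampK' f f' g g' η) (Ioo (-η) η) :=
  acOn_ampK hf.pos hg.pos (fun ν hν => by grind)
    (fun ν hν => by grind)

lemma acOn_ampK_right (hf : Adm p q Nf f f') (hg : Adm p q Ng g g') (hη : 0 < η) :
    ACOn (ampK f g η) (ampK' f f' g g' η) (Ioi η) :=
  acOn_ampK hf.pos hg.neg (fun ν hν => by grind)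
    (fun ν hν => by grind)

lemma norm_halfK_le (hf : Adm 0 1 Nf f f') (hg : Adm 0 1 Ng g g') (hη : 0 < η) (hm : 0 ≤ m) :
    ‖∫ ν in 0..m, quadOsc η ν*ampK f g η ν‖ ≤ 33*(Nf*Ng)/√η := by
  have hN := mul_nonneg hf.nonneg hg.nonneg
  have habs : ∀ ν, |η - ν|/2 = |(η - ν)/2| := fun ν => by rw [abs_div]; norm_num
  refine norm_integral_quadOsc_le_rsqrt hη hN hm ((acOn_ampK_left hf hg).mono ?_)
    (acOn_ampK_right hf hg hη) (ii_of_loc (locallyIntegrable_ampK le_rfl hf hg η) 0 m) ?_ ?_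
  · grind
  · intro ν hν hne
    refine (norm_ampK_le le_rfl hf hg hne (by linarith)).trans (le_mul_of_one_le_right hN ?_)
    have : 0 ≤ ν/(1 + |η - ν|/2) := by positivity
    linarith
  · intro ν hν hne
    have hf1 : Adm 0 (1 + 0) Nf f f' := by simpa using hf
    have hg1 : Adm 0 (1 + 0) Ng g g' := by simpa using hg
    refine (norm_ampK'_le hf1 hg1 hη hν hne).trans (mul_mono ?_ hN)
    rw [habs]
    simp only [neg_zero, rpow_zero, add_zero, one_mul, rpow_neg_one]
    rw [inv_eq_one_div]
    gcongr
    have : 0 ≤ ν/(1 + |(η - ν)/2|) := by positivity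
    linarith

lemma norm_tailK_le (hp : 0 ≤ p) (hf : Adm p (1 + p) Nf f f') (hg : Adm p (1 + p) Ng g g') {m' : ℝ}
    (hη : 0 < η) (hm : 2*η ≤ m) (hmm : m ≤ m') :
    ‖∫ ν in m..m', quadOsc η ν*ampK f g η ν‖ ≤ 4*4^(1 + 2*p)*(Nf*Ng)*m^(-(1 + 2*p))/η := by
  have hN := mul_nonneg hf.nonneg hg.nonneg
  have hm0 : 0 < m := by linarith
  have hq0 : 0 < 1 + 2*p := by linarith
  have hsp : ∀ ν : ℝ, 0 < ν → (ν/4)^(-(1 + 2*p)) = 4^(1 + 2*p)*ν^(-(1 + 2*p)) := by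
    intro ν hν
    rw [div_rpow hν.le (by norm_num), rpow_neg (by norm_num : (0:ℝ) ≤ 4), div_inv_eq_mul, mul_comm]
  have hb : ∀ ν ∈ Ioo m m', ‖ampK f g η ν‖ ≤ Nf*Ng*(4^(1 + 2*p)*ν^(-(1 + 2*p))*ν) := by
    intro ν hν
    have hν0 : 0 < ν := hm0.trans hν.1
    have hν4 : 0 < ν/4 := by positivity
    have e1 : ν/4 ≤ 1 + |(η + ν)/2| := by grind
    have e2 : ν/4 ≤ 1 + |(η - ν)/2| := by grind
    rw [ampK, norm_mul]
    calc _ ≤ (Nf*(ν/4)^(-p))*(Ng*(ν/4)^(-p)) := by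
          refine mul_le_mul ((hf.bd _ ?_).trans ?_) ((hg.bd _ ?_).trans ?_) (norm_nonneg _)
            (mul_nonneg hf.nonneg (by positivity))
          · positivity
          · exact mul_mono (wt_le_of_le hp hν4 e1) hf.nonneg
          · grind
          · exact mul_mono (wt_le_of_le hp hν4 e2) hg.nonneg
      _ = Nf*Ng*((ν/4)^(-(1 + 2*p))*(ν/4)) := by
          have : (ν/4)^(-(1 + 2*p)) = (ν/4)^(-p)*(ν/4)^(-p)*(ν/4)⁻¹ := by
            rw [← rpow_neg_one, ← rpow_add hν4, ← rpow_add hν4]; congr 1; ring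
          rw [this]; field_simp
      _ ≤ _ := by
          rw [hsp ν hν0]
          gcongr
          linarith
  have hb' : ∀ ν ∈ Ioo m m', ‖ampK' f f' g g' η ν‖ ≤ Nf*Ng*(4^(1 + 2*p)*ν^(-(1 + 2*p))) := by
    intro ν hν
    have hν0 : 0 < ν := hm0.trans hν.1
    have hν4 : 0 < ν/4 := by positivity
    have e1 : ν/4 ≤ 1 + |(η + ν)/2| := by have := le_abs_self ((η + ν)/2); linarith
    have e2 : ν/4 ≤ 1 + |(η - ν)/2| := by have := neg_le_abs ((η - ν)/2); linarith [hν.1]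
    refine (norm_ampK'_le hf hg hη hν0 (by grind)).trans
      (mul_mono ?_ hN)
    rw [← hsp ν hν0]
    calc _ ≤ (ν/4)^(-p)*(ν/4)^(-(1 + p)) :=
          mul_le_mul (wt_le_of_le hp hν4 e1) (wt_le_of_le (by linarith) hν4 e2) (wt_nonneg _ _)
            (by positivity)
      _ = _ := by rw [← rpow_add hν4]; congr 1; ring
  set c := Nf*Ng*4^(1 + 2*p) with hcdef
  have := norm_integral_quadOsc_le (η := η) (a := m) (b := m') (S := c*m^(-(1 + 2*p)))
    (V := 2*c*m^(-(1 + 2*p)))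
    (Γ := fun ν => 2*c/(-(1 + 2*p))*ν^(-(1 + 2*p)))
    (γ := fun ν => 2*c*ν^(-(1 + 2*p) - 1)) hη hm0.le hmm (by positivity) (by positivity)
    ((acOn_ampK_right hf hg hη).mono fun ν hν => by grind) ?_ ?_ ?_ ?_
  · grind
  · intro ν hν
    have hν0 : 0 < ν := hm0.trans hν.1
    refine (hb ν hν).trans ?_
    have : ν^(-(1 + 2*p)) ≤ m^(-(1 + 2*p)) := rpow_le_rpow_of_nonpos hm0 hν.1.le (by linarith)
    calc _ = c*ν^(-(1 + 2*p))*ν := by rw [hcdef]; ring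
      _ ≤ _ := by gcongr
  · intro ν hν
    have hν0 : 0 < ν := hm0.trans hν.1
    refine ((hasDerivAt_rpow_const (.inl hν0.ne')).const_mul _).congr_deriv ?_
    field_simp
  · intro ν hν
    have hν0 : 0 < ν := hm0.trans hν.1
    have e : ν^(-(1 + 2*p) - 1) = ν^(-(1 + 2*p))/ν := by rw [rpow_sub hν0, rpow_one]
    have h1 : ‖ampK' f f' g g' η ν‖/ν ≤ Nf*Ng*(4^(1 + 2*p)*ν^(-(1 + 2*p)))/ν := by
      gcongr; exact hb' ν hν
    have h2 : ‖ampK f g η ν‖/ν^2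
        ≤ Nf*Ng*(4^(1 + 2*p)*ν^(-(1 + 2*p))*ν)/ν^2 := by
      gcongr; exact hb ν hν
    refine (add_le_add h1 h2).trans_eq ?_
    rw [e, hcdef]; field_simp; ring
  · intro x hx y hy _
    have hx0 : 0 < x := hm0.trans hx.1
    have hy0 : 0 < y := hm0.trans hy.1
    have h1 : x^(-(1 + 2*p)) ≤ m^(-(1 + 2*p)) := rpow_le_rpow_of_nonpos hm0 hx.1.le (by linarith)
    have h2 : 0 ≤ y^(-(1 + 2*p)) := by positivity
    have h3 : 2*c/(1 + 2*p) ≤ 2*c := div_le_self (by positivity) (by linarith)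
    have h4 : 0 ≤ 2*c/(1 + 2*p) := by positivity
    have h5 : 2*c/(1 + 2*p)*x^(-(1 + 2*p)) ≤ 2*c*m^(-(1 + 2*p)) := by gcongr
    nlinarith [mul_nonneg h4 h2]

/-! ### Convergence of `opK` -/

/-- A function of a real variable with small increments at infinity converges. -/
lemma exists_tendsto_of_cauchy {I : ℝ → ℂ} {ρ : ℝ → ℝ} (hρ : Tendsto ρ atTop (𝓝 0))
    (h : ∀ m m', m₀ ≤ m → m ≤ m' → ‖I m' - I m‖ ≤ ρ m) :
    ∃ l, Tendsto I atTop (𝓝 l) ∧ ∀ m, m₀ ≤ m → ‖l - I m‖ ≤ ρ m := by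
  have hc : Cauchy (map I atTop) := by
    refine Metric.cauchy_iff.2 ⟨inferInstance, fun ε hε => ?_⟩
    obtain ⟨M, hM⟩ := ((hρ.eventually (gt_mem_nhds (half_pos hε))).and
      (eventually_ge_atTop m₀)).exists
    refine ⟨I '' Ici M, image_mem_map (Ici_mem_atTop M), ?_⟩
    rintro _ ⟨x, hx, rfl⟩ _ ⟨y, hy, rfl⟩
    have h1 := h M x hM.2 hx
    have h2 := h M y hM.2 hy
    rw [dist_eq_norm]
    have : I x - I y = (I x - I M) - (I y - I M) := by ring
    rw [this]
    refine (norm_sub_le _ _).trans_lt ?_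
    linarith [hM.1]
  obtain ⟨l, hl⟩ := CompleteSpace.complete hc
  have hl' : Tendsto I atTop (𝓝 l) := hl
  refine ⟨l, hl', fun m hm => ?_⟩
  refine le_of_tendsto (hl'.sub_const (I m)).norm ?_
  filter_upwards [eventually_ge_atTop m] with m' hm' using h m m' hm hm'

lemma tendsto_const_mul_rpow_neg (c : ℝ) (hy : 0 < y) :
    Tendsto (fun m : ℝ => c*m^(-y)) atTop (𝓝 0) := by
  simpa using (tendsto_rpow_neg_atTop hy).const_mul c

/-- The half of `opK` coming from `ν > 0`. -/
def halfK (f g : ℝ → ℂ) (η : ℝ) : ℂ :=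
  limUnder atTop (fun m : ℝ => ∫ ν in 0..m, quadOsc η ν*ampK f g η ν)

lemma halfK_spec (hp : 0 ≤ p) (hf : Adm p (1 + p) Nf f f') (hg : Adm p (1 + p) Ng g g') (hη : 0 < η)
    : Tendsto (fun m : ℝ => ∫ ν in 0..m, quadOsc η ν*ampK f g η ν) atTop (𝓝 (halfK f g η)) ∧ ∀ m,
    2*η ≤ m → ‖halfK f g η - ∫ ν in 0..m, quadOsc η ν*ampK f g η ν‖ ≤
    4*4^(1 + 2*p)*(Nf*Ng)*m^(-(1 + 2*p))/η := by
  have hi := ii_of_loc (locallyIntegrable_quadOsc_ampK hp hf hg η)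
  obtain ⟨l, hl, hl'⟩ := exists_tendsto_of_cauchy (m₀ := 2*η)
    (I := fun m : ℝ => ∫ ν in 0..m, quadOsc η ν*ampK f g η ν)
    (ρ := fun m => 4*4^(1 + 2*p)*(Nf*Ng)/η*m^(-(1 + 2*p)))
    (tendsto_const_mul_rpow_neg _ (by linarith)) (fun m m' hm hmm => by
      rw [integral_interval_sub_left (hi _ _) (hi _ _)]
      refine (norm_tailK_le hp hf hg hη hm hmm).trans_eq (by ring))
  have : halfK f g η = l := hl.limUnder_eq
  grind

lemma tendsto_halfK (hf : Adm 0 1 Nf f f') (hg : Adm 0 1 Ng g g') (hη : 0 < η) :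
    Tendsto (fun m : ℝ => ∫ ν in 0..m, quadOsc η ν*ampK f g η ν) atTop (𝓝 (halfK f g η)) :=
  (halfK_spec (p := 0) le_rfl (by simpa using hf) (by simpa using hg) hη).1

lemma integral_integrandK (hf : Adm 0 1 Nf f f') (hg : Adm 0 1 Ng g g') (η a b : ℝ) :
    ∫ ν in a..b, integrandK f g η ν = (∫ ν in 0..b, quadOsc η ν*ampK f g η ν) + ∫ ν in 0..(-a),
      quadOsc η ν*ampK g f η ν := by
  have hi := ii_of_loc (locallyIntegrable_quadOsc_ampK le_rfl hf hg η)
  have e : ∫ ν in 0..(-a), quadOsc η ν*ampK g f η ν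
      = ∫ ν in a..0, quadOsc η ν*ampK f g η ν := by
    have := integral_comp_neg (a := 0) (b := -a) (fun ν => quadOsc η ν*ampK f g η ν)
    simp only [quadOsc_neg_right, ampK_neg, neg_neg, neg_zero] at this
    exact this
  simp only [integrandK_eq]
  rw [e, add_comm, ii_split (hi _ _) (hi _ _)]

lemma locallyIntegrable_integrandK (hf : Adm 0 1 Nf f f') (hg : Adm 0 1 Ng g g') (η : ℝ) :
    LocallyIntegrable (integrandK f g η) volume := by
  have := locallyIntegrable_quadOsc_ampK le_rfl hf hg η
  have e : integrandK f g η = fun ν => quadOsc η ν*ampK f g η ν := by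
    funext ν; exact integrandK_eq f g η ν
  rwa [e]

lemma tendsto_integrandK (hf : Adm 0 1 Nf f f') (hg : Adm 0 1 Ng g g') (hη : 0 < η) :
    Tendsto (fun p : ℝ × ℝ => ∫ x in p.1..p.2, integrandK f g η x) (atBot ×ˢ atTop)
      (𝓝 (halfK f g η + halfK g f η)) := by
  simp only [integral_integrandK hf hg]
  refine Tendsto.add ?_ ?_
  · exact (tendsto_halfK hf hg hη).comp tendsto_snd
  · exact (tendsto_halfK hg hf hη).comp (tendsto_neg_atBot_atTop.comp tendsto_fst)

lemma improperIntegral_eq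
    (h : Tendsto (fun p : ℝ × ℝ => ∫ x in p.1..p.2, F x) (atBot ×ˢ atTop) (𝓝 l)) :
    improperIntegral F = l := h.limUnder_eq

lemma opK_eq_halfK (hf : Adm 0 1 Nf f f') (hg : Adm 0 1 Ng g g') (hη : 0 < η) :
    opK f g η = halfK f g η + halfK g f η :=
  improperIntegral_eq (tendsto_integrandK hf hg hη)

lemma integrandK_neg (f g : ℝ → ℂ) (η ν : ℝ) :
    integrandK f g (-η) ν = conj (integrandK (refl f) (refl g) η (-ν)) := by
  simp only [integrandK, refl, map_mul, conj_conj, ← Complex.exp_conj, conj_ofReal, Complex.conj_I]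
  congr 3
  · push_cast; ring_nf
  · ring
  · ring

lemma tendsto_integrandK_neg (h : Tendsto (fun p : ℝ × ℝ => ∫ x in p.1..p.2, integrandK (refl f)
    (refl g) η x) (atBot ×ˢ atTop) (𝓝 l)) : Tendsto
    (fun p : ℝ × ℝ => ∫ x in p.1..p.2, integrandK f g (-η) x) (atBot ×ˢ atTop) (𝓝 (conj l)) := by
  have h2 : Tendsto (fun p : ℝ × ℝ => (-p.2, -p.1)) (atBot ×ˢ atTop) (atBot ×ˢ atTop) :=
    (tendsto_neg_atTop_atBot.comp tendsto_snd).prodMk (tendsto_neg_atBot_atTop.comp tendsto_fst)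
  have h3 := (continuous_conj.tendsto l).comp (h.comp h2)
  refine h3.congr fun p => ?_
  simp only [Function.comp]
  rw [← integral_comp_neg (a := p.1) (b := p.2) (fun ν => integrandK (refl f) (refl g) η ν)]
  simp only [integrandK_neg]
  rw [intervalIntegral, intervalIntegral, map_sub, ← integral_conj, ← integral_conj]

lemma opK_neg (hf : Adm 0 1 Nf f f') (hg : Adm 0 1 Ng g g') (hη : 0 < η) :
    opK f g (-η) = conj (opK (refl f) (refl g) η) := by
  have := tendsto_integrandK hf.refl hg.refl hη
  rw [opK_eq_halfK hf.refl hg.refl hη]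
  exact improperIntegral_eq (tendsto_integrandK_neg this)

lemma improperConverges_integrandK (hf : Adm 0 1 Nf f f') (hg : Adm 0 1 Ng g g') (hη : η ≠ 0) :
    ImproperConverges (integrandK f g η) := by
  refine ⟨locallyIntegrable_integrandK hf hg η, ?_⟩
  rcases lt_or_gt_of_ne hη with h | h
  · have := tendsto_integrandK_neg (tendsto_integrandK hf.refl hg.refl (neg_pos.2 h))
    rw [neg_neg] at this
    exact ⟨_, this⟩
  · exact ⟨_, tendsto_integrandK hf hg h⟩

lemma tendsto_opK (hf : Adm 0 1 Nf f f') (hg : Adm 0 1 Ng g g') (hη : η ≠ 0) :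
    Tendsto (fun p : ℝ × ℝ => ∫ x in p.1..p.2, integrandK f g η x) (atBot ×ˢ atTop) (𝓝 (opK f g η))
      := by
  obtain ⟨l, hl⟩ := (improperConverges_integrandK hf hg hη).2
  rw [opK, improperIntegral_eq hl]; exact hl

lemma norm_halfK_lim_le (hf : Adm 0 1 Nf f f') (hg : Adm 0 1 Ng g g') (hη : 0 < η) :
    ‖halfK f g η‖ ≤ 33*(Nf*Ng)/√η :=
  le_of_tendsto (tendsto_halfK hf hg hη).norm
    ((eventually_ge_atTop 0).mono fun _ hm => norm_halfK_le hf hg hη hm)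

lemma norm_opK_le (hf : Adm 0 1 Nf f f') (hg : Adm 0 1 Ng g g') (hη : η ≠ 0) :
    ‖opK f g η‖ ≤ 66*(Nf*Ng)/√|η| := by
  have pos : ∀ {f f' g g' : ℝ → ℂ}, Adm 0 1 Nf f f' → Adm 0 1 Ng g g' → ∀ η : ℝ, 0 < η →
      ‖opK f g η‖ ≤ 66*(Nf*Ng)/√|η| := by
    intro f f' g g' hf hg η h
    rw [opK_eq_halfK hf hg h, abs_of_pos h]
    refine (norm_add_le_of_le (norm_halfK_lim_le hf hg h) (norm_halfK_lim_le hg hf h)).trans_eq ?_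
    ring
  rcases lt_or_gt_of_ne hη with h | h
  · have h' := neg_pos.2 h
    have e := opK_neg hf hg h'
    rw [neg_neg] at e
    rw [e, Complex.norm_conj]
    simpa using pos hf.refl hg.refl (-η) h'
  · exact pos hf hg η h

lemma measurable_integral_quadOsc_ampK (hf : Measurable f) (hg : Measurable g) (a b : ℝ) :
    StronglyMeasurable (fun η => ∫ ν in a..b, integrandK f g η ν) := by
  have hm : StronglyMeasurable (fun x : ℝ × ℝ => integrandK f g x.1 x.2) := by
    apply Measurable.stronglyMeasurable
    simp only [integrandK_eq]
    refine Measurable.mul ?_ (measurable_ampK hf hg)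
    unfold quadOsc
    exact Continuous.measurable (by fun_prop)
  exact (hm.integral_prod_right (ν := volume.restrict (Ioc a b))).sub
    (hm.integral_prod_right (ν := volume.restrict (Ioc b a)))

lemma aestronglyMeasurable_opK (hf : Adm 0 1 Nf f f') (hg : Adm 0 1 Ng g g') :
    AEStronglyMeasurable (opK f g) volume := by
  refine aestronglyMeasurable_of_tendsto_ae (u := atTop)
    (f := fun (n : ℕ) η => ∫ ν in (-(n : ℝ))..n, integrandK f g η ν)
    (fun n => (measurable_integral_quadOsc_ampK hf.meas hg.meas _ _).aestronglyMeasurable) ?_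
  filter_upwards [ae_ne 0] with η hη
  have h2 : Tendsto (fun n : ℕ => (-(n : ℝ), (n : ℝ))) atTop (atBot ×ˢ atTop) :=
    (tendsto_neg_atTop_atBot.comp tendsto_natCast_atTop_atTop).prodMk tendsto_natCast_atTop_atTop
  exact (tendsto_opK hf hg hη).comp h2

/-! ### The leading term of `opK` at large frequencies -/

lemma norm_ampK'_near_le (hp : 0 ≤ p) (hf : Adm p (1 + p) Nf f f') (hg : Adm p (1 + p) Ng g g')
    (hη : 0 < η) (hν : 0 < ν) (hν2 : ν < η/2) :
    ‖ampK' f f' g g' η ν‖ ≤ Nf*Ng*(η/4)^(-(1 + 2*p)) := by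
  have hη4 : 0 < η/4 := by positivity
  refine (norm_ampK'_le hf hg hη hν (by linarith)).trans
    (mul_mono ?_ (mul_nonneg hf.nonneg hg.nonneg))
  have e1 : η/4 ≤ 1 + |(η + ν)/2| := by grind
  have e2 : η/4 ≤ 1 + |(η - ν)/2| := by grind
  calc _ ≤ (η/4)^(-p)*(η/4)^(-(1 + p)) :=
        mul_le_mul (wt_le_of_le hp hη4 e1) (wt_le_of_le (by linarith) hη4 e2) (wt_nonneg _ _)
          (by positivity)
    _ = _ := by rw [← rpow_add hη4]; congr 1; ring

lemma norm_integral_near_le (hp : 0 ≤ p) (hf : Adm p (1 + p) Nf f f') (hg : Adm p (1 + p) Ng g g')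
    (hη : 1 ≤ η) : ‖∫ ν in 0..η/2, quadOsc η ν*(ampK f g η ν - ampK f g η 0)‖ ≤
    Nf*Ng*(η/4)^(-(1 + 2*p))*(3 + 3*log η)/η := by
  have hη0 : 0 < η := by linarith
  have hN := mul_nonneg hf.nonneg hg.nonneg
  set D := Nf*Ng*(η/4)^(-(1 + 2*p)) with hD
  have hD0 : 0 ≤ D := by positivity
  have hlog : 0 ≤ log η := Real.log_nonneg hη
  have hq : 0 < √η := sqrt_pos.2 hη0
  have hqq : √η*√η = η := mul_self_sqrt hη0.le
  have hq1 : 1 ≤ √η := one_le_sqrt.2 hη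
  set δ := (2*√η)⁻¹ with hδ
  have hδ0 : 0 < δ := by positivity
  have hδη : δ ≤ η/2 := by
    have : δ ≤ 1/2 := by
      rw [hδ, inv_eq_one_div, div_le_div_iff₀ (by positivity) (by norm_num)]; linarith
    linarith
  have hac : ACOn (fun ν => ampK f g η ν - ampK f g η 0) (ampK' f f' g g' η) (Ioo (-η) η) := by
    have := (acOn_ampK_left hf hg (η := η)).sub (ACOn.const (ampK f g η 0) _)
    simpa using this
  have hlip : ∀ ν ∈ Ioo 0 (η/2), ‖ampK f g η ν - ampK f g η 0‖ ≤ D*ν := by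
    intro ν hν
    have h1 := (acOn_ampK_left hf hg (η := η)).ftc 0 ⟨by linarith, hη0⟩ ν
      ⟨by linarith [hν.1], by linarith [hν.2]⟩ hν.1.le
    rw [h1]
    have := norm_ii_le_const (a := 0) (b := ν) (C := D) (f := ampK' f f' g g' η) (fun t ht => by
        rw [uIoc_of_le hν.1.le] at ht
        exact norm_ampK'_near_le hp hf hg hη0 ht.1 (ht.2.trans_lt hν.2))
    grind
  have hloc : LocallyIntegrable (fun ν => quadOsc η ν*(ampK f g η ν - ampK f g η 0)) volume := by
    have h1 := locallyIntegrable_quadOsc_ampK hp hf hg η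
    have h2 : LocallyIntegrable (fun ν => quadOsc η ν*ampK f g η 0) volume :=
      ((continuous_quadOsc η).mul continuous_const).locallyIntegrable
    refine (h1.sub h2).congr (.of_forall fun ν => ?_)
    simp [mul_sub]
  have hi := ii_of_loc hloc
  rw [← ii_split (hi 0 δ) (hi δ (η/2))]
  have b1 : ‖∫ ν in 0..δ, quadOsc η ν*(ampK f g η ν - ampK f g η 0)‖ ≤ D/η := by
    have : ‖∫ ν in 0..δ, quadOsc η ν*(ampK f g η ν - ampK f g η 0)‖ ≤ (D*δ)*|δ - 0| := by
      refine intervalIntegral.norm_integral_le_of_norm_le_const_ae ?_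
      filter_upwards [ae_ne δ] with ν hne hν
      rw [uIoc_of_le hδ0.le] at hν
      have hlt : ν < δ := lt_of_le_of_ne hν.2 hne
      rw [norm_mul, norm_quadOsc, one_mul]
      refine (hlip ν ⟨hν.1, hlt.trans_le hδη⟩).trans ?_
      gcongr
    refine this.trans ?_
    rw [sub_zero, abs_of_pos hδ0]
    have : δ*δ ≤ 1/η := by
      rw [hδ, ← mul_inv, inv_eq_one_div]
      apply one_div_le_one_div_of_le hη0
      nlinarith
    calc D*δ*δ = D*(δ*δ) := by ring
      _ ≤ D*(1/η) := by gcongr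
      _ = D/η := by ring
  have b2 : ‖∫ ν in δ..η/2, quadOsc η ν*(ampK f g η ν - ampK f g η 0)‖
      ≤ (2*D + 3*D*log η)/η := by
    have hsub : Ioo δ (η/2) ⊆ Ioo 0 (η/2) := Ioo_subset_Ioo hδ0.le le_rfl
    refine norm_integral_quadOsc_le (Γ := fun ν => 2*D*log ν) (γ := fun ν => 2*D*ν⁻¹)
      hη0 hδ0.le hδη hD0 (by positivity) (hac.mono ?_) (fun ν hν => hlip ν (hsub hν)) ?_ ?_ ?_
    · grind
    · intro ν hν
      exact (Real.hasDerivAt_log (hδ0.trans hν.1).ne').const_mul _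
    · intro ν hν
      have hν0 := hδ0.trans hν.1
      calc _ ≤ D/ν + D*ν/ν^2 := by
            gcongr
            · exact norm_ampK'_near_le hp hf hg hη0 hν0 hν.2
            grind
        _ = _ := by field_simp; ring
    · intro x hx y hy _
      have hy0 := hδ0.trans hy.1
      have e1 : log y ≤ log (η/2) := log_le_log hy0 hy.2.le
      have e2 : log δ ≤ log x := log_le_log hδ0 hx.1.le
      have e3 : log (η/2) - log δ = 3/2*log η := by
        rw [hδ, Real.log_inv, Real.log_div hη0.ne' (by norm_num),
          Real.log_mul (by norm_num) hq.ne', Real.log_sqrt hη0.le]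
        ring
      have : 2*D*(log y - log x) ≤ 2*D*(3/2*log η) := by gcongr; linarith
      linarith
  refine (norm_add_le_of_le b1 b2).trans_eq ?_
  ring

lemma norm_integral_far_le (hp : 0 ≤ p) (hσ : 0 < σ) (hpσ : p ≤ σ) (hσp : σ ≤ p + 1)
    (hf : Adm p (1 + p) Nf f f') (hg : Adm p (1 + p) Ng g g') (hη : 1 ≤ η) (ha : η/2 ≤ a)
    (hab : a ≤ b) (hside : b ≤ η ∨ η ≤ a) :
    ‖∫ ν in a..b, quadOsc η ν*ampK f g η ν‖ ≤ Nf*Ng*(η/4)^(-p)*(6/η + 16/σ*η^(σ - p - 1))/η := by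
  have hη0 : 0 < η := by linarith
  have hN := mul_nonneg hf.nonneg hg.nonneg
  have ha0 : 0 < a := by linarith
  set D := Nf*Ng*(η/4)^(-p) with hD
  have hD0 : 0 ≤ D := by positivity
  set X := η^(σ - p - 1) with hX
  have hX0 : 0 ≤ X := by positivity
  have hne : ∀ ν ∈ Ioo a b, ν ≠ η := by grind
  have e1 : ∀ ν ∈ Ioo a b, η/4 ≤ 1 + |(η + ν)/2| := by grind
  have hG : ∀ ν ∈ Ioo a b, ‖ampK f g η ν‖ ≤ D := by
    intro ν hν
    rw [ampK, norm_mul]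
    calc _ ≤ (Nf*(η/4)^(-p))*Ng := by
          refine mul_le_mul ((hf.bd _ ?_).trans ?_) (hg.le hp ?_) (norm_nonneg _)
            (mul_nonneg hf.nonneg (by positivity))
          · grind
          · exact mul_mono (wt_le_of_le hp (by positivity) (e1 ν hν)) hf.nonneg
          grind
      _ = D := by rw [hD]; ring
  have hG' : ∀ ν ∈ Ioo a b, ‖ampK' f f' g g' η ν‖ ≤ D*(1 + |(η - ν)/2|)^(-(1 + p)) := by
    intro ν hν
    refine (norm_ampK'_le hf hg hη0 (ha0.trans hν.1) (hne ν hν)).trans ?_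
    rw [hD, mul_assoc (Nf*Ng) ((η/4)^(-p))]
    refine mul_mono ?_ hN
    exact mul_le_mul_of_nonneg_right (wt_le_of_le hp (by positivity) (e1 ν hν)) (wt_nonneg _ _)
  have hkey : ∀ ν ∈ Ioo a b, (1 + |(η - ν)/2|)^(-(1 + p))/ν ≤ 8*X*(1 + |(η - ν)/2|)^(-(1 + σ)) := by
    intro ν hν
    have hν0 := ha0.trans hν.1
    have hT0 : 0 < 1 + |(η - ν)/2| := by positivity
    have hT : 1 + |(η - ν)/2| ≤ 4*ν := by
      have : |(η - ν)/2| ≤ (η + ν)/2 := by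
        rw [abs_le]; constructor <;> linarith
      linarith [hν.1]
    have h2 : (4*ν)^(σ - p)/ν = 4^(σ - p)*ν^(σ - p - 1) := by
      rw [Real.mul_rpow (by norm_num) hν0.le, rpow_sub hν0 (σ - p), rpow_one]; ring
    have h3 : ν^(σ - p - 1) ≤ (η/2)^(σ - p - 1) :=
      rpow_le_rpow_of_nonpos (by positivity) (by linarith [hν.1]) (by linarith)
    have h4 : (4 : ℝ)^(σ - p) ≤ 4 := by
      calc (4 : ℝ)^(σ - p) ≤ 4^(1 : ℝ) :=
            rpow_mono (by norm_num) (by linarith)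
        _ = 4 := by norm_num
    have h5 : (η/2)^(σ - p - 1) ≤ 2*X := by
      rw [div_rpow hη0.le (by norm_num), ← hX, div_eq_mul_inv, ← rpow_neg (by norm_num)]
      have : (2 : ℝ)^(-(σ - p - 1)) ≤ 2^(1 : ℝ) := rpow_mono (by norm_num) (by linarith)
      nlinarith
    have h6 : (1 + |(η - ν)/2|)^(-(1 + p)) =
        (1 + |(η - ν)/2|)^(σ - p)*(1 + |(η - ν)/2|)^(-(1 + σ)) := by
      rw [← rpow_add hT0]; congr 1; ring
    rw [h6]
    calc _ ≤ (4*ν)^(σ - p)*(1 + |(η - ν)/2|)^(-(1 + σ))/ν := by gcongr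
      _ = (4*ν)^(σ - p)/ν*(1 + |(η - ν)/2|)^(-(1 + σ)) := by ring
      _ ≤ 8*X*(1 + |(η - ν)/2|)^(-(1 + σ)) := by
          gcongr
          rw [h2]
          calc _ ≤ 4*(2*X) := by
                gcongr
                exact h3.trans h5
            _ = 8*X := by ring
  have main : ∀ τ : ℝ, |τ| = 1 → (∀ ν ∈ Ioo a b, |(η - ν)/2| = τ*((η - ν)/2)) →
      ‖∫ ν in a..b, quadOsc η ν*ampK f g η ν‖ ≤ D*(6/η + 16/σ*X)/η := by
    intro τ hτ habs
    have hτ2 : τ^2 = 1 := by rw [← sq_abs, hτ, one_pow]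
    have hac : ACOn (ampK f g η) (ampK' f f' g g' η) (Ioo a b) := by
      rcases hside with h | h
      · exact (acOn_ampK_left hf hg).mono (Ioo_subset_Ioo (by linarith) h)
      · exact (acOn_ampK_right hf hg hη0).mono fun ν hν => h.trans_lt hν.1
    have := norm_integral_quadOsc_le (η := η) (S := D*(2/η)) (V := D*(16/σ*X) + D*(2/η))
      (Γ := fun ν => D*(8*X*(τ*(2/σ*(1 + τ*((η - ν)/2))^(-σ)))) + D*(-ν⁻¹))
      (γ := fun ν => D*(8*X*(1 + τ*((η - ν)/2))^(-(1 + σ))) + D*(ν^2)⁻¹)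
      hη0 ha0.le hab (by positivity) (by positivity) hac ?_ ?_ ?_ ?_
    · grind
    · intro ν hν
      refine (hG ν hν).trans ?_
      rw [mul_assoc]
      refine le_mul_of_one_le_right hD0 ?_
      rw [div_mul_eq_mul_div, le_div_iff₀ hη0]; linarith [hν.1]
    · intro ν hν
      have hν0 := ha0.trans hν.1
      have hpos : 0 < 1 + τ*((η - ν)/2) := by rw [← habs ν hν]; positivity
      have hd : HasDerivAt (fun ν : ℝ => 1 + τ*((η - ν)/2)) (-(τ/2)) ν := by
        have := ((((hasDerivAt_id ν).const_sub η).div_const 2).const_mul τ).const_add 1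
        exact this.congr_deriv (by ring)
      have h1 := (hd.rpow_const (p := -σ) (.inl hpos.ne')).const_mul (2/σ)
      have h2 := ((h1.const_mul τ).const_mul (8*X)).const_mul D
      have h3 := (hasDerivAt_inv hν0.ne').neg.const_mul D
      refine (h2.add h3).congr_deriv ?_
      rw [show -σ - 1 = -(1 + σ) by ring]
      have hσσ : σ*σ⁻¹ = 1 := mul_inv_cancel₀ hσ.ne'
      grind
    · intro ν hν
      have hν0 := ha0.trans hν.1
      rw [← habs ν hν]
      refine add_le_add ?_ ?_
      · calc _ ≤ D*(1 + |(η - ν)/2|)^(-(1 + p))/ν := by gcongr; exact hG' ν hν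
          _ = D*((1 + |(η - ν)/2|)^(-(1 + p))/ν) := by ring
          _ ≤ _ := mul_mono (hkey ν hν) hD0
      · rw [div_eq_mul_inv]; gcongr; exact hG ν hν
    · intro x hx y hy _
      have hy0 := ha0.trans hy.1
      have hb1 : ∀ ν ∈ Ioo a b, 0 ≤ (1 + τ*((η - ν)/2))^(-σ) ∧ (1 + τ*((η - ν)/2))^(-σ) ≤ 1 := by
        intro ν hν
        rw [← habs ν hν]
        exact ⟨by positivity, wt_le_one hσ.le⟩
      have hby := hb1 y hy
      have hbx := hb1 x hx
      have h6 : τ*(1 + τ*((η - y)/2))^(-σ) - τ*(1 + τ*((η - x)/2))^(-σ) ≤ 1 := by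
        rcases eq_or_eq_neg_of_abs_eq hτ with h | h
        · simp only [h] at hby hbx ⊢; linarith
        · simp only [h] at hby hbx ⊢; linarith
      have h7 : x⁻¹ - y⁻¹ ≤ 2/η := by
        have h71 : x⁻¹ ≤ (η/2)⁻¹ := by gcongr; linarith [hx.1]
        have h72 : 0 < y⁻¹ := by positivity
        rw [inv_div] at h71; linarith
      have h8 : D*(8*X*(2/σ)) * (τ*(1 + τ*((η - y)/2))^(-σ) - τ*(1 + τ*((η - x)/2))^(-σ))
          ≤ D*(8*X*(2/σ))*1 := by gcongr
      have h9 : D*(x⁻¹ - y⁻¹) ≤ D*(2/η) := by gcongr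
      grind
  rcases hside with h | h
  · refine main 1 (by simp) fun ν hν => ?_
    rw [one_mul, abs_of_nonneg]; linarith [hν.2]
  · refine main (-1) (by simp) fun ν hν => ?_
    rw [abs_of_nonpos]; · ring
    linarith [hν.1]

/-- The half-line Fresnel integral at frequency `η`. -/
def halfFresnel (η : ℝ) : ℂ := halfK (fun _ => 1) (fun _ => 1) η

lemma tendsto_halfFresnel (hη : 0 < η) :
    Tendsto (fun m : ℝ => ∫ ν in 0..m, quadOsc η ν) atTop (𝓝 (halfFresnel η)) := by
  have := tendsto_halfK (adm_const 1) (adm_const 1) hη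
  simpa [ampK, halfFresnel] using this

lemma norm_integral_quadOsc_tail (hη : 0 < η) (ha : 0 < a) (hab : a ≤ b) :
    ‖∫ ν in a..b, quadOsc η ν‖ ≤ 3/a/η := by
  have := norm_integral_quadOsc_le (η := η) (G := fun _ => 1) (G' := fun _ => 0) (S := 1/a)
    (V := 1/a) (Γ := fun ν => -ν⁻¹) (γ := fun ν => (ν^2)⁻¹) hη ha.le hab (by positivity)
    (by positivity) (ACOn.const 1 _) ?_ ?_ ?_ ?_
  · grind
  · intro ν hν
    simp only [norm_one]
    rw [div_mul_eq_mul_div, le_div_iff₀ ha]; linarith [hν.1]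
  · intro ν hν
    exact (hasDerivAt_inv (ha.trans hν.1).ne').neg.congr_deriv (by ring)
  · intro ν hν
    simp
  · intro x hx y hy _
    have h1 : x⁻¹ ≤ a⁻¹ := by gcongr; exact hx.1.le
    have h2 : 0 < y⁻¹ := inv_pos.2 (ha.trans hy.1)
    rw [one_div]; linarith

/-- Expansion of `halfK` at large frequencies. -/
lemma norm_halfK_sub_le (hp : 0 ≤ p) (hσ : 0 < σ) (hpσ : p ≤ σ) (hσp : σ ≤ p + 1)
    (hf : Adm p (1 + p) Nf f f') (hg : Adm p (1 + p) Ng g g') (hη : 1 ≤ η) :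
    ‖halfK f g η - f (η/2)*g (η/2)*halfFresnel η‖ ≤ 4^(1 + 2*p)*(24 + 35/σ)*(Nf*Ng)*η^(-2 - 2*p + σ)
      := by
  have hη0 : 0 < η := by linarith
  have hN := mul_nonneg hf.nonneg hg.nonneg
  have e0 : ampK f g η 0 = f (η/2)*g (η/2) := by simp [ampK]
  rw [← e0]
  have hlim := ((halfK_spec hp hf hg hη0).1.sub
    ((tendsto_halfFresnel hη0).const_mul (ampK f g η 0))).norm
  refine le_of_tendsto hlim ((eventually_ge_atTop η).mono fun m hm => ?_)
  have hi := ii_of_loc (locallyIntegrable_quadOsc_ampK hp hf hg η)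
  have hi1 : ∀ a b : ℝ, IntervalIntegrable (quadOsc η) volume a b := fun a b =>
    (continuous_quadOsc η).intervalIntegrable _ _
  have split : (∫ ν in 0..m, quadOsc η ν*ampK f g η ν)
      - ampK f g η 0*∫ ν in 0..m, quadOsc η ν
      = (∫ ν in 0..η/2, quadOsc η ν*(ampK f g η ν - ampK f g η 0))
        + (∫ ν in η/2..η, quadOsc η ν*ampK f g η ν)
        + (∫ ν in η..m, quadOsc η ν*ampK f g η ν)
        - ampK f g η 0*∫ ν in η/2..m, quadOsc η ν := by
    rw [← ii_split (hi 0 (η/2)) (hi (η/2) m), ← ii_split (hi (η/2) η) (hi η m),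
      ← ii_split (hi1 0 (η/2)) (hi1 (η/2) m)]
    have : ∫ ν in 0..η/2, quadOsc η ν*(ampK f g η ν - ampK f g η 0)
        = (∫ ν in 0..η/2, quadOsc η ν*ampK f g η ν)
          - ampK f g η 0*∫ ν in 0..η/2, quadOsc η ν := by
      rw [← ii_const_mul, ← ii_sub (hi _ _) ((hi1 _ _).const_mul _)]
      congr 1; funext ν; ring
    rw [this]; ring
  rw [split]
  have b1 := norm_integral_near_le hp hf hg hη
  have b2 := norm_integral_far_le hp hσ hpσ hσp hf hg hη le_rfl (by linarith) (.inl le_rfl)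
  have b3 := norm_integral_far_le hp hσ hpσ hσp hf hg hη (by linarith) hm (.inr le_rfl)
  have b4 := norm_integral_quadOsc_tail hη0 (by positivity : 0 < η/2) (by linarith : η/2 ≤ m)
  have b5 : ‖ampK f g η 0‖ ≤ Nf*Ng*(η/4)^(-(2*p)) := by
    rw [e0, norm_mul]
    have e1 : η/4 ≤ 1 + |η/2| := by grind
    calc _ ≤ (Nf*(η/4)^(-p))*(Ng*(η/4)^(-p)) := by
          refine mul_le_mul ((hf.bd _ ?_).trans ?_) ((hg.bd _ ?_).trans ?_) (norm_nonneg _)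
            (mul_nonneg hf.nonneg (by positivity))
          · positivity
          · exact mul_mono (wt_le_of_le hp (by positivity) e1) hf.nonneg
          · positivity
          · exact mul_mono (wt_le_of_le hp (by positivity) e1) hg.nonneg
      _ = Nf*Ng*((η/4)^(-p)*(η/4)^(-p)) := by ring
      _ = _ := by rw [← rpow_add (by positivity)]; congr 2; ring
  have hdiv : ∀ r : ℝ, (η/4)^(-r) = 4^r*η^(-r) := by
    intro r
    rw [div_rpow hη0.le (by norm_num), rpow_neg (by norm_num : (0:ℝ) ≤ 4), div_inv_eq_mul, mul_comm]
  set E := η^(-2 - 2*p + σ) with hE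
  set A := (4 : ℝ)^(1 + 2*p) with hA
  have hA1 : (4 : ℝ)^p ≤ A := rpow_mono (by norm_num) (by linarith)
  have hA2 : (4 : ℝ)^(2*p) ≤ A := rpow_mono (by norm_num) (by linarith)
  have hlog : log η ≤ η^σ/σ := Real.log_le_rpow_div hη0.le hσ
  have hmono : ∀ r, r ≤ -2 - 2*p + σ → η^r ≤ E := fun r hr => rpow_mono hη hr
  have hdivη : ∀ r : ℝ, η^r/η = η^(r - 1) := fun r => by rw [rpow_sub hη0, rpow_one]
  have c1 : Nf*Ng*(η/4)^(-(1 + 2*p))*(3 + 3*log η)/η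
      ≤ A*(3 + 3/σ)*(Nf*Ng)*E := by
    rw [hdiv]
    have h1 : η^(-(1 + 2*p))/η ≤ E := by grind
    have h2 : η^(-(1 + 2*p))/η*log η ≤ E/σ := by
      calc η^(-(1 + 2*p))/η*log η ≤ η^(-(1 + 2*p))/η*(η^σ/σ) := by gcongr
        _ = (η^(-(1 + 2*p) - 1)*η^σ)/σ := by rw [hdivη]; ring
        _ = E/σ := by rw [← rpow_add hη0, hE]; congr 2; ring
    calc _ = Nf*Ng*A*(3*(η^(-(1 + 2*p))/η)
          + 3*(η^(-(1 + 2*p))/η*log η)) := by ring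
      _ ≤ Nf*Ng*A*(3*E + 3*(E/σ)) := by gcongr
      _ = _ := by ring
  have c2 : Nf*Ng*(η/4)^(-p)*(6/η + 16/σ*η^(σ - p - 1))/η
      ≤ A*(6 + 16/σ)*(Nf*Ng)*E := by
    rw [hdiv]
    have h1 : η^(-p)/η/η ≤ E := by grind
    have h2 : η^(-p)/η*η^(σ - p - 1) ≤ E := by rw [hdivη, ← rpow_add hη0]; grind
    calc _ = Nf*Ng*4^p*(6*(η^(-p)/η/η)
          + 16/σ*(η^(-p)/η*η^(σ - p - 1))) := by ring
      _ ≤ Nf*Ng*A*(6*E + 16/σ*E) := by gcongr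
      _ = _ := by ring
  have c4 : ‖ampK f g η 0*∫ ν in η/2..m, quadOsc η ν‖ ≤ A*6*(Nf*Ng)*E := by
    rw [norm_mul]
    have h1 : η^(-(2*p))/η/η ≤ E := by grind
    calc _ ≤ (Nf*Ng*(η/4)^(-(2*p)))*(3/(η/2)/η) := by gcongr
      _ = Nf*Ng*4^(2*p)*(6*(η^(-(2*p))/η/η)) := by rw [hdiv]; field_simp; ring
      _ ≤ Nf*Ng*A*(6*E) := by gcongr
      _ = _ := by ring
  refine (norm_sub_le_of_le ((norm_add_le_of_le (norm_add_le_of_le (b1.trans c1) (b2.trans c2)) (b3.trans c2))) c4).trans ?_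
  have : 0 ≤ A*(Nf*Ng)*E := by positivity
  grind

/-! ### The phase of `opJ` -/

/-- The oscillation `e^{-3iΦ(ξ, η)}`. -/
def phaseOsc (ξ η : ℝ) : ℂ := cis(-3*phase ξ η)

/-- The derivative of `Φ(ξ, η)` in `η`. -/
def dphase (ξ η : ℝ) : ℝ := ξ^2 - 2*ξ*η + 3/4*η^2

lemma norm_phaseOsc (ξ η : ℝ) : ‖phaseOsc ξ η‖ = 1 := norm_exp_ofReal_mul_I _

lemma continuous_phaseOsc_right (ξ : ℝ) : Continuous (phaseOsc ξ) := by
  unfold phaseOsc phase; fun_prop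

lemma integrandJ_eq (f g : ℝ → ℂ) (ξ η : ℝ) :
    integrandJ f g ξ η = phaseOsc ξ η*(g η*refl f (ξ - η)) := by
  rw [integrandJ, phaseOsc, refl, neg_sub]; ring

lemma dphase_eq (ξ η : ℝ) : dphase ξ η = 3/4*(η - 2*ξ)*(η - 2/3*ξ) := by
  rw [dphase]; ring

lemma hasDerivAt_dphase (ξ η : ℝ) : HasDerivAt (dphase ξ) (-2*ξ + 3/2*η) η := by
  have h1 := ((hasDerivAt_id η).const_mul (2*ξ)).const_sub (ξ^2)
  have h2 := (hasDerivAt_pow 2 η).const_mul (3/4)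
  refine (h1.add h2).congr_deriv ?_
  simp; ring

lemma norm_integral_phaseOsc_le (hab : a ≤ b) (hS0 : 0 ≤ S) (hV0 : 0 ≤ V)
    (hne : ∀ η ∈ Ioo a b, dphase ξ η ≠ 0) (hG : ACOn G G' (Ioo a b))
    (hS : ∀ η ∈ Ioo a b, ‖G η‖ ≤ S*|dphase ξ η|) (hΓ : ∀ η ∈ Ioo a b, HasDerivAt Γ (γ η) η)
    (hγ : ∀ η ∈ Ioo a b, ‖G' η‖/|dphase ξ η| + ‖G η‖*(|-2*ξ + 3/2*η|/dphase ξ η^2) ≤ γ η)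
    (hV : ∀ x ∈ Ioo a b, ∀ y ∈ Ioo a b, x ≤ y → Γ y - Γ x ≤ V) :
    ‖∫ η in a..b, phaseOsc ξ η*G η‖ ≤ 2*S + V := by
  have hdc : Continuous (dphase ξ) := by unfold dphase; fun_prop
  have hinv : ACOn (fun η : ℝ => (((-3*dphase ξ η)⁻¹ : ℝ) : ℂ))
      (fun η : ℝ => ((1/3*((-2*ξ + 3/2*η)/dphase ξ η^2) : ℝ) : ℂ)) (Ioo a b) := by
    refine ACOn.of_hasDerivAt (fun η hη => ?_) ?_
    · have := ((hasDerivAt_dphase ξ η).const_mul (-3)).inv (by simpa using hne η hη)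
      refine HasDerivAt.ofReal_comp (this.congr_deriv ?_)
      field_simp
    · refine continuous_ofReal.comp_continuousOn (continuousOn_const.mul
        (ContinuousOn.div (by fun_prop) (hdc.pow 2).continuousOn fun η hη => ?_))
      grind
  have hB := hG.mul hinv
  have habs : ∀ η, |(-3*dphase ξ η)⁻¹| = 1/3*|dphase ξ η|⁻¹ := fun η => by
    rw [abs_inv, abs_mul, abs_neg, abs_of_pos (by norm_num : (0 : ℝ) < 3), mul_inv]; norm_num
  refine norm_integral_osc_le (ψ := fun η => -3*phase ξ η) (ψ' := fun η => -3*dphase ξ η)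
    hab hS0 hV0 (fun η _ => ?_) (hdc.const_smul (-3 : ℝ)).continuousOn hB (fun η hη => ?_)
    hΓ (fun η hη => ?_) hV (fun η hη => ?_)
  · have h1 := (hasDerivAt_id η).mul_const (ξ^2)
    have h2 := (hasDerivAt_pow 2 η).const_mul ξ
    have h3 := (hasDerivAt_pow 3 η).div_const 4
    refine (((h1.sub h2).add h3).const_mul (-3)).congr_deriv ?_
    simp [dphase]; ring
  · have hd := abs_pos.2 (hne η hη)
    rw [norm_mul, norm_real, norm_eq_abs, habs]
    calc _ ≤ S*|dphase ξ η| * (1/3*|dphase ξ η|⁻¹) := by gcongr; exact hS η hη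
      _ = S/3 := by field_simp
      _ ≤ S := by linarith
  · refine le_trans ?_ (hγ η hη)
    refine (norm_add_le _ _).trans ?_
    rw [norm_mul, norm_mul, norm_real, norm_real, norm_eq_abs,
      norm_eq_abs, habs, abs_mul, abs_of_pos (by norm_num : (0 : ℝ) < 1/3), abs_div,
      abs_of_nonneg (sq_nonneg (dphase ξ η)), div_eq_mul_inv (‖G' η‖)]
    gcongr
    · have : 0 ≤ |dphase ξ η|⁻¹ := by positivity
      linarith
    · have : 0 ≤ |-2*ξ + 3/2*η|/dphase ξ η^2 := by positivity
      linarith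
  · have hd : ((-3*dphase ξ η : ℝ) : ℂ) ≠ 0 := by
      exact_mod_cast mul_ne_zero (by norm_num) (hne η hη)
    rw [phaseOsc, Complex.ofReal_inv]
    grind

/-- Van der Corput bound on an interval that avoids the stationary points. -/
lemma norm_integral_phaseOsc_piece_le (hξ : 0 < ξ) (hρ : 0 < ρ) (hab : a ≤ b)
    (h1 : ∀ η ∈ Ioo a b, ρ ≤ |η - 2*ξ|) (h2 : ∀ η ∈ Ioo a b, ρ ≤ |η - 2/3*ξ|)
    (s1 : b ≤ 2*ξ ∨ 2*ξ ≤ a) (s2 : b ≤ 2/3*ξ ∨ 2/3*ξ ≤ a) :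
    ‖∫ η in a..b, phaseOsc ξ η‖ ≤ 6/(ρ*ξ) := by
  have hlow : ∀ η ∈ Ioo a b, ρ*ξ/2 ≤ |dphase ξ η| := by
    intro η hη
    have a1 := h1 η hη
    have a2 := h2 η hη
    have htri : 4/3*ξ ≤ |η - 2*ξ| + |η - 2/3*ξ| := by grind
    rw [dphase_eq, abs_mul, abs_mul, abs_of_pos (by norm_num : (0 : ℝ) < 3/4)]
    rcases le_total (2/3*ξ) (|η - 2*ξ|) with h | h
    · nlinarith [mul_le_mul h a2 hρ.le (abs_nonneg _)]
    · have h' : 2/3*ξ ≤ |η - 2/3*ξ| := by linarith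
      nlinarith [mul_le_mul a1 h' (by positivity) (abs_nonneg (η - 2*ξ))]
  have hpos : 0 < ρ*ξ/2 := by positivity
  have hne : ∀ η ∈ Ioo a b, dphase ξ η ≠ 0 := fun η hη => abs_pos.1 (hpos.trans_le (hlow η hη))
  have n1 : ∀ η ∈ Ioo a b, η - 2*ξ ≠ 0 := fun η hη => abs_pos.1 (hρ.trans_le (h1 η hη))
  have n2 : ∀ η ∈ Ioo a b, η - 2/3*ξ ≠ 0 := fun η hη => abs_pos.1 (hρ.trans_le (h2 η hη))
  have range : ∀ c : ℝ, (b ≤ c ∨ c ≤ a) → (∀ η ∈ Ioo a b, ρ ≤ |η - c|) →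
      ∀ x ∈ Ioo a b, ∀ y ∈ Ioo a b, (x - c)⁻¹ - (y - c)⁻¹ ≤ 1/ρ := by
    intro c hc hcρ x hx y hy
    have hx' := hcρ x hx
    have hy' := hcρ y hy
    rcases hc with h | h
    · rw [abs_of_neg (by linarith [hy.2])] at hy'
      have e1 : (x - c)⁻¹ ≤ 0 := inv_nonpos.2 (by linarith [hx.2])
      have e2 : (-(y - c))⁻¹ ≤ ρ⁻¹ := by gcongr
      grind
    · rw [abs_of_pos (by linarith [hx.1])] at hx'
      have e1 : 0 ≤ (y - c)⁻¹ := inv_nonneg.2 (by linarith [hy.1])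
      have e2 : (x - c)⁻¹ ≤ ρ⁻¹ := by gcongr
      rw [one_div]; linarith
  have := norm_integral_phaseOsc_le (ξ := ξ) (G := fun _ => 1) (G' := fun _ => 0)
    (S := 2/(ρ*ξ)) (V := 2/(ρ*ξ))
    (Γ := fun η => 1/ξ*(-(η - 2*ξ)⁻¹) + 1/ξ*(-(η - 2/3*ξ)⁻¹))
    (γ := fun η => 1/ξ*((η - 2*ξ)^2)⁻¹ + 1/ξ*((η - 2/3*ξ)^2)⁻¹)
    hab (by positivity) (by positivity) hne (ACOn.const 1 _) ?_ ?_ ?_ ?_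
  · grind
  · intro η hη
    rw [norm_one, div_mul_eq_mul_div, le_div_iff₀ (by positivity)]
    linarith [hlow η hη]
  · intro η hη
    have d1 := (((hasDerivAt_id η).sub_const (2*ξ)).inv (n1 η hη)).neg.const_mul (1/ξ)
    have d2 := (((hasDerivAt_id η).sub_const (2/3*ξ)).inv (n2 η hη)).neg.const_mul (1/ξ)
    refine (d1.add d2).congr_deriv ?_
    simp only [id]; ring
  · intro η hη
    simp only [norm_zero, zero_div, zero_add, norm_one, one_mul]
    have m1 := n1 η hη
    have m2 := n2 η hη
    have z : ∀ u w : ℝ, u ≠ 0 → w ≠ 0 → 0 < w - u → 3/4*(u + w)/(3/4*u*w)^2 =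
          1/(3/4*(w - u))*(u^2)⁻¹ - 1/(3/4*(w - u))*(w^2)⁻¹ := by
      grind
    have z' := z _ _ m1 m2 (by linarith)
    rw [show 3/4*(η - 2/3*ξ - (η - 2*ξ)) = ξ by ring,
      show 3/4*(η - 2*ξ + (η - 2/3*ξ)) = -2*ξ + 3/2*η by ring,
      ← dphase_eq] at z'
    have p1 : 0 ≤ 1/ξ*((η - 2*ξ)^2)⁻¹ := by positivity
    have p2 : 0 ≤ 1/ξ*((η - 2/3*ξ)^2)⁻¹ := by positivity
    rw [← abs_of_nonneg (sq_nonneg (dphase ξ η)), ← abs_div, z', abs_le]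
    constructor <;> linarith
  · intro x hx y hy _
    have r1 := range _ s1 h1 x hx y hy
    have r2 := range _ s2 h2 x hx y hy
    have e : 2/(ρ*ξ) = 1/ξ*(1/ρ) + 1/ξ*(1/ρ) := by field_simp; ring
    have hξ1 : 0 ≤ 1/ξ := by positivity
    nlinarith [mul_mono r1 hξ1, mul_mono r2 hξ1]

lemma norm_integral_le_of_window {M' : ℝ} (hab : a ≤ b) (hρ : 0 ≤ ρ) (hM : 0 ≤ M) (hM' : 0 ≤ M')
    (hi : ∀ x y, IntervalIntegrable F volume x y) (h1 : ∀ x, ‖F x‖ ≤ 1)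
    (H : ∀ y, a ≤ y → y ≤ b → y ≤ c - ρ → ‖∫ t in a..y, F t‖ ≤ M)
    (H' : ∀ x, a ≤ x → x ≤ b → c + ρ ≤ x → ‖∫ t in x..b, F t‖ ≤ M') :
    ‖∫ t in a..b, F t‖ ≤ M + (2*ρ + M') := by
  obtain ⟨p, hp⟩ : ∃ p, p = max a (min b (c - ρ)) := ⟨_, rfl⟩
  obtain ⟨q, hq⟩ : ∃ q, q = max a (min b (c + ρ)) := ⟨_, rfl⟩
  have w := norm_ii_le_const (a := p) (b := q) fun x _ => h1 x
  rw [← ii_split (hi a p) (hi p b), ← ii_split (hi p q) (hi q b)]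
  refine norm_add_le_of_le ?_ (norm_add_le_of_le (w.trans (by grind)) ?_)
  · rcases (by grind : p = a ∨ a ≤ p ∧ p ≤ b ∧ p ≤ c - ρ) with h | h
    · simpa [h]
    · exact H p h.1 h.2.1 h.2.2
  · rcases (by grind : q = b ∨ a ≤ q ∧ q ≤ b ∧ c + ρ ≤ q) with h | h
    · simpa [h]
    · exact H' q h.1 h.2.1 h.2.2

/-- Van der Corput bound on arbitrary intervals. -/
lemma norm_integral_phaseOsc_le_rsqrt (hξ : 1 ≤ ξ) (hab : a ≤ b) :
    ‖∫ η in a..b, phaseOsc ξ η‖ ≤ 40/√ξ := by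
  have hξ0 : 0 < ξ := by linarith
  have hq1 : 1 ≤ √ξ := one_le_sqrt.2 hξ
  obtain ⟨ρ, hρ⟩ : ∃ ρ, ρ = 1/(2*√ξ) := ⟨_, rfl⟩
  have hρ0 : 0 < ρ := by rw [hρ]; positivity
  have hρ1 : ρ ≤ 1/2 := by rw [hρ, div_le_div_iff₀ (by positivity) (by norm_num)]; linarith
  have h12 : 6/(ρ*ξ) = 12/√ξ := by
    have := mul_self_sqrt hξ0.le
    grind
  have hi : ∀ x y : ℝ, IntervalIntegrable (phaseOsc ξ) volume x y := fun x y =>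
    (continuous_phaseOsc_right ξ).intervalIntegrable _ _
  have n1 : ∀ x, ‖phaseOsc ξ x‖ ≤ 1 := fun x => (norm_phaseOsc ξ x).le
  have m0 : 0 ≤ 12/√ξ := by positivity
  have piece : ∀ x y, x ≤ y → (y ≤ 2*ξ - ρ ∨ 2*ξ + ρ ≤ x) →
      (y ≤ 2/3*ξ - ρ ∨ 2/3*ξ + ρ ≤ x) → ‖∫ η in x..y, phaseOsc ξ η‖ ≤ 12/√ξ := by
    intro x y hxy h1 h2
    rw [← h12]
    refine norm_integral_phaseOsc_piece_le hξ0 hρ0 hxy (fun η hη => ?_) (fun η hη => ?_)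
      (by grind) (by grind)
    all_goals obtain ⟨l, r⟩ := hη; grind
  have left : ∀ y, a ≤ y → y ≤ b → y ≤ 2*ξ - ρ → ‖∫ η in a..y, phaseOsc ξ η‖ ≤
      12/√ξ + (2*ρ + 12/√ξ) := fun y hy _ hc =>
    norm_integral_le_of_window hy hρ0.le m0 m0 hi n1
      (fun x h1 h2 h3 => piece a x h1 (by grind) (.inl h3))
      fun x h1 h2 h3 => piece x y h2 (.inl hc) (.inr h3)
  refine (norm_integral_le_of_window hab hρ0.le (by positivity) m0 hi n1 left
    fun x h1 h2 h3 => piece x b h2 (.inr h3) (.inr (by linarith))).trans ?_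
  have h1ρ : 2*ρ = 1/√ξ := by rw [hρ]; field_simp
  rw [h1ρ]
  linarith [show 38/√ξ = 12/√ξ + (1/√ξ + 12/√ξ) + (1/√ξ + 12/√ξ) by ring,
    show 38/√ξ ≤ 40/√ξ by gcongr; norm_num]

/-! ### Amplitudes of bounded variation -/

/-- On `(a, b)`, the function `G` with derivative `G'` is bounded by `V` and has variation at
most `V`. -/
structure SV (G G' : ℝ → ℂ) (a b V : ℝ) : Prop where
  nonneg : 0 ≤ V
  ac : ACOn G G' (Ioo a b)
  sup : ∀ x ∈ Ioo a b, ‖G x‖ ≤ V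
  var : ∀ x ∈ Ioo a b, ∀ y ∈ Ioo a b, x ≤ y → ∫ t in x..y, ‖G' t‖ ≤ V

lemma SV.mono {a₁ b₁ V₁ : ℝ} (h : SV G G' a b V) (ha : a ≤ a₁) (hb : b₁ ≤ b) (hV : V ≤ V₁) :
    SV G G' a₁ b₁ V₁ := by
  have hs : Ioo a₁ b₁ ⊆ Ioo a b := Ioo_subset_Ioo ha hb
  exact ⟨h.nonneg.trans hV, h.ac.mono hs, fun x hx => (h.sup x (hs hx)).trans hV,
    fun x hx y hy hxy => (h.var x (hs hx) y (hs hy) hxy).trans hV⟩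

lemma SV.of_antideriv (hV : 0 ≤ V) (hG : ACOn G G' (Ioo a b)) (hS : ∀ x ∈ Ioo a b, ‖G x‖ ≤ V)
    (hΓ : ∀ x ∈ Ioo a b, HasDerivAt Γ (γ x) x) (hγ : ∀ x ∈ Ioo a b, ‖G' x‖ ≤ γ x)
    (h : ∀ x ∈ Ioo a b, ∀ y ∈ Ioo a b, x ≤ y → Γ y - Γ x ≤ V) : SV G G' a b V := by
  refine ⟨hV, hG, hS, fun x hx y hy hxy => ?_⟩
  have hsub : Icc x y ⊆ Ioo a b := Icc_subset_Ioo hx.1 hy.2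
  have := norm_integral_le_of_antideriv_Icc (F := fun t => ((‖G' t‖ : ℝ) : ℂ)) hxy
    (fun t ht => hΓ t (hsub ht)) (fun t ht => by simpa using hγ t (hsub ht))
  rw [intervalIntegral.integral_ofReal, norm_real] at this
  exact (le_abs_self _).trans (this.trans (h x hx y hy hxy))

/-- An increasing primitive of a power of the distance to a point outside the interval. -/
lemma exists_antideriv_rpow {s : ℝ} (hα : 0 ≤ α) (hs : s ≠ 0) (hN : 0 ≤ N) (h : c ≤ a ∨ b ≤ c)
    (hK : ∀ x ∈ Ioo a b, N/|s| * (α + |x - c|)^s ≤ K) : ∃ Γ : ℝ → ℝ,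
    (∀ x ∈ Ioo a b, HasDerivAt Γ (N*(α + |x - c|)^(s - 1)) x) ∧ ∀ x ∈ Ioo a b, ∀ y ∈ Ioo a b, x ≤ y
    → Γ y - Γ x ≤ K := by
  obtain ⟨σ, hσ, e⟩ : ∃ σ : ℝ, (σ = 1 ∨ σ = -1) ∧ ∀ x ∈ Ioo a b, |x - c| = σ*(x - c) := by
    rcases h with h | h
    · exact ⟨1, by simp, by grind⟩
    · exact ⟨-1, by simp, by grind⟩
  have h0 : ∀ x : ℝ, 0 ≤ N/|s| * (α + |x - c|)^s := fun x => by positivity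
  refine ⟨fun x => σ*(N/s*(α + σ*(x - c))^s), fun x hx => ?_, fun x hx y hy _ => ?_⟩
  · have hx0 : 0 < |x - c| := by grind
    rw [e x hx] at hx0 ⊢
    refine ((((((hasDerivAt_id x).sub_const c).const_mul σ).const_add α).rpow_const (p := s)
      (.inl (by simp; linarith))).const_mul (N/s)).const_mul σ |>.congr_deriv ?_
    have : σ*σ = 1 := by grind
    simp only [id]
    grind
  · simp only [← e x hx, ← e y hy]
    have h1 := hK x hx
    have h2 := hK y hy
    have h3 := h0 x
    have h4 := h0 y
    rcases hσ with rfl | rfl <;> rcases abs_cases s with ⟨e, _⟩ | ⟨e, _⟩ <;>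
      simp only [e, div_neg, neg_mul, one_mul] at * <;> linarith

lemma SV.of_rpow {s : ℝ} (hK0 : 0 ≤ K) (hα : 0 ≤ α) (hs : s ≠ 0) (hN : 0 ≤ N) (h : 0 ≤ a ∨ b ≤ 0)
    (hK : ∀ x ∈ Ioo a b, N/|s| * (α + |x|)^s ≤ K) (hG : ACOn G G' (Ioo a b))
    (hS : ∀ x ∈ Ioo a b, ‖G x‖ ≤ K) (hd : ∀ x ∈ Ioo a b, ‖G' x‖ ≤ N*(α + |x|)^(s - 1)) :
    SV G G' a b K := by
  obtain ⟨Γ, h1, h2⟩ := exists_antideriv_rpow hα hs hN h (by simpa using hK)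
  simp only [sub_zero] at h1
  exact SV.of_antideriv hK0 hG hS h1 hd h2

lemma SV.mul {W : ℝ} (hG : SV G G' a b V) (hH : SV H H' a b W) :
    SV (fun x => G x*H x) (fun x => G' x*H x + G x*H' x) a b (2*(V*W)) := by
  have hV := hG.nonneg
  have hW := hH.nonneg
  refine ⟨by positivity, hG.ac.mul hH.ac, fun x hx => ?_, fun x hx y hy hxy => ?_⟩
  · rw [norm_mul]
    have := mul_le_mul (hG.sup x hx) (hH.sup x hx) (norm_nonneg _) hV
    have : 0 ≤ V*W := by positivity
    linarith
  · have hsub : Icc x y ⊆ Ioo a b := Icc_subset_Ioo hx.1 hy.2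
    have i1 := (hG.ac.int x hx y hy hxy).norm.mul_const W
    have i2 := (hH.ac.int x hx y hy hxy).norm.const_mul V
    have i0 := ((hG.ac.mul hH.ac).int x hx y hy hxy).norm
    calc ∫ t in x..y, ‖G' t*H t + G t*H' t‖
        ≤ ∫ t in x..y, (‖G' t‖*W + V*‖H' t‖) := by
          refine intervalIntegral.integral_mono_on hxy i0 (i1.add i2) fun t ht => ?_
          refine (norm_add_le _ _).trans ?_
          rw [norm_mul, norm_mul]
          gcongr
          · exact hH.sup t (hsub ht)
          · exact hG.sup t (hsub ht)
      _ = (∫ t in x..y, ‖G' t‖)*W + V*∫ t in x..y, ‖H' t‖ := by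
          rw [ii_add i1 i2, ii_mul_const, ii_const_mul]
      _ ≤ V*W + V*W := by
          gcongr
          · exact hG.var x hx y hy hxy
          · exact hH.var x hx y hy hxy
      _ = 2*(V*W) := by ring

lemma SV.comp_sub (h : SV G G' a b V) (c : ℝ) :
    SV (fun x => G (c - x)) (fun x => -G' (c - x)) (c - b) (c - a) V := by
  have hm : ∀ x, x ∈ Ioo (c - b) (c - a) → c - x ∈ Ioo a b := fun x hx =>
    ⟨by linarith [hx.2], by linarith [hx.1]⟩
  refine ⟨h.nonneg, ?_, fun x hx => h.sup _ (hm x hx), fun x hx y hy hxy => ?_⟩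
  · have := (h.ac.comp_affine (c := -1) (by norm_num) c).mono (t := Ioo (c - b) (c - a))
      (fun x hx => by grind)
    refine this.congr (fun x _ => ?_) (fun x _ => ?_)
    · congr 1; ring
    · push_cast; grind
  · simp only [norm_neg]
    rw [intervalIntegral.integral_comp_sub_left (fun x => ‖G' x‖)]
    exact h.var _ (hm y hy) _ (hm x hx) (by linarith)

/-- Integration by parts against a function with bounded primitives. -/
lemma SV.norm_integral_mul_le {E : ℝ → ℂ} (hab : a ≤ b) (hG : SV G G' a b V) (hM : 0 ≤ M)
    (hi : ∀ x ∈ Ioo a b, ∀ y ∈ Ioo a b, IntervalIntegrable E volume x y)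
    (hE : ∀ x ∈ Ioo a b, ∀ y ∈ Ioo a b, x ≤ y → ‖∫ t in x..y, E t‖ ≤ M) :
    ‖∫ t in a..b, E t*G t‖ ≤ 2*M*V := by
  have hV := hG.nonneg
  refine norm_intervalIntegral_le_of_Ioo hab (by positivity) fun x hx y hy hxy => ?_
  have hF : ACOn (fun t => ∫ s in x..t, E s) E (Ioo a b) :=
    ⟨fun u hu v hv _ => hi u hu v hv, fun u hu v hv _ =>
      integral_interval_sub_left (hi x hx v hv) (hi x hx u hu)⟩
  obtain ⟨i2, e⟩ := hF.integral_mul hG.ac hx hy hxy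
  rw [e, intervalIntegral.integral_same, zero_mul, sub_zero, mul_assoc, two_mul]
  refine norm_sub_le_of_le ?_ ((intervalIntegral.norm_integral_le_integral_norm hxy).trans ?_)
  · rw [norm_mul]
    exact mul_le_mul (hE x hx y hy hxy) (hG.sup y hy) (norm_nonneg _) hM
  · refine (intervalIntegral.integral_mono_on hxy i2.norm
      ((hG.ac.int x hx y hy hxy).norm.const_mul M) fun t ht => ?_).trans ?_
    · rw [norm_mul]
      exact mul_le_mul_of_nonneg_right (hE x hx t (Icc_subset_Ioo hx.1 hy.2 ht) ht.1)
        (norm_nonneg _)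
    · rw [ii_const_mul]
      exact mul_mono (hG.var x hx y hy hxy) hM

/-- First derivative test for oscillatory integrals. -/
lemma SV.norm_integral_osc_le {ψ'' : ℝ → ℝ} (hab : a ≤ b) (hρ : 0 < ρ) (hG : SV G G' a b V)
    (hψ : ∀ x ∈ Ioo a b, HasDerivAt ψ (ψ' x) x) (hψ' : ∀ x ∈ Ioo a b, HasDerivAt ψ' (ψ'' x) x)
    (hψ'' : ContinuousOn ψ'' (Ioo a b)) (hs : (∀ x ∈ Ioo a b, 0 ≤ ψ'' x) ∨ ∀ x ∈ Ioo a b, ψ'' x ≤ 0)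
    (hl : ∀ x ∈ Ioo a b, ρ ≤ |ψ' x|) : ‖∫ t in a..b, cis(ψ t)*G t‖ ≤ 12*V/ρ := by
  have hV := hG.nonneg
  have hne : ∀ x ∈ Ioo a b, ψ' x ≠ 0 := fun x hx => abs_pos.1 (hρ.trans_le (hl x hx))
  have hc : ContinuousOn ψ (Ioo a b) := HasDerivAt.continuousOn hψ
  have hc' : ContinuousOn ψ' (Ioo a b) := fun x hx => (hψ' x hx).continuousAt.continuousWithinAt
  have hd : ∀ x ∈ Ioo a b, HasDerivAt (fun x => (ψ' x)⁻¹) (-ψ'' x/ψ' x^2) x := fun x hx =>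
    (hψ' x hx).inv (hne x hx)
  have hinv : ∀ x ∈ Ioo a b, |(ψ' x)⁻¹| ≤ 1/ρ := fun x hx => by
    rw [abs_inv, one_div]; exact inv_anti₀ hρ (hl x hx)
  have ac : ACOn (fun x => (((ψ' x)⁻¹ : ℝ) : ℂ)) (fun x => ((-ψ'' x/ψ' x^2 : ℝ) : ℂ))
      (Ioo a b) := by
    refine ACOn.of_hasDerivAt (fun x hx => (hd x hx).ofReal_comp) ?_
    exact continuous_ofReal.comp_continuousOn
      (hψ''.neg.div (hc'.pow 2) fun x hx => pow_ne_zero 2 (hne x hx))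
  obtain ⟨σ, hσ, hs⟩ : ∃ σ : ℝ, |σ| = 1 ∧ ∀ x ∈ Ioo a b, |ψ'' x| = σ*ψ'' x := by
    rcases hs with h | h
    · exact ⟨1, abs_one, fun x hx => by rw [abs_of_nonneg (h x hx), one_mul]⟩
    · exact ⟨-1, by simp, fun x hx => by rw [abs_of_nonpos (h x hx), neg_one_mul]⟩
  refine (hG.norm_integral_mul_le hab (M := 2*(1/ρ) + 2*(1/ρ)) (by positivity)
    (fun x hx y hy => ContinuousOn.intervalIntegrable ?_) fun x hx y hy hxy => ?_).trans ?_
  · have := ordConnected_Ioo.uIcc_subset hx hy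
    have := hc.mono this
    fun_prop
  · have hsub : Ioo x y ⊆ Ioo a b := Ioo_subset_Ioo hx.1.le hy.2.le
    refine SelfSimilar.norm_integral_osc_le (ψ := ψ) (ψ' := ψ') (Γ := fun x => -σ*(ψ' x)⁻¹) hxy
      (by positivity) (by positivity) (fun t ht => hψ t (hsub ht)) (hc'.mono hsub) (ac.mono hsub)
      (fun t ht => ?_) (fun t ht => (hd t (hsub ht)).const_mul _) (fun t ht => ?_)
      (fun u hu v hv _ => ?_) fun t ht => ?_
    · rw [norm_real]; exact hinv t (hsub ht)
    · rw [norm_real, norm_eq_abs, abs_div, abs_neg, hs t (hsub ht), abs_of_nonneg (sq_nonneg _)]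
      exact le_of_eq (by ring)
    · rw [← mul_sub]
      refine (le_abs_self _).trans ?_
      rw [abs_mul, abs_neg, hσ, one_mul, two_mul]
      exact (abs_sub _ _).trans (add_le_add (hinv v (hsub hv)) (hinv u (hsub hu)))
    · have : (ψ' t : ℂ) ≠ 0 := by exact_mod_cast hne t (hsub ht)
      push_cast
      field_simp
  · rw [show 2*(2*(1/ρ) + 2*(1/ρ))*V = 8*V/ρ by ring]
    gcongr; norm_num

lemma SV.norm_integral_phaseOsc_le (hξ : 1 ≤ ξ) (hab : a ≤ b) (hG : SV G G' a b V) :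
    ‖∫ η in a..b, phaseOsc ξ η*G η‖ ≤ 80/√ξ*V := by
  rw [show 80/√ξ = 2*(40/√ξ) by ring]
  exact hG.norm_integral_mul_le hab (by positivity)
    (fun x _ y _ => (continuous_phaseOsc_right ξ).intervalIntegrable x y)
    fun x _ y _ hxy => norm_integral_phaseOsc_le_rsqrt hξ hxy

lemma SV.of_symbol (hρ : 0 < ρ) (hθ : 1/2 ≤ θ) (hM : 0 ≤ M) (h : ρ ≤ a ∨ b ≤ -ρ)
    (ac : ACOn G G' (Ioo a b)) (bd : ∀ x ∈ Ioo a b, ‖G x‖ ≤ M*|x|^(-θ))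
    (bd' : ∀ x ∈ Ioo a b, ‖G' x‖ ≤ M*|x|^(-θ - 1)) : SV G G' a b (2*M*ρ^(-θ)) := by
  have hab : ∀ x ∈ Ioo a b, ρ ≤ |x| := fun x hx => by grind
  have hpow : ∀ x ∈ Ioo a b, M*|x|^(-θ) ≤ M*ρ^(-θ) := fun x hx =>
    mul_mono (rpow_le_rpow_of_nonpos hρ (hab x hx) (by linarith)) hM
  have h0 : 0 ≤ M*ρ^(-θ) := by positivity
  refine SV.of_rpow (α := 0) (N := M) (s := -θ) (by positivity) le_rfl (by linarith) hM (h.imp (by grind) (by grind))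
    (fun x hx => ?_) ac (fun x hx => by linarith [bd x hx, hpow x hx]) (by simpa using bd')
  rw [zero_add, abs_neg, abs_of_pos (by linarith), div_mul_eq_mul_div, div_le_iff₀ (by linarith)]
  nlinarith [hpow x hx]

lemma Adm.acOn_Ioo (hf : Adm p q N f f') (h : 0 ≤ a ∨ b ≤ 0) : ACOn f f' (Ioo a b) := by
  rcases h with h | h
  · exact hf.pos.mono fun x hx => h.trans_lt hx.1
  · exact hf.neg.mono fun x hx => hx.2.trans_le h

/-- Far from the origin, relative to the length of the interval. -/
lemma Adm.sv_far (hf : Adm p (1 + p) N f f') (hp : 0 ≤ p) (hρ : 0 < ρ) (h : ρ ≤ a ∨ b ≤ -ρ)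
    (hL : b - a ≤ 4*ρ) : SV f f' a b (4*N*ρ^(-p)) := by
  have hN := hf.nonneg
  have hab : ∀ x ∈ Ioo a b, ρ ≤ |x| := fun x hx => by grind
  have hne : ∀ x ∈ Ioo a b, x ≠ 0 := fun x hx => abs_pos.1 (hρ.trans_le (hab x hx))
  refine SV.of_antideriv (Γ := fun x => N*ρ^(-p - 1)*x) (γ := fun _ => N*ρ^(-p - 1))
    (by positivity) (hf.acOn_Ioo (by grind))
    (fun x hx => ?_) (fun x _ => by simpa using (hasDerivAt_id x).const_mul (N*ρ^(-p - 1)))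
    (fun x hx => ?_) (fun x hx y hy _ => ?_)
  · have h1 := hf.bd x (hne x hx)
    have h2 := mul_mono (wt_le_of_le hp hρ (by linarith [hab x hx] : ρ ≤ 1 + |x|)) hN
    have h0 : 0 ≤ N*ρ^(-p) := by positivity
    linarith
  · refine (hf.bd' x (hne x hx)).trans ?_
    have := wt_le_of_le (p := 1 + p) (by linarith) hρ (by linarith [hab x hx] : ρ ≤ 1 + |x|)
    rw [show -p - 1 = -(1 + p) by ring]
    gcongr
  · have e : 4*N*ρ^(-p) = N*ρ^(-p - 1)*(4*ρ) := by rw [rpow_sub hρ, rpow_one]; field_simp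
    rw [e, ← mul_sub]
    gcongr
    linarith [hx.1, hy.2]

/-- On a bounded half neighbourhood of the origin. -/
lemma Adm.sv_near (hf : Adm 0 1 N f f') (hL : 1 ≤ L) (h : 0 ≤ a ∧ b ≤ L ∨ b ≤ 0 ∧ -L ≤ a) :
    SV f f' a b (10*N*L^(1/5 : ℝ)) := by
  have hN := hf.nonneg
  have hL1 : 1 ≤ L^(1/5 : ℝ) := one_le_rpow hL (by norm_num)
  have hbd : ∀ x : ℝ, |x| ≤ L → (1 + |x|)^(1/5 : ℝ) ≤ 2*L^(1/5 : ℝ) := fun x hx => by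
    calc (1 + |x|)^(1/5 : ℝ) ≤ (2*L)^(1/5 : ℝ) :=
          rpow_le_rpow (by positivity) (by linarith) (by norm_num)
      _ = 2^(1/5 : ℝ)*L^(1/5 : ℝ) := Real.mul_rpow (by norm_num) (by linarith)
      _ ≤ 2*L^(1/5 : ℝ) := by
          gcongr
          calc (2 : ℝ)^(1/5 : ℝ) ≤ 2^(1 : ℝ) :=
                rpow_mono (by norm_num) (by norm_num)
            _ = 2 := rpow_one _
  have hne : ∀ x ∈ Ioo a b, x ≠ 0 := fun x hx => by grind
  refine SV.of_rpow (α := 1) (N := N) (s := 1/5) (by positivity) zero_le_one (by norm_num) hN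
    (by grind) (fun x hx => ?_)
    (hf.acOn_Ioo (by grind)) (fun x hx => ?_) fun x hx => ?_
  · have := mul_mono (hbd x (by grind)) hN
    rw [abs_of_pos (by norm_num)]
    linarith
  · have h1 := hf.bd x (hne x hx)
    rw [neg_zero, rpow_zero] at h1
    nlinarith
  · refine (hf.bd' x (hne x hx)).trans ?_
    gcongr
    · linarith [abs_nonneg x]
    · norm_num

/-! ### Symbols and the estimates of `opJ` -/

/-- A function which behaves like `|x|^(-θ)` up to one derivative. -/
structure Symb (θ D : ℝ) (κ κ' : ℝ → ℂ) : Prop where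
  nonneg : 0 ≤ D
  bd : ∀ x, x ≠ 0 → ‖κ x‖ ≤ D*|x|^(-θ)
  bd' : ∀ x, x ≠ 0 → ‖κ' x‖ ≤ D*|x|^(-θ - 1)
  pos : ACOn κ κ' (Ioi 0)
  neg : ACOn κ κ' (Iio 0)

lemma Symb.acOn_Ioo (hf : Symb θ D f f') (h : 0 ≤ a ∨ b ≤ 0) : ACOn f f' (Ioo a b) := by
  rcases h with h | h
  · exact hf.pos.mono fun x hx => h.trans_lt hx.1
  · exact hf.neg.mono fun x hx => hx.2.trans_le h

lemma Symb.sv (hκ : Symb θ D κ κ') (hθ : 1/2 ≤ θ) (hρ : 0 < ρ) (h : ρ ≤ a ∨ b ≤ -ρ) :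
    SV κ κ' a b (2*D*ρ^(-θ)) := by
  have hne : ∀ x ∈ Ioo a b, x ≠ 0 := fun x hx => by grind
  exact SV.of_symbol hρ hθ hκ.nonneg h (hκ.acOn_Ioo (by grind))
    (fun x hx => hκ.bd x (hne x hx)) (fun x hx => hκ.bd' x (hne x hx))

lemma rpow_neg_le (hx : 0 < x) (hc : 1 ≤ c) (hq : 0 ≤ q) {n : ℕ} (hqn : q ≤ n)
    (h : x/c ≤ y) : y^(-q) ≤ c^n*x^(-q) := by
  have hc0 : 0 < c := by linarith
  calc y^(-q) ≤ (x/c)^(-q) := rpow_le_rpow_of_nonpos (by positivity) h (by linarith)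
    _ = c^q*x^(-q) := by rw [div_rpow hx.le hc0.le, rpow_neg hc0.le, div_inv_eq_mul, mul_comm]
    _ ≤ c^n*x^(-q) := by
      gcongr
      rw [← rpow_natCast]
      exact rpow_mono hc hqn

/-- The amplitude of `opJ` in the region where `|η| ≤ 5 |ξ - η|`. -/
lemma Symb.sv_mul_far (hκ : Symb θ D κ κ') (hθ : 1/2 ≤ θ) (hH : Adm p (1 + p) N H H') (hp : 0 ≤ p)
    (hp1 : p ≤ 1) (hρ : 0 < ρ) (h : ρ ≤ a ∨ b ≤ -ρ) (hs : ξ ≤ a ∨ b ≤ ξ)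
    (hfar : ∀ x ∈ Ioo a b, |x| ≤ 5*|ξ - x|) : SV (fun η => κ η*H (ξ - η))
    (fun η => κ' η*H (ξ - η) + κ η * -H' (ξ - η)) a b (60*(D*N)*ρ^(-(θ + p))) := by
  have hD := hκ.nonneg
  have hN := hH.nonneg
  have hne : ∀ x ∈ Ioo a b, x ≠ 0 := fun x hx => by grind
  have hne' : ∀ x ∈ Ioo a b, ξ - x ≠ 0 := fun x hx h0 => by grind
  have hacH : ACOn (fun η => H (ξ - η)) (fun η => -H' (ξ - η)) (Ioo a b) := by
    have key : ∀ s : Set ℝ, ACOn H H' s → (∀ x ∈ Ioo a b, ξ - x ∈ s) →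
        ACOn (fun η => H (ξ - η)) (fun η => -H' (ξ - η)) (Ioo a b) := fun s hs hm => by
      have := (hs.comp_affine (c := -1) (by norm_num) ξ).mono (t := Ioo a b)
        (fun x hx => by grind)
      refine this.congr (fun x _ => ?_) (fun x _ => ?_)
      · congr 1; ring
      · push_cast; grind
    rcases hs with hs | hs
    · exact key _ hH.neg fun x hx => by grind
    · exact key _ hH.pos fun x hx => by grind
  have hac := (hκ.acOn_Ioo (h.imp (fun h => by linarith) (fun h => by linarith) :
    0 ≤ a ∨ b ≤ 0)).mul hacH
  have h1 : ∀ x ∈ Ioo a b, (1 + |ξ - x|)^(-p) ≤ 5*|x|^(-p) := fun x hx => by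
    have := rpow_neg_le (c := 5) (n := 1) (q := p) (abs_pos.2 (hne x hx)) (by norm_num)
      hp (by simpa using hp1) (y := 1 + |ξ - x|) (by linarith [hfar x hx])
    simpa using this
  have h2 : ∀ x ∈ Ioo a b, (1 + |ξ - x|)^(-(1 + p)) ≤ 25*|x|^(-(1 + p)) := fun x hx => by
    have := rpow_neg_le (c := 5) (n := 2) (q := 1 + p) (abs_pos.2 (hne x hx))
      (by norm_num) (by linarith) (by norm_num; linarith) (y := 1 + |ξ - x|)
      (by linarith [hfar x hx])
    linarith
  have h3 := SV.of_symbol (θ := θ + p) (M := 30*(D*N)) hρ (by linarith) (by positivity) h hac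
    (fun x hx => ?_) (fun x hx => ?_)
  · grind
  · have hx0 := abs_pos.2 (hne x hx)
    rw [norm_mul, neg_add, rpow_add hx0]
    calc ‖κ x‖*‖H (ξ - x)‖ ≤ (D*|x|^(-θ))*(N*(5*|x|^(-p))) := by
          gcongr
          · exact hκ.bd x (hne x hx)
          · exact (hH.bd _ (hne' x hx)).trans (by gcongr; exact h1 x hx)
      _ ≤ 30*(D*N)*(|x|^(-θ)*|x|^(-p)) := by
          have : 0 ≤ D*N*(|x|^(-θ)*|x|^(-p)) := by positivity
          linarith
  · have hx0 := abs_pos.2 (hne x hx)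
    have e1 : |x|^(-(θ + p) - 1) = |x|^(-θ - 1)*|x|^(-p) := by rw [← rpow_add hx0]; congr 1; ring
    have e2 : |x|^(-θ)*|x|^(-(1 + p)) = |x|^(-θ - 1)*|x|^(-p) := by
      rw [← rpow_add hx0, ← rpow_add hx0]; congr 1; ring
    calc ‖κ' x*H (ξ - x) + κ x * -H' (ξ - x)‖
        ≤ ‖κ' x‖*‖H (ξ - x)‖ + ‖κ x‖*‖H' (ξ - x)‖ := by
          refine (norm_add_le _ _).trans ?_
          simp
      _ ≤ (D*|x|^(-θ - 1))*(N*(5*|x|^(-p)))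
          + (D*|x|^(-θ))*(N*(25*|x|^(-(1 + p)))) := by
          gcongr
          · exact hκ.bd' x (hne x hx)
          · exact (hH.bd _ (hne' x hx)).trans (by gcongr; exact h1 x hx)
          · exact hκ.bd x (hne x hx)
          · exact (hH.bd' _ (hne' x hx)).trans (by gcongr; exact h2 x hx)
      _ = 5*(D*N)*(|x|^(-θ - 1)*|x|^(-p))
          + 25*(D*N)*(|x|^(-θ)*|x|^(-(1 + p))) := by ring
      _ = 30*(D*N)*|x|^(-(θ + p) - 1) := by rw [e2, e1]; ring

lemma hasDerivAt_phase (ξ η : ℝ) : HasDerivAt (phase ξ) (dphase ξ η) η := by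
  have h1 := (hasDerivAt_id η).mul_const (ξ^2)
  have h2 := (hasDerivAt_pow 2 η).const_mul ξ
  have h3 := (hasDerivAt_pow 3 η).div_const 4
  refine ((h1.sub h2).add h3).congr_deriv ?_
  simp [dphase]; ring

/-- First derivative test for the phase of `opJ`. -/
lemma SV.norm_integral_phaseOsc_le_of_lb (hab : a ≤ b) (hρ : 0 < ρ) (hG : SV G G' a b V)
    (hs : b ≤ 4/3*ξ ∨ 4/3*ξ ≤ a) (hl : ∀ x ∈ Ioo a b, ρ ≤ |dphase ξ x|) :
    ‖∫ η in a..b, phaseOsc ξ η*G η‖ ≤ 4*V/ρ := by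
  have := hG.norm_integral_osc_le (ρ := 3*ρ) (ψ := fun η => -3*phase ξ η)
    (ψ' := fun η => -3*dphase ξ η) (ψ'' := fun η => -3*(-2*ξ + 3/2*η)) hab
    (by positivity) (fun x _ => (hasDerivAt_phase ξ x).const_mul _)
    (fun x _ => (hasDerivAt_dphase ξ x).const_mul _) (by fun_prop) ?_ (fun x hx => ?_)
  · refine this.trans_eq ?_
    field_simp; ring
  · grind
  grind

lemma norm_integral_J_low_le (hξ : 0 < ξ) (hab : a ≤ b) (ha : -(ξ/8) ≤ a) (hb : b ≤ ξ/8)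
    (hκ : SV κ κ' a b V) (hH : Adm p (1 + p) N H H') (hp : 0 ≤ p) (hp1 : p ≤ 1) :
    ‖∫ η in a..b, phaseOsc ξ η*(κ η*H (ξ - η))‖ ≤ 128*(V*N)*ξ^(-2 - p) := by
  have hV := hκ.nonneg
  have hN := hH.nonneg
  have h1 := (hH.sv_far hp (a := ξ - b) (b := ξ - a) (ρ := ξ/2) (by positivity)
    (.inl (by linarith)) (by linarith)).comp_sub ξ
  rw [sub_sub_cancel, sub_sub_cancel] at h1
  have h2 : (ξ/2)^(-p) ≤ 2*ξ^(-p) := by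
    simpa using rpow_neg_le (c := 2) (n := 1) hξ (by norm_num) hp (by simpa using hp1)
      (le_refl (ξ/2))
  have h3 := (hκ.mul h1).norm_integral_phaseOsc_le_of_lb (ξ := ξ) (ρ := ξ^2/2) hab
    (by positivity) (.inl (by linarith)) (fun x hx => ?_)
  · refine h3.trans ?_
    have e : ξ^(-2 - p) = ξ^(-p)/ξ^2 := by
      rw [show -2 - p = -p - (2 : ℕ) by push_cast; ring, Real.rpow_sub_natCast hξ.ne']
    rw [e, div_le_iff₀ (by positivity)]
    have : 128*(V*N)*(ξ^(-p)/ξ^2)*(ξ^2/2) = 32*(V*N)*(2*ξ^(-p)) := by field_simp; ring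
    have : V*N*(ξ/2)^(-p) ≤ V*N*(2*ξ^(-p)) := by gcongr
    linarith
  · have hx2 : x ≤ ξ/8 := hx.2.le.trans hb
    refine le_trans ?_ (le_abs_self _)
    rw [dphase]
    nlinarith

lemma norm_integral_J_in_le (hκ : Symb θ D κ κ') (hθ : 1/2 ≤ θ) (hθ2 : θ ≤ 2)
    (hH : Adm p (1 + p) N H H') (hp : 0 ≤ p) (hp1 : p ≤ 1) (hξ : 1 ≤ ξ) (hab : a ≤ b) (ha : ξ/8 ≤ a)
    (hb : b ≤ 3*ξ/4) :
    ‖∫ η in a..b, phaseOsc ξ η*(κ η*H (ξ - η))‖ ≤ 400000*(D*N)*ξ^(-1/2 - θ - p) := by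
  have hξ0 : 0 < ξ := by linarith
  have hD := hκ.nonneg
  have hN := hH.nonneg
  have h1 := (hH.sv_far hp (a := ξ - b) (b := ξ - a) (ρ := ξ/4) (by positivity)
    (.inl (by linarith)) (by linarith)).comp_sub ξ
  rw [sub_sub_cancel, sub_sub_cancel] at h1
  have h0 := hκ.sv hθ (a := a) (b := b) (ρ := ξ/8) (by positivity) (.inl ha)
  have h2 : (ξ/4)^(-p) ≤ 4*ξ^(-p) := by
    simpa using rpow_neg_le (c := 4) (n := 1) hξ0 (by norm_num) hp (by simpa using hp1)
      (le_refl (ξ/4))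
  have h3 : (ξ/8)^(-θ) ≤ 64*ξ^(-θ) := by
    have := rpow_neg_le (c := 8) (n := 2) (q := θ) hξ0 (by norm_num) (by linarith)
      (by simpa using hθ2) (le_refl (ξ/8))
    linarith
  refine ((h0.mul h1).norm_integral_phaseOsc_le hξ hab).trans ?_
  have e : ξ^(-1/2 - θ - p) = ξ^(-θ)*ξ^(-p)/√ξ := by
    rw [sqrt_eq_rpow, ← rpow_add hξ0, ← rpow_sub hξ0]; congr 1; ring
  rw [e]
  calc 80/√ξ*(2*(2*D*(ξ/8)^(-θ)*(4*N*(ξ/4)^(-p))))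
      ≤ 80/√ξ*(2*(2*D*(64*ξ^(-θ))*(4*N*(4*ξ^(-p))))) := by gcongr
    _ = 327680*(D*N*(ξ^(-θ)*ξ^(-p)/√ξ)) := by ring
    _ ≤ 400000*(D*N)*(ξ^(-θ)*ξ^(-p)/√ξ) := by
      have : 0 ≤ D*N*(ξ^(-θ)*ξ^(-p)/√ξ) := by positivity
      linarith

lemma norm_integral_J_out_le (hκ : Symb θ D κ κ') (hθ : 1/2 ≤ θ) (hθ2 : θ ≤ 2)
    (hH : Adm p (1 + p) N H H') (hp : 0 ≤ p) (hp1 : p ≤ 1) (hξ : 1 ≤ ξ) (hab : a ≤ b)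
    (h : 5*ξ/4 ≤ a ∨ b ≤ -(ξ/8)) :
    ‖∫ η in a..b, phaseOsc ξ η*(κ η*H (ξ - η))‖ ≤ 2500000*(D*N)*ξ^(-1/2 - θ - p) := by
  have hξ0 : 0 < ξ := by linarith
  have hD := hκ.nonneg
  have hN := hH.nonneg
  have h0 := hκ.sv_mul_far hθ hH hp hp1 (ξ := ξ) (a := a) (b := b) (ρ := ξ/8) (by positivity)
    (h.imp (fun h => by linarith) id) (by grind)
    (fun x hx => ?_)
  · have h3 : (ξ/8)^(-(θ + p)) ≤ 512*ξ^(-(θ + p)) := by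
      have := rpow_neg_le (c := 8) (n := 3) hξ0 (by norm_num)
        (by linarith : 0 ≤ θ + p) (by norm_num; linarith) (le_refl (ξ/8))
      linarith
    refine (h0.norm_integral_phaseOsc_le hξ hab).trans ?_
    have e : ξ^(-1/2 - θ - p) = ξ^(-(θ + p))/√ξ := by
      rw [sqrt_eq_rpow, ← rpow_sub hξ0]; congr 1; ring
    rw [e]
    calc 80/√ξ*(60*(D*N)*(ξ/8)^(-(θ + p)))
        ≤ 80/√ξ*(60*(D*N)*(512*ξ^(-(θ + p)))) := by gcongr
      _ = 2457600*(D*N*(ξ^(-(θ + p))/√ξ)) := by ring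
      _ ≤ 2500000*(D*N)*(ξ^(-(θ + p))/√ξ) := by
        have : 0 ≤ D*N*(ξ^(-(θ + p))/√ξ) := by positivity
        linarith
  grind

lemma norm_integral_J_mid_le (hκ : Symb θ D κ κ') (hθ : 1/2 ≤ θ) (hθ2 : θ ≤ 2) (hH : Adm 0 1 N H H')
    (hξ : 1 ≤ ξ) (hab : a ≤ b) (h : 3*ξ/4 ≤ a ∧ b ≤ ξ ∨ ξ ≤ a ∧ b ≤ 5*ξ/4) :
    ‖∫ η in a..b, phaseOsc ξ η*(κ η*H (ξ - η))‖ ≤ 20000*(D*N)*ξ^(-2 - θ + 1/5) := by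
  have hξ0 : 0 < ξ := by linarith
  have hD := hκ.nonneg
  have hN := hH.nonneg
  have ha : 3*ξ/4 ≤ a := by grind
  have hb : b ≤ 5*ξ/4 := by grind
  have h1 := (hH.sv_near (a := ξ - b) (b := ξ - a) (L := ξ) hξ
    (h.imp (fun h => ⟨by linarith [h.2], by linarith [h.1]⟩)
      (fun h => ⟨by linarith [h.1], by linarith [h.2]⟩))).comp_sub ξ
  rw [sub_sub_cancel, sub_sub_cancel] at h1
  have h0 := hκ.sv hθ (a := a) (b := b) (ρ := ξ/2) (by positivity) (.inl (by linarith))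
  have h3 : (ξ/2)^(-θ) ≤ 4*ξ^(-θ) := by
    have := rpow_neg_le (c := 2) (n := 2) (q := θ) hξ0 (by norm_num) (by linarith)
      (by simpa using hθ2) (le_refl (ξ/2))
    linarith
  have h4 := (h0.mul h1).norm_integral_phaseOsc_le_of_lb (ξ := ξ) (ρ := ξ^2/30) hab
    (by positivity) (.inl (by linarith)) (fun x hx => ?_)
  · refine h4.trans ?_
    have e : ξ^(-2 - θ + 1/5) = ξ^(-θ)*ξ^(1/5 : ℝ)/ξ^2 := by
      rw [← rpow_add hξ0, ← Real.rpow_sub_natCast hξ0.ne']; congr 1; push_cast; ring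
    rw [e, div_le_iff₀ (by positivity)]
    have e2 : 20000*(D*N)*(ξ^(-θ)*ξ^(1/5 : ℝ)/ξ^2)*(ξ^2/30)
        = 20000/30*(D*N*(ξ^(-θ)*ξ^(1/5 : ℝ))) := by
      field_simp
    calc 4*(2*(2*D*(ξ/2)^(-θ)*(10*N*ξ^(1/5 : ℝ))))
        ≤ 4*(2*(2*D*(4*ξ^(-θ))*(10*N*ξ^(1/5 : ℝ)))) := by gcongr
      _ = 640*(D*N*(ξ^(-θ)*ξ^(1/5 : ℝ))) := by ring
      _ ≤ _ := by
        have : 0 ≤ D*N*(ξ^(-θ)*ξ^(1/5 : ℝ)) := by positivity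
        linarith
  · have hx1 : 3*ξ/4 ≤ x := ha.trans hx.1.le
    have hx2 : x ≤ 5*ξ/4 := hx.2.le.trans hb
    refine le_trans ?_ (neg_le_abs _)
    rw [dphase]
    nlinarith

lemma norm_integral_J_inf_le (hκ : Symb θ D κ κ') (hθ : 1/2 ≤ θ) (hH : Adm p (1 + p) N H H')
    (hp : 0 ≤ p) (hp1 : p ≤ 1) (hξ : 0 < ξ) (hab : a ≤ b) (hm : 8*ξ ≤ m) (h : m ≤ a ∨ b ≤ -m) :
    ‖∫ η in a..b, phaseOsc ξ η*(κ η*H (ξ - η))‖ ≤ 500*(D*N)*m^(-2 - θ - p) := by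
  have hm0 : 0 < m := by linarith
  have hD := hκ.nonneg
  have hN := hH.nonneg
  have h0 := hκ.sv_mul_far hθ hH hp hp1 (ξ := ξ) (a := a) (b := b) (ρ := m) hm0
    h (by grind) (fun x hx => ?_)
  · refine (h0.norm_integral_phaseOsc_le_of_lb (ξ := ξ) (ρ := m^2/2) hab (by positivity) (by grind)
      (fun x hx => ?_)).trans ?_
    · refine le_trans ?_ (le_abs_self _)
      rw [dphase]
      rcases h with h | h
      · have : m ≤ x := h.trans hx.1.le
        nlinarith
      · have : x ≤ -m := hx.2.le.trans h
        nlinarith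
    · have e : m^(-2 - θ - p) = m^(-(θ + p))/m^2 := by
        rw [← Real.rpow_sub_natCast hm0.ne']; congr 1; push_cast; ring
      rw [e, div_le_iff₀ (by positivity)]
      have e2 : 500*(D*N)*(m^(-(θ + p))/m^2)*(m^2/2)
          = 250*(D*N*m^(-(θ + p))) := by field_simp; ring
      have : 0 ≤ D*N*m^(-(θ + p)) := by positivity
      linarith
  grind

/-! ### The Fresnel integral -/

/-- The value of `∫₀^∞ e^{iu²} du`. -/
def fresnelC : ℂ := ((√π/2 : ℝ) : ℂ)*cis(π/4)

lemma norm_fresnelC_le : ‖fresnelC‖ ≤ 1 := by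
  rw [fresnelC, norm_mul, norm_exp_ofReal_mul_I, mul_one, norm_real,
    norm_eq_abs, abs_of_nonneg (by positivity)]
  have : √π ≤ 2 := Real.sqrt_le_iff.2 ⟨by norm_num, by linarith [Real.pi_lt_four]⟩
  linarith

lemma fresnelC_eq : fresnelC = (π / -I : ℂ)^(1/2 : ℂ)/2 := by
  have h0 : (π / -I : ℂ) = (π : ℂ)*I := by rw [div_neg, Complex.div_I, neg_neg]
  have hpi := pi_pos
  rw [h0, Complex.cpow_def_of_ne_zero (by simp [hpi.ne']), Complex.log_ofReal_mul hpi
    Complex.I_ne_zero, Complex.log_I, fresnelC, add_mul, exp_add]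
  have : exp (((log π : ℝ) : ℂ)*(1/2)) = ((√π : ℝ) : ℂ) := by
    rw [sqrt_eq_rpow, Real.rpow_def_of_pos hpi]; push_cast; rfl
  rw [this]
  push_cast
  grind

lemma norm_integral_fresnel_sub_le (hm : 0 < m) : ‖(∫ u in 0..m, cis(u^2)) - fresnelC‖ ≤ 6/m := by
  set F : ℝ → ℝ → ℂ := fun ε u => exp (-((ε : ℂ) - I)*(u : ℂ)^2) with hF
  have hFc : Continuous (Function.uncurry F) := by fun_prop
  have step : ∀ ε : ℝ, 0 < ε → ‖(∫ u in 0..m, F ε u) - (π/((ε : ℂ) - I))^(1/2 : ℂ)/2‖ ≤ 6/m := by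
    intro ε hε
    have hre : 0 < ((ε : ℂ) - I).re := by simpa using hε
    rw [← integral_gaussian_complex_Ioi hre]
    have hint : IntegrableOn (fun x : ℝ => F ε x) (Ioi 0) :=
      (integrable_cexp_neg_mul_sq hre).integrableOn
    have hlim := intervalIntegral_tendsto_integral_Ioi 0 hint tendsto_id
    have := (hlim.const_sub (∫ u in 0..m, F ε u)).norm
    refine le_of_tendsto this ((eventually_ge_atTop m).mono fun M hM => ?_)
    have hi : ∀ x y : ℝ, IntervalIntegrable (F ε) volume x y := fun x y =>
      (hFc.comp (by fun_prop : Continuous fun u : ℝ => (ε, u))).intervalIntegrable _ _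
    rw [id, ← ii_split (hi 0 m) (hi m M), sub_add_cancel_left, norm_neg]
    have hsv : SV (fun u => ((Real.exp (-ε*u^2) : ℝ) : ℂ))
        (fun u => ((Real.exp (-ε*u^2)*(-ε*(2*u)) : ℝ) : ℂ)) m M 1 := by
      have hd : ∀ u : ℝ, HasDerivAt (fun u => Real.exp (-ε*u^2))
          (Real.exp (-ε*u^2)*(-ε*(2*u))) u := fun u => by
        have := ((hasDerivAt_pow 2 u).const_mul (-ε)).exp
        simpa using this
      have hle : ∀ u : ℝ, Real.exp (-ε*u^2) ≤ 1 := fun u =>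
        Real.exp_le_one_iff.2 (by nlinarith [sq_nonneg u])
      refine SV.of_antideriv (Γ := fun u => -Real.exp (-ε*u^2)) zero_le_one
        (ACOn.of_hasDerivAt (fun u _ => (hd u).ofReal_comp) (by fun_prop)) (fun u _ => ?_)
        (fun u _ => (hd u).neg) (fun u hu => ?_) (fun x _ y _ _ => ?_)
      · rw [norm_real, norm_eq_abs, abs_of_pos (Real.exp_pos _)]; exact hle u
      · have hu0 : 0 < u := hm.trans hu.1
        rw [norm_real, norm_eq_abs, abs_mul, abs_of_pos (Real.exp_pos _), abs_of_neg (by nlinarith)]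
        linarith
      · linarith [hle x, Real.exp_pos (-ε*y^2)]
    have := hsv.norm_integral_osc_le (ψ := fun u => u^2) (ψ' := fun u => 2*u)
      (ψ'' := fun _ => 2) (ρ := 2*m) hM (by positivity)
      (fun u _ => by simpa using hasDerivAt_pow 2 u)
      (fun u _ => by simpa using (hasDerivAt_id u).const_mul 2) (by fun_prop)
      (.inl fun _ _ => by norm_num) (fun u hu => by grind)
    have e : 12*1/(2*m) = 6/m := by field_simp; norm_num
    rw [e] at this
    refine le_trans (le_of_eq ?_) this
    congr 2
    funext u
    simp only [hF]
    push_cast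
    rw [← exp_add]
    congr 1; ring
  have l1 : Tendsto (fun ε : ℝ => ∫ u in 0..m, F ε u) (𝓝[>] 0) (𝓝 (∫ u in 0..m, F 0 u)) :=
    ((intervalIntegral.continuous_parametric_intervalIntegral_of_continuous' hFc 0 m).tendsto
      0).mono_left nhdsWithin_le_nhds
  have l2 : Tendsto (fun ε : ℝ => (π/((ε : ℂ) - I))^(1/2 : ℂ)/2) (𝓝[>] 0) (𝓝 fresnelC) := by
    have : ContinuousAt (fun ε : ℝ => (π/((ε : ℂ) - I))^(1/2 : ℂ)/2) 0 := by
      refine ContinuousAt.div_const (ContinuousAt.cpow ?_ continuousAt_const ?_) _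
      · refine continuousAt_const.div (by fun_prop) (by simp)
      · right; rw [Complex.ofReal_zero, zero_sub, div_neg, Complex.div_I]; simp [pi_ne_zero]
    have h := this.tendsto.mono_left (nhdsWithin_le_nhds (s := Ioi 0))
    rw [fresnelC_eq]
    simpa using h
  have e0 : ∫ u in 0..m, cis(u^2) = ∫ u in 0..m, F 0 u := by
    congr 1; funext u; congr 1; push_cast; ring
  rw [e0]
  exact le_of_tendsto (l1.sub l2).norm (eventually_mem_nhdsWithin.mono step)

lemma tendsto_fresnel : Tendsto (fun m : ℝ => ∫ u in 0..m, cis(u^2)) atTop (𝓝 fresnelC) := by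
  rw [tendsto_iff_norm_sub_tendsto_zero]
  refine squeeze_zero' (.of_forall fun _ => norm_nonneg _)
    ((eventually_gt_atTop 0).mono fun m hm => norm_integral_fresnel_sub_le hm) ?_
  exact tendsto_const_nhds.div_atTop tendsto_id

lemma halfFresnel_eq (hη : 0 < η) : halfFresnel η = ((√(3/4*η))⁻¹ : ℝ)*fresnelC := by
  have hs : 0 < √(3/4*η) := sqrt_pos.2 (by positivity)
  refine tendsto_nhds_unique (tendsto_halfFresnel hη) ?_
  have := (tendsto_fresnel.comp (tendsto_id.const_mul_atTop hs)).const_mul (((√(3/4*η))⁻¹ : ℝ) : ℂ)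
  refine this.congr fun m => ?_
  have := intervalIntegral.integral_comp_mul_left
    (f := fun u : ℝ => cis(u^2)) (a := 0) (b := m) hs.ne'
  simp only [mul_zero] at this
  simp only [Function.comp, id]
  rw [← real_smul, ← this]
  congr 1; funext ν
  rw [quadOsc, mul_pow, sq_sqrt (by positivity)]

/-! ### The main term of `opK` -/

/-- The coefficient of the main term of `opK` at the frequency `η`. -/
def coefK (η : ℝ) : ℂ :=
  ((4/√3*|η|^(-(1/2) : ℝ) : ℝ) : ℂ)*if 0 < η then fresnelC else conj fresnelC

/-- The main term of `opK`. -/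
def mainK (f g : ℝ → ℂ) (η : ℝ) : ℂ := coefK η*(f (η/2)*g (η/2))

lemma coefK_of_pos (hη : 0 < η) : coefK η = 2*halfFresnel η := by
  rw [coefK, if_pos hη, halfFresnel_eq hη, abs_of_pos hη, sqrt_mul (by norm_num),
    Real.sqrt_div (by norm_num), show (4 : ℝ) = 2^2 by norm_num, sqrt_sq (by norm_num),
    rpow_neg hη.le, ← sqrt_eq_rpow, ← mul_assoc]
  rw [← Complex.ofReal_ofNat, ← ofReal_mul]
  congr 1
  field_simp

lemma coefK_neg (hη : 0 < η) : coefK (-η) = conj (coefK η) := by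
  rw [coefK, coefK, if_pos hη, if_neg (by linarith), abs_neg, map_mul, conj_ofReal]

lemma refl_mainK (f g : ℝ → ℂ) (hη : 0 < η) : mainK f g (-η) = conj (mainK (refl f) (refl g) η) :=
    by
  rw [mainK, mainK, coefK_neg hη]
  simp [refl, neg_div]

lemma norm_opK_sub_mainK_le (hp : 0 ≤ p) (hσ : 0 < σ) (hpσ : p ≤ σ) (hσp : σ ≤ p + 1)
    (hf : Adm p (1 + p) Nf f f') (hg : Adm p (1 + p) Ng g g') (hη : 1 ≤ |η|) :
    ‖opK f g η - mainK f g η‖ ≤ 2*(4^(1 + 2*p)*(24 + 35/σ))*(Nf*Ng)*|η|^(-2 - 2*p + σ) := by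
  have pos : ∀ {f f' g g' : ℝ → ℂ}, Adm p (1 + p) Nf f f' → Adm p (1 + p) Ng g g' →
      ∀ η : ℝ, 1 ≤ η → ‖opK f g η - mainK f g η‖ ≤
      2*(4^(1 + 2*p)*(24 + 35/σ))*(Nf*Ng)*η^(-2 - 2*p + σ) := by
    intro f f' g g' hf hg η h
    have h0 : 0 < η := by linarith
    rw [opK_eq_halfK (hf.zero hp) (hg.zero hp) h0, mainK, coefK_of_pos h0]
    have e : halfK f g η + halfK g f η - 2*halfFresnel η*(f (η/2)*g (η/2)) =
      (halfK f g η - f (η/2)*g (η/2)*halfFresnel η) +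
      (halfK g f η - g (η/2)*f (η/2)*halfFresnel η) := by ring
    rw [e]
    have a1 := norm_halfK_sub_le hp hσ hpσ hσp hf hg h
    have a2 := norm_halfK_sub_le hp hσ hpσ hσp hg hf h
    refine (norm_add_le_of_le a1 a2).trans_eq ?_
    ring
  rcases le_total 0 η with h | h
  · grind
  · rw [abs_of_nonpos h] at hη ⊢
    have h0 : 0 < -η := by linarith
    have e : η = -(-η) := (neg_neg η).symm
    have h1 := pos hf.refl hg.refl (-η) hη
    rw [e, opK_neg (hf.zero hp) (hg.zero hp) h0,
      refl_mainK f g h0, ← map_sub, RCLike.norm_conj, neg_neg]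
    exact h1

/-- The derivative of `mainK`. -/
def mainK' (f f' g g' : ℝ → ℂ) (η : ℝ) : ℂ := -(1/(2*η))*coefK η*(f (η/2)*g (η/2)) +
    coefK η*((1/2 : ℂ)*f' (η/2)*g (η/2) + f (η/2)*((1/2 : ℂ)*g' (η/2)))

lemma norm_coefK_le (η : ℝ) : ‖coefK η‖ ≤ 3*|η|^(-(1/2) : ℝ) := by
  have h : ‖(if 0 < η then fresnelC else conj fresnelC : ℂ)‖ ≤ 1 := by
    split_ifs
    · exact norm_fresnelC_le
    · rw [RCLike.norm_conj]; exact norm_fresnelC_le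
  rw [coefK, norm_mul, norm_real, norm_eq_abs, abs_of_nonneg (by positivity)]
  have h3 : (4 : ℝ)/√3 ≤ 3 := by
    rw [div_le_iff₀ (by positivity)]
    have : (3/2 : ℝ) ≤ √3 := Real.le_sqrt_of_sq_le (by norm_num)
    linarith
  calc _ ≤ (3*|η|^(-(1/2) : ℝ))*1 := by gcongr
    _ = _ := mul_one _

lemma acOn_coefK_pos : ACOn coefK (fun η => -(1/(2*η))*coefK η) (Ioi 0) := by
  have h : ACOn (fun η : ℝ => ((4/√3*η^(-(1/2) : ℝ) : ℝ) : ℂ))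
      (fun η => ((4/√3*(-(1/2)*η^(-(1/2) - 1 : ℝ)) : ℝ) : ℂ)) (Ioi 0) := by
    refine ACOn.of_hasDerivAt (fun x hx => HasDerivAt.ofReal_comp
      ((hasDerivAt_rpow_const (.inl (ne_of_gt hx))).const_mul _)) ?_
    refine continuous_ofReal.comp_continuousOn (continuousOn_const.mul
      (continuousOn_const.mul (ContinuousOn.rpow_const continuousOn_id fun x hx => Or.inl
        (ne_of_gt hx))))
  refine (h.const_mul fresnelC).congr (fun x hx => ?_) (fun x hx => ?_)
  · rw [coefK, if_pos (mem_Ioi.1 hx), abs_of_pos hx, mul_comm]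
  · have hx0 : (0 : ℝ) < x := hx
    rw [coefK, if_pos hx0, abs_of_pos hx0, Real.rpow_sub_one hx0.ne']
    push_cast
    field_simp

lemma acOn_coefK_neg : ACOn coefK (fun η => -(1/(2*η))*coefK η) (Iio 0) := by
  have := (acOn_coefK_pos.comp_affine (c := -1) (by norm_num) 0).conj.mono (t := Iio 0)
      (fun x hx => by simpa using hx)
  refine this.congr (fun x hx => ?_) (fun x hx => ?_)
  · have hx0 : 0 < -x := by simpa using hx
    have := coefK_neg hx0
    rw [neg_neg] at this
    simp [this]
  · have hx0 : 0 < -x := by simpa using hx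
    have := coefK_neg hx0
    rw [neg_neg] at this
    rw [this]; simp [Complex.conj_ofNat]

lemma symb_mainK (hp : 0 ≤ p) (hf : Adm p (1 + p) Nf f f') (hg : Adm p (1 + p) Ng g g') :
    Symb (1/2 + 2*p) (9*2^(1 + 2*p)*(Nf*Ng)) (mainK f g) (mainK' f f' g g') := by
  have hNf := hf.nonneg
  have hNg := hg.nonneg
  have b1 : ∀ {f f' : ℝ → ℂ} {N : ℝ}, Adm p (1 + p) N f f' → ∀ x : ℝ, x ≠ 0 →
      ‖f (x/2)‖ ≤ N*(2^p*|x|^(-p)) := fun {f f' N} hf x hx => by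
    have hx0 := abs_pos.2 hx
    refine (hf.bd _ (by positivity)).trans (mul_mono ?_ hf.nonneg)
    refine (wt_le_of_le hp (c := |x|/2) (by positivity) ?_).trans_eq ?_
    · grind
    · rw [div_rpow hx0.le (by norm_num), rpow_neg (by norm_num : (0 : ℝ) ≤ 2),
        div_inv_eq_mul, mul_comm]
  have b2 : ∀ {f f' : ℝ → ℂ} {N : ℝ}, Adm p (1 + p) N f f' → ∀ x : ℝ, x ≠ 0 →
      ‖f' (x/2)‖ ≤ N*(2*2^p*(|x|^(-p)*|x|⁻¹)) := fun {f f' N} hf x hx => by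
    have hx0 := abs_pos.2 hx
    refine (hf.bd' _ (by positivity)).trans (mul_mono ?_ hf.nonneg)
    refine (wt_le_of_le (by linarith) (c := |x|/2) (by positivity) ?_).trans_eq ?_
    · grind
    · rw [div_rpow hx0.le (by norm_num), rpow_neg (by norm_num : (0 : ℝ) ≤ 2),
        div_inv_eq_mul, neg_add, rpow_add hx0, rpow_add (by norm_num : (0 : ℝ) < 2),
        rpow_neg_one, rpow_one]
      ring
  have e0 : (2 : ℝ)^(1 + 2*p) = 2*(2^p*2^p) := by
    rw [two_mul p, rpow_add (by norm_num), rpow_add (by norm_num), rpow_one]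
  have e1 : ∀ x : ℝ, x ≠ 0 → |x|^(-(1/2 + 2*p)) =
      |x|^(-(1/2) : ℝ)*(|x|^(-p)*|x|^(-p)) := fun x hx => by
    have hx0 := abs_pos.2 hx
    rw [← rpow_add hx0, ← rpow_add hx0]; congr 1; ring
  have achalf : ∀ {f f' : ℝ → ℂ} {s : Set ℝ}, ACOn f f' s → (∀ x ∈ s, x/2 ∈ s) →
      OrdConnected s → ACOn (fun x => f (x/2)) (fun x => (1/2 : ℂ)*f' (x/2)) s := by
    intro f f' s hf hs ho
    have := (hf.comp_affine (c := 1/2) (by norm_num) 0).mono (t := s) (fun x hx => by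
      have := hs x hx
      simp only [mem_ofPred_eq]; grind)
    refine this.congr (fun x _ => ?_) (fun x _ => ?_)
    · congr 1; ring
    · push_cast; congr 2; ring
  refine ⟨by positivity, fun x hx => ?_, fun x hx => ?_, ?_, ?_⟩
  · rw [mainK, norm_mul, norm_mul, e0, e1 x hx]
    calc ‖coefK x‖*(‖f (x/2)‖*‖g (x/2)‖)
        ≤ (3*|x|^(-(1/2) : ℝ))*((Nf*(2^p*|x|^(-p)))*(Ng*(2^p*|x|^(-p)))) := by
          gcongr
          · exact norm_coefK_le x
          · exact b1 hf x hx
          · exact b1 hg x hx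
      _ = 3*(2^p*2^p*(Nf*Ng)*(|x|^(-(1/2) : ℝ)*(|x|^(-p)*|x|^(-p)))) := by ring
      _ ≤ 18*(2^p*2^p*(Nf*Ng)*(|x|^(-(1/2) : ℝ)*(|x|^(-p)*|x|^(-p)))) := by gcongr; norm_num
      _ = _ := by ring
  · have hx0 := abs_pos.2 hx
    rw [mainK', Real.rpow_sub_one hx0.ne', e0, e1 x hx]
    have n1 : ‖(-(1/(2*(x : ℂ))))‖ = 1/2*|x|⁻¹ := by
      rw [norm_neg, norm_div, norm_mul, norm_one, norm_real, norm_eq_abs,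
        norm_ofNat, one_div, mul_inv, one_div]
    calc _ ≤ ‖(-(1/(2*(x : ℂ))))‖*‖coefK x‖*(‖f (x/2)‖*‖g (x/2)‖) +
          ‖coefK x‖*(1/2*‖f' (x/2)‖*‖g (x/2)‖ + ‖f (x/2)‖*(1/2*‖g' (x/2)‖)) := by
          refine norm_add_le_of_le (by simp) ?_
          rw [norm_mul]
          refine mul_mono ((norm_add_le _ _).trans_eq ?_) (norm_nonneg _)
          simp
      _ ≤ 1/2*|x|⁻¹*(3*|x|^(-(1/2) : ℝ)) * ((Nf*(2^p*|x|^(-p)))*(Ng*(2^p*|x|^(-p)))) +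
          (3*|x|^(-(1/2) : ℝ)) * (1/2*(Nf*(2*2^p*(|x|^(-p)*|x|⁻¹)))*(Ng*(2^p*|x|^(-p))) +
            (Nf*(2^p*|x|^(-p)))*(1/2*(Ng*(2*2^p*(|x|^(-p)*|x|⁻¹))))) := by
          rw [n1]
          gcongr
          · exact norm_coefK_le x
          · exact b1 hf x hx
          · exact b1 hg x hx
          · exact norm_coefK_le x
          · exact b2 hf x hx
          · exact b1 hg x hx
          · exact b1 hf x hx
          · exact b2 hg x hx
      _ = 7.5*(2^p*2^p*(Nf*Ng) * (|x|^(-(1/2) : ℝ)*(|x|^(-p)*|x|^(-p))/|x|)) := by field_simp; ring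
      _ ≤ 18*(2^p*2^p*(Nf*Ng) * (|x|^(-(1/2) : ℝ)*(|x|^(-p)*|x|^(-p))/|x|)) := by gcongr; norm_num
      _ = _ := by ring
  · exact acOn_coefK_pos.mul ((achalf hf.pos (fun x hx => by simpa using hx) inferInstance).mul
      (achalf hg.pos (fun x hx => by simpa using hx) inferInstance))
  · exact acOn_coefK_neg.mul ((achalf hf.neg (fun x hx => by simp at hx ⊢; linarith) inferInstance).mul
      (achalf hg.neg (fun x hx => by simp at hx ⊢; linarith) inferInstance))

/-! ### Absolute bounds -/

lemma norm_integral_le_of_rpow {s : ℝ} (c d : ℝ) (hab : a ≤ b) (hK0 : 0 ≤ K) (hα : 0 ≤ α)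
    (hs : s ≠ 0) (hN : 0 ≤ N) (h : d ≤ a ∨ b ≤ d) (hK : ∀ x ∈ Ioo a b, N/|s| * (α + |x - d|)^s ≤ K)
    (hF : ∀ x ∈ Ioo a b, x ≠ c → ‖F x‖ ≤ N*(α + |x - d|)^(s - 1)) : ‖∫ t in a..b, F t‖ ≤ K := by
  obtain ⟨Γ, h1, h2⟩ := exists_antideriv_rpow hα hs hN h hK
  have e : ∫ t in a..b, F t = ∫ t in a..b, Function.update F c 0 t := by
    refine ii_congr_ae ?_
    filter_upwards [ae_ne c] with t ht _
    grind
  rw [e]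
  refine norm_integral_le_of_antideriv hab hK0 h1 (fun x hx => ?_) h2
  rcases eq_or_ne x c with rfl | h
  · simp; positivity
  grind

lemma norm_integral_le_rpow_inner (hab : a ≤ b) (hD : 0 ≤ D) (hq : q < 1) (ha : -m ≤ a) (hb : b ≤ m)
    (h : ∀ x ∈ Ioo a b, x ≠ 0 → x ≠ c → ‖F x‖ ≤ D*|x|^(-q)) :
    ‖∫ t in a..b, F t‖ ≤ 2*(D/(1 - q)*m^(1 - q)) := by
  have hm : 0 ≤ m := by linarith
  have hq' : 0 < 1 - q := by linarith
  have h0 : 0 ≤ D/(1 - q)*m^(1 - q) := by positivity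
  have half : ∀ u v : ℝ, a ≤ u → v ≤ b → u ≤ v → (0 ≤ u ∨ v ≤ 0) →
      ‖∫ t in u..v, F t‖ ≤ D/(1 - q)*m^(1 - q) := by
    intro u v hu hv huv h'
    refine norm_integral_le_of_rpow (α := 0) (s := 1 - q) (N := D) c 0 huv h0 le_rfl hq'.ne' hD h'
      (fun x hx => ?_) fun x hx hc => ?_
    · rw [abs_of_pos hq', zero_add, sub_zero]
      gcongr
      grind
    · have := h x ⟨hu.trans_lt hx.1, hx.2.trans_le hv⟩ (by grind) hc
      simpa [sub_sub_cancel_left] using this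
  rcases le_total 0 a with h1 | h1
  · grind
  rcases le_total b 0 with h2 | h2
  · grind
  by_cases hF : IntervalIntegrable F volume a b
  · rw [← ii_split (hF.mono_set (c := a) (d := 0) (by grind [uIcc_of_le]))
      (hF.mono_set (by grind [uIcc_of_le]))]
    refine (norm_add_le _ _).trans ?_
    grind
  · rw [intervalIntegral.integral_undef hF, norm_zero]; linarith

lemma norm_integral_le_rpow_half (hab : a ≤ b) (hD : 0 ≤ D) (ha : -m ≤ a) (hb : b ≤ m)
    (h : ∀ x ∈ Ioo a b, x ≠ 0 → x ≠ c → ‖F x‖ ≤ D*|x|^(-(1/2) : ℝ)) :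
    ‖∫ t in a..b, F t‖ ≤ 4*D*√m := by
  refine (norm_integral_le_rpow_inner hab hD (by norm_num) ha hb h).trans_eq ?_
  rw [sqrt_eq_rpow]; norm_num; ring

lemma norm_integral_le_rpow_tail (hab : a ≤ b) (hD : 0 ≤ D) (hm : 0 < m) (hq : 0 < q)
    (hs : m ≤ a ∨ b ≤ -m) (h : ∀ x, m ≤ |x| → x ≠ c → ‖F x‖ ≤ D*|x|^(-q - 1)) :
    ‖∫ t in a..b, F t‖ ≤ D/q*m^(-q) :=
    by
  refine norm_integral_le_of_rpow (α := 0) (s := -q) (N := D) c 0 hab (by positivity) le_rfl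
    (by linarith) hD (by grind) (fun x hx => ?_) fun x hx hc => ?_
  · rw [abs_neg, abs_of_pos hq, zero_add, sub_zero]
    exact mul_mono (rpow_le_rpow_of_nonpos hm (by grind) (by linarith))
      (by positivity)
  · simpa using h x (by grind) hc

/-! ### Convergence of `opJ` -/

lemma measurable_coefK : Measurable coefK := by
  refine Measurable.mul (by fun_prop) (Measurable.ite measurableSet_Ioi measurable_const
    measurable_const)

lemma measurable_mainK (hf : Measurable f) (hg : Measurable g) : Measurable (mainK f g) :=
  measurable_coefK.mul ((hf.comp (measurable_id.div_const 2)).mul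
    (hg.comp (measurable_id.div_const 2)))

lemma norm_opK_le' (hf : Adm 0 1 Nf f f') (hg : Adm 0 1 Ng g g') (hη : η ≠ 0) :
    ‖opK f g η‖ ≤ 66*(Nf*Ng)*|η|^(-(1/2) : ℝ) := by
  refine (norm_opK_le hf hg hη).trans_eq ?_
  rw [rpow_neg (abs_nonneg _), ← sqrt_eq_rpow, div_eq_mul_inv]

lemma norm_J_le (hκ : ∀ η, η ≠ 0 → ‖κ η‖ ≤ D*|η|^(-(1/2) : ℝ)) (hh : Adm 0 1 N h h') (h0 : η ≠ 0)
    (h1 : η ≠ ξ) : ‖phaseOsc ξ η*(κ η*h (ξ - η))‖ ≤ D*N*|η|^(-(1/2) : ℝ) := by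
  rw [norm_mul, norm_phaseOsc, one_mul, norm_mul]
  calc _ ≤ (D*|η|^(-(1/2) : ℝ))*N :=
        mul_le_mul (hκ η h0) (hh.le le_rfl (sub_ne_zero.2 h1.symm)) (norm_nonneg _)
          ((norm_nonneg _).trans (hκ η h0))
    _ = _ := by ring

lemma locallyIntegrable_J (hκm : AEStronglyMeasurable κ volume)
    (hκ : ∀ η, η ≠ 0 → ‖κ η‖ ≤ D*|η|^(-(1/2) : ℝ)) (hh : Adm 0 1 N h h') (ξ : ℝ) :
    LocallyIntegrable (fun η => phaseOsc ξ η*(κ η*h (ξ - η))) volume := by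
  refine locallyIntegrable_of_norm_le_rpow (C := D*N) (α := 1/2) (by simp) (by norm_num) ?_ ?_
  · filter_upwards [ae_ne 0, ae_ne ξ] with η h0 h1
    exact norm_J_le hκ hh h0 h1
  · exact (continuous_phaseOsc_right ξ).aestronglyMeasurable.mul (hκm.mul
      (hh.meas.comp (measurable_const.sub measurable_id)).aestronglyMeasurable)

lemma locallyIntegrable_integrandJ (hf : Adm 0 1 Nf f f') (hg : Adm 0 1 Ng g g')
    (hh : Adm 0 1 Nh h h') (ξ : ℝ) : LocallyIntegrable (integrandJ h (opK f g) ξ) volume := by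
  have e : integrandJ h (opK f g) ξ = fun η => phaseOsc ξ η*(opK f g η*refl h (ξ - η)) := by
    funext η; exact integrandJ_eq _ _ _ _
  rw [e]
  exact locallyIntegrable_J (aestronglyMeasurable_opK hf hg) (fun η hη => norm_opK_le' hf hg hη)
    hh.refl ξ

lemma norm_integral_integrandJ_le (hf : Adm 0 1 Nf f f') (hg : Adm 0 1 Ng g g')
    (hh : Adm 0 1 Nh h h') (ξ : ℝ) (hab : a ≤ b) (ha : -m ≤ a) (hb : b ≤ m) :
    ‖∫ η in a..b, integrandJ h (opK f g) ξ η‖ ≤ 264*(Nf*Ng*Nh)*√m := by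
  have hNf := hf.nonneg
  have hNg := hg.nonneg
  have hNh := hh.nonneg
  refine (norm_integral_le_rpow_half (c := ξ) (D := 66*(Nf*Ng)*Nh) hab (by positivity) ha hb
    (fun η _ h0 h1 => ?_)).trans_eq (by ring)
  rw [integrandJ_eq]
  exact norm_J_le (fun η hη => norm_opK_le' hf hg hη) hh.refl h0 h1

lemma symb_mainK_zero (hf : Adm 0 1 Nf f f') (hg : Adm 0 1 Ng g g') :
    Symb (1/2) (18*(Nf*Ng)) (mainK f g) (mainK' f f' g g') := by
  have := symb_mainK (p := 0) le_rfl (by simpa using hf) (by simpa using hg)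
  norm_num at this ⊢
  exact this

lemma norm_opK_sub_mainK_le_zero (hf : Adm 0 1 Nf f f') (hg : Adm 0 1 Ng g g') (hη : 1 ≤ |η|) :
    ‖opK f g η - mainK f g η‖ ≤ 1600*(Nf*Ng)*|η|^(-(4/5) - 1 : ℝ) := by
  have hN := mul_nonneg hf.nonneg hg.nonneg
  have := norm_opK_sub_mainK_le (p := 0) (σ := 1/5) le_rfl (by norm_num) (by norm_num)
    (by norm_num) (by simpa using hf) (by simpa using hg) hη
  norm_num at this ⊢
  refine this.trans ?_
  gcongr
  norm_num

/-- Splitting of the integral which defines `opJ` according to the main term of `opK`. -/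
lemma integral_integrandJ_eq (hf : Adm 0 1 Nf f f') (hg : Adm 0 1 Ng g g') (hh : Adm 0 1 Nh h h')
    (ξ a b : ℝ) : ∫ η in a..b, integrandJ h (opK f g) ξ η =
    (∫ η in a..b, phaseOsc ξ η*(mainK f g η*refl h (ξ - η))) + ∫ η in a..b, phaseOsc ξ
    η*((opK f g η - mainK f g η)*refl h (ξ - η)) := by
  have hs := symb_mainK_zero hf hg
  have h1 := ii_of_loc (locallyIntegrable_J
    (measurable_mainK hf.meas hg.meas).aestronglyMeasurable hs.bd hh.refl ξ) a b
  have h2 := ii_of_loc (locallyIntegrable_J (D := 66*(Nf*Ng) + 18*(Nf*Ng))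
    ((aestronglyMeasurable_opK hf hg).sub
    (measurable_mainK hf.meas hg.meas).aestronglyMeasurable) (fun η hη => ?_) hh.refl ξ) a b
  · simp only [Pi.sub_apply] at h2
    rw [← ii_add h1 h2]
    congr 1; funext η
    rw [integrandJ_eq]; ring
  · refine (norm_sub_le _ _).trans ?_
    rw [add_mul]
    exact add_le_add (norm_opK_le' hf hg hη) (hs.bd η hη)

lemma norm_integral_remainder_le (hf : Adm 0 1 Nf f f') (hg : Adm 0 1 Ng g g')
    (hh : Adm 0 1 Nh h h') (hab : a ≤ b) (hm : 1 ≤ m) (hs : m ≤ a ∨ b ≤ -m) :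
    ‖∫ η in a..b, phaseOsc ξ η*((opK f g η - mainK f g η)*refl h (ξ - η))‖ ≤
      2000*(Nf*Ng*Nh)*m^(-(4/5) : ℝ) := by
  have hNf := hf.nonneg
  have hNg := hg.nonneg
  have hNh := hh.nonneg
  refine (norm_integral_le_rpow_tail (c := ξ) (D := 1600*(Nf*Ng)*Nh) (q := 4/5) hab
    (by positivity) (by linarith) (by norm_num) hs (fun η h0 h1 => ?_)).trans_eq ?_
  · rw [norm_mul, norm_phaseOsc, one_mul, norm_mul]
    calc _ ≤ (1600*(Nf*Ng)*|η|^(-(4/5) - 1 : ℝ))*Nh := by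
          gcongr
          · exact norm_opK_sub_mainK_le_zero hf hg (hm.trans h0)
          · exact hh.refl.le le_rfl (sub_ne_zero.2 h1.symm)
      _ = _ := by ring
  · ring

lemma norm_integral_integrandJ_tail_le (hf : Adm 0 1 Nf f f') (hg : Adm 0 1 Ng g g')
    (hh : Adm 0 1 Nh h h') (hξ : 0 < ξ) (hab : a ≤ b) (hm : 8*ξ ≤ m) (hm1 : 1 ≤ m)
    (hs : m ≤ a ∨ b ≤ -m) :
    ‖∫ η in a..b, integrandJ h (opK f g) ξ η‖ ≤ 11000*(Nf*Ng*Nh)*m^(-(4/5) : ℝ) := by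
  have hNf := hf.nonneg
  have hNg := hg.nonneg
  have hNh := hh.nonneg
  rw [integral_integrandJ_eq hf hg hh]
  have h1 := norm_integral_J_inf_le (p := 0) (symb_mainK_zero hf hg) le_rfl
    (by simpa using hh.refl) le_rfl zero_le_one hξ hab hm hs
  have h2 := norm_integral_remainder_le hf hg hh (ξ := ξ) hab hm1 hs
  have h3 : m^(-2 - 1/2 - 0 : ℝ) ≤ m^(-(4/5) : ℝ) := rpow_mono hm1 (by norm_num)
  refine (norm_add_le_of_le h1 h2).trans ?_
  calc _ ≤ 500*(18*(Nf*Ng)*Nh)*m^(-(4/5) : ℝ)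
        + 2000*(Nf*Ng*Nh)*m^(-(4/5) : ℝ) := by gcongr
    _ = _ := by ring

lemma exists_tendsto_integrandJ (hf : Adm 0 1 Nf f f') (hg : Adm 0 1 Ng g g') (hh : Adm 0 1 Nh h h')
    (hξ : 0 < ξ) : ∃ l, Tendsto (fun p : ℝ × ℝ => ∫ x in p.1..p.2, integrandJ h (opK f g) ξ x)
    (atBot ×ˢ atTop) (𝓝 l) ∧ ∀ m, max (8*ξ) 1 ≤ m → ‖l - ∫ x in -m..m, integrandJ h (opK f g) ξ x‖ ≤
    22000*(Nf*Ng*Nh)*m^(-(4/5) : ℝ) := by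
  have hi := ii_of_loc (locallyIntegrable_integrandJ hf hg hh ξ)
  have hz := tendsto_const_mul_rpow_neg (11000*(Nf*Ng*Nh)) (y := 4/5) (by norm_num)
  obtain ⟨l₁, h1, h1'⟩ := exists_tendsto_of_cauchy (m₀ := max (8*ξ) 1)
    (I := fun m => ∫ x in 0..m, integrandJ h (opK f g) ξ x) hz (fun m m' hm hmm => by
      rw [integral_interval_sub_left (hi _ _) (hi _ _)]
      exact norm_integral_integrandJ_tail_le hf hg hh hξ hmm ((le_max_left _ _).trans hm)
        ((le_max_right _ _).trans hm) (.inl le_rfl))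
  obtain ⟨l₂, h2, h2'⟩ := exists_tendsto_of_cauchy (m₀ := max (8*ξ) 1)
    (I := fun m => ∫ x in -m..0, integrandJ h (opK f g) ξ x) hz (fun m m' hm hmm => by
      have := ii_split (hi (-m') (-m)) (hi (-m) 0)
      rw [← this, add_sub_cancel_right]
      exact norm_integral_integrandJ_tail_le hf hg hh hξ (by linarith) ((le_max_left _ _).trans hm)
        ((le_max_right _ _).trans hm) (.inr le_rfl))
  have hsplit : ∀ a b : ℝ, ∫ x in a..b, integrandJ h (opK f g) ξ x =
      (∫ x in -(-a)..0, integrandJ h (opK f g) ξ x) + ∫ x in 0..b, integrandJ h (opK f g) ξ x :=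
    fun a b => by rw [neg_neg, ii_split (hi _ _) (hi _ _)]
  refine ⟨l₂ + l₁, ?_, fun m hm => ?_⟩
  · exact ((h2.comp (tendsto_neg_atBot_atTop.comp tendsto_fst)).add (h1.comp tendsto_snd)).congr
      fun p => (hsplit p.1 p.2).symm
  · rw [hsplit, neg_neg, add_sub_add_comm]
    refine (norm_add_le_of_le (h2' m hm) (h1' m hm)).trans_eq ?_
    ring

lemma improperConverges_integrandJ (hf : Adm 0 1 Nf f f') (hg : Adm 0 1 Ng g g')
    (hh : Adm 0 1 Nh h h') (hξ : 0 < ξ) : ImproperConverges (integrandJ h (opK f g) ξ) := by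
  obtain ⟨l, hl, -⟩ := exists_tendsto_integrandJ hf hg hh hξ
  exact ⟨locallyIntegrable_integrandJ hf hg hh ξ, l, hl⟩

lemma norm_opJ_sub_le (hf : Adm 0 1 Nf f f') (hg : Adm 0 1 Ng g g') (hh : Adm 0 1 Nh h h')
    (hξ : 0 < ξ) (hm : max (8*ξ) 1 ≤ m) : ‖opJ h (opK f g) ξ - ∫ x in -m..m, integrandJ h (opK f g)
    ξ x‖ ≤ 22000*(Nf*Ng*Nh)*m^(-(4/5) : ℝ) := by
  obtain ⟨l, hl, hl'⟩ := exists_tendsto_integrandJ hf hg hh hξ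
  rw [opJ, improperIntegral_eq hl]
  exact hl' m hm

lemma tendsto_opJ (hf : Adm 0 1 Nf f f') (hg : Adm 0 1 Ng g g') (hh : Adm 0 1 Nh h h') (hξ : 0 < ξ)
    : Tendsto (fun m : ℝ => ∫ x in -m..m, integrandJ h (opK f g) ξ x) atTop (𝓝 (opJ h (opK f g) ξ))
    := by
  rw [tendsto_iff_norm_sub_tendsto_zero]
  refine squeeze_zero' (.of_forall fun _ => norm_nonneg _)
    ((eventually_ge_atTop (max (8*ξ) 1)).mono fun m hm => ?_)
    (tendsto_const_mul_rpow_neg (22000*(Nf*Ng*Nh)) (y := 4/5) (by norm_num))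
  rw [norm_sub_rev]
  exact norm_opJ_sub_le hf hg hh hξ hm

lemma norm_triI_sub_le_of_window {E : ℝ} {L : ℂ} (hf : Adm 0 1 Nf f f') (hg : Adm 0 1 Ng g g')
    (hh : Adm 0 1 Nh h h') (hξ : 0 < ξ) (hL : ∀ m, m₀ ≤ m → ‖(∫ η in -m..m, integrandJ h (opK f g) ξ
    η) - L‖ ≤ E) : ‖triI f g h ξ - 1/2*L‖ ≤ E/2 := by
  have h1 := ((tendsto_opJ hf hg hh hξ).sub_const L).norm
  have h2 : ‖opJ h (opK f g) ξ - L‖ ≤ E := by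
    refine le_of_tendsto h1 ?_
    filter_upwards [eventually_ge_atTop m₀] with m hm
    exact hL m hm
  rw [triI, ← mul_sub, norm_mul]
  norm_num
  linarith

lemma norm_triI_le_of_window {E : ℝ} (hf : Adm 0 1 Nf f f') (hg : Adm 0 1 Ng g g')
    (hh : Adm 0 1 Nh h h') (hξ : 0 < ξ)
    (hL : ∀ m, m₀ ≤ m → ‖∫ η in -m..m, integrandJ h (opK f g) ξ η‖ ≤ E) : ‖triI f g h ξ‖ ≤ E/2 := by
  simpa using norm_triI_sub_le_of_window (L := 0) hf hg hh hξ (by simpa using hL)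

lemma norm_triI_le (hf : Adm 0 1 Nf f f') (hg : Adm 0 1 Ng g g') (hh : Adm 0 1 Nh h h') (hξ : 0 < ξ)
    : ‖triI f g h ξ‖ ≤ 12000*(Nf*Ng*Nh)*√(max (8*ξ) 1) := by
  have hNf := hf.nonneg
  have hNg := hg.nonneg
  have hNh := hh.nonneg
  set m := max (8*ξ) 1 with hm
  have hm1 : 1 ≤ m := le_max_right _ _
  have h1 := norm_opJ_sub_le hf hg hh hξ le_rfl
  have h2 := norm_integral_integrandJ_le hf hg hh ξ (a := -m) (b := m) (by linarith) le_rfl le_rfl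
  have h3 : m^(-(4/5) : ℝ) ≤ √m := (Real.rpow_le_one_of_one_le_of_nonpos hm1 (by norm_num)).trans
    (one_le_sqrt.2 hm1)
  have h5 := norm_add_le_of_le h1 h2
  rw [sub_add_cancel] at h5
  rw [triI, norm_mul, show ‖(1/2 : ℂ)‖ = 1/2 by norm_num]
  have h6 := mul_mono h3 (by positivity : 0 ≤ Nf*Ng*Nh)
  have h7 : 0 ≤ Nf*Ng*Nh*√m := by positivity
  linarith

/-! ### Estimates of `opJ` for symbols -/

lemma norm_integral_J_high_le (hκ : Symb θ D κ κ') (hθ : 1/2 ≤ θ) (hθ2 : θ ≤ 2)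
    (hH : Adm p (1 + p) N H H') (hp : 0 ≤ p) (hp1 : p ≤ 1) (hξ : 1 ≤ ξ) (hm : 5*ξ/4 ≤ m)
    (hi : ∀ a b : ℝ, IntervalIntegrable (fun η => phaseOsc ξ η*(κ η*H (ξ - η))) volume a b) :
    ‖∫ η in ξ/8..m, phaseOsc ξ η*(κ η*H (ξ - η))‖ ≤
      3000000*(D*N)*(ξ^(-1/2 - θ - p) + ξ^(-2 - θ + 1/5)) := by
  have hD := hκ.nonneg
  have hN := hH.nonneg
  have hH0 := hH.zero hp
  rw [← ii_split (hi (ξ/8) (3*ξ/4)) (hi _ m), ← ii_split (hi (3*ξ/4) ξ) (hi _ m),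
    ← ii_split (hi ξ (5*ξ/4)) (hi _ m)]
  have h1 := norm_integral_J_in_le hκ hθ hθ2 hH hp hp1 hξ (a := ξ/8) (b := 3*ξ/4)
    (by linarith) le_rfl le_rfl
  have h2 := norm_integral_J_mid_le hκ hθ hθ2 hH0 hξ (a := 3*ξ/4) (b := ξ)
    (by linarith) (.inl ⟨le_rfl, le_rfl⟩)
  have h3 := norm_integral_J_mid_le hκ hθ hθ2 hH0 hξ (a := ξ) (b := 5*ξ/4)
    (by linarith) (.inr ⟨le_rfl, le_rfl⟩)
  have h4 := norm_integral_J_out_le hκ hθ hθ2 hH hp hp1 hξ (a := 5*ξ/4) (b := m) hm (.inl le_rfl)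
  have p1 : 0 ≤ D*N*ξ^(-1/2 - θ - p) := by positivity
  have p2 : 0 ≤ D*N*ξ^(-2 - θ + 1/5) := by positivity
  refine (norm_add_le_of_le h1 (norm_add_le_of_le h2 (norm_add_le_of_le h3 h4))).trans ?_
  linarith

/-- The bound on the operator `opJ` for a symbol of order `1/2`. -/
lemma norm_integral_J_symb_le (hκm : AEStronglyMeasurable κ volume) (hκ : Symb (1/2) D κ κ')
    (hH : Adm p (1 + p) N H H') (hp : 0 ≤ p) (hp1 : p ≤ 1) (hξ : 8 ≤ ξ) (hm : 5*ξ/4 ≤ m) :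
    ‖∫ η in -m..m, phaseOsc ξ η*(κ η*H (ξ - η))‖ ≤ 10000000*(D*N)*ξ^(-1 - p) := by
  have hD := hκ.nonneg
  have hN := hH.nonneg
  have hξ0 : 0 < ξ := by linarith
  have hξ1 : 1 ≤ ξ := by linarith
  have hH0 := hH.zero hp
  have hL := locallyIntegrable_J hκm hκ.bd hH0 ξ
  have hi := ii_of_loc hL
  set τ : ℝ := (ξ^2)⁻¹ with hτ
  have hτ0 : 0 < τ := by positivity
  have hτξ : τ ≤ ξ/8 := by
    have : (ξ^2)⁻¹ ≤ 1 := inv_le_one_of_one_le₀ (by nlinarith)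
    linarith
  have hτs : τ^(-(1/2) : ℝ) = ξ := by
    rw [rpow_neg hτ0.le, ← sqrt_eq_rpow, hτ, Real.sqrt_inv, sqrt_sq hξ0.le, inv_inv]
  have hτs' : √τ = ξ⁻¹ := by rw [hτ, Real.sqrt_inv, sqrt_sq hξ0.le]
  have e1 : ξ^(-2 - p)*ξ = ξ^(-1 - p) := by rw [← Real.rpow_add_one hξ0.ne']; congr 1; ring
  have e2 : ξ^(-p)*ξ⁻¹ = ξ^(-1 - p) := by rw [← rpow_neg_one, ← rpow_add hξ0]; congr 1; ring
  have h1 := norm_integral_J_out_le hκ le_rfl (by norm_num) hH hp hp1 hξ1 (a := -m)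
    (b := -(ξ/8)) (by linarith) (.inr le_rfl)
  have h2 := norm_integral_J_low_le hξ0 (by linarith) le_rfl (by linarith)
    (hκ.sv le_rfl (a := -(ξ/8)) (b := -τ) hτ0 (.inr le_rfl)) hH hp hp1
  have h4 := norm_integral_J_low_le hξ0 hτξ (by linarith) le_rfl
    (hκ.sv le_rfl (a := τ) (b := ξ/8) hτ0 (.inl le_rfl)) hH hp hp1
  have h5 := norm_integral_J_high_le hκ le_rfl (by norm_num) hH hp hp1 hξ1 hm hi
  have h3 := norm_integral_le_rpow_half (F := fun η => phaseOsc ξ η*(κ η*H (ξ - η))) (c := ξ) (D := D*N*(2*ξ^(-p))) (a := -τ) (b := τ)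
    (m := τ) (by linarith) (by positivity) le_rfl le_rfl (fun η hη h0 hc => by
      rw [norm_mul, norm_phaseOsc, one_mul, norm_mul]
      have hη' := And.intro hη.1 hη.2
      have hb : ‖H (ξ - η)‖ ≤ N*(2*ξ^(-p)) := by
        refine (hH.bd _ (sub_ne_zero.2 hc.symm)).trans (mul_mono ?_ hN)
        simpa using rpow_neg_le (c := 2) (n := 1) hξ0 (by norm_num) hp
          (by simpa using hp1) (y := 1 + |ξ - η|) (by grind)
      calc _ ≤ D*|η|^(-(1/2) : ℝ)*(N*(2*ξ^(-p))) := by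
            gcongr
            exact hκ.bd η h0
        _ = _ := by ring)
  rw [hτs] at h2 h4
  rw [hτs'] at h3
  have e3 : ξ^(-1/2 - 1/2 - p) = ξ^(-1 - p) := by congr 1; ring
  have e4 : ξ^(-2 - 1/2 + 1/5 : ℝ) ≤ ξ^(-1 - p) := rpow_mono hξ1 (by linarith)
  rw [e3] at h1 h5
  have p1 : 0 ≤ D*N*ξ^(-1 - p) := by positivity
  have h5' := h5.trans (mul_mono (add_le_add_right e4 (ξ^(-1 - p))) (by positivity))
  have f2 : 128*(2*D*ξ*N)*ξ^(-2 - p) = 256*(D*N*ξ^(-1 - p)) := by rw [← e1]; ring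
  have f3 : 4*(D*N*(2*ξ^(-p)))*ξ⁻¹ = 8*(D*N*ξ^(-1 - p)) := by rw [← e2]; ring
  rw [← ii_split (hi (-m) (-(ξ/8))) (hi _ m), ← ii_split (hi (-(ξ/8)) (-τ)) (hi _ m),
    ← ii_split (hi (-τ) τ) (hi _ m),
    ← ii_split (hi τ (ξ/8)) (hi _ m)]
  refine (norm_add_le_of_le h1 (norm_add_le_of_le h2
    (norm_add_le_of_le h3 (norm_add_le_of_le h4 h5')))).trans ?_
  linarith

/-- A trilinear estimate with a decaying third factor, given symbol estimates for `opK`. -/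
lemma norm_triI_le_of_symb (hf : Adm 0 1 Nf f f') (hg : Adm 0 1 Ng g g')
    (hκ : Symb (1/2) D (opK f g) κ') (hh : Adm p (1 + p) N h h') (hp : 0 ≤ p) (hp1 : p ≤ 1)
    (hξ : 8 ≤ ξ) : ‖triI f g h ξ‖ ≤ 5000000*(D*N)*ξ^(-1 - p) := by
  have hh0 := hh.zero hp
  refine (norm_triI_le_of_window (m₀ := 5*ξ/4) hf hg hh0 (by linarith) fun m hm => ?_).trans_eq
    (by ring : 10000000*(D*N)*ξ^(-1 - p)/2 = _)
  simp only [integrandJ_eq]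
  exact norm_integral_J_symb_le (aestronglyMeasurable_opK hf hg) hκ hh.refl hp hp1 hξ hm

/-! ### Two decaying factors: low frequencies -/

lemma SV.comp_half (h : SV G G' ((a + c)/2) ((b + c)/2) V) :
    SV (fun x => G ((x + c)/2)) (fun x => (1/2 : ℂ)*G' ((x + c)/2)) a b V := by
  have hm : ∀ x, x ∈ Ioo a b → (x + c)/2 ∈ Ioo ((a + c)/2) ((b + c)/2) := fun x hx =>
    ⟨by linarith [hx.1], by linarith [hx.2]⟩
  have e : ∀ x : ℝ, 1/2*x + c/2 = (x + c)/2 := fun x => by ring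
  refine ⟨h.nonneg, ?_, fun x hx => h.sup _ (hm x hx), fun x hx y hy hxy => ?_⟩
  · have := (h.ac.comp_affine (c := 1/2) (by norm_num) (c/2)).mono (t := Ioo a b)
      (fun x hx => by grind)
    refine this.congr (fun x _ => ?_) (fun x _ => ?_)
    · rw [e]
    · rw [e]; push_cast; rfl
  · have h2 := h.var _ (hm x hx) _ (hm y hy) (by linarith)
    have h3 := intervalIntegral.integral_comp_mul_add (fun x => ‖G' x‖) (a := x) (b := y)
      (c := 1/2) (by norm_num) (c/2)
    simp only [e] at h3
    simp only [norm_mul]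
    rw [ii_const_mul, h3]
    simp only [one_div, inv_inv, norm_inv, norm_ofNat, smul_eq_mul]
    linarith

/-- A decaying function has bounded variation. -/
lemma Adm.sv_all (hf : Adm p (1 + p) N f f') (hp : 1/2 ≤ p) (h : 0 ≤ a ∨ b ≤ 0) :
    SV f f' a b (2*N) := by
  have hN := hf.nonneg
  have hp0 : 0 < p := by linarith
  have hne : ∀ x ∈ Ioo a b, x ≠ 0 := fun x hx => by grind
  refine SV.of_rpow (α := 1) (N := N) (s := -p) (by positivity) zero_le_one (by linarith) hN h
    (fun x hx => ?_) (hf.acOn_Ioo h) (fun x hx => by linarith [hf.le hp0.le (hne x hx)])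
    fun x hx => by simpa [← sub_eq_neg_add, add_comm, ← sub_eq_add_neg] using hf.bd' x (hne x hx)
  rw [abs_neg, abs_of_pos hp0, div_mul_eq_mul_div, div_le_iff₀ hp0]
  nlinarith [mul_mono (wt_le_one (x := x) hp0.le) hN]

lemma Adm.sv_tail (hf : Adm p (1 + p) N f f') (hp : 1/2 ≤ p) (hρ : 0 < ρ) (h : ρ ≤ a ∨ b ≤ -ρ) :
    SV f f' a b (2*N*ρ^(-p)) := by
  have hne : ∀ x ∈ Ioo a b, x ≠ 0 := fun x hx => by grind
  refine SV.of_symbol hρ hp hf.nonneg h (hf.acOn_Ioo (by grind)) (fun x hx => ?_)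
    (fun x hx => ?_)
  · exact (hf.bd x (hne x hx)).trans (mul_mono
      (wt_le_of_le (by linarith) (abs_pos.2 (hne x hx)) (by linarith)) hf.nonneg)
  · rw [show -p - 1 = -(1 + p) by ring]
    exact (hf.bd' x (hne x hx)).trans (mul_mono
      (wt_le_of_le (by linarith) (abs_pos.2 (hne x hx)) (by linarith)) hf.nonneg)

section
variable {N₂ : ℝ}

/-- The full amplitude of the trilinear operator, in the variables `η`, `ν`. -/
def ampT (f g H : ℝ → ℂ) (ξ η ν : ℝ) : ℂ := phaseOsc ξ η*(quadOsc η ν*ampK f g η ν*H (ξ - η))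

lemma norm_integral_ampT_piece_le (hf : Adm k (1 + k) N₁ f f') (hg : Adm k (1 + k) N₂ g g')
    (hH : Adm 0 1 N H H') (hk : 1/2 ≤ k) (hk1 : k ≤ 1) (hξ : 0 < ξ) (hν : ν ≠ 0) (hνξ : |ν| ≤ ξ)
    (hab : a ≤ b) (ha : -(ξ/8) ≤ a) (hb : b ≤ ξ/8) (s1 : 0 ≤ a + ν ∨ b + ν ≤ 0)
    (s2 : 0 ≤ a - ν ∨ b - ν ≤ 0) (s3 : (|ν| ≤ a + ν ∨ b + ν ≤ -|ν|) ∨ (|ν| ≤ a - ν ∨ b - ν ≤ -|ν|))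
    : ‖∫ η in a..b, ampT f g H ξ η ν‖ ≤ 1024*(N₁*N₂*N)*(|ν|^(-k)/ξ^2) := by
  have hN1 := hf.nonneg
  have hN2 := hg.nonneg
  have hν0 := abs_pos.2 hν
  have hhalf : (|ν|/2)^(-k) ≤ 2*|ν|^(-k) := by
    simpa using rpow_neg_le (c := 2) (n := 1) hν0 (by norm_num)
      (by linarith) (by simpa using hk1) (le_refl (|ν|/2))
  have hprod : ∃ G' : ℝ → ℂ, SV (fun η => f ((η + ν)/2)*g ((η + -ν)/2)) G' a b
      (2*(2*N₁*(2*N₂)*(2*|ν|^(-k)))) := by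
    have t1 := (hf.sv_all hk (a := (a + ν)/2) (b := (b + ν)/2) (by grind)).comp_half
    have t2 := (hg.sv_all hk (a := (a + -ν)/2) (b := (b + -ν)/2) (by grind)).comp_half
    rcases s3 with s3 | s3
    · have t3 := (hf.sv_tail hk (a := (a + ν)/2) (b := (b + ν)/2) (ρ := |ν|/2)
        (by positivity) (by grind)).comp_half
      refine ⟨_, (t3.mul t2).mono le_rfl le_rfl ?_⟩
      calc _ = 2*(2*N₁*(2*N₂)*((|ν|/2)^(-k))) := by ring
        _ ≤ _ := by gcongr
    · have t3 := (hg.sv_tail hk (a := (a + -ν)/2) (b := (b + -ν)/2) (ρ := |ν|/2)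
        (by positivity) (by grind)).comp_half
      refine ⟨_, (t1.mul t3).mono le_rfl le_rfl ?_⟩
      calc _ = 2*(2*N₁*(2*N₂)*((|ν|/2)^(-k))) := by ring
        _ ≤ _ := by gcongr
  obtain ⟨G', hG⟩ := hprod
  have t4 := (Adm.sv_far (p := 0) (by simpa using hH) le_rfl (a := ξ - b) (b := ξ - a)
    (ρ := ξ/2) (by positivity) (.inl (by linarith)) (by linarith)).comp_sub ξ
  rw [sub_sub_cancel, sub_sub_cancel] at t4
  have h3 := (hG.mul t4).norm_integral_osc_le (ρ := 3/2*ξ^2)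
    (ψ := fun η => -3*phase ξ η + 3/4*ν^2*η)
    (ψ' := fun η => -3*dphase ξ η + 3/4*ν^2) (ψ'' := fun η => -3*(-2*ξ + 3/2*η))
    hab (by positivity)
    (fun x _ => (((hasDerivAt_phase ξ x).const_mul _).add
      ((hasDerivAt_id x).const_mul (3/4*ν^2))).congr_deriv (by simp))
    (fun x _ => ((hasDerivAt_dphase ξ x).const_mul _).add_const _) (by fun_prop)
    (.inl fun x hx => by nlinarith [hx.2]) (fun x hx => ?_)
  · have e : ∫ η in a..b, ampT f g H ξ η ν = ∫ η in a..b, cis(-3*phase ξ η + 3/4*ν^2*η) *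
          (f ((η + ν)/2)*g ((η + -ν)/2)*H (ξ - η)) := by
      congr 1; funext η
      rw [ampT, phaseOsc, quadOsc, ampK, ofReal_add, add_mul, exp_add,
        ← sub_eq_add_neg, show 3/4*ν^2*η = 3/4*η*ν^2 by ring]
      ring
    rw [e]
    refine h3.trans_eq ?_
    rw [neg_zero, rpow_zero]
    field_simp; ring
  · have hx2 : x ≤ ξ/8 := hx.2.le.trans hb
    have hν2 : ν^2 ≤ ξ^2 := sq_le_sq' (by linarith [neg_abs_le ν]) ((le_abs_self ν).trans hνξ)
    refine le_trans ?_ (neg_le_abs _)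
    rw [dphase]
    nlinarith

lemma measurable_ampT (hf : Measurable f) (hg : Measurable g) (hH : Measurable H) (ξ : ℝ) :
    Measurable (fun x : ℝ × ℝ => ampT f g H ξ x.1 x.2) := by
  refine ((continuous_phaseOsc_right ξ).measurable.comp measurable_fst).mul
    (Measurable.mul (Measurable.mul ?_ (measurable_ampK hf hg))
      (hH.comp (measurable_const.sub measurable_fst)))
  unfold quadOsc
  fun_prop

lemma norm_ampT_le (hf : Adm 0 1 N₁ f f') (hg : Adm 0 1 N₂ g g') (hH : Adm 0 1 N H H') (h1 : ν ≠ η)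
    (h2 : ν ≠ -η) (h3 : η ≠ ξ) : ‖ampT f g H ξ η ν‖ ≤ N₁*N₂*N := by
  rw [ampT, norm_mul, norm_phaseOsc, one_mul, norm_mul, norm_mul, norm_quadOsc, one_mul]
  exact mul_le_mul (norm_ampK_le le_rfl hf hg h1 h2) (hH.le le_rfl (sub_ne_zero.2 h3.symm))
    (norm_nonneg _) (mul_nonneg hf.nonneg hg.nonneg)

lemma integrable_ampT (hf : Adm 0 1 N₁ f f') (hg : Adm 0 1 N₂ g g') (hH : Adm 0 1 N H H')
    (ξ a b c d : ℝ) : Integrable (fun x : ℝ × ℝ => ampT f g H ξ x.1 x.2)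
    ((volume.restrict (Ioc a b)).prod (volume.restrict (Ioc c d))) := by
  refine Integrable.of_bound (C := N₁*N₂*N)
    (measurable_ampT hf.meas hg.meas hH.meas ξ).aestronglyMeasurable ?_
  rw [Measure.prod_restrict]
  refine ae_restrict_of_ae ?_
  have key : ∀ᵐ x : ℝ × ℝ, x.2 ≠ x.1 ∧ x.2 ≠ -x.1 ∧ x.1 ≠ ξ := by
    refine Measure.ae_prod_iff_ae_ae ?_ |>.2 ?_
    · exact (measurableSet_eq_fun measurable_snd measurable_fst).compl.inter
        ((measurableSet_eq_fun measurable_snd measurable_fst.neg).compl.inter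
          (measurableSet_eq_fun measurable_fst measurable_const).compl)
    · filter_upwards [ae_ne ξ] with x hx
      filter_upwards [ae_ne x, ae_ne (-x)] with y h1 h2 using ⟨h1, h2, hx⟩
  filter_upwards [key] with x hx using norm_ampT_le hf hg hH hx.1 hx.2.1 hx.2.2

lemma integral_ampT_swap (hf : Adm 0 1 N₁ f f') (hg : Adm 0 1 N₂ g g') (hH : Adm 0 1 N H H') (ξ : ℝ)
    {d : ℝ} (hab : a ≤ b) (hcd : c ≤ d) :
    ∫ η in a..b, ∫ ν in c..d, ampT f g H ξ η ν = ∫ ν in c..d, ∫ η in a..b, ampT f g H ξ η ν := by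
  simp only [ii_of_le hab, ii_of_le hcd]
  exact integral_integral_swap (integrable_ampT hf hg hH ξ a b c d)

/-- The contribution of `|η| ≤ ξ / 8` and `|ν| ≤ ξ`. -/
lemma norm_integral_ampT_rect_le (hf : Adm k (1 + k) N₁ f f') (hg : Adm k (1 + k) N₂ g g')
    (hH : Adm 0 1 N H H') (hk : 1/2 ≤ k) (hk1 : k ≤ 3/4) (hξ : 0 < ξ) :
    ‖∫ η in -(ξ/8)..ξ/8, ∫ ν in -ξ..ξ, ampT f g H ξ η ν‖ ≤ 40000*(N₁*N₂*N)*ξ^(-1 - k) := by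
  have hN := hH.nonneg
  have hN1 := hf.nonneg
  have hN2 := hg.nonneg
  have hf0 := hf.zero (by linarith)
  have hg0 := hg.zero (by linarith)
  rw [integral_ampT_swap hf0 hg0 hH ξ (by linarith) (by linarith)]
  refine (norm_integral_le_rpow_inner (c := 0) (D := 4096*(N₁*N₂*N)/ξ^2) (q := k)
    (m := ξ) (by linarith) (by positivity) (by linarith) le_rfl le_rfl
    (fun ν hν' hν0 _ => ?_)).trans ?_
  · have hν : |ν| < ξ := abs_lt.2 hν'
    have hi : ∀ a b : ℝ, IntervalIntegrable (fun η => ampT f g H ξ η ν) volume a b := by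
      refine ii_of_loc (locallyIntegrable_of_bounded (C := N₁*N₂*N)
        ((measurable_ampT hf.meas hg.meas hH.meas ξ).comp
          (measurable_id.prodMk measurable_const)).aestronglyMeasurable ?_)
      filter_upwards [ae_ne ν, ae_ne (-ν), ae_ne ξ] with η h1 h2 h3
      exact norm_ampT_le hf0 hg0 hH h1.symm (fun h => h2 (by linarith)) h3
    set c := min |ν| (ξ/8) with hc
    have hν1 := abs_pos.2 hν0
    have hc0 : 0 < c := lt_min hν1 (by positivity)
    have hcξ : c ≤ ξ/8 := min_le_right _ _
    have hcν : c ≤ |ν| := min_le_left _ _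
    have hcc : c = |ν| ∨ c = ξ/8 := by grind
    have piece : ∀ a b : ℝ, a ≤ b → -(ξ/8) ≤ a → b ≤ ξ/8 →
        (b ≤ -c ∨ -c ≤ a ∧ b ≤ 0 ∨ 0 ≤ a ∧ b ≤ c ∨ c ≤ a) →
        ‖∫ η in a..b, ampT f g H ξ η ν‖ ≤ 1024*(N₁*N₂*N)*(|ν|^(-k)/ξ^2) := by
      intro a b hab ha hb h
      rcases hab.eq_or_lt with rfl | hab'
      · rw [intervalIntegral.integral_same, norm_zero]; positivity
      · exact norm_integral_ampT_piece_le hf hg hH hk (by linarith) hξ hν0 hν.le hab ha hb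
          (by grind) (by grind) (by grind)
    have q1 := piece (-(ξ/8)) (-c) (by linarith) le_rfl (by linarith) (by simp)
    have q2 := piece (-c) 0 (by linarith) (by linarith) (by linarith) (by simp)
    have q3 := piece 0 c (by linarith) (by linarith) (by linarith) (by simp)
    have q4 := piece c (ξ/8) (by linarith) (by linarith) le_rfl (by simp)
    rw [← ii_split (hi (-(ξ/8)) (-c)) (hi _ (ξ/8)), ← ii_split (hi (-c) 0) (hi _ (ξ/8)),
      ← ii_split (hi 0 c) (hi _ (ξ/8))]
    refine (norm_add_le_of_le q1 (norm_add_le_of_le q2 (norm_add_le_of_le q3 q4))).trans_eq ?_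
    ring
  · have e : ξ^(1 - k) = ξ^(-1 - k)*ξ^2 := by
      rw [← Real.rpow_add_natCast hξ.ne']; congr 1; push_cast; ring
    rw [e]
    have hk' : 0 < 1 - k := by linarith
    have : 2*(4096*(N₁*N₂*N)/ξ^2/(1 - k)*(ξ^(-1 - k)*ξ^2))
        = 8192/(1 - k)*((N₁*N₂*N)*ξ^(-1 - k)) := by field_simp; ring
    rw [this, mul_assoc (40000 : ℝ)]
    gcongr
    rw [div_le_iff₀ hk']
    linarith

end

/-! ### Truncations of `opK` -/

lemma integral_integrandK_neg (f g : ℝ → ℂ) (η m : ℝ) : ∫ ν in -m..m, integrandK f g (-η) ν = conj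
    (∫ ν in -m..m, integrandK (refl f) (refl g) η ν) := by
  simp only [integrandK_neg]
  rw [integral_comp_neg (fun ν => conj (integrandK (refl f) (refl g) η ν)),
    neg_neg, intervalIntegral, intervalIntegral, integral_conj, integral_conj, map_sub]

lemma norm_opK_sub_trunc_le (hp : 0 ≤ p) (hf : Adm p (1 + p) Nf f f') (hg : Adm p (1 + p) Ng g g')
    (hη : η ≠ 0) (hm : 2*|η| ≤ m) :
    ‖opK f g η - ∫ ν in -m..m, integrandK f g η ν‖ ≤ 8*4^(1 + 2*p)*(Nf*Ng)*m^(-(1 + 2*p))/|η| := by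
  have pos : ∀ {f f' g g' : ℝ → ℂ}, Adm p (1 + p) Nf f f' → Adm p (1 + p) Ng g g' →
      ∀ η : ℝ, 0 < η → 2*η ≤ m → ‖opK f g η - ∫ ν in -m..m, integrandK f g η ν‖ ≤
      8*4^(1 + 2*p)*(Nf*Ng)*m^(-(1 + 2*p))/η := by
    intro f f' g g' hf hg η h hm
    have hf0 := hf.zero hp
    have hg0 := hg.zero hp
    rw [opK_eq_halfK hf0 hg0 h, integral_integrandK hf0 hg0, neg_neg, add_sub_add_comm]
    have h1 := (halfK_spec hp hf hg h).2 m hm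
    have h2 := (halfK_spec hp hg hf h).2 m hm
    refine (norm_add_le_of_le h1 h2).trans_eq ?_
    ring
  rcases lt_or_gt_of_ne hη with h | h
  · have h0 : 0 < -η := by linarith
    rw [abs_of_neg h] at hm ⊢
    have := pos hf.refl hg.refl (-η) h0 hm
    have e1 := opK_neg (hf.zero hp) (hg.zero hp) h0
    have e2 := integral_integrandK_neg f g (-η) m
    rw [neg_neg] at e1 e2
    rw [e1, e2, ← map_sub, RCLike.norm_conj]
    exact this
  grind

lemma norm_trunc_le (hf : Adm 0 1 Nf f f') (hg : Adm 0 1 Ng g g') (hη : η ≠ 0) (hm : 0 ≤ m) :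
    ‖∫ ν in -m..m, integrandK f g η ν‖ ≤ 66*(Nf*Ng)*|η|^(-(1/2) : ℝ) := by
  have pos : ∀ {f f' g g' : ℝ → ℂ}, Adm 0 1 Nf f f' → Adm 0 1 Ng g g' →
      ∀ η : ℝ, 0 < η → ‖∫ ν in -m..m, integrandK f g η ν‖ ≤ 66*(Nf*Ng)*η^(-(1/2) : ℝ) := by
    intro f f' g g' hf hg η h
    rw [integral_integrandK hf hg, neg_neg, rpow_neg h.le, ← sqrt_eq_rpow]
    have h1 := norm_halfK_le hf hg h hm
    have h2 := norm_halfK_le hg hf h hm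
    refine (norm_add_le_of_le h1 h2).trans_eq ?_
    ring
  rcases lt_or_gt_of_ne hη with h | h
  · have h0 : 0 < -η := by linarith
    rw [abs_of_neg h]
    have e2 := integral_integrandK_neg f g (-η) m
    rw [neg_neg] at e2
    rw [e2, RCLike.norm_conj]
    exact pos hf.refl hg.refl (-η) h0
  grind

/-- The low frequency part of the trilinear operator, with two decaying factors. -/
lemma norm_integral_integrandJ_low_le (hf : Adm k (1 + k) Nf f f') (hg : Adm k (1 + k) Ng g g')
    (hh : Adm 0 1 Nh h h') (hk : 1/2 ≤ k) (hk1 : k ≤ 3/4) (hξ : 1 ≤ ξ) :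
    ‖∫ η in -(ξ/8)..ξ/8, integrandJ h (opK f g) ξ η‖ ≤ 100000*(Nf*Ng*Nh)*ξ^(-1 - k) := by
  have hNf := hf.nonneg
  have hNg := hg.nonneg
  have hNh := hh.nonneg
  have hξ0 : 0 < ξ := by linarith
  have hf0 := hf.zero (by linarith)
  have hg0 := hg.zero (by linarith)
  set T : ℝ → ℂ := fun η => ∫ ν in -ξ..ξ, integrandK f g η ν with hT
  have hTm : AEStronglyMeasurable T volume :=
    (measurable_integral_quadOsc_ampK hf.meas hg.meas _ _).aestronglyMeasurable
  have hTb : ∀ η, η ≠ 0 → ‖T η‖ ≤ 66*(Nf*Ng)*|η|^(-(1/2) : ℝ) := fun η hη =>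
    norm_trunc_le hf0 hg0 hη hξ0.le
  have i1 := ii_of_loc (locallyIntegrable_J hTm hTb hh.refl ξ) (-(ξ/8)) (ξ/8)
  have i2 := ii_of_loc (locallyIntegrable_integrandJ hf0 hg0 hh ξ) (-(ξ/8)) (ξ/8)
  have split : ∫ η in -(ξ/8)..ξ/8, integrandJ h (opK f g) ξ η =
      (∫ η in -(ξ/8)..ξ/8, phaseOsc ξ η*(T η*refl h (ξ - η))) +
      ∫ η in -(ξ/8)..ξ/8, phaseOsc ξ η*((opK f g η - T η)*refl h (ξ - η)) := by
    have e : ∀ η, phaseOsc ξ η*((opK f g η - T η)*refl h (ξ - η)) =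
        integrandJ h (opK f g) ξ η - phaseOsc ξ η*(T η*refl h (ξ - η)) := fun η => by
      rw [integrandJ_eq]; ring
    simp only [e]
    rw [ii_sub i2 i1]; ring
  have b1 : ‖∫ η in -(ξ/8)..ξ/8, phaseOsc ξ η*(T η*refl h (ξ - η))‖
      ≤ 40000*(Nf*Ng*Nh)*ξ^(-1 - k) := by
    refine le_trans (le_of_eq ?_) (norm_integral_ampT_rect_le hf hg hh.refl hk hk1 hξ0)
    congr 2; funext η
    simp only [ampT, hT]
    rw [ii_const_mul, ii_mul_const]
    simp only [integrandK_eq]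
  have e5 : ξ^(-1 - 2*k + 1/5) ≤ ξ^(-1 - k - 1/20) := rpow_mono hξ (by linarith)
  have e6 : ξ^(-(9/5) : ℝ) ≤ ξ^(-1 - k - 1/20) := rpow_mono hξ (by linarith)
  set W := ξ^(-1 - k - 1/20) with hW
  have hc : (4 : ℝ)^(1 + 2*k) ≤ 32 := by
    calc (4 : ℝ)^(1 + 2*k) ≤ 4^(5/2 : ℝ) :=
          rpow_mono (by norm_num) (by linarith)
      _ = 32 := by linarith
  have b2 : ‖∫ η in -(ξ/8)..ξ/8, phaseOsc ξ η*((opK f g η - T η)*refl h (ξ - η))‖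
      ≤ 2*(256*(Nf*Ng*Nh)*W/(1 - 19/20)*ξ^(1 - 19/20 : ℝ)) := by
    refine norm_integral_le_rpow_inner (c := ξ) (by linarith) (by positivity) (by norm_num)
      (by linarith) (by linarith) (fun η hη h0 h1 => ?_)
    have hη0 := abs_pos.2 h0
    have hηξ : |η| ≤ ξ/8 := abs_le.2 ⟨hη.1.le, hη.2.le⟩
    have key : ‖opK f g η - T η‖ ≤ 256*(Nf*Ng)*W*|η|^(-(19/20) : ℝ) := by
      rcases le_total (ξ^(-4 : ℝ)) |η| with hl | hl
      · have h2 := norm_opK_sub_trunc_le (by linarith) hf hg h0 (m := ξ) (by linarith)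
        have h3 : |η|⁻¹ ≤ ξ^(1/5 : ℝ)*|η|^(-(19/20) : ℝ) := by
          have : |η|⁻¹ = |η|^(-(1/20) : ℝ)*|η|^(-(19/20) : ℝ) := by
            rw [← rpow_add hη0, ← rpow_neg_one]; norm_num
          rw [this]
          gcongr
          calc |η|^(-(1/20) : ℝ) ≤ (ξ^(-4 : ℝ))^(-(1/20) : ℝ) :=
                rpow_le_rpow_of_nonpos (by positivity) hl (by norm_num)
            _ = ξ^(1/5 : ℝ) := by rw [← rpow_mul hξ0.le]; norm_num
        calc _ ≤ 8*4^(1 + 2*k)*(Nf*Ng)*ξ^(-(1 + 2*k))/|η| := h2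
          _ = 8*4^(1 + 2*k)*(Nf*Ng)*ξ^(-(1 + 2*k))*|η|⁻¹ := div_eq_mul_inv _ _
          _ ≤ 8*32*(Nf*Ng)*ξ^(-(1 + 2*k)) * (ξ^(1/5 : ℝ)*|η|^(-(19/20) : ℝ)) := by gcongr
          _ = 256*(Nf*Ng)*ξ^(-1 - 2*k + 1/5)*|η|^(-(19/20) : ℝ) := by
              rw [rpow_add hξ0, show -(1 + 2*k) = -1 - 2*k by ring]; ring
          _ ≤ _ := by gcongr
      · have h2 := (norm_sub_le (opK f g η) (T η)).trans
          (add_le_add (norm_opK_le' hf0 hg0 h0) (hTb η h0))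
        have h3 : |η|^(-(1/2) : ℝ) ≤ ξ^(-(9/5) : ℝ)*|η|^(-(19/20) : ℝ) := by
          have : |η|^(-(1/2) : ℝ) = |η|^(9/20 : ℝ)*|η|^(-(19/20) : ℝ) := by
            rw [← rpow_add hη0]; norm_num
          rw [this]
          gcongr
          calc |η|^(9/20 : ℝ) ≤ (ξ^(-4 : ℝ))^(9/20 : ℝ) :=
                rpow_le_rpow hη0.le hl (by norm_num)
            _ = ξ^(-(9/5) : ℝ) := by rw [← rpow_mul hξ0.le]; norm_num
        calc _ ≤ 132*(Nf*Ng)*|η|^(-(1/2) : ℝ) := by linarith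
          _ ≤ 256*(Nf*Ng)*(W*|η|^(-(19/20) : ℝ)) := by
              gcongr
              · norm_num
              · exact h3.trans (by gcongr)
          _ = _ := by ring
    rw [norm_mul, norm_phaseOsc, one_mul, norm_mul]
    calc _ ≤ (256*(Nf*Ng)*W*|η|^(-(19/20) : ℝ))*Nh := by
          gcongr
          exact hh.refl.le le_rfl (sub_ne_zero.2 h1.symm)
      _ = _ := by ring
  have e7 : W*ξ^(1 - 19/20 : ℝ) = ξ^(-1 - k) := by rw [hW, ← rpow_add hξ0]; congr 1; ring
  rw [split]
  have e8 : 2*(256*(Nf*Ng*Nh)*W/(1 - 19/20)*ξ^(1 - 19/20 : ℝ))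
      = 10240*(Nf*Ng*Nh)*(W*ξ^(1 - 19/20 : ℝ)) := by ring
  rw [e8, e7] at b2
  have h9 : 0 ≤ (Nf*Ng*Nh)*ξ^(-1 - k) := by positivity
  refine (norm_add_le _ _).trans ?_
  linarith

/-- The trilinear estimate with two decaying factors. -/
lemma norm_triI_le_of_decay (hf : Adm k (1 + k) Nf f f') (hg : Adm k (1 + k) Ng g g')
    (hh : Adm 0 1 Nh h h') (hk : 1/2 ≤ k) (hk1 : k ≤ 3/4) (hξ : 8 ≤ ξ) :
    ‖triI f g h ξ‖ ≤ 1000000000*(Nf*Ng*Nh)*ξ^(-1 - k) := by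
  have hNf := hf.nonneg
  have hNg := hg.nonneg
  have hNh := hh.nonneg
  have hξ0 : 0 < ξ := by linarith
  have hξ1 : 1 ≤ ξ := by linarith
  have hf0 := hf.zero (by linarith)
  have hg0 := hg.zero (by linarith)
  have hc2 : (2 : ℝ)^(1 + 2*k) ≤ 8 := by
    calc (2 : ℝ)^(1 + 2*k) ≤ 2^(3 : ℝ) :=
          rpow_mono (by norm_num) (by linarith)
      _ = 8 := by norm_num
  have hc4 : (4 : ℝ)^(1 + 2*k) ≤ 64 := by
    calc (4 : ℝ)^(1 + 2*k) ≤ 4^(3 : ℝ) :=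
          rpow_mono (by norm_num) (by linarith)
      _ = 64 := by norm_num
  have hs : Symb (1/2 + 2*k) (72*(Nf*Ng)) (mainK f g) (mainK' f f' g g') := by
    have := symb_mainK (by linarith) hf hg
    have hle : 9*2^(1 + 2*k)*(Nf*Ng) ≤ 72*(Nf*Ng) := by gcongr; linarith
    exact ⟨by positivity, fun x hx => (this.bd x hx).trans (by gcongr),
      fun x hx => (this.bd' x hx).trans (by gcongr), this.pos, this.neg⟩
  have hH : Adm 0 (1 + 0) Nh (refl h) (fun x => -refl h' x) := by simpa using hh.refl
  have hLm := locallyIntegrable_J (measurable_mainK hf.meas hg.meas).aestronglyMeasurable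
    (symb_mainK_zero hf0 hg0).bd hh.refl ξ
  have hrem : ∀ a b : ℝ, a ≤ b → (ξ/8 ≤ a ∨ b ≤ -(ξ/8)) →
      ‖∫ η in a..b, phaseOsc ξ η*((opK f g η - mainK f g η)*refl h (ξ - η))‖
        ≤ 1000000*(Nf*Ng*Nh)*ξ^(-1 - k) := by
    intro a b hab hs
    have h1 := norm_integral_le_rpow_tail (c := ξ) (D := 12100*(Nf*Ng)*Nh) (q := 1 + k)
      (F := fun η => phaseOsc ξ η*((opK f g η - mainK f g η)*refl h (ξ - η)))
      (m := ξ/8) hab (by positivity) (by linarith) (by linarith) hs (fun η h0 h1 => by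
        rw [norm_mul, norm_phaseOsc, one_mul, norm_mul]
        have h2 := norm_opK_sub_mainK_le (by linarith) (by linarith) le_rfl (by linarith) hf hg
          (η := η) (by linarith)
        rw [show -2 - 2*k + k = -(1 + k) - 1 by ring] at h2
        have h3 : 35/k ≤ 70 := by rw [div_le_iff₀ (by linarith)]; linarith
        calc _ ≤ (2*(64*(24 + 70))*(Nf*Ng)*|η|^(-(1 + k) - 1))*Nh := by
              refine mul_le_mul (h2.trans (by gcongr))
                (hh.refl.le le_rfl (sub_ne_zero.2 h1.symm)) (norm_nonneg _) (by positivity)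
          _ = 12032*(Nf*Ng*Nh*|η|^(-(1 + k) - 1)) := by ring
          _ ≤ 12100*(Nf*Ng*Nh*|η|^(-(1 + k) - 1)) := by gcongr; norm_num
          _ = _ := by ring)
    have h2 : (ξ/8)^(-(1 + k)) ≤ 64*ξ^(-(1 + k)) := by
      have := rpow_neg_le (c := 8) (n := 2) (q := 1 + k) hξ0 (by norm_num) (by linarith)
        (by norm_num; linarith) (le_refl (ξ/8))
      linarith
    have h3 : 12100*(Nf*Ng)*Nh/(1 + k) ≤ 12100*(Nf*Ng)*Nh :=
      div_le_self (by positivity) (by linarith)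
    calc _ ≤ _ := h1
      _ ≤ 12100*(Nf*Ng)*Nh*(64*ξ^(-(1 + k))) := by gcongr
      _ = 774400*(Nf*Ng*Nh*ξ^(-(1 + k))) := by ring
      _ ≤ 1000000*(Nf*Ng*Nh*ξ^(-(1 + k))) := by gcongr; norm_num
      _ = _ := by ring
  refine (norm_triI_le_of_window (m₀ := 5*ξ/4) hf0 hg0 hh hξ0 fun m hm => ?_).trans
    (by linarith [show 0 ≤ Nf*Ng*Nh*ξ^(-1 - k) by positivity] :
      1000000000*(Nf*Ng*Nh)*ξ^(-1 - k)/2 ≤ _)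
  have hi := ii_of_loc (locallyIntegrable_integrandJ hf0 hg0 hh ξ)
  rw [← ii_split (hi (-m) (-(ξ/8))) (hi _ m), ← ii_split (hi (-(ξ/8)) (ξ/8)) (hi _ m),
    integral_integrandJ_eq hf0 hg0 hh ξ (-m), integral_integrandJ_eq hf0 hg0 hh ξ (ξ/8)]
  have a1 := norm_integral_J_out_le hs (by linarith) (by linarith) hH le_rfl zero_le_one hξ1
    (a := -m) (b := -(ξ/8)) (by linarith) (.inr le_rfl)
  have a2 := hrem (-m) (-(ξ/8)) (by linarith) (.inr le_rfl)
  have a3 := norm_integral_integrandJ_low_le hf hg hh hk hk1 hξ1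
  have a4 := norm_integral_J_high_le hs (by linarith) (by linarith) hH le_rfl zero_le_one hξ1
    hm (ii_of_loc hLm)
  have a5 := hrem (ξ/8) m (by linarith) (.inl le_rfl)
  have e1 : ξ^(-1/2 - (1/2 + 2*k) - 0) ≤ ξ^(-1 - k) := rpow_mono hξ1 (by linarith)
  have e2 : ξ^(-2 - (1/2 + 2*k) + 1/5) ≤ ξ^(-1 - k) := rpow_mono hξ1 (by linarith)
  have a1' := a1.trans (mul_mono e1 (by positivity))
  have a4' := a4.trans (mul_mono (add_le_add e1 e2) (by positivity))
  have h9 : 0 ≤ (Nf*Ng*Nh)*ξ^(-1 - k) := by positivity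
  refine (norm_add_le_of_le (norm_add_le_of_le a1' a2)
    (norm_add_le_of_le a3 (norm_add_le_of_le a4' a5))).trans ?_
  linarith

/-! ### A rapidly decaying third factor -/

section
variable {b : ℝ → ℂ}

lemma norm_triI_le_of_fast (hf : Adm 0 1 Nf f f') (hg : Adm 0 1 Ng g g') (hb : Adm 3 1 N b b')
    (hξ : 8 ≤ ξ) : ‖triI f g b ξ‖ ≤ 1000000*(Nf*Ng*N)*ξ^(-(9/5) : ℝ) := by
  have hNf := hf.nonneg
  have hNg := hg.nonneg
  have hN := hb.nonneg
  have hξ0 : 0 < ξ := by linarith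
  have hξ1 : 1 ≤ ξ := by linarith
  have hb0 : Adm 0 1 N b b' := hb.mono (by norm_num) le_rfl le_rfl
  have hH := hb.refl
  have hH0 := hb0.refl
  have hs := symb_mainK_zero hf hg
  have hi := ii_of_loc (locallyIntegrable_integrandJ hf hg hb0 ξ)
  have hsq : ξ^(-(5/2) : ℝ) ≤ ξ^(-(9/5) : ℝ) := rpow_mono hξ1 (by norm_num)
  have h9 : 0 ≤ (Nf*Ng*N)*ξ^(-(9/5) : ℝ) := by positivity
  -- the two tails
  have tail : ∀ x y : ℝ, x ≤ y → (2*ξ ≤ x ∨ y ≤ -(2*ξ)) → ‖∫ η in x..y, integrandJ b (opK f g) ξ η‖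
        ≤ 300*(Nf*Ng*N)*ξ^(-(9/5) : ℝ) := by
    intro x y hxy hs
    have h1 := norm_integral_le_rpow_tail (c := ξ) (D := 528*(Nf*Ng)*N) (q := 5/2)
      (F := integrandJ b (opK f g) ξ) (m := 2*ξ) hxy (by positivity) (by linarith) (by norm_num)
      hs (fun η h0 h1 => by
        have hη0 : 0 < |η| := by linarith
        have hne : η ≠ 0 := abs_pos.1 hη0
        rw [integrandJ_eq, norm_mul, norm_phaseOsc, one_mul, norm_mul]
        have hbd : ‖refl b (ξ - η)‖ ≤ N*(2^3*|η|^(-(3 : ℝ))) := by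
          refine (hH.bd _ (sub_ne_zero.2 h1.symm)).trans (mul_mono ?_ hN)
          refine rpow_neg_le (c := 2) (n := 3) hη0 (by norm_num) (by norm_num)
            (by norm_num) ?_
          grind
        calc _ ≤ (66*(Nf*Ng)*|η|^(-(1/2) : ℝ))*(N*(2^3*|η|^(-(3 : ℝ)))) := by
              gcongr
              exact norm_opK_le' hf hg hne
          _ = 528*(Nf*Ng)*N*(|η|^(-(1/2) : ℝ)*|η|^(-(3 : ℝ))) := by ring
          _ = _ := by rw [← rpow_add hη0]; norm_num)
    have h2 : (2*ξ)^(-(5/2) : ℝ) ≤ ξ^(-(5/2) : ℝ) :=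
      rpow_le_rpow_of_nonpos hξ0 (by linarith) (by norm_num)
    calc _ ≤ _ := h1
      _ ≤ 528*(Nf*Ng)*N/(5/2)*ξ^(-(9/5) : ℝ) := by gcongr; exact h2.trans hsq
      _ ≤ _ := by linarith
  -- moderate frequencies away from the third factor
  have moderate : ∀ x y : ℝ, x ≤ y → -(2*ξ) ≤ x → y ≤ 2*ξ → (y ≤ 3*ξ/4 ∨ 5*ξ/4 ≤ x) →
      ‖∫ η in x..y, integrandJ b (opK f g) ξ η‖
        ≤ 34000*(Nf*Ng*N)*ξ^(-(9/5) : ℝ) := by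
    intro x y hxy hx hy hs
    have h1 := norm_integral_le_rpow_half (c := ξ) (D := 4224*(Nf*Ng)*N*ξ^(-3 : ℝ))
      (F := integrandJ b (opK f g) ξ) hxy (by positivity) hx hy
      (fun η hη h0 h1 => by
        rw [integrandJ_eq, norm_mul, norm_phaseOsc, one_mul, norm_mul]
        have hbd : ‖refl b (ξ - η)‖ ≤ N*(4^3*ξ^(-(3 : ℝ))) := by
          refine (hH.bd _ (sub_ne_zero.2 h1.symm)).trans (mul_mono ?_ hN)
          refine rpow_neg_le (c := 4) (n := 3) hξ0 (by norm_num) (by norm_num)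
            (by norm_num) ?_
          rcases hs with hs | hs
          · linarith [le_abs_self (ξ - η), hη.2]
          · linarith [neg_le_abs (ξ - η), hη.1]
        calc _ ≤ (66*(Nf*Ng)*|η|^(-(1/2) : ℝ))*(N*(4^3*ξ^(-(3 : ℝ)))) := by
              gcongr
              exact norm_opK_le' hf hg h0
          _ = _ := by ring)
    have h2 : √(2*ξ) ≤ 2*ξ^(1/2 : ℝ) := by
      rw [← sqrt_eq_rpow]
      calc √(2*ξ) ≤ √(4*ξ) := Real.sqrt_le_sqrt (by linarith)
        _ = 2*√ξ := by
          rw [sqrt_mul (by norm_num), show (4 : ℝ) = 2^2 by norm_num, sqrt_sq (by norm_num)]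
    have e : ξ^(-3 : ℝ)*ξ^(1/2 : ℝ) = ξ^(-(5/2) : ℝ) := by rw [← rpow_add hξ0]; norm_num
    calc _ ≤ _ := h1
      _ ≤ 4*(4224*(Nf*Ng)*N*ξ^(-3 : ℝ))*(2*ξ^(1/2 : ℝ)) := by gcongr
      _ = 33792*(Nf*Ng*N)*(ξ^(-3 : ℝ)*ξ^(1/2 : ℝ)) := by ring
      _ ≤ 34000*(Nf*Ng*N)*ξ^(-(9/5) : ℝ) := by rw [e]; gcongr; norm_num
  -- near the third factor
  have near : ∀ x y : ℝ, x ≤ y → (3*ξ/4 ≤ x ∧ y ≤ ξ ∨ ξ ≤ x ∧ y ≤ 5*ξ/4) →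
      ‖∫ η in x..y, integrandJ b (opK f g) ξ η‖
        ≤ 370000*(Nf*Ng*N)*ξ^(-(9/5) : ℝ) := by
    intro x y hxy hs'
    have hx : 3*ξ/4 ≤ x := by grind
    have h1 := norm_integral_J_mid_le hs le_rfl (by norm_num) hH0 hξ1 hxy hs'
    have h2 : ‖∫ η in x..y, phaseOsc ξ η*((opK f g η - mainK f g η)*refl b (ξ - η))‖
        ≤ 6400*(Nf*Ng)*N*ξ^(-(9/5) : ℝ) := by
      refine norm_integral_le_of_rpow (α := 1) (s := -1) (N := 6400*(Nf*Ng)*N*ξ^(-(9/5) : ℝ)) ξ ξ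
        hxy (by positivity) zero_le_one (by norm_num) (by positivity) (by grind) (fun η hη => ?_)
        fun η hη hc => ?_
      · rw [abs_neg, abs_one, div_one]
        exact mul_le_of_le_one_right (by positivity) (wt_le_one zero_le_one)
      · have hη1 : ξ/2 ≤ |η| := by linarith [le_abs_self η, hη.1]
        rw [norm_mul, norm_phaseOsc, one_mul, norm_mul]
        have a1 := norm_opK_sub_mainK_le_zero hf hg (η := η) (by linarith)
        have a2 : |η|^(-(4/5) - 1 : ℝ) ≤ 4*ξ^(-(9/5) : ℝ) := by
          have := rpow_neg_le (c := 2) (n := 2) (q := 9/5) hξ0 (by norm_num)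
            (by norm_num) (by norm_num) hη1
          linarith
        have a3 : ‖refl b (ξ - η)‖ ≤ N*(1 + |ξ - η|)^(-2 : ℝ) :=
          (hH.bd _ (sub_ne_zero.2 hc.symm)).trans (mul_mono (wt_mono (by norm_num)) hN)
        rw [abs_sub_comm η, show (-1 - 1 : ℝ) = -2 by norm_num]
        calc _ ≤ (1600*(Nf*Ng)*(4*ξ^(-(9/5) : ℝ)))*(N*(1 + |ξ - η|)^(-2 : ℝ)) := by
              gcongr
              exact a1.trans (by gcongr)
          _ = _ := by ring
    have h3 : ξ^(-2 - 1/2 + 1/5 : ℝ) ≤ ξ^(-(9/5) : ℝ) := rpow_mono hξ1 (by norm_num)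
    rw [integral_integrandJ_eq hf hg hb0]
    refine (norm_add_le_of_le (h1.trans (mul_mono h3 (by positivity))) h2).trans ?_
    linarith
  refine (norm_triI_le_of_window (m₀ := 2*ξ) hf hg hb0 hξ0 fun m hm => ?_).trans
    (by linarith : 1000000*(Nf*Ng*N)*ξ^(-(9/5) : ℝ)/2 ≤ _)
  rw [← ii_split (hi (-m) (-(2*ξ))) (hi _ m), ← ii_split (hi (-(2*ξ)) (3*ξ/4)) (hi _ m),
    ← ii_split (hi (3*ξ/4) ξ) (hi _ m),
    ← ii_split (hi ξ (5*ξ/4)) (hi _ m),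
    ← ii_split (hi (5*ξ/4) (2*ξ)) (hi _ m)]
  have a1 := tail (-m) (-(2*ξ)) (by linarith) (.inr le_rfl)
  have a2 := moderate (-(2*ξ)) (3*ξ/4) (by linarith) le_rfl (by linarith) (.inl le_rfl)
  have a3 := near (3*ξ/4) ξ (by linarith) (.inl ⟨le_rfl, le_rfl⟩)
  have a4 := near ξ (5*ξ/4) (by linarith) (.inr ⟨le_rfl, le_rfl⟩)
  have a5 := moderate (5*ξ/4) (2*ξ) (by linarith) (by linarith) le_rfl (.inr le_rfl)
  have a6 := tail (2*ξ) m hm (.inl le_rfl)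
  refine (norm_add_le_of_le a1 (norm_add_le_of_le a2 (norm_add_le_of_le a3 (norm_add_le_of_le a4
    (norm_add_le_of_le a5 a6))))).trans ?_
  linarith

end

/-! ### Dependence on the factors -/

lemma tendsto_of_approx {a : ℕ → ℂ} {b : ℝ → ℕ → ℂ} {ρ : ℝ → ℝ} (hρ : Tendsto ρ atTop (𝓝 0))
    (h1 : ∀ m, m₀ ≤ m → ∀ n, ‖a n - b m n‖ ≤ ρ m) (h2 : ∀ m, m₀ ≤ m → ‖l - b' m‖ ≤ ρ m)
    (h3 : ∀ m, m₀ ≤ m → Tendsto (b m) atTop (𝓝 (b' m))) : Tendsto a atTop (𝓝 l) := by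
  refine Metric.tendsto_atTop.2 fun ε hε => ?_
  obtain ⟨m, hm, hm0⟩ := ((hρ.eventually (gt_mem_nhds (by positivity : 0 < ε/3))).and
    (eventually_ge_atTop m₀)).exists
  obtain ⟨n₀, hn⟩ := Metric.tendsto_atTop.1 (h3 m hm0) (ε/3) (by positivity)
  refine ⟨n₀, fun n hn0 => ?_⟩
  have e1 := h1 m hm0 n
  have e2 := h2 m hm0
  have e3 := hn n hn0
  rw [dist_eq_norm] at e3 ⊢
  have e : a n - l = (a n - b m n) + (b m n - b' m) - (l - b' m) := by ring
  rw [e]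
  have n1 := norm_sub_le ((a n - b m n) + (b m n - b' m)) (l - b' m)
  have n2 := norm_add_le (a n - b m n) (b m n - b' m)
  linarith

section
variable {fs fs' gs gs' hs hs' : ℕ → ℝ → ℂ}

lemma tendsto_opK_seq (hf : Adm 0 1 Nf f f') (hg : Adm 0 1 Ng g g')
    (hfs : ∀ n, Adm 0 1 Nf (fs n) (fs' n)) (hgs : ∀ n, Adm 0 1 Ng (gs n) (gs' n))
    (cf : ∀ x, Tendsto (fun n => fs n x) atTop (𝓝 (f x)))
    (cg : ∀ x, Tendsto (fun n => gs n x) atTop (𝓝 (g x))) (hη : η ≠ 0) :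
    Tendsto (fun n => opK (fs n) (gs n) η) atTop (𝓝 (opK f g η)) := by
  have hz := tendsto_const_mul_rpow_neg (8*4^(1 + 2*0 : ℝ)*(Nf*Ng)/|η|) (y := 1 + 2*0) (by norm_num)
  refine tendsto_of_approx (m₀ := 2*|η|) (b := fun m n => ∫ ν in -m..m, integrandK (fs n) (gs n) η ν)
    (b' := fun m => ∫ ν in -m..m, integrandK f g η ν) hz (fun m hm n => ?_) (fun m hm => ?_)
    (fun m _ => ?_)
  · refine (norm_opK_sub_trunc_le le_rfl (by simpa using hfs n) (by simpa using hgs n) hη hm).trans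
      (le_of_eq (by ring))
  · refine (norm_opK_sub_trunc_le le_rfl (by simpa using hf) (by simpa using hg) hη hm).trans
      (le_of_eq (by ring))
  · refine tendsto_integral_filter_of_dominated_convergence (fun _ => Nf*Ng) (.of_forall fun n =>
        (locallyIntegrable_integrandK (hfs n) (hgs n) η).aestronglyMeasurable.restrict)
      (.of_forall fun n => ?_) (by simp) (.of_forall fun ν _ => ?_)
    · filter_upwards [ae_ne η, ae_ne (-η)] with ν h1 h2 _
      rw [integrandK_eq, norm_mul, norm_quadOsc, one_mul]
      exact norm_ampK_le le_rfl (hfs n) (hgs n) h1 h2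
    · exact (tendsto_const_nhds.mul (cf _)).mul (cg _)

lemma tendsto_triI_seq (hf : Adm 0 1 Nf f f') (hg : Adm 0 1 Ng g g') (hh : Adm 0 1 Nh h h')
    (hfs : ∀ n, Adm 0 1 Nf (fs n) (fs' n)) (hgs : ∀ n, Adm 0 1 Ng (gs n) (gs' n))
    (hhs : ∀ n, Adm 0 1 Nh (hs n) (hs' n)) (cf : ∀ x, Tendsto (fun n => fs n x) atTop (𝓝 (f x)))
    (cg : ∀ x, Tendsto (fun n => gs n x) atTop (𝓝 (g x)))
    (ch : ∀ x, Tendsto (fun n => hs n x) atTop (𝓝 (h x))) (hξ : 0 < ξ) :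
    Tendsto (fun n => triI (fs n) (gs n) (hs n) ξ) atTop (𝓝 (triI f g h ξ)) := by
  refine Tendsto.const_mul _ ?_
  have hz := tendsto_const_mul_rpow_neg (22000*(Nf*Ng*Nh)) (y := 4/5) (by norm_num)
  refine tendsto_of_approx (m₀ := max (8*ξ) 1)
    (b := fun m n => ∫ η in -m..m, integrandJ (hs n) (opK (fs n) (gs n)) ξ η)
    (b' := fun m => ∫ η in -m..m, integrandJ h (opK f g) ξ η) hz
    (fun m hm n => norm_opJ_sub_le (hfs n) (hgs n) (hhs n) hξ hm)
    (fun m hm => norm_opJ_sub_le hf hg hh hξ hm) (fun m _ => ?_)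
  refine tendsto_integral_filter_of_dominated_convergence (fun η => 66*(Nf*Ng)*Nh*|η|^(-(1/2) : ℝ))
    (.of_forall fun n =>
      (locallyIntegrable_integrandJ (hfs n) (hgs n) (hhs n) ξ).aestronglyMeasurable.restrict)
    (.of_forall fun n => ?_) ?_ ?_
  · filter_upwards [ae_ne 0, ae_ne ξ] with η h0 h1 _
    rw [integrandJ_eq]
    exact norm_J_le (fun η hη => norm_opK_le' (hfs n) (hgs n) hη) (hhs n).refl h0 h1
  · have : LocallyIntegrable (fun η : ℝ => |η|^(-(1/2) : ℝ)) volume := by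
      refine locallyIntegrable_of_norm_le_rpow (C := 1) (α := 1/2) (by simp) (by norm_num)
        (.of_forall fun x => ?_) (Measurable.aestronglyMeasurable (by fun_prop))
      rw [one_mul, norm_eq_abs, norm_eq_abs, abs_of_nonneg (by positivity)]
    exact ((this.integrableOn_isCompact isCompact_uIcc).intervalIntegrable).const_mul _
  · filter_upwards [ae_ne 0] with η h0 _
    exact (tendsto_const_nhds.mul ((continuous_conj.tendsto _).comp (ch _))).mul
      (tendsto_opK_seq hf hg hfs hgs cf cg h0)

/-! ### Symmetries of the trilinear operator -/

lemma opK_comm (hf : Adm 0 1 Nf f f') (hg : Adm 0 1 Ng g g') (hη : η ≠ 0) : opK f g η = opK g f η :=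
    by
  rcases lt_or_gt_of_ne hη with h | h
  · have h0 : 0 < -η := by linarith
    have e1 := opK_neg hf hg h0
    have e2 := opK_neg hg hf h0
    rw [neg_neg] at e1 e2
    rw [e1, e2, opK_eq_halfK hf.refl hg.refl h0, opK_eq_halfK hg.refl hf.refl h0, add_comm]
  · rw [opK_eq_halfK hf hg h, opK_eq_halfK hg hf h, add_comm]

lemma opJ_congr {v : ℝ → ℂ} (h : ℝ → ℂ) (ξ : ℝ) (huv : ∀ η, η ≠ 0 → u η = v η) :
    opJ h u ξ = opJ h v ξ := by
  rw [opJ, opJ, improperIntegral, improperIntegral]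
  congr 1
  funext p
  refine ii_congr_ae ?_
  filter_upwards [ae_ne 0] with η hη _
  rw [integrandJ, integrandJ, huv η hη]

lemma triI_comm (hf : Adm 0 1 Nf f f') (hg : Adm 0 1 Ng g g') (h : ℝ → ℂ) (ξ : ℝ) :
    triI f g h ξ = triI g f h ξ := by
  rw [triI, triI, opJ_congr h ξ fun η hη => opK_comm hf hg hη]

/-- The integrand of the trilinear operator in the variables `x = η₁` and `η = η₁ + η₂`. -/
def triQ (f g H : ℝ → ℂ) (ξ η x : ℝ) : ℂ := cis(-3*phase ξ η + 3/4*η*(2*x - η)^2) *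
    (f x*g (η - x)*H (ξ - η))

lemma triQ_symm (f g H : ℝ → ℂ) (ξ η x : ℝ) : triQ H g f ξ (ξ - x) (ξ - η) = triQ f g H ξ η x := by
  rw [triQ, triQ, sub_sub_cancel]
  have e1 : ξ - x - (ξ - η) = η - x := by ring
  have e2 : -3*phase ξ (ξ - x) + 3/4*(ξ - x)*(2*(ξ - η) - (ξ - x))^2 =
      -3*phase ξ η + 3/4*η*(2*x - η)^2 := by rw [phase, phase]; ring
  rw [e1, e2]
  ring

lemma integrable_wt_two : Integrable (fun x : ℝ => (1 + |x|)^(-(2 : ℝ))) volume := by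
  have := integrable_one_add_norm (E := ℝ) (μ := volume) (r := 2) (by simp)
  simpa [norm_eq_abs] using this

lemma integrable_triQ (hf : Adm 2 1 Nf f f') (hg : Adm 0 1 Ng g g') (hH : Adm 2 1 Nh H H') (ξ : ℝ) :
    Integrable (fun p : ℝ × ℝ => triQ f g H ξ p.1 p.2) (volume.prod volume) := by
  have hNf := hf.nonneg
  have hNg := hg.nonneg
  have hdom := ((integrable_wt_two.comp_sub_left ξ).mul_prod integrable_wt_two).const_mul (Nf*Ng*Nh)
  have hm : Measurable (fun p : ℝ × ℝ => triQ f g H ξ p.1 p.2) := by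
    unfold triQ phase
    refine Measurable.mul (by fun_prop) (((hf.meas.comp measurable_snd).mul
      (hg.meas.comp (by fun_prop))).mul (hH.meas.comp (by fun_prop)))
  refine hdom.mono' hm.aestronglyMeasurable ?_
  have key : ∀ᵐ p : ℝ × ℝ ∂(volume.prod volume), p.1 ≠ ξ ∧ p.2 ≠ 0 ∧ p.2 ≠ p.1 := by
    refine Measure.ae_prod_iff_ae_ae ?_ |>.2 ?_
    · exact (measurableSet_eq_fun measurable_fst measurable_const).compl.inter
        ((measurableSet_eq_fun measurable_snd measurable_const).compl.inter
          (measurableSet_eq_fun measurable_snd measurable_fst).compl)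
    · filter_upwards [ae_ne ξ] with x hx
      filter_upwards [ae_ne 0, ae_ne x] with y h1 h2 using ⟨hx, h1, h2⟩
  filter_upwards [key] with p hp
  rw [triQ, norm_mul, norm_exp_ofReal_mul_I, one_mul, norm_mul, norm_mul]
  calc _ ≤ (Nf*(1 + |p.2|)^(-(2 : ℝ)))*Ng*(Nh*(1 + |ξ - p.1|)^(-(2 : ℝ))) := by
        gcongr
        · exact hf.bd _ hp.2.1
        · exact hg.le le_rfl (sub_ne_zero.2 hp.2.2.symm)
        · exact hH.bd _ (sub_ne_zero.2 hp.1.symm)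
    _ = _ := by ring

lemma opJ_eq_integral_triQ (hf : Adm 2 1 Nf f f') (hg : Adm 0 1 Ng g g') (hh : Adm 2 1 Nh h h')
    (hξ : 0 < ξ) : opJ h (opK f g) ξ = 2*∫ η, ∫ x, triQ f g (refl h) ξ η x := by
  have hf0 : Adm 0 1 Nf f f' := hf.mono (by norm_num) le_rfl le_rfl
  have hh0 : Adm 0 1 Nh h h' := hh.mono (by norm_num) le_rfl le_rfl
  have hNf := hf.nonneg
  have hQ := integrable_triQ hf hg hh.refl ξ
  have hlim2 : Tendsto (fun m : ℝ => (-m, m)) atTop (atBot ×ˢ atTop) :=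
    tendsto_neg_atTop_atBot.prodMk tendsto_id
  have hK : ∀ η, η ≠ 0 → opK f g η = 2*∫ x, integrandK f g η (2*x - η) := by
    intro η hη
    have i1 : Integrable (fun x => integrandK f g η (2*x - η)) volume := by
      refine (integrable_wt_two.const_mul (Nf*Ng)).mono' ?_ ?_
      · have hm : Measurable (fun ν => integrandK f g η ν) := by
          simp only [integrandK_eq]
          exact (continuous_quadOsc η).measurable.mul (measurable_ampK_right hf.meas hg.meas η)
        exact (hm.comp (by fun_prop : Measurable fun x : ℝ => 2*x - η)).aestronglyMeasurable
      · filter_upwards [ae_ne 0, ae_ne η] with x h0 h1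
        rw [integrandK_eq, norm_mul, norm_quadOsc, one_mul, ampK, norm_mul,
          show (η + (2*x - η))/2 = x by ring, show (η - (2*x - η))/2 = η - x by ring]
        calc _ ≤ (Nf*(1 + |x|)^(-(2 : ℝ)))*Ng := by
              gcongr
              · exact hf.bd _ h0
              · exact hg.le le_rfl (sub_ne_zero.2 h1.symm)
          _ = _ := by ring
    have i2 : Integrable (integrandK f g η) volume := by
      have := (i1.comp_div (R := 2) (by norm_num)).comp_add_right η
      refine this.congr (.of_forall fun x => ?_)
      simp only; congr 1; ring
    have e1 : opK f g η = ∫ ν, integrandK f g η ν :=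
      tendsto_nhds_unique ((tendsto_opK hf0 hg hη).comp hlim2)
        (intervalIntegral_tendsto_integral i2 tendsto_neg_atTop_atBot tendsto_id)
    have e2 := Measure.integral_comp_mul_left (fun y => integrandK f g η (y - η)) 2
    rw [integral_sub_right_eq_self] at e2
    rw [e1, e2]
    simp
  have hJ : ∀ η, η ≠ 0 → integrandJ h (opK f g) ξ η = 2*∫ x, triQ f g (refl h) ξ η x := by
    intro η hη
    rw [integrandJ_eq, hK η hη, mul_left_comm (phaseOsc ξ η), mul_assoc, mul_left_comm,
      ← integral_mul_const, ← integral_const_mul]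
    congr 1; funext x
    rw [triQ, integrandK, phaseOsc, ofReal_add, add_mul, exp_add,
      show (η + (2*x - η))/2 = x by ring, show (η - (2*x - η))/2 = η - x by ring]
    ring
  have i3 : Integrable (integrandJ h (opK f g) ξ) volume := by
    refine (hQ.integral_prod_left.const_mul 2).congr ?_
    filter_upwards [ae_ne 0] with η hη using (hJ η hη).symm
  have e3 := tendsto_nhds_unique (tendsto_opJ hf0 hg hh0 hξ)
    (intervalIntegral_tendsto_integral i3 tendsto_neg_atTop_atBot tendsto_id)
  rw [e3, ← integral_const_mul]
  refine integral_congr_ae ?_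
  filter_upwards [ae_ne 0] with η hη using hJ η hη

lemma triI_symm_of_decay (hf : Adm 2 1 Nf f f') (hg : Adm 0 1 Ng g g') (hh : Adm 2 1 Nh h h')
    (hξ : 0 < ξ) : triI f g h ξ = triI (refl h) g (refl f) ξ := by
  rw [triI, triI, opJ_eq_integral_triQ hf hg hh hξ, opJ_eq_integral_triQ hh.refl hg hf.refl hξ,
    refl_refl]
  congr 2
  have hQ := integrable_triQ hf hg hh.refl ξ
  rw [integral_integral_swap hQ]
  simp only [← triQ_symm f g (refl h) ξ]
  rw [integral_sub_left_eq_self (fun x => ∫ y, triQ (refl h) g f ξ x (ξ - y)) volume ξ]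
  congr 1; funext x
  exact integral_sub_left_eq_self (fun y => triQ (refl h) g f ξ x y) volume ξ

lemma Adm.mul_one (hf : Adm p (1 + p) N f f') (hu : Adm 0 1 M u u') :
    Adm p (1 + p) (2*(N*M)) (fun x => f x*u x) (fun x => f' x*u x + f x*u' x) where
  nonneg := by have := hf.nonneg; have := hu.nonneg; positivity
  meas := hf.meas.mul hu.meas
  meas' := (hf.meas'.mul hu.meas).add (hf.meas.mul hu.meas')
  bd := fun x hx => by
    have h0 := hf.nonneg
    have h1 := hu.nonneg
    rw [norm_mul]
    calc _ ≤ (N*(1 + |x|)^(-p))*M :=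
          mul_le_mul (hf.bd x hx) (hu.le le_rfl hx) (norm_nonneg _) (by positivity)
      _ ≤ _ := by
          have : 0 ≤ N*M*(1 + |x|)^(-p) := by positivity
          linarith
  bd' := fun x hx => by
    have h0 := hf.nonneg
    have e : (1 + |x|)^(-(1 + p)) = (1 + |x|)^(-p)*(1 + |x|)^(-(1 : ℝ)) := by
      rw [← rpow_add (by positivity)]; congr 1; ring
    refine (norm_add_le _ _).trans ?_
    rw [norm_mul, norm_mul]
    calc _ ≤ (N*(1 + |x|)^(-(1 + p)))*M
          + (N*(1 + |x|)^(-p))*(M*(1 + |x|)^(-(1 : ℝ))) := by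
          gcongr
          · exact hf.bd' x hx
          · exact hu.le le_rfl hx
          · exact hf.bd x hx
          · exact hu.bd' x hx
      _ = _ := by rw [e]; ring
  pos := hf.pos.mul hu.pos
  neg := hf.neg.mul hu.neg

/-- A smooth cut-off at the scale `n`. -/
def damp (n : ℕ) (x : ℝ) : ℂ := (((1 + (x/(n + 1))^2)⁻¹ : ℝ) : ℂ)

/-- The derivative of `damp n`. -/
def dampDeriv (n : ℕ) (x : ℝ) : ℂ :=
  ((-(2*(x/(n + 1))*(1/(n + 1)))/(1 + (x/(n + 1))^2)^2 : ℝ) : ℂ)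

lemma adm_damp (n : ℕ) : Adm 0 1 2 (damp n) (dampDeriv n) := by
  have hn : (0 : ℝ) < n + 1 := by positivity
  have hd : ∀ x : ℝ, HasDerivAt (fun x : ℝ => (1 + (x/(n + 1))^2)⁻¹)
      (-(2*(x/(n + 1))*(1/(n + 1)))/(1 + (x/(n + 1))^2)^2) x := fun x => by
    have h1 : HasDerivAt (fun x : ℝ => 1 + (x/(n + 1))^2) (2*(x/(n + 1))*(1/(n + 1))) x := by
      have := (((hasDerivAt_id x).div_const ((n : ℝ) + 1)).pow 2).const_add 1
      refine this.congr_deriv ?_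
      simp
    exact h1.inv (by positivity)
  have hac : ∀ s : Set ℝ, OrdConnected s → ACOn (damp n) (dampDeriv n) s := fun s _ => by
      refine ACOn.of_hasDerivAt (fun x _ => (hd x).ofReal_comp) (Continuous.continuousOn ?_)
      refine continuous_ofReal.comp (Continuous.div (by fun_prop) (by fun_prop)
        fun x => by positivity)
  refine ⟨by norm_num, ?_, ?_, fun x _ => ?_, fun x _ => ?_, hac _ inferInstance,
    hac _ inferInstance⟩
  · unfold damp; fun_prop
  · unfold dampDeriv; fun_prop
  · rw [damp, norm_real, norm_eq_abs, abs_of_pos (by positivity), neg_zero, rpow_zero]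
    have : (1 + (x/(n + 1))^2)⁻¹ ≤ 1 := inv_le_one_of_one_le₀ (by nlinarith [sq_nonneg (x/(n + 1))])
    linarith
  · rw [dampDeriv, norm_real, norm_eq_abs, rpow_neg_one, abs_div, abs_neg, abs_mul, abs_mul,
      abs_two, abs_of_pos (by positivity : 0 < 1/((n : ℝ) + 1)),
      abs_of_pos (by positivity : 0 < (1 + (x/((n : ℝ) + 1))^2)^2)]
    set u := x/((n : ℝ) + 1) with hu
    have hx : |x| = |u| * (n + 1) := by rw [hu, abs_div, abs_of_pos hn]; field_simp
    have hd1 : 1/((n : ℝ) + 1) ≤ 1 := by rw [div_le_one hn]; linarith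
    rw [div_le_iff₀ (by positivity), ← div_eq_mul_inv, div_mul_eq_mul_div, le_div_iff₀
      (by positivity)]
    have e : 2*|u| * (1/((n : ℝ) + 1))*(1 + |x|)
        = 2*|u| * (1/((n : ℝ) + 1)) + 2*|u|^2 := by rw [hx]; field_simp
    rw [e, ← sq_abs u]
    nlinarith [sq_nonneg (|u| - 1), abs_nonneg u, sq_nonneg (|u|^2)]

lemma Adm.mul_damp (hf : Adm 0 1 Nf f f') (n : ℕ) :
    Adm 0 1 (2*(Nf*2)) (fun x => f x*damp n x) (fun x => f' x*damp n x + f x*dampDeriv n x) := by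
  have := Adm.mul_one (p := 0) (by simpa using hf) (adm_damp n)
  simpa using this

lemma tendsto_damp (x : ℝ) : Tendsto (fun n => damp n x) atTop (𝓝 1) := by
  have h1 : Tendsto (fun n : ℕ => x/((n : ℝ) + 1)) atTop (𝓝 0) :=
    tendsto_const_nhds.div_atTop (tendsto_natCast_atTop_atTop.atTop_add tendsto_const_nhds)
  have h2 : Tendsto (fun n : ℕ => (1 + (x/((n : ℝ) + 1))^2)⁻¹) atTop (𝓝 1) := by
    have := ((h1.pow 2).const_add 1).inv₀ (by norm_num)
    simpa using this
  have := (continuous_ofReal.tendsto 1).comp h2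
  simpa [damp, Function.comp_def] using this

lemma adm_two_mul_damp (hf : Adm 0 1 Nf f f') (n : ℕ) :
    ∃ N u', Adm 2 1 N (fun x => f x*damp n x) u' := by
  have hN := hf.nonneg
  have hn : (1 : ℝ) ≤ n + 1 := by linarith
  have h0 := hf.mul_damp n
  refine ⟨4*Nf*((n : ℝ) + 1)^2, _, ⟨by positivity, h0.meas, h0.meas', fun x hx => ?_,
    fun x hx => (h0.bd' x hx).trans ?_, h0.pos, h0.neg⟩⟩
  · rw [norm_mul, damp, norm_real, norm_eq_abs, abs_of_pos (by positivity)]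
    have e : (1 + |x|)^(-(2 : ℝ)) = ((1 + |x|)^2)⁻¹ := by simp
    rw [e]
    have key : (1 + (x/((n : ℝ) + 1))^2)⁻¹ ≤ 2*((n : ℝ) + 1)^2*((1 + |x|)^2)⁻¹ := by
      rw [← div_eq_mul_inv, inv_eq_one_div, div_le_div_iff₀ (by positivity) (by positivity)]
      have : 2*((n : ℝ) + 1)^2*(1 + (x/((n : ℝ) + 1))^2)
          = 2*(((n : ℝ) + 1)^2 + x^2) := by field_simp
      rw [this, ← sq_abs x]
      nlinarith [sq_nonneg (|x| - 1)]
    calc _ ≤ Nf*(2*((n : ℝ) + 1)^2*((1 + |x|)^2)⁻¹) := by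
          gcongr
          exact hf.le le_rfl hx
      _ ≤ _ := by
          have : 0 ≤ Nf*((n : ℝ) + 1)^2*((1 + |x|)^2)⁻¹ := by positivity
          linarith
  · have h2 : 2*(Nf*2) ≤ 4*Nf*((n : ℝ) + 1)^2 := by nlinarith [one_le_pow₀ hn (n := 2)]
    gcongr

lemma triI_symm (hf : Adm 0 1 Nf f f') (hg : Adm 0 1 Ng g g') (hh : Adm 0 1 Nh h h') (hξ : 0 < ξ) :
    triI f g h ξ = triI (refl h) g (refl f) ξ := by
  have le : ∀ {N : ℝ} {u u' : ℝ → ℂ}, Adm 0 1 N u u' → Adm 0 1 (2*(N*2)) u u' := fun hu =>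
    hu.mono le_rfl le_rfl (by linarith [hu.nonneg])
  have cv : ∀ (u : ℝ → ℂ) (x : ℝ), Tendsto (fun n => u x*damp n x) atTop (𝓝 (u x)) :=
    fun u x => by simpa using (tendsto_damp x).const_mul (u x)
  have l1 := tendsto_triI_seq (le hf) hg (le hh) (hf.mul_damp) (fun _ => hg) (hh.mul_damp) (cv f)
    (fun _ => tendsto_const_nhds) (cv h) hξ
  have l2 := tendsto_triI_seq (le hh.refl) hg (le hf.refl) (fun n => (hh.mul_damp n).refl) (fun _ => hg)
    (fun n => (hf.mul_damp n).refl)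
    (fun x => (continuous_conj.tendsto _).comp (cv h (-x))) (fun _ => tendsto_const_nhds)
    (fun x => (continuous_conj.tendsto _).comp (cv f (-x))) hξ
  refine tendsto_nhds_unique l1 (l2.congr fun n => ?_)
  obtain ⟨N1, u1, h1⟩ := adm_two_mul_damp hf n
  obtain ⟨N2, u2, h2⟩ := adm_two_mul_damp hh n
  exact (triI_symm_of_decay h1 hg h2 hξ).symm

end

/-! ### Symbol estimates for `K` -/

/-- Twice differentiable functions that vanish near the origin and obey symbol estimates. -/
structure SmoothSymb (N : ℝ) (f f' f'' : ℝ → ℂ) : Prop where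
  adm : Adm 0 1 N f f'
  adm_deriv : Adm 0 1 N f' f''
  adm_euler : Adm 0 1 N (fun x => x*f' x) (fun x => f' x + x*f'' x)
  deriv : ∀ x, HasDerivAt f (f' x) x
  cont : Continuous f'
  zero : f 0 = 0
  zero' : f' 0 = 0

protected lemma SmoothSymb.refl (h : SmoothSymb N f f' f'') :
    SmoothSymb N (refl f) (fun x => -refl f' x) (refl f'') where
  adm := h.adm.refl
  adm_deriv := by
    have := h.adm_deriv.refl
    refine ⟨this.nonneg, this.meas.neg, ?_, fun x hx => ?_, fun x hx => ?_, ?_, ?_⟩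
    · exact continuous_conj.measurable.comp (h.adm_deriv.meas'.comp measurable_neg)
    · simpa using this.bd x hx
    · simpa using this.bd' x hx
    · exact (this.pos.const_mul (-1)).congr (by simp) (by simp)
    · exact (this.neg.const_mul (-1)).congr (by simp) (by simp)
  adm_euler := by
    have := h.adm_euler.refl
    have e1 : (fun x : ℝ => (x : ℂ) * -refl f' x) = refl (fun x => x*f' x) := by
      funext x; simp [refl]
    have e2 : (fun x : ℝ => -refl f' x + (x : ℂ)*refl f'' x) =
        fun x => -refl (fun x => f' x + x*f'' x) x := by
      funext x; simp [refl]; ring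
    rw [e1, e2]; exact this
  deriv := fun x => by
    have := ((h.deriv (-x)).scomp x (hasDerivAt_neg x)).star
    refine this.congr_deriv ?_
    simp [refl]
  cont := (continuous_conj.comp (h.cont.comp continuous_neg)).neg
  zero := by simp [refl, h.zero]
  zero' := by simp [refl, h.zero']

/-- The truncated integral of `√η * K(f, g)(η)`, in the variable `√η * ν`. -/
def scaledK (f g : ℝ → ℂ) (m η : ℝ) : ℂ :=
  ∫ μ in -m..m, quadOsc 1 μ*(f ((η + μ/√η)/2)*g ((η - μ/√η)/2))

lemma scaledK_eq (f g : ℝ → ℂ) (m : ℝ) (hη : 0 < η) :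
    scaledK f g m η = √η*∫ ν in -(m/√η)..m/√η, integrandK f g η ν := by
  have h := sqrt_pos.2 hη
  have e := intervalIntegral.integral_comp_div (a := -m) (b := m) (integrandK f g η) h.ne'
  rw [neg_div] at e
  rw [← real_smul, ← e, scaledK]
  refine integral_congr fun μ _ => ?_
  have e2 : (μ/√η)^2 = μ^2/η := by grind
  simp only [integrandK, quadOsc]
  grind

lemma norm_scaledK_le (hf : Adm 0 1 Nf f f') (hg : Adm 0 1 Ng g g') (hη : 0 < η) (hm : 0 ≤ m) :
    ‖scaledK f g m η‖ ≤ 66*(Nf*Ng) := by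
  rw [scaledK_eq f g m hη, norm_mul, norm_real, norm_eq_abs, abs_of_nonneg (Real.sqrt_nonneg _)]
  have h := norm_trunc_le hf hg hη.ne' (m := m/√η) (by positivity)
  have e : √η*|η|^(-(1/2) : ℝ) = 1 := by rw [abs_of_pos hη, sqrt_eq_rpow, ← rpow_add hη]; norm_num
  calc _ ≤ √η*(66*(Nf*Ng)*|η|^(-(1/2) : ℝ)) := by gcongr
    _ = 66*(Nf*Ng)*(√η*|η|^(-(1/2) : ℝ)) := by ring
    _ = _ := by rw [e, mul_one]

lemma tendsto_scaledK (hf : Adm 0 1 Nf f f') (hg : Adm 0 1 Ng g g') (hη : 0 < η) :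
    Tendsto (fun m => scaledK f g m η) atTop (𝓝 (√η*opK f g η)) := by
  have h1 : Tendsto (fun m : ℝ => m/√η) atTop atTop := tendsto_id.atTop_div_const (sqrt_pos.2 hη)
  have h2 : Tendsto (fun m : ℝ => (-(m/√η), m/√η)) atTop (atBot ×ˢ atTop) :=
    (tendsto_neg_atTop_atBot.comp h1).prodMk h1
  have := ((tendsto_opK hf hg hη.ne').comp h2).const_mul (√η : ℂ)
  exact this.congr fun m => (scaledK_eq f g m hη).symm

lemma measurable_scaledK (hf : Measurable f) (hg : Measurable g) (m : ℝ) :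
    Measurable (scaledK f g m) := by
  have hm : StronglyMeasurable (fun p : ℝ × ℝ =>
      quadOsc 1 p.2*(f ((p.1 + p.2/√p.1)/2)*g ((p.1 - p.2/√p.1)/2))) := by
    refine Measurable.stronglyMeasurable ?_
    exact ((continuous_quadOsc 1).measurable.comp measurable_snd).mul
      ((hf.comp (by fun_prop)).mul (hg.comp (by fun_prop)))
  exact ((hm.integral_prod_right (ν := volume.restrict (Ioc (-m) m))).sub
    (hm.integral_prod_right (ν := volume.restrict (Ioc m (-m))))).measurable

/-- The derivative of `√η * K(f, g)(η)`, divided by `√η`, as a combination of four values of `T`. -/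
def eulerComb (T : (ℝ → ℂ) → (ℝ → ℂ) → ℂ) (f f' g g' : ℝ → ℂ) (η : ℝ) : ℂ :=
  3/4*(T f' g + T f g') - 1/(2*η)*(T (fun x => x*f' x) g + T f (fun x => x*g' x))

lemma norm_eulerComb_le {T : (ℝ → ℂ) → (ℝ → ℂ) → ℂ} (hη : 0 < η) (h1 : ‖T f' g‖ ≤ c)
    (h2 : ‖T f g'‖ ≤ c) (h3 : ‖T (fun x => x*f' x) g‖ ≤ C) (h4 : ‖T f (fun x => x*g' x)‖ ≤ C) :
    ‖eulerComb T f f' g g' η‖ ≤ 3/2*c + C*η⁻¹ := by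
  refine (norm_sub_le _ _).trans ?_
  have e : ‖(1/(2*(η : ℂ)))‖ = η⁻¹/2 := by simp [abs_of_pos hη, div_eq_mul_inv]
  rw [norm_mul, norm_mul, e]
  calc _ ≤ 3/4*(c + c) + η⁻¹/2*(C + C) := by
        gcongr
        · norm_num
        · exact norm_add_le_of_le h1 h2
        · exact norm_add_le_of_le h3 h4
    _ = _ := by ring

lemma hasDerivAt_scaled (hf : SmoothSymb N f f' f'') (hg : SmoothSymb M g g' g'') (μ : ℝ)
    (hη : 0 < η) : HasDerivAt (fun η : ℝ => f ((η + μ/√η)/2)*g ((η - μ/√η)/2))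
    (eulerComb (fun u v => u ((η + μ/√η)/2)*v ((η - μ/√η)/2)) f f' g g' η) η := by
  have h := sqrt_pos.2 hη
  have hs : ∀ c : ℝ, HasDerivAt (fun η : ℝ => (η + c/√η)/2)
      (3/4 - (η + c/√η)/2/(2*η)) η := fun c => by
    have h1 := (((Real.hasDerivAt_sqrt hη.ne').inv h.ne').const_mul c)
    have h2 := ((hasDerivAt_id η).add h1).div_const 2
    have e : (fun η : ℝ => (η + c/√η)/2) = fun x => (id x + c*(√x)⁻¹)/2 := by grind
    refine h2.congr_deriv ?_
    grind
  have hs2 := hs (-μ)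
  have e2 : ∀ x : ℝ, x + -μ/√x = x - μ/√x := fun x => by ring
  simp only [e2] at hs2
  have d1 := (hf.deriv ((η + μ/√η)/2)).scomp η (hs μ)
  have d2 := (hg.deriv ((η - μ/√η)/2)).scomp η hs2
  refine (d1.mul d2).congr_deriv ?_
  simp only [eulerComb, Function.comp_def, real_smul]
  push_cast
  ring

lemma norm_le_of_adm (hf : Adm 0 1 N f f') (h0 : f 0 = 0) (x : ℝ) : ‖f x‖ ≤ N := by
  by_cases hx : x = 0
  · rw [hx, h0, norm_zero]; exact hf.nonneg
  · exact hf.le le_rfl hx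

lemma scaledK_sub (hf : SmoothSymb N f f' f'') (hg : SmoothSymb M g g' g'') (ha : 0 < a)
    (hab : a ≤ b) (hm : 0 ≤ m) : scaledK f g m b - scaledK f g m a = ∫ η in a..b, eulerComb
    (fun u v => scaledK u v m η) f f' g g' η := by
  have cf : Continuous f := continuous_iff_continuousAt.2 fun x => (hf.deriv x).continuousAt
  have cg : Continuous g := continuous_iff_continuousAt.2 fun x => (hg.deriv x).continuousAt
  have cE : ∀ {u : ℝ → ℂ}, Continuous u → Continuous (fun x : ℝ => (x : ℂ)*u x) := fun hu =>
    continuous_ofReal.mul hu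
  have nf := norm_le_of_adm hf.adm hf.zero
  have nf' := norm_le_of_adm hf.adm_deriv hf.zero'
  have nE := norm_le_of_adm hf.adm_euler (by simp)
  have ng := norm_le_of_adm hg.adm hg.zero
  have ng' := norm_le_of_adm hg.adm_deriv hg.zero'
  have nEg := norm_le_of_adm hg.adm_euler (by simp)
  have hN := hf.adm.nonneg
  have ci : ∀ {u v : ℝ → ℂ} (η : ℝ), Continuous u → Continuous v → IntervalIntegrable (fun μ =>
      quadOsc 1 μ*(u ((η + μ/√η)/2)*v ((η - μ/√η)/2))) volume (-m) m := fun η hu hv => by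
    refine Continuous.intervalIntegrable ?_ _ _
    exact (continuous_quadOsc 1).mul ((hu.comp (by fun_prop)).mul (hv.comp (by fun_prop)))
  set H : ℝ → ℝ → ℂ := fun η μ => quadOsc 1 μ *
    eulerComb (fun u v => u ((η + μ/√η)/2)*v ((η - μ/√η)/2)) f f' g g' η with hH
  have hpos : ∀ η ∈ uIcc a b, 0 < η := fun η hη => by
    rw [uIcc_of_le hab] at hη; exact ha.trans_le hη.1
  have e1 : ∀ μ, (∫ η in a..b, H η μ) = quadOsc 1 μ*(f ((b + μ/√b)/2)*g ((b - μ/√b)/2))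
      - quadOsc 1 μ*(f ((a + μ/√a)/2)*g ((a - μ/√a)/2)) := by
    intro μ
    have cs : ∀ c : ℝ, ContinuousOn (fun η : ℝ => (η + c*(μ/√η))/2) (uIcc a b) := fun c => by
      refine ContinuousOn.div_const (continuousOn_id.add (continuousOn_const.mul
        (continuousOn_const.div Real.continuous_sqrt.continuousOn fun x hx => ?_))) _
      grind
    have cp : ∀ {u v : ℝ → ℂ}, Continuous u → Continuous v → ContinuousOn (fun η : ℝ =>
        u ((η + μ/√η)/2)*v ((η - μ/√η)/2)) (uIcc a b) := fun hu hv => by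
      refine (hu.comp_continuousOn ?_).mul (hv.comp_continuousOn ?_)
      · simpa using cs 1
      · exact (cs (-1)).congr fun x _ => by ring
    have := integral_eq_sub_of_hasDerivAt
      (fun η hη => hasDerivAt_scaled hf hg μ (hpos η hη)) (ContinuousOn.intervalIntegrable ?_)
    · rw [← mul_sub, ← this, ← ii_const_mul]
    · refine (continuousOn_const.mul ((cp hf.cont cg).add (cp cf hg.cont))).sub
        (ContinuousOn.mul ?_ ((cp (cE hf.cont) cg).add (cp cf (cE hg.cont))))
      refine continuousOn_const.div (by fun_prop) fun x hx => ?_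
      have := (hpos x hx).ne'
      simpa using this
  have e2 : ∀ η, (∫ μ in -m..m, H η μ) = eulerComb (fun u v => scaledK u v m η) f f' g g' η := by
    intro η
    have i1 := ci η hf.cont cg
    have i2 := ci η cf hg.cont
    have i3 := ci η (cE hf.cont) cg
    have i4 := ci η cf (cE hg.cont)
    simp only [eulerComb, scaledK]
    rw [← ii_add i1 i2, ← ii_add i3 i4, ← ii_const_mul, ← ii_const_mul,
      ← ii_sub ((i1.add i2).const_mul _) ((i3.add i4).const_mul _)]
    congr 1; funext μ
    simp only [hH, eulerComb]
    ring
  have hint : Integrable (Function.uncurry H)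
      ((volume.restrict (Ioc a b)).prod (volume.restrict (Ioc (-m) m))) := by
    refine Integrable.of_bound (C := 3/2*(N*M) + N*M*a⁻¹) ?_ ?_
    · refine Measurable.aestronglyMeasurable ?_
      have ms : Measurable (fun p : ℝ × ℝ => (p.1 + p.2/√p.1)/2) := by fun_prop
      have mt : Measurable (fun p : ℝ × ℝ => (p.1 - p.2/√p.1)/2) := by fun_prop
      have mp : ∀ {u v : ℝ → ℂ}, Continuous u → Continuous v → Measurable (fun p : ℝ × ℝ =>
          u ((p.1 + p.2/√p.1)/2)*v ((p.1 - p.2/√p.1)/2)) := fun hu hv =>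
        (hu.measurable.comp ms).mul (hv.measurable.comp mt)
      have mc : Measurable (fun p : ℝ × ℝ => 1/(2*(p.1 : ℂ))) := by fun_prop
      exact ((continuous_quadOsc 1).measurable.comp measurable_snd).mul
        ((((mp hf.cont cg).add (mp cf hg.cont)).const_mul _).sub
          (mc.mul ((mp (cE hf.cont) cg).add (mp cf (cE hg.cont)))))
    · rw [Measure.prod_restrict]
      filter_upwards [ae_restrict_mem (measurableSet_Ioc.prod measurableSet_Ioc)] with p hp
      have hp1 : a ≤ p.1 := hp.1.1.le
      simp only [Function.uncurry, hH]
      rw [norm_mul, norm_quadOsc, one_mul]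
      have n3 : ∀ {u v : ℝ → ℂ} (x y : ℝ), (∀ x, ‖u x‖ ≤ N) → (∀ x, ‖v x‖ ≤ M) →
          ‖u x*v y‖ ≤ N*M := fun x y hu hv => by
        rw [norm_mul]; exact mul_le_mul (hu x) (hv y) (norm_nonneg _) hN
      refine (norm_eulerComb_le (ha.trans_le hp1) (n3 _ _ nf' ng) (n3 _ _ nf ng')
        (n3 (u := fun x => (x : ℂ)*f' x) _ _ nE ng)
        (n3 (v := fun x => (x : ℂ)*g' x) _ _ nf nEg)).trans ?_
      have := hg.adm.nonneg
      gcongr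
  have hmm : -m ≤ m := by linarith
  rw [scaledK, scaledK, ← ii_sub (ci b cf cg) (ci a cf cg)]
  simp only [← e1, ← e2]
  simp only [ii_of_le hab, ii_of_le hmm]
  exact (integral_integral_swap hint).symm

/-- The derivative of `K(f, g)`. -/
def opK' (f f' g g' : ℝ → ℂ) (η : ℝ) : ℂ :=
  eulerComb (fun u v => opK u v η) f f' g g' η - 1/(2*η)*opK f g η

lemma intervalIntegrable_opK (hf : Adm 0 1 Nf f f') (hg : Adm 0 1 Ng g g') (a b : ℝ) :
    IntervalIntegrable (opK f g) volume a b := by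
  have h := locallyIntegrable_of_norm_le_rpow (μ := volume) (f := opK f g) (C := 66*(Nf*Ng))
    (α := 1/2) (by simp) (by norm_num) ?_ (aestronglyMeasurable_opK hf hg)
  · exact (h.integrableOn_isCompact isCompact_uIcc).intervalIntegrable
  · filter_upwards [ae_ne 0] with η hη
    exact norm_opK_le' hf hg hη

lemma acOn_opK_pos (hf : SmoothSymb N f f' f'') (hg : SmoothSymb M g g' g'') :
    ACOn (opK f g) (opK' f f' g g') (Ioi 0) := by
  have iK : ∀ {u u' v v' : ℝ → ℂ}, Adm 0 1 N u u' → Adm 0 1 M v v' → ∀ a b : ℝ,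
      IntervalIntegrable (opK u v) volume a b := fun hu hv a b => intervalIntegrable_opK hu hv a b
  have i0 : ∀ a b : ℝ, 0 < a → a ≤ b → IntervalIntegrable
      (fun η => eulerComb (fun u v => opK u v η) f f' g g' η) volume a b := fun a b ha hab => by
    refine ((((iK hf.adm_deriv hg.adm a b).add (iK hf.adm hg.adm_deriv a b)).const_mul _)).sub
      ((((iK hf.adm_euler hg.adm a b).add (iK hf.adm hg.adm_euler a b))).continuousOn_mul ?_)
    refine continuousOn_const.div (by fun_prop) fun x hx => ?_
    rw [uIcc_of_le hab] at hx
    have : x ≠ 0 := (ha.trans_le hx.1).ne'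
    simpa using this
  have key : ACOn (fun η : ℝ => (√η : ℂ)*opK f g η)
      (fun η => √η*eulerComb (fun u v => opK u v η) f f' g g' η) (Ioi 0) := by
    refine ⟨fun a ha b _ hab => (i0 a b ha hab).continuousOn_mul (by fun_prop),
      fun a ha b _ hab => ?_⟩
    have ha0 : 0 < a := ha
    have hb0 : 0 < b := ha0.trans_le hab
    have t1 := (tendsto_scaledK hf.adm hg.adm hb0).sub (tendsto_scaledK hf.adm hg.adm ha0)
    refine tendsto_nhds_unique t1 (Tendsto.congr' (f₁ := fun m =>
      ∫ η in a..b, eulerComb (fun u v => scaledK u v m η) f f' g g' η) ?_ ?_)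
    · filter_upwards [eventually_ge_atTop 0] with m hm using (scaledK_sub hf hg ha0 hab hm).symm
    refine tendsto_integral_filter_of_dominated_convergence 
      (fun _ => 3/2*(66*(N*M)) + 66*(N*M)*a⁻¹) ?_ ?_ (by simp) ?_
    · refine .of_forall fun m => Measurable.aestronglyMeasurable ?_
      have mf := hf.adm.meas
      have mg := hg.adm.meas
      have mc : Measurable (fun p : ℝ => 1/(2*(p : ℂ))) := by fun_prop
      exact (((measurable_scaledK hf.adm_deriv.meas mg m).add
        (measurable_scaledK mf hg.adm_deriv.meas m)).const_mul _).sub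
        (mc.mul ((measurable_scaledK hf.adm_euler.meas mg m).add
        (measurable_scaledK mf hg.adm_euler.meas m)))
    · filter_upwards [eventually_ge_atTop 0] with m hm
      refine .of_forall fun η hη => ?_
      rw [uIoc_of_le hab] at hη
      have h0 : 0 < η := ha0.trans hη.1
      refine (norm_eulerComb_le h0 (norm_scaledK_le hf.adm_deriv hg.adm h0 hm)
        (norm_scaledK_le hf.adm hg.adm_deriv h0 hm) (norm_scaledK_le hf.adm_euler hg.adm h0 hm)
        (norm_scaledK_le hf.adm hg.adm_euler h0 hm)).trans ?_
      have := hη.1.le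
      have := hf.adm.nonneg
      have := hg.adm.nonneg
      gcongr
    · refine .of_forall fun η hη => ?_
      rw [uIoc_of_le hab] at hη
      have h0 : 0 < η := ha0.trans hη.1
      have := (((tendsto_scaledK hf.adm_deriv hg.adm h0).add
        (tendsto_scaledK hf.adm hg.adm_deriv h0)).const_mul (3/4)).sub
        (((tendsto_scaledK hf.adm_euler hg.adm h0).add
        (tendsto_scaledK hf.adm hg.adm_euler h0)).const_mul (1/(2*(η : ℂ))))
      refine this.trans_eq ?_
      simp only [eulerComb]; ring
  have hr : ACOn (fun η : ℝ => (((√η)⁻¹ : ℝ) : ℂ))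
      (fun η => ((-(1/(2*η)*(√η)⁻¹) : ℝ) : ℂ)) (Ioi 0) := by
    refine ACOn.of_hasDerivAt (fun x hx => ?_) ?_
    · have hx0 : 0 < x := hx
      have h := sqrt_pos.2 hx0
      have := ((Real.hasDerivAt_sqrt hx0.ne').inv h.ne').ofReal_comp
      refine this.congr_deriv ?_
      grind
    · refine continuous_ofReal.comp_continuousOn (ContinuousOn.neg (ContinuousOn.mul ?_ ?_))
      · exact continuousOn_const.div (by fun_prop) fun x hx => by grind
      · exact Real.continuous_sqrt.continuousOn.inv₀ fun x hx => (sqrt_pos.2 hx).ne'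
  refine (hr.mul key).congr (fun x hx => ?_) (fun x hx => ?_)
  · have h := (sqrt_pos.2 (show 0 < x from hx)).ne'
    have hc : (√x : ℂ) ≠ 0 := by exact_mod_cast h
    push_cast
    field_simp
  · have h := (sqrt_pos.2 (show 0 < x from hx)).ne'
    have hc : (√x : ℂ) ≠ 0 := by exact_mod_cast h
    simp only [opK']
    push_cast
    field_simp
    ring

lemma norm_opK_le_of_deriv (hN : 0 ≤ N) (hM : 0 ≤ M) (hf : Adm 0 1 N f f') (hg : Adm 0 1 M g g')
    (h : ∀ x, x ≠ 0 → ‖f x*g x‖ ≤ N*M*|x|⁻¹) (hη : η ≠ 0) :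
    ‖opK f g η‖ ≤ 2000*(N*M)*|η|^(-(3/2) : ℝ) := by
  have h0 : 0 < |η| := abs_pos.2 hη
  have hNM : 0 ≤ N*M := by positivity
  rcases le_total |η| 1 with h1 | h1
  · refine (norm_opK_le' hf hg hη).trans ?_
    have : |η|^(-(1/2) : ℝ) ≤ |η|^(-(3/2) : ℝ) :=
      Real.rpow_le_rpow_of_exponent_ge h0 h1 (by norm_num)
    have h2 : 66*(N*M) ≤ 2000*(N*M) := by linarith
    gcongr
  · have e1 := norm_opK_sub_mainK_le_zero hf hg h1
    have e2 : ‖mainK f g η‖ ≤ 6*(N*M)*|η|^(-(3/2) : ℝ) := by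
      rw [mainK, norm_mul]
      have e : |η|^(-(3/2) : ℝ) = |η|^(-(1/2) : ℝ)*|η|⁻¹ := by
        rw [← rpow_neg_one, ← rpow_add h0]; norm_num
      calc _ ≤ 3*|η|^(-(1/2) : ℝ)*(N*M*|η/2|⁻¹) := by
            gcongr
            · exact norm_coefK_le η
            grind
        _ = _ := by grind
    have e3 : |η|^(-(4/5) - 1 : ℝ) ≤ |η|^(-(3/2) : ℝ) := rpow_mono h1 (by norm_num)
    have e4 : opK f g η = (opK f g η - mainK f g η) + mainK f g η := by ring
    rw [e4]
    refine (norm_add_le _ _).trans ?_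
    have e5 := mul_mono e3 (by positivity : 0 ≤ 1600*(N*M))
    have : 0 ≤ N*M*|η|^(-(3/2) : ℝ) := by positivity
    linarith

lemma opK_add (hf : Adm 0 1 Nf f f') (hu : Adm 0 1 N u u') (hg : Adm 0 1 Ng g g') (hη : η ≠ 0) :
    opK (fun x => f x + u x) g η = opK f g η + opK u g η := by
  refine improperIntegral_eq (((tendsto_opK hf hg hη).add (tendsto_opK hu hg hη)).congr fun p => ?_)
  rw [← ii_add (ii_of_loc (locallyIntegrable_integrandK hf hg η) _ _)
    (ii_of_loc (locallyIntegrable_integrandK hu hg η) _ _)]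
  congr 1; funext ν
  simp only [integrandK]; ring

lemma opK_const_mul (c : ℂ) (hf : Adm 0 1 Nf f f') (hg : Adm 0 1 Ng g g') (hη : η ≠ 0) :
    opK (fun x => c*f x) g η = c*opK f g η := by
  refine improperIntegral_eq (((tendsto_opK hf hg hη).const_mul c).congr fun p => ?_)
  rw [← ii_const_mul]
  congr 1; funext ν
  simp only [integrandK]; ring

lemma opK_neg_left (hf : Adm 0 1 Nf f f') (hg : Adm 0 1 Ng g g') (hη : η ≠ 0) :
    opK (fun x => -f x) g η = -opK f g η := by
  have := opK_const_mul (-1) hf hg hη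
  simpa using this

lemma opK_neg_right (hf : Adm 0 1 Nf f f') (hg : Adm 0 1 Ng g g') (hη : η ≠ 0) :
    opK f (fun x => -g x) η = -opK f g η := by
  refine improperIntegral_eq ((tendsto_opK hf hg hη).neg.congr fun p => ?_)
  rw [← intervalIntegral.integral_neg]
  congr 1; funext ν
  simp only [integrandK]; ring

lemma eulerComb_neg (hf : SmoothSymb N f f' f'') (hg : SmoothSymb M g g' g'') (hη : 0 < η) :
    opK' f f' g g' (-η) = -conj
      (opK' (refl f) (fun x => -refl f' x) (refl g) (fun x => -refl g' x) η) :=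
    by
  have e1 : ∀ {u : ℝ → ℂ}, (fun x : ℝ => (x : ℂ) * -refl u x) = refl (fun x => x*u x) := by
    intro u; funext x; simp [refl]
  simp only [opK', eulerComb, e1, opK_neg_left hf.adm_deriv.refl hg.adm.refl hη.ne',
    opK_neg_right hf.adm.refl hg.adm_deriv.refl hη.ne', opK_neg hf.adm hg.adm hη,
    opK_neg hf.adm_deriv hg.adm hη, opK_neg hf.adm hg.adm_deriv hη,
    opK_neg hf.adm_euler hg.adm hη, opK_neg hf.adm hg.adm_euler hη]
  simp only [map_sub, map_mul, map_add, map_div₀, map_neg, conj_ofReal, map_one, map_ofNat]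
  push_cast
  grind

/-- `K(f, g)` is a symbol of order `-1/2`. -/
lemma symb_opK (hf : SmoothSymb N f f' f'') (hg : SmoothSymb M g g' g'') :
    Symb (1/2) (6000*(N*M)) (opK f g) (opK' f f' g g') := by
  have hN := hf.adm.nonneg
  have hM := hg.adm.nonneg
  have hNM : 0 ≤ N*M := by positivity
  refine ⟨by positivity, fun η hη => ?_, fun η hη => ?_, acOn_opK_pos hf hg, ?_⟩
  · refine (norm_opK_le' hf.adm hg.adm hη).trans ?_
    have : 66*(N*M) ≤ 6000*(N*M) := by linarith
    gcongr
  · have h0 : 0 < |η| := abs_pos.2 hη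
    have wt : ∀ x : ℝ, x ≠ 0 → (1 + |x|)^(-(1 : ℝ)) ≤ |x|⁻¹ := fun x hx => by
      rw [rpow_neg_one]
      exact inv_anti₀ (abs_pos.2 hx) (by linarith)
    have d1 := norm_opK_le_of_deriv hN hM hf.adm_deriv hg.adm (fun x hx => by
      rw [norm_mul, mul_right_comm]
      exact mul_le_mul ((hf.adm.bd' x hx).trans (mul_mono (wt x hx) hN))
        (hg.adm.le le_rfl hx) (norm_nonneg _) (by positivity)) hη
    have d2 := norm_opK_le_of_deriv hN hM hf.adm hg.adm_deriv (fun x hx => by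
      rw [norm_mul, mul_assoc]
      exact mul_le_mul (hf.adm.le le_rfl hx) ((hg.adm.bd' x hx).trans
        (mul_mono (wt x hx) hM)) (norm_nonneg _) hN) hη
    have d3 := norm_opK_le' hf.adm_euler hg.adm hη
    have d4 := norm_opK_le' hf.adm hg.adm_euler hη
    have d5 := norm_opK_le' hf.adm hg.adm hη
    have e : |η|^(-(1/2) - 1 : ℝ) = |η|^(-(1/2) : ℝ)*|η|⁻¹ := by
      rw [← rpow_neg_one, ← rpow_add h0]; norm_num
    have e2 : |η|^(-(3/2) : ℝ) = |η|^(-(1/2) : ℝ)*|η|⁻¹ := by rw [← e]; norm_num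
    rw [e2] at d1 d2
    set X := |η|^(-(1/2) : ℝ)
    have n1 : ‖(1/(2*(η : ℂ)))‖ = |η|⁻¹/2 := by
      rw [norm_div, norm_mul, norm_real, norm_eq_abs]
      simp only [norm_one, norm_ofNat]
      field_simp
    have n2 : ‖(3/4 : ℂ)‖ = 3/4 := by norm_num
    refine (norm_sub_le _ _).trans ((add_le_add_left (norm_sub_le _ _) _).trans ?_)
    rw [norm_mul, norm_mul, norm_mul, n1, n2]
    have a1 := norm_add_le_of_le d1 d2
    have a2 := norm_add_le_of_le d3 d4
    have hX : 0 ≤ N*M*(X*|η|⁻¹) := by positivity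
    calc _ ≤ 3/4*(2000*(N*M)*(X*|η|⁻¹) + 2000*(N*M)*(X*|η|⁻¹)) +
          |η|⁻¹/2*(66*(N*M)*X + 66*(N*M)*X) + |η|⁻¹/2*(66*(N*M)*X) := by
          gcongr
      _ ≤ _ := by nlinarith
  · have h := ((acOn_opK_pos hf.refl hg.refl).comp_affine (c := -1) (by norm_num) 0).conj
    refine ACOn.congr (h.mono (t := Iio 0) fun x hx => ?_) (fun x hx => ?_) (fun x hx => ?_)
    · grind
    · have h0 : 0 < -x := neg_pos.2 hx
      have := opK_neg hf.adm hg.adm h0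
      grind
    · have h0 : 0 < -x := neg_pos.2 hx
      have := eulerComb_neg hf hg h0
      rw [neg_neg] at this
      rw [this]; simp

/-! ### Stationary phase -/

lemma log_div_rsqrt_le (hξ : 1 ≤ ξ) : log (8*ξ) - log (1/(16*√ξ)) ≤ 24*ξ^(4/5 : ℝ) := by
  have h0 : 0 < ξ := by linarith
  have e : log (8*ξ) - log (1/(16*√ξ)) = 2*log (√128*ξ^(3/4 : ℝ)) := by
    rw [← Real.log_div (by positivity) (by positivity), ← Real.log_rpow (by positivity),
      rpow_two, mul_pow, sq_sqrt (by norm_num), ← rpow_natCast, ← rpow_mul h0.le]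
    rw [div_div_eq_mul_div, div_one, sqrt_eq_rpow]
    have : ξ^(3/4*((2 : ℕ) : ℝ) : ℝ) = ξ*ξ^(1/2 : ℝ) := by
      rw [show (3/4*((2 : ℕ) : ℝ) : ℝ) = 1 + 1/2 by norm_num, rpow_add h0, rpow_one]
    rw [this]; ring
  have h1 : log (√128*ξ^(3/4 : ℝ)) ≤ √128*ξ^(3/4 : ℝ) := Real.log_le_self (by positivity)
  have h2 : √128 ≤ 12 := by rw [Real.sqrt_le_left (by norm_num)]; norm_num
  have h3 : ξ^(3/4 : ℝ) ≤ ξ^(4/5 : ℝ) := rpow_mono hξ (by norm_num)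
  have h4 : √128*ξ^(3/4 : ℝ) ≤ 12*ξ^(4/5 : ℝ) := by gcongr
  rw [e]; linarith

section
variable {u u' u'' w : ℝ → ℝ} {r r' : ℝ → ℂ}

lemma norm_integral_sq_far_le (hξ : 1 ≤ ξ) (hab : a ≤ b) (hL : 0 ≤ L)
    (hs : x₀ + 1/(16*√ξ) ≤ a ∧ b ≤ x₀ + 8*ξ ∨ b ≤ x₀ - 1/(16*√ξ) ∧ x₀ - 8*ξ ≤ a)
    (hu : ∀ x ∈ Ioo a b, HasDerivAt u (u' x) x) (hu' : ∀ x ∈ Ioo a b, HasDerivAt u' (u'' x) x)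
    (hc : ContinuousOn u'' (Ioo a b)) (l1 : ∀ x ∈ Ioo a b, √ξ/2 ≤ u' x)
    (l2 : ∀ x ∈ Ioo a b, u' x ≤ 4*√ξ) (l3 : ∀ x ∈ Ioo a b, |u'' x| ≤ 2/√ξ)
    (m1 : ∀ x ∈ Ioo a b, √ξ/2*|x - x₀| ≤ |u x|) (m2 : ∀ x ∈ Ioo a b, |u x| ≤ 4*√ξ*|x - x₀|)
    (hr : ACOn r r' (Ioo a b)) (r1 : ∀ x ∈ Ioo a b, ‖r x‖ ≤ L/ξ*|x - x₀|)
    (r2 : ∀ x ∈ Ioo a b, ‖r' x‖ ≤ L/ξ) :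
    ‖∫ x in a..b, cis(u x^2)*r x‖ ≤ 16000*L*ξ^(-(6/5) : ℝ) := by
  have h0 : 0 < ξ := by linarith
  have hsq := sqrt_pos.2 h0
  have hss : √ξ*√ξ = ξ := mul_self_sqrt h0.le
  set δ := 1/(16*√ξ) with hδ
  have hδ0 : 0 < δ := by positivity
  have hx : ∀ x ∈ Ioo a b, δ ≤ |x - x₀| ∧ |x - x₀| ≤ 8*ξ := fun x hx => by
    rcases hs with h | h
    · rw [abs_of_nonneg (by linarith [hx.1])]; grind
    · rw [abs_of_nonpos (by linarith [hx.2])]; grind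
  have hne : ∀ x ∈ Ioo a b, x - x₀ ≠ 0 := fun x h => by grind
  have cu : ContinuousOn u (Ioo a b) := HasDerivAt.continuousOn hu
  have cu' : ContinuousOn u' (Ioo a b) := fun x h => (hu' x h).continuousAt.continuousWithinAt
  have hψ' : ∀ x ∈ Ioo a b, ξ/2*|x - x₀| ≤ |2*u x*u' x| := fun x h => by
    rw [abs_mul, abs_mul, abs_two, abs_of_pos (show 0 < u' x by linarith [l1 x h])]
    calc _ = √ξ*√ξ/2*|x - x₀| := by rw [hss]
      _ = 2*(√ξ/2*|x - x₀|)*(√ξ/2) := by ring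
      _ ≤ _ := by gcongr; exacts [m1 x h, l1 x h]
  have hψ0 : ∀ x ∈ Ioo a b, 2*u x*u' x ≠ 0 := fun x h => by
    have h1 := hψ' x h
    have h2 := abs_pos.2 (hne x h)
    exact abs_pos.1 (lt_of_lt_of_le (by positivity) h1)
  have hψ'' : ∀ x ∈ Ioo a b, |2*u' x*u' x + 2*u x*u'' x| ≤ 160*ξ := fun x h => by
    have n1 : 0 < u' x := by linarith [l1 x h]
    have n2 := (hx x h).2
    refine (abs_add_le _ _).trans ?_
    rw [abs_mul, abs_mul, abs_mul, abs_mul, abs_two, abs_of_pos n1]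
    calc _ ≤ 2*(4*√ξ)*(4*√ξ) + 2*(4*√ξ*(8*ξ))*(2/√ξ) := by
          gcongr
          · exact l2 x h
          · exact l2 x h
          · exact (m2 x h).trans (by gcongr)
          · exact l3 x h
      _ = 32*(√ξ*√ξ) + 128*ξ := by field_simp; ring
      _ = _ := by rw [hss]; ring
  have hw : ACOn (fun x => (((2*u x*u' x)⁻¹ : ℝ) : ℂ)) (fun x =>
      ((-(2*u' x*u' x + 2*u x*u'' x)/(2*u x*u' x)^2 : ℝ) : ℂ)) (Ioo a b) := by
    refine ACOn.of_hasDerivAt (fun x h => ?_) ?_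
    · exact ((((hu x h).const_mul 2).mul (hu' x h)).inv (hψ0 x h)).ofReal_comp
    · refine continuous_ofReal.comp_continuousOn (ContinuousOn.div ?_ ?_ fun x h =>
        pow_ne_zero 2 (hψ0 x h)) <;> fun_prop
  have key := norm_integral_osc_le (ψ := fun x => u x^2) (ψ' := fun x => 2*u x*u' x)
    (F := fun x => cis(u x^2)*r x)
    (B := fun x => r x*(((2*u x*u' x)⁻¹ : ℝ) : ℂ))
    (Γ := fun x => (if x₀ ≤ a then 1 else -1)*(650*L/ξ^2*log (x - x₀)))
    (γ := fun x => 650*L/ξ^2*|x - x₀|⁻¹) (S := 2*L/ξ^2)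
    (V := 650*L/ξ^2*(24*ξ^(4/5 : ℝ))) hab (by positivity) (by positivity)
    (fun x h => ((hu x h).pow 2).congr_deriv (by simp)) (by fun_prop) (hr.mul hw) ?_ ?_ ?_ ?_ ?_
  · refine key.trans ?_
    have e1 : ξ^(-(6/5) : ℝ) = ξ^(4/5 : ℝ)/ξ^2 := by
      rw [← rpow_natCast ξ 2, ← rpow_sub h0]; norm_num
    have e2 : 1 ≤ ξ^(4/5 : ℝ) := one_le_rpow hξ (by norm_num)
    rw [e1]
    calc _ = 4*(L/ξ^2)*1 + 15600*(L/ξ^2)*ξ^(4/5 : ℝ) := by ring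
      _ ≤ 4*(L/ξ^2)*ξ^(4/5 : ℝ) + 15600*(L/ξ^2)*ξ^(4/5 : ℝ) := by gcongr
      _ = 15604*(L/ξ^2*ξ^(4/5 : ℝ)) := by ring
      _ ≤ 16000*(L/ξ^2*ξ^(4/5 : ℝ)) := by gcongr; norm_num
      _ = _ := by ring
  · intro x h
    have h1 := hψ' x h
    have h2 := abs_pos.2 (hne x h)
    rw [norm_mul, norm_real, norm_inv, norm_eq_abs]
    calc _ ≤ (L/ξ*|x - x₀|)*(ξ/2*|x - x₀|)⁻¹ := by gcongr; exact r1 x h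
      _ = _ := by field_simp
  · intro x h
    have h1 := ((((hasDerivAt_id x).sub_const x₀).log (hne x h)).const_mul
      (650*L/ξ^2)).const_mul (if x₀ ≤ a then (1 : ℝ) else -1)
    refine h1.congr_deriv ?_
    simp only [id]
    split_ifs with hxa
    · rw [abs_of_pos (by linarith [h.1])]; ring
    · rcases hs with h' | h'
      · linarith
      · rw [abs_of_neg (by linarith [h.2])]
        grind
  · intro x h
    have h1 := hψ' x h
    have h2 := abs_pos.2 (hne x h)
    refine (norm_add_le _ _).trans ?_
    rw [norm_mul, norm_mul, norm_real, norm_real, norm_inv, norm_eq_abs,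
      norm_eq_abs, abs_div, abs_neg, abs_pow]
    calc _ ≤ L/ξ*(ξ/2*|x - x₀|)⁻¹ +
          (L/ξ*|x - x₀|)*(160*ξ/(ξ/2*|x - x₀|)^2) := by
          gcongr
          · exact r2 x h
          · exact r1 x h
          · exact hψ'' x h
      _ = 642*L/ξ^2*|x - x₀|⁻¹ := by field_simp; ring
      _ ≤ _ := by gcongr; norm_num
  · intro x h y h' hxy
    have h3 := log_div_rsqrt_le hξ
    have l1 : ∀ z ∈ Ioo a b, log δ ≤ log (z - x₀) ∧ log (z - x₀) ≤ log (8*ξ) := fun z hz => by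
      rw [← Real.log_abs (z - x₀)]
      exact ⟨log_le_log hδ0 (hx z hz).1, log_le_log (hδ0.trans_le (hx z hz).1) (hx z hz).2⟩
    have p1 := l1 x h
    have p2 := l1 y h'
    rw [← mul_sub, ← mul_sub]
    have e : (if x₀ ≤ a then (1 : ℝ) else -1)*(650*L/ξ^2 *
        (log (y - x₀) - log (x - x₀))) = 650*L/ξ^2 *
        ((if x₀ ≤ a then (1 : ℝ) else -1)*(log (y - x₀) - log (x - x₀))) := by ring
    rw [e]
    refine mul_mono (le_trans ?_ h3) (by positivity)
    split_ifs <;> linarith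
  · intro x h
    have h1 := hψ0 x h
    have : ((2*u x*u' x : ℝ) : ℂ)*(((2*u x*u' x)⁻¹ : ℝ) : ℂ) = 1 := by
      rw [← ofReal_mul, mul_inv_cancel₀ h1, Complex.ofReal_one]
    grind

/-- Stationary phase for a phase that is a square. -/
lemma norm_integral_sq_sub_le (hξ : 1 ≤ ξ) (ha : a + ξ/16 ≤ x₀) (hb : x₀ + ξ/16 ≤ b)
    (hab : b - a ≤ 8*ξ) (hM : 0 ≤ M) (hu : ∀ x ∈ Icc a b, HasDerivAt u (u' x) x)
    (hu' : ∀ x ∈ Icc a b, HasDerivAt u' (u'' x) x) (hc : ContinuousOn u'' (Icc a b))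
    (l1 : ∀ x ∈ Icc a b, √ξ/2 ≤ u' x) (l2 : ∀ x ∈ Icc a b, u' x ≤ 4*√ξ)
    (l3 : ∀ x ∈ Icc a b, |u'' x| ≤ 2/√ξ)
    (hw : ∀ x ∈ Icc a b, u x = (x - x₀)*w x ∧ √ξ/2 ≤ w x ∧ w x ≤ 4*√ξ) (hG : ACOn G G' (Icc a b))
    (g1 : ‖G x₀‖ ≤ M) (g2 : ∀ x ∈ Icc a b, ‖G' x‖ ≤ M/ξ) :
    ‖(∫ x in a..b, cis(u x^2)*G x) - 2*fresnelC*(G x₀/u' x₀)‖ ≤ 200000*M*ξ^(-(6/5) : ℝ) := by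
  have h0 : 0 < ξ := by linarith
  have hsq := sqrt_pos.2 h0
  have hss : √ξ*√ξ = ξ := mul_self_sqrt h0.le
  have hab' : a ≤ b := by linarith
  have hx₀ : x₀ ∈ Icc a b := ⟨by linarith, by linarith⟩
  have ha' : a ∈ Icc a b := ⟨le_rfl, hab'⟩
  have hb' : b ∈ Icc a b := ⟨hab', le_rfl⟩
  have cu : ContinuousOn u (Icc a b) := HasDerivAt.continuousOn hu
  have cu' : ContinuousOn u' (Icc a b) := fun x h => (hu' x h).continuousAt.continuousWithinAt
  set δ := 1/(16*√ξ) with hδ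
  have hδ0 : 0 < δ := by positivity
  have h1s : 1 ≤ √ξ := by rw [one_le_sqrt]; exact hξ
  have hδ1 : δ ≤ ξ/16 := by
    rw [hδ, div_le_div_iff₀ (by positivity) (by norm_num)]
    nlinarith
  have m12 : ∀ x ∈ Icc a b, √ξ/2*|x - x₀| ≤ |u x| ∧ |u x| ≤ 4*√ξ*|x - x₀| := fun x hx => by
    obtain ⟨e, h1, h2⟩ := hw x hx
    rw [e, abs_mul, abs_of_pos (by linarith : 0 < w x), mul_comm |x - x₀|]
    exact ⟨by gcongr, by gcongr⟩
  -- the leading term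
  set c₀ : ℂ := G x₀/u' x₀ with hc₀
  have hup : 0 < u' x₀ := by linarith [l1 x₀ hx₀]
  have nc : ‖c₀‖ ≤ 2*M/√ξ := by
    rw [hc₀, norm_div, norm_real, norm_eq_abs, abs_of_pos hup]
    calc _ ≤ M/(√ξ/2) := by gcongr; exact l1 x₀ hx₀
      _ = _ := by field_simp
  have hE : Continuous (fun w : ℝ => cis(w^2)) := by fun_prop
  have e1 : ∫ x in a..b, cis(u x^2)*u' x = (∫ w in 0..u b, cis(w^2)) +
      ∫ w in 0..-u a, cis(w^2) := by
    have := intervalIntegral.integral_deriv_smul_comp (f := u) (f' := u')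
      (g := fun w : ℝ => cis(w^2)) (a := a) (b := b)
      (by rwa [uIcc_of_le hab']) (by rwa [uIcc_of_le hab']) hE
    simp only [Function.comp_def, real_smul] at this
    have e2 := integral_comp_neg (a := u a) (b := 0) (fun w : ℝ => cis(w^2))
    simp only [neg_sq, neg_zero] at e2
    rw [← e2, add_comm, ii_split (hE.intervalIntegrable _ _) (hE.intervalIntegrable _ _), ← this]
    congr 1; funext x; ring
  have fr : ∀ m : ℝ, √ξ/2*(ξ/16) ≤ m → ‖(∫ w in 0..m, cis(w^2)) - fresnelC‖ ≤
        192/(√ξ*ξ) := fun m hm => by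
    have hm0 : 0 < √ξ/2*(ξ/16) := by positivity
    refine (norm_integral_fresnel_sub_le (hm0.trans_le hm)).trans ?_
    calc _ ≤ 6/(√ξ/2*(ξ/16)) := by gcongr
      _ = _ := by field_simp; norm_num
  have f1 := fr (u b) (by
    obtain ⟨e, h, -⟩ := hw b hb'
    linarith [mul_le_mul h (by linarith : ξ/16 ≤ b - x₀) (by positivity) (by linarith)])
  have f2 := fr (-u a) (by
    obtain ⟨e, h, -⟩ := hw a ha'
    linarith [mul_le_mul h (by linarith : ξ/16 ≤ x₀ - a) (by positivity) (by linarith)])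
  have lead : ‖c₀*(∫ x in a..b, cis(u x^2)*u' x)
      - 2*fresnelC*c₀‖ ≤ 768*M/ξ^2 := by
    rw [e1]
    set P := ∫ w in 0..u b, cis(w^2)
    set Q := ∫ w in 0..-u a, cis(w^2)
    have : c₀*(P + Q) - 2*fresnelC*c₀ = c₀*((P - fresnelC) + (Q - fresnelC)) := by ring
    rw [this, norm_mul]
    calc _ ≤ 2*M/√ξ*(192/(√ξ*ξ) + 192/(√ξ*ξ)) := by gcongr; exact norm_add_le_of_le f1 f2
      _ = 768*M/(√ξ*√ξ*ξ) := by field_simp; ring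
      _ = _ := by rw [hss]; ring
  -- the remainder
  have cG : ContinuousOn G (Icc a b) := hG.continuousOn_Icc ha' hb' hab'
  have hr : ACOn (fun x => G x - c₀*u' x) (fun x => G' x - c₀*u'' x) (Icc a b) := by
    refine hG.sub (ACOn.const_mul c₀ (ACOn.of_hasDerivAt (fun x hx => (hu' x hx).ofReal_comp) ?_))
    exact continuous_ofReal.comp_continuousOn hc
  have r2 : ∀ x ∈ Icc a b, ‖G' x - c₀*u'' x‖ ≤ 5*M/ξ := fun x hx => by
    refine (norm_sub_le _ _).trans ?_
    rw [norm_mul, norm_real, norm_eq_abs]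
    calc _ ≤ M/ξ + 2*M/√ξ*(2/√ξ) := by gcongr; exacts [g2 x hx, l3 x hx]
      _ = M/ξ + 4*M/(√ξ*√ξ) := by field_simp; ring
      _ = _ := by rw [hss]; ring
  have hr0 : G x₀ - c₀*u' x₀ = 0 := by
    have : (u' x₀ : ℂ) ≠ 0 := by exact_mod_cast hup.ne'
    grind
  have r1 : ∀ x ∈ Icc a b, ‖G x - c₀*u' x‖ ≤ 5*M/ξ*|x - x₀| := fun x hx => by
    rcases le_total x₀ x with h | h
    · have e := hr.ftc x₀ hx₀ x hx h
      rw [hr0, sub_zero] at e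
      rw [e]
      refine norm_ii_le_const fun y hy => ?_
      rw [uIoc_of_le h] at hy
      exact r2 y ⟨hx₀.1.trans hy.1.le, hy.2.trans hx.2⟩
    · have e := hr.ftc x hx x₀ hx₀ h
      rw [hr0, zero_sub] at e
      rw [← norm_neg, e, abs_sub_comm]
      refine norm_ii_le_const fun y hy => ?_
      rw [uIoc_of_le h] at hy
      exact r2 y ⟨hx.1.trans hy.1.le, hy.2.trans hx₀.2⟩
  set R : ℝ → ℂ := fun x => cis(u x^2)*(G x - c₀*u' x)
    with hR
  have cE : ContinuousOn (fun x => cis(u x^2)) (Icc a b) := hE.comp_continuousOn cu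
  have cR : ContinuousOn R (Icc a b) := cE.mul (cG.sub (continuousOn_const.mul
    (continuous_ofReal.comp_continuousOn cu')))
  have iR : ∀ x ∈ Icc a b, ∀ y ∈ Icc a b, IntervalIntegrable R volume x y := fun x hx y hy =>
    (cR.mono (ordConnected_Icc.uIcc_subset hx hy)).intervalIntegrable
  have far : ∀ c d, a ≤ c → d ≤ b → c ≤ d → (x₀ + δ ≤ c ∨ d ≤ x₀ - δ) →
      ‖∫ x in c..d, R x‖ ≤ 16000*(5*M)*ξ^(-(6/5) : ℝ) := fun c d hac hdb hcd hs => by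
    have sub : Ioo c d ⊆ Icc a b := fun x hx => ⟨hac.trans hx.1.le, hx.2.le.trans hdb⟩
    refine norm_integral_sq_far_le (x₀ := x₀) hξ hcd (by positivity) ?_ (fun x hx => hu x (sub hx))
      (fun x hx => hu' x (sub hx)) (hc.mono sub) (fun x hx => l1 x (sub hx))
      (fun x hx => l2 x (sub hx)) (fun x hx => l3 x (sub hx)) (fun x hx => (m12 x (sub hx)).1)
      (fun x hx => (m12 x (sub hx)).2) (hr.mono sub) (fun x hx => r1 x (sub hx))
      (fun x hx => r2 x (sub hx))
    rcases hs with h | h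
    · grind
    grind
  have mem1 : x₀ - δ ∈ Icc a b := ⟨by linarith, by linarith [hx₀.2]⟩
  have mem2 : x₀ + δ ∈ Icc a b := ⟨by linarith [hx₀.1], by linarith⟩
  have F1 := far a (x₀ - δ) le_rfl mem1.2 mem1.1 (.inr le_rfl)
  have F2 := far (x₀ + δ) b mem2.1 le_rfl mem2.2 (.inl le_rfl)
  have near : ‖∫ x in (x₀ - δ)..(x₀ + δ), R x‖ ≤ M/ξ^2 := by
    have := norm_ii_le_const (a := x₀ - δ) (b := x₀ + δ) (f := R) (C := 5*M/ξ*δ) fun x hx => by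
        rw [uIoc_of_le (by linarith)] at hx
        have hx' : x ∈ Icc a b := ⟨mem1.1.trans hx.1.le, hx.2.trans mem2.2⟩
        rw [hR]
        simp only
        rw [norm_mul, norm_exp_ofReal_mul_I, one_mul]
        refine (r1 x hx').trans ?_
        gcongr
        rw [abs_le]; constructor <;> linarith [hx.1, hx.2]
    refine this.trans ?_
    rw [show x₀ + δ - (x₀ - δ) = 2*δ by ring, abs_of_pos (by positivity), hδ]
    calc _ = 10/256*M/(ξ*(√ξ*√ξ)) := by field_simp; ring
      _ = 10/256*(M/ξ^2) := by rw [hss]; field_simp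
      _ ≤ _ := by
        have : 0 ≤ M/ξ^2 := by positivity
        linarith
  have split : (∫ x in a..b, cis(u x^2)*G x) = c₀*(∫ x in a..b, cis(u x^2)*u' x) +
      ((∫ x in a..(x₀ - δ), R x) + (∫ x in (x₀ - δ)..(x₀ + δ), R x) + ∫ x in (x₀ + δ)..b, R x) := by
    rw [ii_split (iR _ ha' _ mem1) (iR _ mem1 _ mem2), ii_split (iR _ ha' _ mem2) (iR _ mem2 _ hb'),
      ← ii_const_mul, ← ii_add _ (iR _ ha' _ hb')]
    · congr 1; funext x; simp only [hR]; ring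
    · refine ContinuousOn.intervalIntegrable ?_
      rw [uIcc_of_le hab']
      exact continuousOn_const.mul (cE.mul (continuous_ofReal.comp_continuousOn cu'))
  have e5 : ξ^(-(2 : ℝ)) ≤ ξ^(-(6/5) : ℝ) := rpow_mono hξ (by norm_num)
  have e6 : M/ξ^2 = M*ξ^(-(2 : ℝ)) := by rw [rpow_neg h0.le, rpow_two, div_eq_mul_inv]
  have e7 : M/ξ^2 ≤ M*ξ^(-(6/5) : ℝ) := by rw [e6]; gcongr
  rw [split]
  set T := c₀*(∫ x in a..b, cis(u x^2)*u' x)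
  set A1 := ∫ x in a..(x₀ - δ), R x
  set A2 := ∫ x in (x₀ - δ)..(x₀ + δ), R x
  set A3 := ∫ x in (x₀ + δ)..b, R x
  have : T + (A1 + A2 + A3) - 2*fresnelC*c₀ = (T - 2*fresnelC*c₀) + A1 + A2 + A3 := by ring
  rw [this]
  refine (norm_add_le _ _).trans ((add_le_add_left (norm_add₃_le) _).trans ?_)
  have hMx : 0 ≤ M*ξ^(-(6/5) : ℝ) := by positivity
  have : 768*M/ξ^2 = 768*(M/ξ^2) := by ring
  linarith

end

/-! ### The leading behaviour of the trilinear operator -/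

lemma Adm.acOn_comp_sub_right (hH : Adm p q N H H') (ξ : ℝ) :
    ACOn (fun η => H (ξ - η)) (fun η => -H' (ξ - η)) (Ioi ξ) := by
  refine ((hH.neg.comp_affine (c := -1) (by norm_num) ξ).mono fun x hx => ?_).congr
    (fun x _ => ?_) (fun x _ => ?_)
  · grind
  · ring_nf
  · push_cast; ring_nf

lemma Adm.acOn_comp_sub_left (hH : Adm p q N H H') (ξ : ℝ) :
    ACOn (fun η => H (ξ - η)) (fun η => -H' (ξ - η)) (Iio ξ) := by
  refine ((hH.pos.comp_affine (c := -1) (by norm_num) ξ).mono fun x hx => ?_).congr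
    (fun x _ => ?_) (fun x _ => ?_)
  · grind
  · ring_nf
  · push_cast; ring_nf

lemma amplitude_bounds (hκ : Symb (1/2) D κ κ') (hH : Adm 0 1 N H H') (hξ : 1 ≤ ξ) (ha : ξ/8 ≤ a)
    (h : b ≤ 3*ξ/4 ∨ 5*ξ/4 ≤ a) : ACOn (fun η => κ η*H (ξ - η))
    (fun η => κ' η*H (ξ - η) + κ η * -H' (ξ - η)) (Icc a b) ∧
    (∀ x ∈ Icc a b, ‖κ x*H (ξ - x)‖ ≤ 100*(D*N)*ξ^(-(1/2) : ℝ)) ∧ ∀ x ∈ Icc a b, ‖κ' x*H (ξ - x) + κ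
    x * -H' (ξ - x)‖ ≤ 100*(D*N)*ξ^(-(1/2) : ℝ)/ξ := by
  have h0 : 0 < ξ := by linarith
  have hD := hκ.nonneg
  have hN := hH.nonneg
  have hne : ∀ x ∈ Icc a b, ξ/4 ≤ |ξ - x| ∧ ξ/8 ≤ |x| ∧ x ≠ 0 := fun x hx => by grind
  have k1 : ∀ x ∈ Icc a b, ‖κ x‖ ≤ D*(8*ξ^(-(1/2) : ℝ)) := fun x hx => by
    refine (hκ.bd x (hne x hx).2.2).trans (mul_mono ?_ hD)
    simpa using rpow_neg_le (n := 1) h0 (by norm_num) (by norm_num : (0 : ℝ) ≤ 1/2)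
      (by norm_num) (hne x hx).2.1
  have k2 : ∀ x ∈ Icc a b, ‖κ' x‖ ≤ D*(64*(ξ^(-(1/2) : ℝ)/ξ)) := fun x hx => by
    refine (hκ.bd' x (hne x hx).2.2).trans (mul_mono ?_ hD)
    have := rpow_neg_le (n := 2) h0 (by norm_num) (by norm_num : (0 : ℝ) ≤ 3/2)
      (by norm_num) (hne x hx).2.1
    have e : ξ^(-(1/2) : ℝ)/ξ = ξ^(-(3/2) : ℝ) := by rw [← Real.rpow_sub_one h0.ne']; norm_num
    linarith
  have hne' : ∀ x ∈ Icc a b, ξ - x ≠ 0 := fun x hx => by grind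
  have H2 : ∀ x ∈ Icc a b, ‖H' (ξ - x)‖ ≤ N*(4/ξ) := fun x hx => by
    refine (hH.bd' _ (hne' x hx)).trans (mul_mono ?_ hN)
    rw [rpow_neg_one, inv_le_comm₀ (by positivity) (by positivity), inv_div]
    linarith [(hne x hx).1]
  have hX : 0 ≤ D*N*ξ^(-(1/2) : ℝ) := by positivity
  refine ⟨?_, fun x hx => ?_, fun x hx => ?_⟩
  · refine ACOn.mul (hκ.pos.mono fun x hx => ?_) ?_
    · grind
    · rcases h with h | h
      · exact (hH.acOn_comp_sub_left ξ).mono fun x hx => lt_of_le_of_lt hx.2 (by linarith)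
      · exact (hH.acOn_comp_sub_right ξ).mono fun x hx => lt_of_lt_of_le (by linarith) hx.1
  · rw [norm_mul]
    calc _ ≤ (D*(8*ξ^(-(1/2) : ℝ)))*N := by
          gcongr
          exacts [k1 x hx, hH.le le_rfl (hne' x hx)]
      _ ≤ _ := by linarith
  · refine (norm_add_le _ _).trans ?_
    rw [norm_mul, norm_mul, norm_neg]
    calc _ ≤ (D*(64*(ξ^(-(1/2) : ℝ)/ξ)))*N +
          (D*(8*ξ^(-(1/2) : ℝ)))*(N*(4/ξ)) := by
          gcongr
          exacts [k2 x hx, hH.le le_rfl (hne' x hx), k1 x hx, H2 x hx]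
      _ = 96*(D*N*ξ^(-(1/2) : ℝ))/ξ := by ring
      _ ≤ _ := div_le_div_of_nonneg_right (by linarith) h0.le

lemma rsqrt_mul_rpow_eq (h0 : 0 < ξ) (c : ℝ) :
    200000*(100*c*ξ^(-(1/2) : ℝ))*ξ^(-(6/5) : ℝ) = 20000000*c*ξ^(-(17/10) : ℝ) := by
  have : ξ^(-(17/10) : ℝ) = ξ^(-(1/2) : ℝ)*ξ^(-(6/5) : ℝ) := by rw [← rpow_add h0]; norm_num
  rw [this]; ring

lemma norm_integral_window_le (hσ : |σ| = 1) (hξ : 1 ≤ ξ) (ha : a + ξ/16 ≤ x₀) (hb : x₀ + ξ/16 ≤ b)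
    (hab : b - a ≤ 8*ξ) (hM : 0 ≤ M) (hw : ∀ x ∈ Icc a b, 15/16*ξ ≤ 3*ξ/2 + σ*(3/4*(x - x₀)) ∧ 3*ξ/2
    + σ*(3/4*(x - x₀)) ≤ 6*ξ) (hG : ACOn G G' (Icc a b)) (g1 : ‖G x₀‖ ≤ M)
    (g2 : ∀ x ∈ Icc a b, ‖G' x‖ ≤ M/ξ) :
    ‖(∫ x in a..b, cis(((x - x₀)*√(3*ξ/2 + σ*(3/4*(x - x₀))))^2)*G x) -
    2*fresnelC*(G x₀/(√(3*ξ/2) : ℝ))‖ ≤ 200000*M*ξ^(-(6/5) : ℝ) := by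
  have h0 : 0 < ξ := by linarith
  have hss : √ξ^2 = ξ := sq_sqrt h0.le
  have hsq := sqrt_pos.2 h0
  obtain ⟨W, hW⟩ : ∃ W : ℝ → ℝ, W = fun x => √(3*ξ/2 + σ*(3/4*(x - x₀))) := ⟨_, rfl⟩
  have hw' : ∀ x ∈ Icc a b, W x^2 = 3*ξ/2 + σ*(3/4*(x - x₀)) ∧ 9/10*√ξ ≤ W x ∧
      W x ≤ 5/2*√ξ := fun x hx => by
    obtain ⟨h1, h2⟩ := hw x hx
    have e : W x^2 = 3*ξ/2 + σ*(3/4*(x - x₀)) := by rw [hW]; exact sq_sqrt (by linarith)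
    have p : 0 ≤ W x := by rw [hW]; exact Real.sqrt_nonneg _
    exact ⟨e, abs_le_of_sq_le_sq' (by grind) p |>.2,
      abs_le_of_sq_le_sq' (by grind) (by positivity) |>.2⟩
  have hp : ∀ x ∈ Icc a b, 0 < W x := fun x hx => by linarith [(hw' x hx).2.1]
  have dW : ∀ x ∈ Icc a b, HasDerivAt W (σ*(3/(8*W x))) x := fun x hx => by
    have h := (((((hasDerivAt_id x).sub_const x₀).const_mul (3/4)).const_mul σ).const_add
      (3*ξ/2)).sqrt (by have := hw x hx; simp only [id]; linarith)
    rw [hW]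
    exact h.congr_deriv (by simp only [id]; ring)
  have cW : ContinuousOn W (Icc a b) := HasDerivAt.continuousOn dW
  have W0 : W x₀ = √(3*ξ/2) := by simp [hW]
  have key := norm_integral_sq_sub_le (u := fun x => (x - x₀)*W x)
    (u' := fun x => 3/2*W x - 3/4*ξ/W x) (w := W)
    (u'' := fun x => (3/2 + 3/4*ξ/W x^2)*(σ*(3/(8*W x)))) hξ ha hb hab hM
    (fun x hx => ?_) (fun x hx => ?_) ?_ (fun x hx => ?_) (fun x hx => ?_) (fun x hx => ?_)
    (fun x hx => ⟨rfl, by linarith [hw' x hx], by linarith [hw' x hx]⟩) hG g1 g2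
  · have e : 3/2*W x₀ - 3/4*ξ/W x₀ = √(3*ξ/2) := by
      rw [W0, sub_eq_iff_eq_add, ← sub_eq_iff_eq_add', eq_div_iff (sqrt_pos.2 (by linarith)).ne']
      linarith [mul_self_sqrt (show 0 ≤ 3*ξ/2 by linarith)]
    beta_reduce at key
    rw [e] at key
    simpa only [hW] using key
  · refine (((hasDerivAt_id x).sub_const x₀).mul (dW x hx)).congr_deriv ?_
    have := hp x hx
    have hσ2 : σ*σ = 1 := by rw [← abs_mul_abs_self, hσ, one_mul]
    simp only [id]
    field_simp
    linarith [hw' x hx]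
  · refine (((dW x hx).const_mul (3/2)).sub (((dW x hx).inv (hp x hx).ne').const_mul
      (3/4*ξ))).congr_deriv ?_
    ring
  · have ne := fun x hx => (hp x hx).ne'
    exact (continuousOn_const.add (continuousOn_const.div (cW.pow 2)
      fun x hx => pow_ne_zero 2 (ne x hx))).mul (continuousOn_const.mul (continuousOn_const.div
        (continuousOn_const.mul cW) fun x hx => mul_ne_zero (by norm_num) (ne x hx)))
  · have : 3/4*ξ/W x ≤ 5/6*√ξ := by
      rw [div_le_iff₀ (hp x hx)]
      nlinarith [hw' x hx]
    linarith [hw' x hx]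
  · have := hp x hx
    have : 0 ≤ 3/4*ξ/W x := by positivity
    linarith [hw' x hx]
  · have p := hp x hx
    obtain ⟨e, h1, -⟩ := hw' x hx
    rw [abs_mul, abs_mul, hσ, one_mul, abs_of_pos (by positivity), abs_of_pos (by positivity)]
    have : 3/(8*W x) ≤ 1/2/√ξ := by
      rw [div_div, div_le_div_iff₀ (by positivity) (by positivity)]; linarith
    calc _ ≤ (3/2 + 1)*(1/2/√ξ) := by
          gcongr
          rw [div_le_one (by positivity)]; linarith [hw x hx]
      _ ≤ _ := by rw [← mul_div_assoc]; gcongr; norm_num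

/-- The contribution of the stationary point `η = 2ξ`. -/
lemma norm_integral_window_two_le (hκ : Symb (1/2) D κ κ') (hH : Adm 0 1 N H H') (hξ : 1 ≤ ξ) :
    ‖(∫ η in 5*ξ/4..8*ξ, phaseOsc ξ η*(κ η*H (ξ - η))) - 2*conj
      fresnelC*(κ (2*ξ)*H (ξ - 2*ξ)/(√(3*ξ/2) : ℝ))‖ ≤ 20000000*(D*N)*ξ^(-(17/10) : ℝ) := by
  have hD := hκ.nonneg
  have hN := hH.nonneg
  obtain ⟨ac, b0, b1⟩ := amplitude_bounds (a := 5*ξ/4) (b := 8*ξ) hκ hH hξ (by linarith)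
    (.inr le_rfl)
  have key := norm_integral_window_le (x₀ := 2*ξ) (M := 100*(D*N)*ξ^(-(1/2) : ℝ)) abs_one hξ
    (by linarith) (by linarith) (by linarith) (by positivity) (fun x hx => by grind) ac.conj
    (by simpa only [RCLike.norm_conj] using b0 (2*ξ) ⟨by linarith, by linarith⟩)
    (fun x hx => by rw [RCLike.norm_conj]; exact b1 x hx)
  rw [rsqrt_mul_rpow_eq (by linarith), ← RCLike.norm_conj] at key
  refine le_trans (le_of_eq ?_) key
  congr 1
  rw [map_sub, ← intervalIntegral.intervalIntegral_conj]
  congr 1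
  · refine integral_congr fun η hη => ?_
    rw [uIcc_of_le (by linarith)] at hη
    have e : -3*phase ξ η = -(((η - 2*ξ)*√(3*ξ/2 + 1*(3/4*(η - 2*ξ))))^2) := by
      rw [mul_pow, sq_sqrt (by linarith [hη.1]), phase]; ring
    simp only [phaseOsc]
    rw [e, map_mul, conj_conj, ← Complex.exp_conj, map_mul, conj_ofReal, Complex.conj_I]
    push_cast
    ring_nf
  · rw [map_mul, map_mul, map_div₀, conj_conj, conj_ofReal, map_ofNat]

/-- The contribution of the stationary point `η = 2ξ/3`. -/
lemma norm_integral_window_third_le (hκ : Symb (1/2) D κ κ') (hH : Adm 0 1 N H H') (hξ : 1 ≤ ξ) :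
    ‖(∫ η in ξ/8..3*ξ/4, phaseOsc ξ η*(κ η*H (ξ - η))) - cis(-(8/9)*ξ^3) *
      (2*fresnelC*(κ (2*ξ/3)*H (ξ - 2*ξ/3)/(√(3*ξ/2) : ℝ)))‖ ≤ 20000000*(D*N)*ξ^(-(17/10) : ℝ) := by
  have hD := hκ.nonneg
  have hN := hH.nonneg
  obtain ⟨ac, b0, b1⟩ := amplitude_bounds (a := ξ/8) (b := 3*ξ/4) hκ hH hξ le_rfl (.inl le_rfl)
  have key := norm_integral_window_le (σ := -1) (x₀ := 2*ξ/3) (M := 100*(D*N)*ξ^(-(1/2) : ℝ))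
    (by simp) hξ (by linarith) (by linarith) (by linarith) (by positivity) (fun x hx => by grind) ac
    (b0 (2*ξ/3) ⟨by linarith, by linarith⟩) b1
  rw [rsqrt_mul_rpow_eq (by linarith)] at key
  refine le_trans (le_of_eq ?_) key
  have e : ∫ η in ξ/8..3*ξ/4, phaseOsc ξ η*(κ η*H (ξ - η)) = cis(-(8/9)*ξ^3)*∫ η in ξ/8..3*ξ/4,
      cis(((η - 2*ξ/3)*√(3*ξ/2 + -1*(3/4*(η - 2*ξ/3))))^2)*(κ η*H (ξ - η)) := by
    rw [← ii_const_mul]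
    refine integral_congr fun η hη => ?_
    rw [uIcc_of_le (by linarith)] at hη
    simp only [phaseOsc]
    rw [← mul_assoc (cis(-(8/9)*ξ^3)), ← exp_add, ← add_mul, ← ofReal_add, mul_pow,
      sq_sqrt (by linarith [hη.2]), phase]
    ring_nf
  rw [e, ← mul_sub, norm_mul, norm_exp_ofReal_mul_I, one_mul]

lemma fresnelC_mul_conj : fresnelC*conj fresnelC = (π/4 : ℝ) := by
  rw [mul_conj, normSq_eq_norm_sq, fresnelC, norm_mul,
    norm_exp_ofReal_mul_I, mul_one, norm_real, norm_eq_abs, sq_abs, div_pow,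
    sq_sqrt pi_pos.le]
  norm_num

lemma fresnelC_sq : fresnelC^2 = (π/4 : ℝ)*I := by
  rw [fresnelC, mul_pow, ← Complex.exp_nat_mul, ← Complex.ofReal_pow, div_pow, sq_sqrt pi_pos.le]
  have : ((2 : ℕ) : ℂ)*(((π/4 : ℝ) : ℂ)*I) = π/2*I := by push_cast; ring
  rw [this, Complex.exp_pi_div_two_mul_I]
  norm_num

lemma norm_integral_J_far_le (hκ : Symb (1/2) D κ κ') (hH : Adm 0 1 N H H') (hξ : 1 ≤ ξ)
    (hab : a ≤ b) (h : 1 ≤ a ∨ b ≤ -1) (hs : ξ ≤ a ∨ b ≤ ξ) (hfar : ∀ x ∈ Ioo a b, |x| ≤ 5*|ξ - x|)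
    (hs' : b ≤ 4/3*ξ ∨ 4/3*ξ ≤ a) (hl : ∀ x ∈ Ioo a b, ξ^2/2 ≤ |dphase ξ x|) :
    ‖∫ η in a..b, phaseOsc ξ η*(κ η*H (ξ - η))‖ ≤ 480*(D*N)*ξ^(-(17/10) : ℝ) := by
  have h0 : 0 < ξ := by linarith
  have hD := hκ.nonneg
  have hN := hH.nonneg
  have sv := Symb.sv_mul_far (p := 0) hκ le_rfl (by simpa using hH) le_rfl zero_le_one one_pos h hs
    hfar
  refine (sv.norm_integral_phaseOsc_le_of_lb hab (by positivity) hs' hl).trans ?_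
  have e : ξ^(-(2 : ℝ)) ≤ ξ^(-(17/10) : ℝ) := rpow_mono hξ (by norm_num)
  rw [rpow_neg h0.le, rpow_two] at e
  calc _ = 480*(D*N)*(ξ^2)⁻¹ := by field_simp; ring
    _ ≤ _ := by gcongr

lemma opK_eq_zero_of_lt (hs : ∀ x, x < 1 → f x = 0) (hη : η < 2) : opK f f η = 0 := by
  refine improperIntegral_eq ?_
  have : ∀ ν, integrandK f f η ν = 0 := fun ν => by
    rw [integrandK]
    grind
  simp [this]

lemma opK_refl_eq_zero_of_gt (hs : ∀ x, x < 1 → f x = 0) (hη : -2 < η) :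
    opK (refl f) (refl f) η = 0 := by
  refine improperIntegral_eq ?_
  have : ∀ ν, integrandK (refl f) (refl f) η ν = 0 := fun ν => by
    rw [integrandK, refl, refl]
    grind
  simp [this]

lemma integral_eq_zero_of_forall (hab : a ≤ b) (h : ∀ x, a < x → x < b → F x = 0) :
    ∫ x in a..b, F x = 0 := by
  refine intervalIntegral.integral_zero_ae ?_
  filter_upwards [ae_ne b] with x hx hxm
  grind

lemma intervalIntegrable_J (hf : Adm 0 1 Nf f f') (hg : Adm 0 1 Ng g g') (hh : Adm 0 1 Nh h h')
    (ξ a b : ℝ) :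
    IntervalIntegrable (fun η => phaseOsc ξ η*(opK f g η*refl h (ξ - η))) volume a b := by
  have := ii_of_loc (locallyIntegrable_integrandJ hf hg hh ξ) a b
  rwa [show integrandJ h (opK f g) ξ = _ from funext (integrandJ_eq _ _ _)] at this

/-- Three frequencies of the same sign, opposite to that of the output. -/
lemma norm_triI_neg_le (hf : SmoothSymb N f f' f'') (hs : ∀ x, x < 1 → f x = 0) (hξ : 1 ≤ ξ) :
    ‖triI (refl f) (refl f) (refl f) ξ‖ ≤ 2000000*N^3*ξ^(-(17/10) : ℝ) := by
  have hN := hf.adm.nonneg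
  have h0 : 0 < ξ := by linarith
  have ha := hf.adm.refl
  refine (norm_triI_le_of_window (m₀ := 1) ha ha ha h0
    (E := 480*(6000*(N*N)*N)*ξ^(-(17/10) : ℝ)) fun m hm => ?_).trans ?_
  · simp only [integrandJ_eq]
    rw [← ii_split
      (intervalIntegrable_J ha ha ha ξ (-m) (-1)) (intervalIntegrable_J ha ha ha ξ (-1) m),
      integral_eq_zero_of_forall (a := -1) (by linarith) fun x h1 _ => by
        rw [opK_refl_eq_zero_of_gt hs (by linarith)]; ring, add_zero]
    refine norm_integral_J_far_le (symb_opK hf.refl hf.refl) ha.refl hξ (by linarith)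
      (.inr le_rfl) (.inr (by linarith)) (fun x hx => ?_) (.inl (by linarith)) fun x hx => ?_
    · grind
    · rw [dphase_eq]
      have := hx.2
      refine le_trans ?_ (le_abs_self _)
      nlinarith
  · have : 0 ≤ N^3*ξ^(-(17/10) : ℝ) := by positivity
    linarith

lemma triI_eq_zero (hs : ∀ x, x < 1 → f x = 0) (hξ : 0 < ξ) : triI (refl f) (refl f) f ξ = 0 := by
  have : opJ f (opK (refl f) (refl f)) ξ = 0 := by
    refine improperIntegral_eq ?_
    have : ∀ η, integrandJ f (opK (refl f) (refl f)) ξ η = 0 := fun η => by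
      rw [integrandJ]
      rcases lt_or_ge (η - ξ) 1 with h | h
      · grind
      · rw [opK_refl_eq_zero_of_gt hs (by linarith)]; ring
    simp [this]
  rw [triI, this, mul_zero]

lemma norm_opK_sub_coefK_le (hf : Adm 0 1 N f f') (hη : ξ/2 ≤ η) (hξ : 2 ≤ ξ) :
    ‖opK f f η - coefK η*f (η/2)^2‖ ≤ 6400*N^2*ξ^(-(17/10) : ℝ) := by
  have hη0 : 0 < η := by linarith
  have := norm_opK_sub_mainK_le_zero hf hf (η := η) (by grind)
  rw [mainK, abs_of_pos hη0] at this
  rw [sq (f (η/2))]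
  refine this.trans ?_
  have e := rpow_neg_le (x := ξ) (y := η) (c := 2) (q := 9/5) (n := 2) (by linarith)
    (by norm_num) (by norm_num) (by norm_num) hη
  have e2 : ξ^(-(9/5) : ℝ) ≤ ξ^(-(17/10) : ℝ) := rpow_mono (by linarith) (by norm_num)
  calc _ = 1600*N^2*η^(-(9/5) : ℝ) := by grind
    _ ≤ 1600*N^2*(2^2*ξ^(-(17/10) : ℝ)) := by gcongr; linarith
    _ = _ := by ring

lemma norm_triI_sub_le_of_stationary {θ y R : ℂ} (hf : Adm 0 1 N f f') (hh : Adm 0 1 N h h')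
    (hξ : 2 ≤ ξ) (hη : ξ/2 ≤ η) (hθ : ‖θ‖ ≤ 1) (hy : ‖y‖ ≤ N)
    (hR : R = θ*(y/(√(3*ξ/2) : ℝ))*(coefK η*f (η/2)^2)) (hL : ∀ m, 8*ξ ≤ m → ‖(∫ η in -m..m,
    phaseOsc ξ η*(opK f f η*refl h (ξ - η))) - 2*θ*(opK f f η*y/(√(3*ξ/2) : ℝ))‖ ≤
    150000000000*N^3*ξ^(-(17/10) : ℝ)) :
    ‖triI f f h ξ - R‖ ≤ 100000000000*N^3*ξ^(-(17/10) : ℝ) := by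
  have hN := hf.nonneg
  have h0 : 0 < ξ := by linarith
  have key := norm_triI_sub_le_of_window hf hf hh h0 fun m hm => by
    simpa only [integrandJ_eq] using hL m hm
  set X := ξ^(-(17/10) : ℝ)
  have hNX : 0 ≤ N^3*X := by positivity
  set P : ℂ := θ*(y/(√(3*ξ/2) : ℝ)) with hP
  have nP : ‖P‖ ≤ N := by
    rw [norm_mul, norm_div, norm_real, norm_of_nonneg (Real.sqrt_nonneg _)]
    have r : 1 ≤ √(3*ξ/2) := one_le_sqrt.2 (by linarith)
    calc _ ≤ 1*(N/1) := by gcongr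
      _ = N := by ring
  have d := norm_opK_sub_coefK_le hf hη hξ
  have e : triI f f h ξ - R = (triI f f h ξ - 1/2*(2*θ*(opK f f η*y/(√(3*ξ/2) : ℝ)))) +
      P*(opK f f η - coefK η*f (η/2)^2) := by rw [hR, hP]; ring
  rw [e]
  refine (norm_add_le _ _).trans ?_
  rw [norm_mul]
  calc _ ≤ 150000000000*N^3*X/2 + N*(6400*N^2*X) := by gcongr
    _ ≤ _ := by linarith

/-- The resonance `ξ = ξ + ξ - ξ`. -/
lemma norm_triI_pos_sub_le (hf : SmoothSymb N f f' f'') (hs : ∀ x, x < 1 → f x = 0) (hξ : 2 ≤ ξ) :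
    ‖triI f f f ξ - (π/(3*ξ) : ℝ)*(f ξ^2*conj (f ξ))‖ ≤ 100000000000*N^3*ξ^(-(17/10) : ℝ) := by
  have hN := hf.adm.nonneg
  have h0 : 0 < ξ := by linarith
  have ha := hf.adm
  have hκ := symb_opK hf hf
  have i := intervalIntegrable_J ha ha ha ξ
  refine norm_triI_sub_le_of_stationary (η := 2*ξ) (θ := conj fresnelC) (y := refl f (ξ - 2*ξ)) ha
    ha hξ (by linarith) (by simpa using norm_fresnelC_le) (ha.refl.le le_rfl (by linarith)) ?_
    fun m hm => ?_
  · rw [coefK_of_pos (by linarith), halfFresnel_eq (by linarith), mul_div_cancel_left₀ ξ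
      two_ne_zero, show 3/4*(2*ξ) = 3*ξ/2 by ring, refl, show -(ξ - 2*ξ) = ξ by ring]
    have r : (π/(3*ξ) : ℝ) = π/4*(2*(√(3*ξ/2))⁻¹/√(3*ξ/2)) := by
      have := sq_sqrt (show 0 ≤ 3*ξ/2 by linarith)
      grind
    rw [r, ofReal_mul, ← fresnelC_mul_conj]
    push_cast
    ring
  · rw [← ii_split (i (-m) ξ) (i ξ m),
      integral_eq_zero_of_forall (a := -m) (b := ξ) (by linarith) fun x _ h1 => by
        rw [refl, hs (-(ξ - x)) (by linarith), map_zero]; ring, zero_add,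
      ← ii_split (i ξ (5*ξ/4)) (i (5*ξ/4) m),
      ← ii_split (i (5*ξ/4) (8*ξ)) (i (8*ξ) m), add_sub_assoc,
      add_sub_right_comm]
    refine (norm_add_le_of_le (norm_integral_J_mid_le hκ le_rfl (by norm_num) ha.refl (by linarith)
      (by linarith : ξ ≤ 5*ξ/4) (.inr ⟨le_rfl, le_rfl⟩)) (norm_add_le_of_le
      (norm_integral_window_two_le hκ ha.refl (by linarith : 1 ≤ ξ)) (norm_integral_J_far_le
      (ξ := ξ) hκ ha.refl (by linarith) hm (.inl (by linarith)) (.inl (by linarith))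
      (fun x hx => by grind) (.inr (by linarith)) fun x hx => ?_))).trans ?_
    · rw [dphase_eq]
      have := hx.1
      refine le_trans ?_ (le_abs_self _)
      nlinarith
    · have : 0 ≤ N^3*ξ^(-(17/10) : ℝ) := by positivity
      have e := mul_mono (rpow_mono (x := ξ)
        (y := -2 - 1/2 + 1/5) (z := -(17/10)) (by linarith) (by norm_num)) (pow_nonneg hN 3)
      linarith

/-- The resonance `ξ = ξ/3 + ξ/3 + ξ/3`. -/
lemma norm_triI_third_sub_le (hf : SmoothSymb N f f' f'') (hs : ∀ x, x < 1 → f x = 0) (hξ : 8 ≤ ξ) :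
    ‖triI f f (refl f) ξ - I*(π/(√3*ξ) : ℝ)*(cis(-(8/9)*ξ^3)*f (ξ/3)^3)‖ ≤
      100000000000*N^3*ξ^(-(17/10) : ℝ) := by
  have hN := hf.adm.nonneg
  have h0 : 0 < ξ := by linarith
  have ha := hf.adm
  have har := hf.adm.refl
  have hκ := symb_opK hf hf
  have i := intervalIntegrable_J ha ha har ξ
  simp only [refl_refl] at i
  refine norm_triI_sub_le_of_stationary (η := 2*ξ/3) (θ := cis(-(8/9)*ξ^3)*fresnelC)
    (y := f (ξ - 2*ξ/3)) ha har (by linarith) (by linarith)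
    (by rw [norm_mul, norm_exp_ofReal_mul_I, one_mul]; exact norm_fresnelC_le)
    (ha.le le_rfl (by linarith)) ?_ fun m hm => ?_
  · rw [coefK_of_pos (by linarith), halfFresnel_eq (by linarith), show 2*ξ/3/2 = ξ/3 by ring,
      show ξ - 2*ξ/3 = ξ/3 by ring]
    have r : (π/(√3*ξ) : ℝ) = π/4*(2*(√(3/4*(2*ξ/3)))⁻¹/√(3*ξ/2)) := by
      have r1 : √(3*ξ/2) = √3*√(3/4*(2*ξ/3)) := by rw [← sqrt_mul (by norm_num)]; congr 1; ring
      have := sq_sqrt (show 0 ≤ 3/4*(2*ξ/3) by linarith)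
      rw [r1]; grind
    have := fresnelC_sq
    rw [r, ofReal_mul]
    push_cast at this ⊢
    grind
  · simp only [refl_refl]
    rw [← ii_split (i (-m) ξ) (i ξ m),
      integral_eq_zero_of_forall (a := ξ) (b := m) (by linarith) fun x h1 _ => by grind, add_zero,
      ← ii_split (i (-m) 1) (i 1 ξ),
      integral_eq_zero_of_forall (a := -m) (b := 1) (by linarith) fun x _ h1 => by
        rw [opK_eq_zero_of_lt hs (by linarith)]; ring, zero_add,
      ← ii_split (i 1 (ξ/8)) (i (ξ/8) ξ),
      ← ii_split (i (ξ/8) (3*ξ/4)) (i (3*ξ/4) ξ), add_sub_assoc,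
      add_sub_right_comm, mul_left_comm 2, mul_assoc (cis(-(8/9)*ξ^3))]
    refine (norm_add_le_of_le (norm_integral_J_far_le (ξ := ξ) hκ ha (a := 1) (b := ξ/8)
      (by linarith) (by linarith) (.inl le_rfl) (.inr (by linarith)) (fun x hx => by grind)
      (.inl (by linarith)) fun x hx => ?_) (norm_add_le_of_le
      (norm_integral_window_third_le hκ ha (by linarith : 1 ≤ ξ)) (norm_integral_J_mid_le hκ le_rfl
      (by norm_num) ha (by linarith) (by linarith : 3*ξ/4 ≤ ξ) (.inl ⟨le_rfl, le_rfl⟩)))).trans ?_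
    · rw [dphase_eq]
      have := hx.2
      refine le_trans ?_ (le_abs_self _)
      nlinarith [hx.1]
    · have : 0 ≤ N^3*ξ^(-(17/10) : ℝ) := by positivity
      have e := mul_mono (rpow_mono (x := ξ)
        (y := -2 - 1/2 + 1/5) (z := -(17/10)) (by linarith) (by norm_num)) (pow_nonneg hN 3)
      linarith

/-! ### Multilinearity and full symmetry -/

lemma Adm.add (hf : Adm p q N f f') (hg : Adm p q M g g') :
    Adm p q (N + M) (fun x => f x + g x) (fun x => f' x + g' x) where
  nonneg := add_nonneg hf.nonneg hg.nonneg
  meas := hf.meas.add hg.meas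
  meas' := hf.meas'.add hg.meas'
  bd := fun x hx => by rw [add_mul]; exact norm_add_le_of_le (hf.bd x hx) (hg.bd x hx)
  bd' := fun x hx => by rw [add_mul]; exact norm_add_le_of_le (hf.bd' x hx) (hg.bd' x hx)
  pos := hf.pos.add hg.pos
  neg := hf.neg.add hg.neg

lemma adm_zero : Adm p q 0 (fun _ => 0) (fun _ => 0) :=
  ⟨le_rfl, measurable_const, measurable_const, by simp, by simp, ACOn.const 0 _, ACOn.const 0 _⟩

/-- Invariance under `f ↦ refl f`, away from the origin. -/
def ConjEven (f : ℝ → ℂ) : Prop := ∀ x, x ≠ 0 → refl f x = f x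

lemma ConjEven.add (hf : ConjEven f) (hg : ConjEven g) :
    ConjEven (fun x => f x + g x) := fun x hx => by
  show conj (f (-x) + g (-x)) = f x + g x
  rw [map_add]; exact congr_arg₂ _ (hf x hx) (hg x hx)

lemma ConjEven.sub (hf : ConjEven f) (hg : ConjEven g) :
    ConjEven (fun x => f x - g x) := fun x hx => by
  show conj (f (-x) - g (-x)) = f x - g x
  rw [map_sub]; exact congr_arg₂ _ (hf x hx) (hg x hx)

lemma opK_congr (hf : ∀ x, x ≠ 0 → f x = f₁ x) (hg : ∀ x, x ≠ 0 → g x = g₁ x) (η : ℝ) :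
    opK f g η = opK f₁ g₁ η := by
  rw [opK, opK, improperIntegral, improperIntegral]
  congr 1
  funext p
  refine ii_congr_ae ?_
  filter_upwards [ae_ne η, ae_ne (-η)] with ν h1 h2 _
  rw [integrandK, integrandK, hf _ fun h => h2 (by linarith), hg _ fun h => h1 (by linarith)]

lemma triI_congr {h₁ : ℝ → ℂ} (hf : ∀ x, x ≠ 0 → f x = f₁ x) (hg : ∀ x, x ≠ 0 → g x = g₁ x)
    (hh : ∀ x, x ≠ 0 → h x = h₁ x) (ξ : ℝ) : triI f g h ξ = triI f₁ g₁ h₁ ξ := by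
  rw [triI, triI, opJ_congr h ξ fun η _ => opK_congr hf hg η]
  congr 1
  rw [opJ, opJ, improperIntegral, improperIntegral]
  congr 1
  funext p
  refine ii_congr_ae ?_
  filter_upwards [ae_ne ξ] with η h1 _
  rw [integrandJ, integrandJ, hh _ (sub_ne_zero.2 h1)]

section
variable {Nu : ℝ}

lemma triI_add_left (hf : Adm 0 1 Nf f f') (hu : Adm 0 1 Nu u u') (hg : Adm 0 1 Ng g g')
    (hh : Adm 0 1 Nh h h') (hξ : 0 < ξ) :
    triI (fun x => f x + u x) g h ξ = triI f g h ξ + triI u g h ξ := by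
  rw [triI, opJ_congr h ξ fun η hη => opK_add hf hu hg hη, triI, triI, ← mul_add]
  congr 1
  refine tendsto_nhds_unique ?_ ((tendsto_opJ hf hg hh hξ).add (tendsto_opJ hu hg hh hξ))
  have h1 := tendsto_opJ (hf.add hu) hg hh hξ
  rw [opJ_congr h ξ fun η hη => opK_add hf hu hg hη] at h1
  refine h1.congr fun m => ?_
  rw [← ii_add (ii_of_loc (locallyIntegrable_integrandJ hf hg hh ξ) _ _)
    (ii_of_loc (locallyIntegrable_integrandJ hu hg hh ξ) _ _)]
  refine ii_congr_ae ?_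
  filter_upwards [ae_ne 0] with η hη _
  rw [integrandJ, opK_add hf hu hg hη, integrandJ, integrandJ]; ring

lemma triI_swap (ef : ConjEven f) (eh : ConjEven h) (hf : Adm 0 1 Nf f f') (hg : Adm 0 1 Ng g g')
    (hh : Adm 0 1 Nh h h') (hξ : 0 < ξ) : triI f g h ξ = triI h g f ξ := by
  rw [triI_symm hf hg hh hξ]
  exact triI_congr eh (fun _ _ => rfl) ef ξ

lemma triI_rotate (ef : ConjEven f) (eh : ConjEven h) (hf : Adm 0 1 Nf f f') (hg : Adm 0 1 Ng g g')
    (hh : Adm 0 1 Nh h h') (hξ : 0 < ξ) : triI f g h ξ = triI g h f ξ := by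
  rw [triI_swap ef eh hf hg hh hξ, triI_comm hh hg]

/-- The difference of two values of the cubic operator. -/
lemma cubicI_sub (ef : ConjEven f) (eu : ConjEven u) (hf : Adm 0 1 Nf f f') (hu : Adm 0 1 Nu u u')
    (hξ : 0 < ξ) : cubicI (fun x => f x + u x) ξ - cubicI f ξ = triI (fun x => f x + u x)
    (fun x => f x + u x) u ξ + triI (fun x => f x + u x) f u ξ + triI f f u ξ := by
  have hv := hf.add hu
  have ev := ef.add eu
  rw [cubicI, cubicI, triI_add_left hf hu hv hv hξ, triI_rotate eu ev hu hv hv hξ,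
    triI_rotate ef ev hf hv hv hξ, triI_add_left hf hu hv hf hξ, triI_rotate eu ef hu hv hf hξ,
    triI_rotate ef ef hf hv hf hξ, triI_add_left hf hu hf hf hξ, triI_rotate eu ef hu hf hf hξ]
  ring

end
lemma norm_le_of_small_of_large {X : ℂ} {c₁ c₂ : ℝ} (hk : 0 ≤ k) (hk1 : k ≤ 1) (hξ : 0 < ξ)
    (hc₁ : 0 ≤ c₁) (hc₂ : 0 ≤ c₂) (h1 : ξ ≤ 8 → ‖X‖ ≤ c₁) (h2 : 8 ≤ ξ → ‖X‖ ≤ c₂*ξ^(-1 - k)) :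
    ‖X‖ ≤ (100*c₁ + 4*c₂)*(1 + |ξ|)^(-(1 + k)) := by
  rw [abs_of_pos hξ]
  have hw : 0 ≤ (1 + ξ)^(-(1 + k)) := by positivity
  rcases le_total ξ 8 with h | h
  · refine (h1 h).trans ?_
    have e := rpow_neg_le (x := 1) (y := 9⁻¹) (c := 9) (q := 1 + k) (n := 2) one_pos
      (by norm_num) (by linarith) (by norm_num; linarith) (by norm_num)
    have e1 : (9 : ℝ)^(-(1 + k)) ≤ (1 + ξ)^(-(1 + k)) :=
      rpow_le_rpow_of_nonpos (by linarith) (by linarith) (by linarith)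
    have e2 : (100 : ℝ)⁻¹ ≤ 9^(-(1 + k)) := by
      have : (9 : ℝ)^(-(2 : ℝ)) ≤ 9^(-(1 + k)) := rpow_mono (by norm_num) (by linarith)
      refine le_trans ?_ this
      linarith
    have e3 := e2.trans e1
    have : 0 ≤ c₂*(1 + ξ)^(-(1 + k)) := by positivity
    nlinarith
  · refine (h2 h).trans ?_
    have e := rpow_neg_le (x := 1 + ξ) (y := ξ) (c := 2) (q := 1 + k) (n := 2)
      (by linarith) (by norm_num) (by linarith) (by norm_num; linarith) (by linarith)
    rw [show -1 - k = -(1 + k) by ring]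
    have : 0 ≤ c₁*(1 + ξ)^(-(1 + k)) := by positivity
    nlinarith

lemma norm_triI_le_of_le_eight (hf : Adm 0 1 Nf f f') (hg : Adm 0 1 Ng g g') (hh : Adm 0 1 Nh h h')
    (hξ : 0 < ξ) (h8 : ξ ≤ 8) : ‖triI f g h ξ‖ ≤ 96000*(Nf*Ng*Nh) := by
  have h1 := hf.nonneg
  have h2 := hg.nonneg
  have h3 := hh.nonneg
  refine (norm_triI_le hf hg hh hξ).trans ?_
  have : √(max (8*ξ) 1) ≤ 8 := by
    rw [Real.sqrt_le_left (by norm_num)]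
    grind
  calc _ ≤ 12000*(Nf*Ng*Nh)*8 := by gcongr
    _ = _ := by ring

section
variable {S S' S'' b y d : ℝ → ℂ}

lemma adm_profile (hk : 0 ≤ k) (hS : SmoothSymb N S S' S'') (hb : Adm 3 1 N b b')
    (hz : Adm k (1 + k) N z z') :
    Adm 0 1 (3*N) (fun x => S x + b x + z x) (fun x => S' x + b' x + z' x) :=
  ((hS.adm.add (hb.mono (by norm_num) le_rfl le_rfl)).add
    (hz.mono hk (by linarith) le_rfl)).mono le_rfl le_rfl (by linarith)

/-- The trilinear operator with one factor in the solution space. -/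
lemma norm_triI_profile_le (hk : 1/2 ≤ k) (hk1 : k ≤ 3/4) (hS : SmoothSymb N S S' S'')
    (hb : Adm 3 1 N b b') (hz : Adm k (1 + k) N z z') (hy : Adm k (1 + k) N y y')
    (hd : Adm k (1 + k) δ d d') (eS : ConjEven S) (eb : ConjEven b) (ey : ConjEven y)
    (ed : ConjEven d) (hξ : 0 < ξ) : ‖triI (fun x => S x + b x + z x) (fun x => S x + b x + y x) d
    ξ‖ ≤ 300000000000*(N^2*δ)*(1 + |ξ|)^(-(1 + k)) := by
  have hN := hS.adm.nonneg
  have hδ := hd.nonneg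
  have hk0 : 0 ≤ k := by linarith
  have lo : ∀ {M : ℝ} {u u' : ℝ → ℂ}, Adm k (1 + k) M u u' → Adm 0 1 M u u' :=
    fun h => h.mono hk0 (by linarith) le_rfl
  have hb0 : Adm 0 1 N b b' := hb.mono (by norm_num) le_rfl le_rfl
  have hS0 := hS.adm
  have hz0 := lo hz
  have hy0 := lo hy
  have hd0 := lo hd
  have hw := adm_profile hk0 hS hb hy
  have ew : ConjEven (fun x => S x + b x + y x) := (eS.add eb).add ey
  have hP : 0 ≤ N^2*δ := by positivity
  refine (norm_le_of_small_of_large (c₁ := 96000*(3*N*(3*N)*δ))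
    (c₂ := 50000000000*(N^2*δ)) hk0 (by linarith) hξ (by positivity) (by positivity)
    (fun h8 => norm_triI_le_of_le_eight (adm_profile hk0 hS hb hz) hw hd0 hξ h8)
    (fun h8 => ?_)).trans ?_
  · set X := ξ^(-1 - k) with hX
    have hX0 : 0 ≤ X := by positivity
    have fast : ξ^(-(9/5) : ℝ) ≤ X := rpow_mono (by linarith) (by linarith)
    rw [triI_add_left (hS0.add hb0) hz0 hw hd0 hξ, triI_add_left hS0 hb0 hw hd0 hξ,
      triI_comm hS0 hw, triI_add_left (hS0.add hb0) hy0 hS0 hd0 hξ, triI_add_left hS0 hb0 hS0 hd0 hξ]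
    have t1 := norm_triI_le_of_symb hS0 hS0 (symb_opK hS hS) hd hk0 (by linarith) h8
    have t2 := norm_triI_le_of_fast hd0 hS0 hb h8
    rw [← triI_swap eb ed hb0 hS0 hd0 hξ] at t2
    have t3 := norm_triI_le_of_decay hd hy hS0 hk hk1 h8
    rw [triI_comm hd0 hy0, ← triI_rotate eS ed hS0 hy0 hd0 hξ, triI_comm hS0 hy0] at t3
    have t4 := norm_triI_le_of_fast hd0 hw hb h8
    rw [← triI_swap eb ed hb0 hw hd0 hξ] at t4
    have t5 := norm_triI_le_of_decay hd hz hw hk hk1 h8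
    rw [triI_comm hd0 hz0, ← triI_rotate ew ed hw hz0 hd0 hξ, triI_comm hw hz0] at t5
    have t2' := t2.trans (mul_mono fast (by positivity))
    have t4' := t4.trans (mul_mono fast (by positivity))
    have hPX : 0 ≤ N^2*δ*X := by positivity
    refine (norm_add_le _ _).trans ((add_le_add_left ((norm_add_le _ _).trans (add_le_add_left
      ((norm_add_le _ _).trans (add_le_add_left (norm_add_le _ _) _)) _)) _).trans ?_)
    linarith
  · gcongr
    nlinarith

end

/-! ### Asymptotics of the cubic operator -/

lemma SmoothSymb.add (hf : SmoothSymb N f f' f'')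
    (hg : SmoothSymb M g g' g'') :
    SmoothSymb (N + M) (fun x => f x + g x) (fun x => f' x + g' x) (fun x => f'' x + g'' x) where
  adm := hf.adm.add hg.adm
  adm_deriv := hf.adm_deriv.add hg.adm_deriv
  adm_euler := by
    have := hf.adm_euler.add hg.adm_euler
    grind
  deriv := fun x => (hf.deriv x).add (hg.deriv x)
  cont := hf.cont.add hg.cont
  zero := by rw [hf.zero, hg.zero, add_zero]
  zero' := by rw [hf.zero', hg.zero', add_zero]

lemma conjEven_add_refl (f : ℝ → ℂ) : ConjEven (fun x => f x + refl f x) := fun x _ => by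
  show conj (f (-x) + refl f (-x)) = f x + refl f x
  rw [map_add, add_comm]; simp [refl]

section
variable {b : ℝ → ℂ}

lemma norm_cubicI_add_refl_sub_le (hf : SmoothSymb N f f' f'') (hs : ∀ x, x < 1 → f x = 0)
    (hξ : 8 ≤ ξ) : ‖cubicI (fun x => f x + refl f x) ξ - ((π/ξ : ℝ)*(f ξ^2*conj (f ξ)) + I*(π/(√3*ξ)
    : ℝ)*(cis(-(8/9)*ξ^3)*f (ξ/3)^3))‖ ≤ 500000000000*N^3*ξ^(-(17/10) : ℝ) := by
  have hN := hf.adm.nonneg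
  have h0 : 0 < ξ := by linarith
  have ha := hf.adm
  have hr := hf.adm.refl
  have hS := ha.add hr
  have e1 : triI f (refl f) f ξ = triI (refl f) (refl f) (refl f) ξ := triI_symm ha hr ha h0
  have e2 : triI (refl f) f f ξ = triI (refl f) (refl f) (refl f) ξ := by rw [triI_comm hr ha, e1]
  have e3 : triI (refl f) f (refl f) ξ = triI f f f ξ := by rw [triI_symm hr ha hr h0, refl_refl]
  have e4 : triI f (refl f) (refl f) ξ = triI f f f ξ := by rw [triI_comm ha hr, e3]
  have e5 : triI (refl f) (refl f) f ξ = 0 := triI_eq_zero hs h0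
  have third : ∀ {g h : ℝ → ℂ} {g' h' : ℝ → ℂ}, Adm 0 1 N g g' → Adm 0 1 N h h' →
      triI g h (fun x => f x + refl f x) ξ = triI g h f ξ + triI g h (refl f) ξ := fun hg hh => by
    have e6 : refl (fun x => f x + refl f x) = fun x => refl f x + refl (refl f) x := by
      funext x; simp [refl]
    rw [triI_symm hg hh hS h0, e6, triI_add_left hr hr.refl hh hg.refl h0,
      triI_symm hr hh hg.refl h0, triI_symm hr.refl hh hg.refl h0, refl_refl, refl_refl]
  have e : cubicI (fun x => f x + refl f x) ξ =
      3*triI f f f ξ + triI f f (refl f) ξ + 3*triI (refl f) (refl f) (refl f) ξ := by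
    rw [cubicI, triI_add_left ha hr hS hS h0, triI_comm ha hS, triI_comm hr hS,
      triI_add_left ha hr ha hS h0, triI_add_left ha hr hr hS h0, third ha ha, third hr ha,
      third ha hr, third hr hr, e1, e2, e3, e4, e5]
    ring
  have t1 := norm_triI_pos_sub_le hf hs (by linarith : 2 ≤ ξ)
  have t2 := norm_triI_third_sub_le hf hs hξ
  have t3 := norm_triI_neg_le hf hs (by linarith : 1 ≤ ξ)
  set P := (π/(3*ξ) : ℝ)*(f ξ^2*conj (f ξ))
  set Q := I*(π/(√3*ξ) : ℝ)*(cis(-(8/9)*ξ^3)*f (ξ/3)^3)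
  have eP : (π/ξ : ℝ)*(f ξ^2*conj (f ξ)) = 3*P := by simp only [P]; push_cast; field_simp
  have e' : 3*triI f f f ξ + triI f f (refl f) ξ + 3*triI (refl f) (refl f) (refl f) ξ -
      (3*P + Q) = 3*(triI f f f ξ - P) + (triI f f (refl f) ξ - Q) +
      3*triI (refl f) (refl f) (refl f) ξ := by ring
  rw [e, eP, e']
  refine norm_add₃_le.trans ?_
  have hX : 0 ≤ N^3*ξ^(-(17/10) : ℝ) := by positivity
  norm_num at t1 t2 t3 hX ⊢
  linarith

lemma norm_cubicI_profile_sub_le (hk : 1/2 ≤ k) (hk1 : k ≤ 7/10) (hf : SmoothSymb N f f' f'')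
    (hs : ∀ x, x < 1 → f x = 0) (hb : Adm 3 1 N b b') (eb : ConjEven b) (hz : Adm k (1 + k) N z z')
    (ez : ConjEven z) (hξ : 8 ≤ ξ) : ‖cubicI (fun x => f x + refl f x + b x + z x) ξ -
    ((π/ξ : ℝ)*(f ξ^2*conj (f ξ)) + I*(π/(√3*ξ) : ℝ)*(cis(-(8/9)*ξ^3)*f (ξ/3)^3))‖ ≤
    10000000000000*N^3*ξ^(-1 - k) := by
  have hN := hf.adm.nonneg
  have h0 : 0 < ξ := by linarith
  have hS := hf.add hf.refl
  have eS := conjEven_add_refl f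
  have hb' := hb.mono le_rfl le_rfl (by linarith : N ≤ N + N)
  have hb0 := hb'.mono (by norm_num : (0 : ℝ) ≤ 3) le_rfl le_rfl
  have hz' := hz.mono le_rfl le_rfl (by linarith : N ≤ N + N)
  have hz0 := hz.mono (by linarith : 0 ≤ k) (by linarith : 1 ≤ 1 + k) le_rfl
  have hzero : Adm k (1 + k) (N + N) (fun _ => 0) (fun _ => 0) :=
    adm_zero.mono le_rfl le_rfl (by linarith)
  have ezero : ConjEven (fun _ => 0) := fun x _ => by simp [refl]
  have hSb := hS.adm.add hb0
  have eSb := eS.add eb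
  set X := ξ^(-1 - k) with hX
  have hNX : 0 ≤ N^3*X := by positivity
  have wt : (1 + |ξ|)^(-(1 + k)) ≤ X := by
    rw [hX, show -1 - k = -(1 + k) by ring]
    exact rpow_le_rpow_of_nonpos h0 (by grind) (by linarith)
  have fast : ξ^(-(9/5) : ℝ) ≤ X := rpow_mono (by linarith) (by linarith)
  have fast' : ξ^(-(17/10) : ℝ) ≤ X := rpow_mono (by linarith) (by linarith)
  have pr := fun {y y' w w' : ℝ → ℂ} (hy : Adm k (1 + k) (N + N) y y')
    (hw : Adm k (1 + k) (N + N) w w') (ew : ConjEven w) =>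
    (norm_triI_profile_le hk (by linarith) hS hb' hy hw hz eS eb ew ez h0).trans
      (mul_mono wt (by positivity))
  have d1 := cubicI_sub eSb ez hSb hz0 h0
  have p1 := pr hz' hz' ez
  have p2 := pr hz' hzero ezero
  have p3 := pr hzero hzero ezero
  simp only [add_zero] at p2 p3
  have d2 := cubicI_sub eS eb hS.adm hb0 h0
  have q := fun {y y' w w' : ℝ → ℂ} (hy : Adm 0 1 (2*(N + N)) y y')
    (hw : Adm 0 1 (2*(N + N)) w w') => (norm_triI_le_of_fast hy hw hb hξ).trans
      (mul_mono fast (by positivity))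
  have hSb1 := hSb.mono le_rfl le_rfl (by linarith : N + N + (N + N) ≤ 2*(N + N))
  have hS1 := hS.adm.mono le_rfl le_rfl (by linarith : N + N ≤ 2*(N + N))
  have q1 := q hSb1 hSb1
  have q2 := q hSb1 hS1
  have q3 := q hS1 hS1
  have q0 := (norm_cubicI_add_refl_sub_le hf hs hξ).trans (mul_mono fast' (by positivity))
  set M := (π/ξ : ℝ)*(f ξ^2*conj (f ξ)) + I*(π/(√3*ξ) : ℝ) * (cis(-(8/9)*ξ^3)*f (ξ/3)^3)
  have e : cubicI (fun x => f x + refl f x + b x + z x) ξ - M =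
      (cubicI (fun x => f x + refl f x + b x + z x) ξ - cubicI (fun x => f x + refl f x + b x) ξ) +
      (cubicI (fun x => f x + refl f x + b x) ξ - cubicI (fun x => f x + refl f x) ξ) +
      (cubicI (fun x => f x + refl f x) ξ - M) := by ring
  rw [e, d1, d2]
  refine norm_add₃_le.trans ((add_le_add (add_le_add (norm_add₃_le.trans (add_le_add
    (add_le_add p1 p2) p3)) (norm_add₃_le.trans (add_le_add (add_le_add q1 q2) q3))) q0).trans ?_)
  nlinarith

end

/-! ### The ansatz -/

lemma hasDerivAt_of_cut (h0 : ∀ x, x < 1 → F x = 0) (h0' : ∀ x, x < 1 → F' x = 0)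
    (h : ∀ x, 0 < x → HasDerivAt F (F' x) x) (x : ℝ) : HasDerivAt F (F' x) x := by
  rcases lt_or_ge x 1 with hx | hx
  · rw [h0' x hx]
    refine (hasDerivAt_const x (0 : ℂ)).congr_of_eventuallyEq ?_
    filter_upwards [gt_mem_nhds hx] with y hy using h0 y hy
  grind

lemma continuous_of_cut (h0 : ∀ x, x < 1 → F x = 0) (h : ContinuousOn F (Ioi 0)) : Continuous F :=
    by
  refine continuous_iff_continuousAt.2 fun x => ?_
  rcases lt_or_ge x 1 with hx | hx
  · refine (continuousAt_const (y := (0 : ℂ))).congr ?_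
    filter_upwards [gt_mem_nhds hx] with y hy using (h0 y hy).symm
  · exact h.continuousAt (Ioi_mem_nhds (by linarith))

lemma adm_of_cut (hN : 0 ≤ N) (h0 : ∀ x, x < 1 → F x = 0) (h0' : ∀ x, x < 1 → F' x = 0)
    (h : ∀ x, 0 < x → HasDerivAt F (F' x) x) (hc : ContinuousOn F' (Ioi 0))
    (bd : ∀ x, 1 ≤ x → ‖F x‖ ≤ N*(1 + |x|)^(-p)) (bd' : ∀ x, 1 ≤ x → ‖F' x‖ ≤ N*(1 + |x|)^(-q)) :
    Adm p q N F F' := by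
  have hd := hasDerivAt_of_cut h0 h0' h
  have hc' := continuous_of_cut h0' hc
  have hc0 : Continuous F := continuous_iff_continuousAt.2 fun x => (hd x).continuousAt
  refine ⟨hN, hc0.measurable, hc'.measurable, fun x _ => ?_, fun x _ => ?_, ?_, ?_⟩
  · rcases lt_or_ge x 1 with hx | hx
    · rw [h0 x hx, norm_zero]; positivity
    · exact bd x hx
  · rcases lt_or_ge x 1 with hx | hx
    · rw [h0' x hx, norm_zero]; positivity
    · exact bd' x hx
  · exact ACOn.of_hasDerivAt (fun x _ => hd x) hc'.continuousOn
  · exact ACOn.of_hasDerivAt (fun x _ => hd x) hc'.continuousOn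

/-- A cut-off with its first two derivatives and a common bound. -/
structure CutoffData (χ χ₁ χ₂ : ℝ → ℝ) (C : ℝ) : Prop where
  one_le : 1 ≤ C
  deriv : ∀ x, HasDerivAt χ (χ₁ x) x
  deriv' : ∀ x, HasDerivAt χ₁ (χ₂ x) x
  cont : Continuous χ₂
  bd : ∀ x, |χ x| ≤ C
  bd' : ∀ x, |χ₁ x| ≤ C
  bd'' : ∀ x, |χ₂ x| ≤ C
  zero : ∀ x, x < 1 → χ x = 0
  zero' : ∀ x, x < 1 → χ₁ x = 0
  zero'' : ∀ x, x < 1 → χ₂ x = 0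
  one : ∀ x, 2 < x → χ x = 1
  one' : ∀ x, 2 < x → χ₁ x = 0
  one'' : ∀ x, 2 < x → χ₂ x = 0

/-- A smooth cut-off with its own derivatives. -/
abbrev SmoothCutoff (χ : ℝ → ℝ) (C : ℝ) : Prop := CutoffData χ (deriv χ) (deriv (deriv χ)) C

lemma deriv_eq_zero_of_const {F : ℝ → ℝ} (hs : IsOpen s) (hx : x ∈ s) (h : ∀ y ∈ s, F y = c) :
    deriv F x = 0 := by
  have : F =ᶠ[𝓝 x] fun _ => c := by filter_upwards [hs.mem_nhds hx] with y hy using h y hy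
  rw [this.deriv_eq, deriv_const]

lemma IsCutoff.exists_data (h : IsCutoff χ) : ∃ C, SmoothCutoff χ C := by
  have s1 : ContDiff ℝ (⊤ : ℕ∞) (deriv χ) := (contDiff_infty_iff_deriv.1 h.smooth).2
  have s2 : ContDiff ℝ (⊤ : ℕ∞) (deriv (deriv χ)) := (contDiff_infty_iff_deriv.1 s1).2
  have z1 : ∀ x, x < 1 → deriv χ x = 0 := fun x hx =>
    deriv_eq_zero_of_const isOpen_Iio (s := Iio 1) hx h.eq_zero
  have z2 : ∀ x, x < 1 → deriv (deriv χ) x = 0 := fun x hx =>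
    deriv_eq_zero_of_const isOpen_Iio (s := Iio 1) hx z1
  have o1 : ∀ x, 2 < x → deriv χ x = 0 := fun x hx =>
    deriv_eq_zero_of_const isOpen_Ioi (s := Ioi 2) hx h.eq_one
  have o2 : ∀ x, 2 < x → deriv (deriv χ) x = 0 := fun x hx =>
    deriv_eq_zero_of_const isOpen_Ioi (s := Ioi 2) hx o1
  have bd : ∀ F : ℝ → ℝ, Continuous F → (∀ x, x < 1 → F x = 0) → (∀ x, 2 < x → |F x| ≤ 1) →
      ∃ C, ∀ x, |F x| ≤ C := fun F hF h0 h1 => by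
    obtain ⟨C, hC⟩ := (isCompact_Icc (a := (1 : ℝ)) (b := 2)).exists_bound_of_continuousOn
      hF.continuousOn
    refine ⟨max C 1, fun x => ?_⟩
    rcases lt_or_ge x 1 with hx | hx
    · grind
    · rcases lt_or_ge 2 x with hx2 | hx2
      · grind
      · exact le_max_of_le_left (hC x ⟨hx, hx2⟩)
  obtain ⟨C0, h0⟩ := bd χ h.smooth.continuous h.eq_zero fun x hx => by rw [h.eq_one x hx]; simp
  obtain ⟨C1, h1⟩ := bd _ s1.continuous z1 fun x hx => by rw [o1 x hx]; simp
  obtain ⟨C2, h2⟩ := bd _ s2.continuous z2 fun x hx => by rw [o2 x hx]; simp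
  refine ⟨max (max C0 C1) (max C2 1), le_max_of_le_right (le_max_right _ _),
    fun x => (h.smooth.differentiable (by simp) x).hasDerivAt,
    fun x => (s1.differentiable (by simp) x).hasDerivAt, s2.continuous,
    fun x => (h0 x).trans (le_max_of_le_left (le_max_left _ _)),
    fun x => (h1 x).trans (le_max_of_le_left (le_max_right _ _)),
    fun x => (h2 x).trans (le_max_of_le_right (le_max_left _ _)), h.eq_zero, z1, z2, h.eq_one, o1,
    o2⟩

/-- The leading part of the ansatz on the positive half-line. -/
def leadPart (χ : ℝ → ℝ) (a : ℝ) (A : ℂ) (x : ℝ) : ℂ := χ x*A*logOsc a 1 x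

/-- The derivative of `leadPart`. -/
def leadPart' (χ χ₁ : ℝ → ℝ) (a : ℝ) (A : ℂ) (x : ℝ) : ℂ :=
  (χ₁ x + I*a/x*χ x)*A*logOsc a 1 x

/-- The second derivative of `leadPart`. -/
def leadPart'' (χ χ₁ χ₂ : ℝ → ℝ) (a : ℝ) (A : ℂ) (x : ℝ) : ℂ :=
  (χ₂ x + 2*(I*a/x)*χ₁ x - (I*a + a^2)/x^2*χ x)*A*logOsc a 1 x

/-- The oscillating function `e^{3ia ln x - 8ix³/9}`. -/
def fastOsc (a x : ℝ) : ℂ := cis(3*a*log |x| - 8/9*x^3)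

/-- The correction in the ansatz on the positive half-line. -/
def fastPart (χ : ℝ → ℝ) (a : ℝ) (B : ℂ) (x : ℝ) : ℂ := χ x/x^3*B*fastOsc a x

/-- The derivative of `fastPart`. -/
def fastPart' (χ χ₁ : ℝ → ℝ) (a : ℝ) (B : ℂ) (x : ℝ) : ℂ :=
  (χ₁ x/x^3 + ((3*I*a - 3)/x^4 - 8/3*I/x)*χ x)*B*fastOsc a x

lemma norm_logOsc (a s x : ℝ) : ‖logOsc a s x‖ = 1 := by
  rw [logOsc, norm_exp_ofReal_mul_I]

lemma norm_fastOsc (a x : ℝ) : ‖fastOsc a x‖ = 1 := by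
  rw [fastOsc, norm_exp_ofReal_mul_I]

lemma fastOsc_eq (a x : ℝ) : fastOsc a x = logOsc a 3 x*cis(-(8/9)*x^3) := by
  rw [fastOsc, logOsc, ← exp_add]; congr 1; push_cast; ring

lemma hasDerivAt_logOsc (a : ℝ) (hx : 0 < x) : HasDerivAt (logOsc a 1) (I*a/x*logOsc a 1 x) x := by
  have h1 : HasDerivAt (fun y : ℝ => 1*a*log |y|) (1*a*x⁻¹) x := by
    simp only [Real.log_abs]
    exact (Real.hasDerivAt_log hx.ne').const_mul _
  refine ((h1.ofReal_comp.mul_const I).cexp).congr_deriv ?_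
  rw [logOsc]; push_cast; ring

lemma hasDerivAt_fastOsc (a : ℝ) (hx : 0 < x) :
    HasDerivAt (fastOsc a) ((3*I*a/x - 8/3*I*x^2)*fastOsc a x) x := by
  have h1 : HasDerivAt (fun y : ℝ => 3*a*log |y| - 8/9*y^3) (3*a*x⁻¹ - 8/9*(3*x^2)) x := by
    simp only [Real.log_abs]
    refine ((Real.hasDerivAt_log hx.ne').const_mul _).sub ?_
    simpa using (hasDerivAt_pow 3 x).const_mul (8/9)
  refine ((h1.ofReal_comp.mul_const I).cexp).congr_deriv ?_
  rw [fastOsc]; push_cast; ring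

section
variable {χ₁ χ₂ : ℝ → ℝ} {B : ℂ}

lemma CutoffData.norm_le (h : CutoffData χ χ₁ χ₂ C) (hx : 1 ≤ x) :
    ‖(χ x : ℂ)‖ ≤ C ∧ ‖(χ₁ x : ℂ)‖ ≤ 3*C*(1 + |x|)⁻¹ ∧ ‖(χ₁ x : ℂ)‖ ≤ C ∧ ‖(χ₂ x : ℂ)‖ ≤
      9*C*((1 + |x|)⁻¹*(1 + |x|)⁻¹) ∧ 0 < (1 + |x|)⁻¹ ∧ (1 + |x|)⁻¹ ≤ 1 ∧ x⁻¹ ≤ 2*(1 + |x|)⁻¹ ∧ 0 <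
      x⁻¹ ∧ x⁻¹ ≤ 1 := by
  have hC := h.one_le
  have h0 : 0 < x := by linarith
  simp only [norm_real, norm_eq_abs]
  rw [abs_of_pos h0]
  have hr : 0 < (1 + x)⁻¹ := by positivity
  refine ⟨h.bd x, ?_, h.bd' x, ?_, hr, inv_le_one_of_one_le₀ (by linarith), ?_, by positivity,
    inv_le_one_of_one_le₀ hx⟩
  · rcases lt_or_ge 2 x with h2 | h2
    · rw [h.one' x h2, abs_zero]; positivity
    · rw [← div_eq_mul_inv, le_div_iff₀ (by positivity)]
      nlinarith [h.bd' x, abs_nonneg (χ₁ x)]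
  · rcases lt_or_ge 2 x with h2 | h2
    · rw [h.one'' x h2, abs_zero]; positivity
    · rw [← mul_inv, ← div_eq_mul_inv, le_div_iff₀ (by positivity)]
      have : (1 + x)*(1 + x) ≤ 9 := by nlinarith
      nlinarith [h.bd'' x, abs_nonneg (χ₂ x)]
  · rw [← div_eq_mul_inv, inv_eq_one_div, div_le_div_iff₀ h0 (by positivity)]; linarith

lemma leadPart_eq_zero (h : CutoffData χ χ₁ χ₂ C) (hx : x < 1) : leadPart χ a A x = 0 := by
  simp [leadPart, h.zero x hx]

lemma leadPart'_eq_zero (h : CutoffData χ χ₁ χ₂ C) (hx : x < 1) : leadPart' χ χ₁ a A x = 0 := by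
  simp [leadPart', h.zero x hx, h.zero' x hx]

lemma leadPart''_eq_zero (h : CutoffData χ χ₁ χ₂ C) (hx : x < 1) : leadPart'' χ χ₁ χ₂ a A x = 0 :=
    by
  simp [leadPart'', h.zero x hx, h.zero' x hx, h.zero'' x hx]

lemma fastPart_eq_zero (h : CutoffData χ χ₁ χ₂ C) (hx : x < 1) : fastPart χ a B x = 0 := by
  simp [fastPart, h.zero x hx]

lemma fastPart'_eq_zero (h : CutoffData χ χ₁ χ₂ C) (hx : x < 1) : fastPart' χ χ₁ a B x = 0 := by
  simp [fastPart', h.zero x hx, h.zero' x hx]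

lemma hasDerivAt_leadPart (h : CutoffData χ χ₁ χ₂ C) (hx : 0 < x) :
    HasDerivAt (leadPart χ a A) (leadPart' χ χ₁ a A x) x := by
  refine (((h.deriv x).ofReal_comp.mul_const A).mul (hasDerivAt_logOsc a hx)).congr_deriv ?_
  rw [leadPart']; ring

lemma hasDerivAt_leadPart' (h : CutoffData χ χ₁ χ₂ C) (hx : 0 < x) :
    HasDerivAt (leadPart' χ χ₁ a A) (leadPart'' χ χ₁ χ₂ a A x) x := by
  have hx0 : (x : ℂ) ≠ 0 := by exact_mod_cast hx.ne'
  have h1 : HasDerivAt (fun y : ℝ => I*a/(y : ℂ)) (-(I*a/x^2)) x := by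
    have := ((hasDerivAt_id x).ofReal_comp.inv hx0).const_mul (I*a)
    refine this.congr_deriv ?_
    simp only [id]; push_cast; ring
  refine (((((h.deriv' x).ofReal_comp).add (h1.mul (h.deriv x).ofReal_comp)).mul_const A).mul
    (hasDerivAt_logOsc a hx)).congr_deriv ?_
  rw [leadPart'']
  have hI := I_sq
  simp only [Pi.add_apply, Pi.mul_apply]
  grind

lemma hasDerivAt_fastPart (h : CutoffData χ χ₁ χ₂ C) (hx : 0 < x) :
    HasDerivAt (fastPart χ a B) (fastPart' χ χ₁ a B x) x := by
  have hx0 : (x : ℂ) ≠ 0 := by exact_mod_cast hx.ne'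
  have h1 := ((hasDerivAt_id x).ofReal_comp.pow 3)
  refine ((((h.deriv x).ofReal_comp.div h1 (pow_ne_zero 3 hx0)).mul_const B).mul
    (hasDerivAt_fastOsc a hx)).congr_deriv ?_
  rw [fastPart']
  simp only [id, Pi.pow_apply, Pi.div_apply]
  push_cast
  field_simp
  ring

lemma continuousOn_leadPart'' (h : CutoffData χ χ₁ χ₂ C) :
    ContinuousOn (leadPart'' χ χ₁ χ₂ a A) (Ioi 0) := by
  have c0 : Continuous χ := continuous_iff_continuousAt.2 fun x => (h.deriv x).continuousAt
  have c1 : Continuous χ₁ := continuous_iff_continuousAt.2 fun x => (h.deriv' x).continuousAt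
  have c2 := h.cont
  have ne : ∀ x ∈ Ioi (0 : ℝ), (x : ℂ) ≠ 0 := fun x hx => by exact_mod_cast (ne_of_gt hx)
  have cl : ContinuousOn (logOsc a 1) (Ioi 0) := fun x hx =>
    (hasDerivAt_logOsc a hx).continuousAt.continuousWithinAt
  refine ContinuousOn.mul (ContinuousOn.mul (ContinuousOn.sub (ContinuousOn.add (by fun_prop)
    (ContinuousOn.mul (continuousOn_const.mul (continuousOn_const.div (by fun_prop) ne))
      (by fun_prop))) (ContinuousOn.mul (continuousOn_const.div (by fun_prop)
        fun x hx => pow_ne_zero 2 (ne x hx)) (by fun_prop))) continuousOn_const) cl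

lemma continuousOn_fastPart' (h : CutoffData χ χ₁ χ₂ C) :
    ContinuousOn (fastPart' χ χ₁ a B) (Ioi 0) := by
  have c0 : Continuous χ := continuous_iff_continuousAt.2 fun x => (h.deriv x).continuousAt
  have c1 : Continuous χ₁ := continuous_iff_continuousAt.2 fun x => (h.deriv' x).continuousAt
  have ne : ∀ x ∈ Ioi (0 : ℝ), (x : ℂ) ≠ 0 := fun x hx => by exact_mod_cast (ne_of_gt hx)
  have cl : ContinuousOn (fastOsc a) (Ioi 0) := fun x hx =>
    (hasDerivAt_fastOsc a hx).continuousAt.continuousWithinAt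
  refine ContinuousOn.mul (ContinuousOn.mul (ContinuousOn.add (ContinuousOn.div (by fun_prop)
    (by fun_prop) fun x hx => pow_ne_zero 3 (ne x hx)) (ContinuousOn.mul (ContinuousOn.sub
      (continuousOn_const.div (by fun_prop) fun x hx => pow_ne_zero 4 (ne x hx))
      (continuousOn_const.div (by fun_prop) ne)) (by fun_prop))) continuousOn_const) cl

lemma smoothSymb_leadPart (h : CutoffData χ χ₁ χ₂ C) (ha : |a| ≤ 1) :
    SmoothSymb (40*C*‖A‖) (leadPart χ a A) (leadPart' χ χ₁ a A) (leadPart'' χ χ₁ χ₂ a A) := by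
  have hC := h.one_le
  have z0 := fun x (hx : x < 1) => leadPart_eq_zero (a := a) (A := A) h hx
  have z1 := fun x (hx : x < 1) => leadPart'_eq_zero (a := a) (A := A) h hx
  have z2 := fun x (hx : x < 1) => leadPart''_eq_zero (a := a) (A := A) h hx
  have d1 := fun x (hx : 0 < x) => hasDerivAt_leadPart (a := a) (A := A) h hx
  have d2 := fun x (hx : 0 < x) => hasDerivAt_leadPart' (a := a) (A := A) h hx
  have c1 : ContinuousOn (leadPart' χ χ₁ a A) (Ioi 0) := fun x hx =>
    (d2 x hx).continuousAt.continuousWithinAt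
  have c2 := continuousOn_leadPart'' (a := a) (A := A) h
  have b0 : ∀ x, 1 ≤ x → ‖leadPart χ a A x‖ ≤ C*‖A‖ := fun x hx => by
    rw [leadPart, norm_mul, norm_mul, norm_logOsc, mul_one]
    gcongr; exact (h.norm_le hx).1
  have na : ∀ x : ℝ, 1 ≤ x → ‖I*a/x‖ ≤ x⁻¹ := fun x hx => by
    rw [norm_div, norm_mul, norm_I, norm_real, norm_real, one_mul,
      norm_eq_abs, norm_eq_abs, abs_of_pos (by linarith : 0 < x), div_eq_mul_inv]
    have : 0 < x⁻¹ := (h.norm_le hx).2.2.2.2.2.2.2.1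
    nlinarith
  have b1 : ∀ x, 1 ≤ x → ‖leadPart' χ χ₁ a A x‖ ≤ 5*C*‖A‖*(1 + |x|)⁻¹ := fun x hx => by
    obtain ⟨n0, n1, -, -, hr, -, hi, hi0, -⟩ := h.norm_le hx
    rw [leadPart', norm_mul, norm_mul, norm_logOsc, mul_one]
    have : ‖(χ₁ x : ℂ) + I*a/x*χ x‖ ≤ 3*C*(1 + |x|)⁻¹ + 2*(1 + |x|)⁻¹*C := by
      refine norm_add_le_of_le n1 ?_
      rw [norm_mul]
      exact mul_le_mul ((na x hx).trans hi) n0 (norm_nonneg _) (by positivity)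
    calc _ ≤ (3*C*(1 + |x|)⁻¹ + 2*(1 + |x|)⁻¹*C)*‖A‖ := by gcongr
      _ = _ := by ring
  have b2 : ∀ x, 1 ≤ x → ‖leadPart'' χ χ₁ χ₂ a A x‖ ≤
      30*C*‖A‖*((1 + |x|)⁻¹*(1 + |x|)⁻¹) := fun x hx => by
    obtain ⟨n0, n1, -, n2, hr, -, hi, hi0, -⟩ := h.norm_le hx
    rw [leadPart'', norm_mul, norm_mul, norm_logOsc, mul_one]
    set r := (1 + |x|)⁻¹
    have t1 : ‖2*(I*a/x)*χ₁ x‖ ≤ 2*(2*r)*(3*C*r) := by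
      rw [norm_mul, norm_mul, norm_ofNat]
      have := (na x hx).trans hi
      gcongr
    have t2 : ‖(I*a + a^2)/x^2*χ x‖ ≤ 2*(2*r*(2*r))*C := by
      rw [norm_mul, norm_div, norm_pow, norm_real, norm_eq_abs, abs_of_pos
        (by linarith : 0 < x), div_eq_mul_inv, show (x^2)⁻¹ = x⁻¹*x⁻¹ by rw [sq, mul_inv]]
      have : ‖I*a + a^2‖ ≤ 2 := by
        refine (norm_add_le _ _).trans ?_
        rw [norm_mul, norm_I, norm_pow, norm_real, norm_eq_abs]
        nlinarith [abs_nonneg a]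
      gcongr
    have t3 := norm_sub_le ((χ₂ x : ℂ) + 2*(I*a/x)*χ₁ x) ((I*a + a^2)/x^2*χ x)
    have t4 := norm_add_le (χ₂ x : ℂ) (2*(I*a/x)*χ₁ x)
    have hrr : 0 ≤ C*(r*r) := by positivity
    calc _ ≤ (30*C*(r*r))*‖A‖ := by
          gcongr
          linarith
      _ = _ := by ring
  have w1 : ∀ x : ℝ, (1 + |x|)^(-(1 : ℝ)) = (1 + |x|)⁻¹ := fun x => rpow_neg_one _
  have w0 : ∀ x : ℝ, (1 + |x|)^(-(0 : ℝ)) = 1 := fun x => by simp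
  have hCA : 0 ≤ C*‖A‖ := by positivity
  have b1' : ∀ x : ℝ, 1 ≤ x → ‖(x : ℂ)*leadPart' χ χ₁ a A x‖ ≤ 5*C*‖A‖ := fun x hx => by
    rw [norm_mul, norm_real, norm_eq_abs]
    calc _ ≤ (1 + |x|)*(5*C*‖A‖*(1 + |x|)⁻¹) := by gcongr; exacts [by linarith, b1 x hx]
      _ = _ := by field_simp
  have b2' : ∀ x : ℝ, 1 ≤ x → ‖(x : ℂ)*leadPart'' χ χ₁ χ₂ a A x‖ ≤ 30*C*‖A‖*(1 + |x|)⁻¹ :=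
    fun x hx => by
    rw [norm_mul, norm_real, norm_eq_abs]
    calc _ ≤ (1 + |x|)*(30*C*‖A‖*((1 + |x|)⁻¹*(1 + |x|)⁻¹)) := by
          gcongr; exacts [by linarith, b2 x hx]
      _ = _ := by field_simp
  have fin : ∀ x, 1 ≤ x → (0 < (1 + |x|)⁻¹ ∧ (1 + |x|)⁻¹ ≤ 1) ∧ 0 ≤ C*‖A‖*(1 + |x|)⁻¹ ∧
      C*‖A‖*(1 + |x|)⁻¹ ≤ C*‖A‖ ∧
      C*‖A‖*((1 + |x|)⁻¹*(1 + |x|)⁻¹) ≤ C*‖A‖*(1 + |x|)⁻¹ := fun x hx => by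
    obtain ⟨-, -, -, -, hr, hr1, -⟩ := h.norm_le hx
    refine ⟨⟨hr, hr1⟩, by positivity, mul_le_of_le_one_right hCA hr1, ?_⟩
    gcongr; exact mul_le_of_le_one_right hr.le hr1
  refine ⟨adm_of_cut (by positivity) z0 z1 d1 c1 (fun x hx => ?_) fun x hx => ?_,
    adm_of_cut (by positivity) z1 z2 d2 c2 (fun x hx => ?_) fun x hx => ?_,
    adm_of_cut (by positivity) (fun x hx => by rw [z1 x hx, mul_zero])
      (fun x hx => by rw [z1 x hx, z2 x hx]; ring)
      (fun x hx => ((hasDerivAt_id x).ofReal_comp.mul (d2 x hx)).congr_deriv (by simp)) (by fun_prop)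
      (fun x hx => ?_) fun x hx => ?_, hasDerivAt_of_cut z0 z1 d1, continuous_of_cut z1 c1,
    z0 0 one_pos, z1 0 one_pos⟩
  · rw [w0]; linarith [b0 x hx]
  · rw [w1]; linarith [b1 x hx, (fin x hx).2.1]
  · rw [w0]; linarith [b1 x hx, (fin x hx).2.2.1]
  · rw [w1]; linarith [b2 x hx, (fin x hx).2.2.2, (fin x hx).2.1]
  · rw [w0]; linarith [b1' x hx]
  · rw [w1]
    refine (norm_add_le _ _).trans ?_
    linarith [b1 x hx, b2' x hx, (fin x hx).2.1]

lemma adm_fastPart (h : CutoffData χ χ₁ χ₂ C) (ha : |a| ≤ 1) :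
    Adm 3 1 (40*C*‖B‖) (fastPart χ a B) (fastPart' χ χ₁ a B) := by
  have hC := h.one_le
  refine adm_of_cut (by positivity) (fun x hx => fastPart_eq_zero h hx)
    (fun x hx => fastPart'_eq_zero h hx) (fun x hx => hasDerivAt_fastPart h hx)
    (continuousOn_fastPart' h) (fun x hx => ?_) fun x hx => ?_
  · obtain ⟨n0, -, -, -, hr, hr1, hi, hi0, hi1⟩ := h.norm_le hx
    rw [rpow_neg (by positivity), show (3 : ℝ) = (3 : ℕ) by norm_num, rpow_natCast,
      ← inv_pow, fastPart, norm_mul, norm_mul, norm_fastOsc, mul_one, norm_div, norm_pow,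
      norm_real (x), norm_eq_abs x, abs_of_pos (by linarith : 0 < x), div_eq_mul_inv,
      ← inv_pow]
    rw [abs_of_pos (by linarith : 0 < x)] at hi hr
    calc _ ≤ C*(2*(1 + x)⁻¹)^3*‖B‖ := by gcongr
      _ = 8*(C*‖B‖*(1 + x)⁻¹^3) := by ring
      _ ≤ 40*(C*‖B‖*(1 + x)⁻¹^3) := by gcongr; norm_num
      _ = _ := by ring
  · obtain ⟨n0, n1, -, -, hr, hr1, hi, hi0, hi1⟩ := h.norm_le hx
    have hx0 : 0 < x := by linarith
    rw [rpow_neg_one, fastPart', norm_mul, norm_mul, norm_fastOsc, mul_one]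
    set r := (1 + |x|)⁻¹
    have p3 : x⁻¹^3 ≤ 1 := pow_le_one₀ hi0.le hi1
    have p4 : x⁻¹^4 ≤ x⁻¹ := by
      calc x⁻¹^4 = x⁻¹^3*x⁻¹ := by ring
        _ ≤ 1*x⁻¹ := by gcongr
        _ = _ := one_mul _
    have nx : ‖(x : ℂ)‖ = x := by rw [norm_real, norm_eq_abs, abs_of_pos hx0]
    have t1 : ‖(χ₁ x : ℂ)/x^3‖ ≤ 3*C*r := by
      rw [norm_div, norm_pow, nx, div_eq_mul_inv, ← inv_pow]
      calc _ ≤ 3*C*r*1 := by gcongr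
        _ = _ := mul_one _
    have t2 : ‖(3*I*a - 3)/(x : ℂ)^4‖ ≤ 12*r := by
      rw [norm_div, norm_pow, nx, div_eq_mul_inv, ← inv_pow]
      have : ‖3*I*a - 3‖ ≤ 6 := by
        refine (norm_sub_le _ _).trans ?_
        rw [norm_mul, norm_mul, norm_I, norm_real, norm_eq_abs, norm_ofNat]
        linarith
      calc _ ≤ 6*(2*r) := by gcongr; exact p4.trans hi
        _ = _ := by ring
    have t3 : ‖8/3*I/(x : ℂ)‖ ≤ 6*r := by
      rw [norm_div, norm_mul, norm_I, nx, div_eq_mul_inv]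
      norm_num
      linarith
    have t4 : ‖((3*I*a - 3)/(x : ℂ)^4 - 8/3*I/x)*χ x‖ ≤ (12*r + 6*r)*C := by
      rw [norm_mul]
      have := norm_sub_le_of_le t2 t3
      gcongr
    have t5 := norm_add_le_of_le t1 t4
    calc _ ≤ (3*C*r + (12*r + 6*r)*C)*‖B‖ := by gcongr
      _ = 21*(C*r*‖B‖) := by ring
      _ ≤ 40*(C*r*‖B‖) := by gcongr; norm_num
      _ = _ := by ring

lemma ansatz_eq (h : CutoffData χ χ₁ χ₂ C) (ε : ℝ) (A : ℂ) :
    ansatz ε χ A = fun x => leadPart χ (coefa ε A) A x + refl (leadPart χ (coefa ε A) A) x +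
      (fastPart χ (coefa ε A) (coefB ε A) x + refl (fastPart χ (coefa ε A) (coefB ε A)) x) := by
  have pos : ∀ x : ℝ, (χ x : ℂ)*logOsc (coefa ε A) 1 x*(A + coefB ε A*logOsc (coefa ε A) 2 x *
        (cis(-(8/9)*x^3)/(x : ℂ)^3)) =
      leadPart χ (coefa ε A) A x + fastPart χ (coefa ε A) (coefB ε A) x := fun x => by
    have e : logOsc (coefa ε A) 3 x = logOsc (coefa ε A) 1 x*logOsc (coefa ε A) 2 x := by
      rw [logOsc, logOsc, logOsc, ← exp_add]; congr 1; push_cast; ring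
    rw [leadPart, fastPart, fastOsc_eq, e]; ring
  funext x
  rw [ansatz]
  simp only [pos]
  split_ifs with hx
  · simp [refl, leadPart_eq_zero h (by linarith : -x < 1), fastPart_eq_zero h (by linarith : -x < 1)]
  · simp [refl, leadPart_eq_zero h (by linarith : x < 1), fastPart_eq_zero h (by linarith : x < 1)]

end

/-! ### Continuity of the trilinear operator -/

lemma Adm.continuousAt (hf : Adm p q N f f') (hx : x ≠ 0) : ContinuousAt f x := by
  rcases lt_or_gt_of_ne hx with h | h
  · have c := hf.neg.continuousOn_Icc (x := x - 1) (y := x/2)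
      (show x - 1 < 0 by linarith) (show x/2 < 0 by linarith) (by linarith)
    exact c.continuousAt (Icc_mem_nhds (by linarith) (by linarith))
  · have c := hf.pos.continuousOn_Icc (x := x/2) (y := x + 1)
      (show 0 < x/2 by linarith) (show 0 < x + 1 by linarith) (by linarith)
    exact c.continuousAt (Icc_mem_nhds (by linarith) (by linarith))

lemma continuousAt_integral_integrandJ (hf : Adm 0 1 Nf f f') (hg : Adm 0 1 Ng g g')
    (hh : Adm 0 1 Nh h h') (m ξ : ℝ) :
    ContinuousAt (fun ξ => ∫ η in -m..m, integrandJ h (opK f g) ξ η) ξ := by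
  have hb : IntervalIntegrable (fun η : ℝ => Nh*(66*(Nf*Ng)*|η|^(-(1/2) : ℝ))) volume (-m) m := by
    refine (IntervalIntegrable.const_mul ?_ _).const_mul _
    have : LocallyIntegrable (fun η : ℝ => |η|^(-(1/2) : ℝ)) volume := by
      refine locallyIntegrable_of_norm_le_rpow (C := 1) (α := 1/2) (by simp) (by norm_num)
        (.of_forall fun x => ?_) (Measurable.aestronglyMeasurable (by fun_prop))
      rw [one_mul, norm_eq_abs, norm_eq_abs, abs_of_nonneg (by positivity)]
    exact (this.integrableOn_isCompact isCompact_uIcc).intervalIntegrable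
  refine intervalIntegral.continuousAt_of_dominated_interval
    (bound := fun η => Nh*(66*(Nf*Ng)*|η|^(-(1/2) : ℝ))) ?_ ?_ hb ?_
  · exact .of_forall fun ξ =>
      (locallyIntegrable_integrandJ hf hg hh ξ).aestronglyMeasurable.restrict
  · refine .of_forall fun ξ => ?_
    have e1 : ∀ᵐ η : ℝ, η ≠ 0 := Measure.ae_ne volume 0
    have e2 : ∀ᵐ η : ℝ, η ≠ ξ := Measure.ae_ne volume ξ
    filter_upwards [e1, e2] with η h0 h1 _
    rw [integrandJ, norm_mul, norm_mul, norm_exp_ofReal_mul_I, one_mul, RCLike.norm_conj]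
    exact mul_le_mul (hh.le le_rfl (sub_ne_zero.2 h1)) (norm_opK_le' hf hg h0) (norm_nonneg _)
      hh.nonneg
  · filter_upwards [Measure.ae_ne volume ξ] with η h1 _
    unfold integrandJ
    have c1 : ContinuousAt (fun x => h (η - x)) ξ :=
      ContinuousAt.comp (f := fun x : ℝ => η - x) (hh.continuousAt (sub_ne_zero.2 h1)) (by fun_prop)
    have c2 : ContinuousAt (fun x => conj (h (η - x))) ξ := continuous_conj.continuousAt.comp c1
    refine ContinuousAt.mul (ContinuousAt.mul ?_ c2) continuousAt_const
    unfold phase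
    fun_prop

lemma continuousOn_triI (hf : Adm 0 1 Nf f f') (hg : Adm 0 1 Ng g g') (hh : Adm 0 1 Nh h h') :
    ContinuousOn (triI f g h) (Ioi 0) := by
  intro ξ hξ
  have hξ0 : 0 < ξ := hξ
  refine (ContinuousAt.mul continuousAt_const ?_).continuousWithinAt
  refine continuousAt_of_locally_uniform_approx_of_continuousAt fun u hu => ?_
  obtain ⟨δ, hδ, hδu⟩ := Metric.mem_uniformity_dist.1 hu
  have lim : Tendsto (fun m : ℝ => 22000*(Nf*Ng*Nh)*m^(-(4/5) : ℝ)) atTop (𝓝 0) := by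
    simpa using (tendsto_rpow_neg_atTop (by norm_num : (0 : ℝ) < 4/5)).const_mul
      (22000*(Nf*Ng*Nh))
  obtain ⟨m, hm1, hm2⟩ := ((lim.eventually (gt_mem_nhds hδ)).and
    (eventually_ge_atTop (max (16*ξ) 1))).exists
  refine ⟨Ioo 0 (2*ξ), Ioo_mem_nhds hξ0 (by linarith), _,
    continuousAt_integral_integrandJ hf hg hh m ξ, fun y hy => hδu ?_⟩
  rw [dist_eq_norm]
  refine (norm_opJ_sub_le hf hg hh hy.1 ?_).trans_lt hm1
  grind

/-! ### Functions on the positive half-line of prescribed decay -/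

/-- `D` is continuous on the positive half-line and bounded by `N (1 + x) ^ (-(1 + k))`. -/
structure Decay (k N : ℝ) (D : ℝ → ℂ) : Prop where
  cont : ContinuousOn D (Ioi 0)
  bd : ∀ x, 0 < x → ‖D x‖ ≤ N*(1 + |x|)^(-(1 + k))

/-- The primitive vanishing at infinity, extended by conjugation. -/
def prim (D : ℝ → ℂ) (x : ℝ) : ℂ :=
  if 0 < x then -∫ t in Ioi x, D t else conj (-∫ t in Ioi (-x), D t)

/-- The derivative of `prim D`. -/
def prim' (D : ℝ → ℂ) (x : ℝ) : ℂ := if 0 < x then D x else -conj (D (-x))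

lemma conjEven_prim (D : ℝ → ℂ) : ConjEven (prim D) := by
  intro x hx
  rcases lt_or_gt_of_ne hx with h | h
  · simp [refl, prim, h, h.le]
  · simp [refl, prim, h, not_lt.2 h.le]

lemma hasDerivAt_wt (hx : 0 < x) :
    HasDerivAt (fun t : ℝ => -(1 + t)^(-k)) (k*(1 + x)^(-(1 + k))) x := by
  have := ((hasDerivAt_rpow_const (p := -k) (.inl (by linarith : (1 + x) ≠ 0))).comp x
    ((hasDerivAt_id x).const_add 1)).neg
  refine this.congr_deriv ?_
  rw [show -(1 + k) = -k - 1 by ring]; simp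

lemma tendsto_wt (hk : 0 < k) : Tendsto (fun t : ℝ => -(1 + t)^(-k)) atTop (𝓝 0) := by
  have := ((tendsto_rpow_neg_atTop hk).comp (tendsto_atTop_add_const_left atTop (1 : ℝ)
    tendsto_id)).neg
  simpa using this

lemma continuousWithinAt_wt (hx : 0 ≤ x) :
    ContinuousWithinAt (fun t : ℝ => -(1 + t)^(-k)) (Ici x) x := by
  refine ContinuousAt.continuousWithinAt ?_
  exact (ContinuousAt.rpow_const (by fun_prop) (.inl (by linarith))).neg

lemma integrableOn_wt (hk : 0 < k) (hx : 0 ≤ x) :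
    IntegrableOn (fun t : ℝ => (1 + |t|)^(-(1 + k))) (Ioi x) := by
  have h1 : IntegrableOn (fun t : ℝ => k*(1 + t)^(-(1 + k))) (Ioi x) :=
    integrableOn_Ioi_deriv_of_nonneg (continuousWithinAt_wt hx)
      (fun t ht => hasDerivAt_wt (hx.trans_lt ht))
      (fun t ht => by have : 0 < t := hx.trans_lt ht; positivity) (tendsto_wt hk)
  refine IntegrableOn.congr_fun (f := fun t : ℝ => k⁻¹*(k*(1 + t)^(-(1 + k))))
    (Integrable.const_mul h1 k⁻¹) (fun t ht => ?_) measurableSet_Ioi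
  grind

lemma integral_wt (hk : 0 < k) (hx : 0 ≤ x) :
    ∫ t in Ioi x, (1 + |t|)^(-(1 + k)) = k⁻¹*(1 + |x|)^(-k) := by
  have h1 : ∫ t in Ioi x, k*(1 + t)^(-(1 + k)) = 0 - -(1 + x)^(-k) :=
    integral_Ioi_of_hasDerivAt_of_nonneg (continuousWithinAt_wt hx)
      (fun t ht => hasDerivAt_wt (hx.trans_lt ht))
      (fun t ht => by have : 0 < t := hx.trans_lt ht; positivity) (tendsto_wt hk)
  rw [integral_const_mul] at h1
  rw [abs_of_nonneg hx, setIntegral_congr_fun (g := fun t : ℝ => (1 + t)^(-(1 + k)))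
    measurableSet_Ioi (fun t ht => by grind)]
  grind

section
variable {D : ℝ → ℂ}

lemma Decay.integrableOn (hk : 0 < k) (h : Decay k N D) (hx : 0 ≤ x) : IntegrableOn D (Ioi x) := by
  refine Integrable.mono' ((integrableOn_wt hk hx).const_mul N)
    ((h.cont.mono (Ioi_subset_Ioi hx)).aestronglyMeasurable measurableSet_Ioi) ?_
  filter_upwards [ae_restrict_mem measurableSet_Ioi] with t ht using h.bd t (hx.trans_lt ht)

lemma Decay.norm_integral_le (hk : 1/2 ≤ k) (h : Decay k N D) (hx : 0 ≤ x) :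
    ‖∫ t in Ioi x, D t‖ ≤ 2*N*(1 + |x|)^(-k) := by
  have hk0 : 0 < k := by linarith
  have hN : 0 ≤ N := by
    have := (norm_nonneg _).trans (h.bd 1 one_pos)
    exact nonneg_of_mul_nonneg_left this (by positivity)
  calc _ ≤ ∫ t in Ioi x, N*(1 + |t|)^(-(1 + k)) :=
        norm_integral_le_of_norm_le ((integrableOn_wt hk0 hx).const_mul N) (by
          filter_upwards [ae_restrict_mem measurableSet_Ioi] with t ht using
            h.bd t (hx.trans_lt ht))
    _ = k⁻¹*(N*(1 + |x|)^(-k)) := by rw [integral_const_mul, integral_wt hk0 hx]; ring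
    _ ≤ 2*(N*(1 + |x|)^(-k)) := by
        gcongr
        rw [inv_le_comm₀ hk0 two_pos]; linarith
    _ = _ := by ring

lemma Decay.hasDerivAt_neg_integral (hk : 0 < k) (h : Decay k N D) (hx : 0 < x) :
    HasDerivAt (fun y => -∫ t in Ioi y, D t) (D x) x := by
  have hi := h.integrableOn hk (x := x/2) (by linarith)
  have e : (fun y => -∫ t in Ioi y, D t) =ᶠ[𝓝 x] fun y =>
      (∫ t in x/2..y, D t) - ∫ t in Ioi (x/2), D t := by
    filter_upwards [lt_mem_nhds (by linarith : x/2 < x)] with y hy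
    rw [← integral_Ioi_sub_Ioi' hi (hi.mono_set (Ioi_subset_Ioi hy.le))]
    ring
  refine HasDerivAt.congr_of_eventuallyEq (HasDerivAt.sub_const _ ?_) e
  refine intervalIntegral.integral_hasDerivAt_right ?_ ?_ (h.cont.continuousAt (Ioi_mem_nhds hx))
  · exact (intervalIntegrable_iff_integrableOn_Ioc_of_le (by linarith)).2
      (hi.mono_set Ioc_subset_Ioi_self)
  · exact h.cont.stronglyMeasurableAtFilter isOpen_Ioi x hx

lemma Decay.hasDerivAt_prim (hk : 0 < k) (h : Decay k N D) (hx : x ≠ 0) :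
    HasDerivAt (prim D) (prim' D x) x := by
  rcases lt_or_gt_of_ne hx with h0 | h0
  · have h1 := (h.hasDerivAt_neg_integral hk (x := -x) (by linarith)).scomp x (hasDerivAt_neg x)
    have h2 : HasDerivAt (fun y => conj (-∫ t in Ioi (-y), D t)) (prim' D x) x := by
      have := (Complex.conjCLE : ℂ ≃L[ℝ] ℂ).toContinuousLinearMap.hasFDerivAt.comp_hasDerivAt x h1
      refine this.congr_deriv ?_
      simp [prim', h0.le]
    refine h2.congr_of_eventuallyEq ?_
    filter_upwards [gt_mem_nhds h0] with y hy
    rw [prim, if_neg (not_lt.2 hy.le)]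
  · rw [prim', if_pos h0]
    refine (h.hasDerivAt_neg_integral hk h0).congr_of_eventuallyEq ?_
    filter_upwards [lt_mem_nhds h0] with y hy
    rw [prim, if_pos hy]

lemma Decay.adm_prim (hk : 1/2 ≤ k) (h : Decay k N D) : Adm k (1 + k) (2*N) (prim D) (prim' D) := by
  have hk0 : 0 < k := by linarith
  have hN : 0 ≤ N := by
    have := (norm_nonneg _).trans (h.bd 1 one_pos)
    exact nonneg_of_mul_nonneg_left this (by positivity)
  have cp : ContinuousOn (prim' D) (Ioi 0) := h.cont.congr fun x hx => if_pos hx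
  have cn : ContinuousOn (prim' D) (Iio 0) := by
    have : ContinuousOn (fun x => -conj (D (-x))) (Iio 0) :=
      (continuous_conj.comp_continuousOn (h.cont.comp continuousOn_neg
        fun x hx => by simpa using hx)).neg
    exact this.congr fun x hx => if_neg (not_lt.2 (le_of_lt hx))
  refine ⟨by positivity, ?_, ?_, fun x hx => ?_, fun x hx => ?_,
    ACOn.of_hasDerivAt (fun x hx => h.hasDerivAt_prim hk0 (ne_of_gt hx)) cp,
    ACOn.of_hasDerivAt (fun x hx => h.hasDerivAt_prim hk0 (ne_of_lt hx)) cn⟩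
  · exact measurable_of_continuousOn_compl_singleton 0 fun x hx =>
      (h.hasDerivAt_prim hk0 hx).continuousAt.continuousWithinAt
  · refine measurable_of_continuousOn_compl_singleton 0 fun x hx => ?_
    rcases lt_or_gt_of_ne hx with h0 | h0
    · exact (cn.continuousAt (Iio_mem_nhds h0)).continuousWithinAt
    · exact (cp.continuousAt (Ioi_mem_nhds h0)).continuousWithinAt
  · rcases lt_or_gt_of_ne hx with h0 | h0
    · rw [prim, if_neg (not_lt.2 h0.le), RCLike.norm_conj, norm_neg, ← abs_neg x]
      exact h.norm_integral_le hk (by linarith)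
    · rw [prim, if_pos h0, norm_neg]
      exact h.norm_integral_le hk h0.le
  · have hw : 0 ≤ N*(1 + |x|)^(-(1 + k)) := by positivity
    rcases lt_or_gt_of_ne hx with h0 | h0
    · rw [prim', if_neg (not_lt.2 h0.le), norm_neg, RCLike.norm_conj, ← abs_neg x] at *
      linarith [h.bd (-x) (by linarith)]
    · rw [prim', if_pos h0]
      linarith [h.bd x h0]

lemma prim_sub (hk : 0 < k) (h1 : Decay k N D₁) (h2 : Decay k M D₂) (x : ℝ) :
    prim D₁ x - prim D₂ x = prim (fun t => D₁ t - D₂ t) x := by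
  have e : ∀ y : ℝ, 0 ≤ y → ∫ t in Ioi y, (D₁ t - D₂ t) = (∫ t in Ioi y, D₁ t) - ∫ t in Ioi y, D₂ t :=
    fun y hy => integral_sub (h1.integrableOn hk hy) (h2.integrableOn hk hy)
  rcases lt_or_ge 0 x with h0 | h0
  · simp only [prim, if_pos h0]; rw [e x h0.le]; ring
  · simp only [prim, if_neg (not_lt.2 h0)]; grind

lemma Decay.mono (h : Decay k N D) (hNM : N ≤ M) : Decay k M D :=
  ⟨h.cont, fun x hx => (h.bd x hx).trans (by gcongr)⟩

/-- Banach's fixed point theorem in a ball of the space of functions of prescribed decay. -/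
lemma exists_decay_fixedPoint (hk : 0 ≤ k) (Φ : (ℝ → ℂ) → ℝ → ℂ)
    (hΦ : ∀ D, Decay k N D → Decay k N (Φ D)) (hc : ∀ D₁ D₂, Decay k N D₁ → Decay k N D₂ → ∀ δ,
    Decay k δ (fun x => D₁ x - D₂ x) → Decay k (δ/2) (fun x => Φ D₁ x - Φ D₂ x)) (hN : 0 ≤ N) :
    ∃ D, Decay k N D ∧ ∀ x, 0 < x → Φ D x = D x := by
  set u : ℕ → ℝ → ℂ := fun n => Φ^[n] 0 with hu
  have us : ∀ n, u (n + 1) = Φ (u n) := fun n => Function.iterate_succ_apply' Φ n 0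
  have ub : ∀ n, Decay k N (u n) := fun n => by
    induction n with
    | zero => exact ⟨continuousOn_const, fun x _ => by simp [hu]; positivity⟩
    | succ n ih => rw [us]; exact hΦ _ ih
  have ud : ∀ n, Decay k (2*N/2/2^n) (fun x => u n x - u (n + 1) x) := fun n => by
    induction n with
    | zero =>
      refine ⟨(ub 0).cont.sub (ub 1).cont, fun x hx => ?_⟩
      have h1 := (ub 1).bd x hx
      simp only [hu, Function.iterate_zero, id, Pi.zero_apply, zero_sub, norm_neg, zero_add] at *
      linarith
    | succ n ih =>
      have := hc _ _ (ub n) (ub (n + 1)) _ ih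
      rw [us (n + 1), us n]
      rw [us n] at this
      refine this.mono (le_of_eq ?_)
      rw [pow_succ]; ring
  have w1 : ∀ x : ℝ, (1 + |x|)^(-(1 + k)) ≤ 1 := fun x => wt_le_one (by linarith)
  have cau : ∀ x, 0 < x → ∀ n, dist (u n x) (u (n + 1) x) ≤
      2*(N*(1 + |x|)^(-(1 + k)))/2/2^n := fun x hx n => by
    rw [dist_eq_norm]
    refine ((ud n).bd x hx).trans_eq ?_; ring
  have lim : ∀ x, ∃ l, 0 < x → Tendsto (fun n => u n x) atTop (𝓝 l) := fun x => by
    by_cases hx : 0 < x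
    · obtain ⟨l, hl⟩ := cauchySeq_tendsto_of_complete (cauchySeq_of_le_geometric_two (cau x hx))
      grind
    · exact ⟨0, fun h => absurd h hx⟩
  choose D hD using lim
  have dist_le : ∀ n x, 0 < x → ‖u n x - D x‖ ≤ 2*N/2^n*(1 + |x|)^(-(1 + k)) := fun n x hx => by
    have := dist_le_of_le_geometric_two_of_tendsto (cau x hx) (hD x hx) n
    rw [dist_eq_norm] at this
    grind
  have t0 : Tendsto (fun n : ℕ => 2*N/2^n) atTop (𝓝 0) := by
    have := (tendsto_pow_atTop_nhds_zero_of_lt_one (by norm_num : (0 : ℝ) ≤ 1/2)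
      (by norm_num)).const_mul (2*N)
    simpa [div_eq_mul_inv] using this
  have cD : ContinuousOn D (Ioi 0) := by
    refine TendstoUniformlyOn.continuousOn (F := u) (p := atTop) ?_
      (Eventually.of_forall fun n => (ub n).cont).frequently
    refine Metric.tendstoUniformlyOn_iff.2 fun e he => ?_
    filter_upwards [t0.eventually (gt_mem_nhds he)] with n hn x hx
    rw [dist_comm, dist_eq_norm]
    refine (dist_le n x hx).trans_lt (lt_of_le_of_lt ?_ hn)
    exact mul_le_of_le_one_right (by positivity) (w1 x)
  have bD : Decay k N D := ⟨cD, fun x hx => by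
    exact le_of_tendsto (hD x hx).norm (.of_forall fun n => (ub n).bd x hx)⟩
  refine ⟨D, bD, fun x hx => ?_⟩
  have l1 : Tendsto (fun n => u (n + 1) x) atTop (𝓝 (D x)) :=
    (tendsto_add_atTop_iff_nat 1).2 (hD x hx)
  refine tendsto_nhds_unique ?_ l1
  rw [tendsto_iff_norm_sub_tendsto_zero]
  refine squeeze_zero (fun n => norm_nonneg _) (fun n => ?_) t0
  have := (hc _ _ (ub n) bD _ ⟨(ub n).cont.sub cD, fun x hx => dist_le n x hx⟩).bd x hx
  rw [us n]
  refine this.trans ?_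
  have : 0 ≤ 2*N/2^n := by positivity
  calc _ ≤ 2*N/2^n/2*1 := by gcongr; exact w1 x
    _ ≤ _ := by linarith

lemma eq_of_decay_half (hδ : Decay k δ (fun x => D₁ x - D₂ x))
    (h : ∀ δ, Decay k δ (fun x => D₁ x - D₂ x) → Decay k (δ/2) (fun x => D₁ x - D₂ x)) (hx : 0 < x)
    : D₁ x = D₂ x := by
  have hn : ∀ n : ℕ, Decay k (δ/2^n) (fun x => D₁ x - D₂ x) := fun n => by
    induction n with
    | zero => simpa using hδ
    | succ n ih => grind
  have t0 : Tendsto (fun n : ℕ => δ/2^n*(1 + |x|)^(-(1 + k))) atTop (𝓝 0) := by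
    have := (tendsto_pow_atTop_nhds_zero_of_lt_one (by norm_num : (0 : ℝ) ≤ 1/2)
      (by norm_num)).const_mul δ |>.mul_const ((1 + |x|)^(-(1 + k)))
    simpa [div_eq_mul_inv] using this
  have := ge_of_tendsto t0 (.of_forall fun n => (hn n).bd x hx)
  exact sub_eq_zero.1 (norm_le_zero_iff.1 this)

end

/-! ### The derivative of the fixed-point map -/

/-- The prefactor of the integral in `Psi`. -/
def prefactor (ε : ℝ) : ℂ := 3*I*ε/(4*π^2)

/-- The derivative of `PsiTilde ε χ A z` on the positive half-line. -/
def residual (ε : ℝ) (χ : ℝ → ℝ) (A : ℂ) (z : ℝ → ℂ) (ξ : ℝ) : ℂ :=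
  -(prefactor ε*cubicI (ansatz ε χ A + z) ξ) -
    (leadPart' χ (deriv χ) (coefa ε A) A ξ + fastPart' χ (deriv χ) (coefa ε A) (coefB ε A) ξ)

lemma norm_prefactor_le (hε : |ε| = 1) : ‖prefactor ε‖ ≤ 1 := by
  rw [prefactor, norm_div, norm_mul, norm_mul, norm_I, norm_real,
    norm_eq_abs, hε, norm_ofNat, norm_mul, norm_pow, norm_real,
    norm_eq_abs, abs_of_pos pi_pos, norm_ofNat, div_le_one (by positivity)]
  nlinarith [pi_gt_three]

lemma prefactor_ne_zero (hε : |ε| = 1) : prefactor ε ≠ 0 := by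
  have h0 : (ε : ℂ) ≠ 0 := by
    intro h
    rw [Complex.ofReal_eq_zero] at h
    simp [h] at hε
  have := pi_ne_zero
  refine div_ne_zero (mul_ne_zero (mul_ne_zero (by norm_num) Complex.I_ne_zero) h0) ?_
  simp

lemma abs_coefa_le (hε : |ε| = 1) (A : ℂ) : |coefa ε A| ≤ ‖A‖^2 := by
  rw [coefa, abs_mul, abs_neg, abs_div, abs_mul, hε, abs_of_pos (by positivity : 0 < 4*π),
    abs_of_nonneg (sq_nonneg ‖A‖), abs_of_pos (by norm_num : (0 : ℝ) < 3)]
  refine mul_le_of_le_one_left (by positivity) ?_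
  rw [div_le_one (by positivity)]
  linarith [pi_gt_three]

lemma norm_coefB_le (hε : |ε| = 1) (A : ℂ) : ‖coefB ε A‖ ≤ ‖A‖^3 := by
  have h3 : 1 ≤ √3 := one_le_sqrt.2 (by norm_num)
  rw [coefB, coefF, norm_mul, norm_mul, norm_mul, norm_logOsc, mul_one, norm_div, norm_div,
    norm_mul, norm_mul, norm_mul, norm_pow, norm_pow, norm_I, norm_real,
    norm_real, norm_real, norm_eq_abs, norm_eq_abs, hε,
    abs_of_pos pi_pos, norm_eq_abs, abs_of_pos (by positivity : 0 < √3), ← mul_assoc]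
  refine mul_le_of_le_one_left (by positivity) ?_
  simp only [norm_ofNat]
  rw [div_mul_div_comm, div_le_one (by positivity)]
  have := pi_gt_three
  nlinarith [pi_pos, sq_nonneg π]

lemma prefactor_mul_coefE (ε : ℝ) (A : ℂ) : prefactor ε*(π*(A^2*conj A)) = -(I*coefa ε A*A) := by
  have h : A^2*conj A = ((‖A‖^2 : ℝ) : ℂ)*A := by rw [← normSq_eq_norm_sq, ← mul_conj]; ring
  rw [h, prefactor, coefa]
  push_cast
  field_simp

lemma prefactor_mul_coefF (ε : ℝ) (A : ℂ) : prefactor ε*coefF ε A = 8/3*I*coefB ε A := by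
  rw [prefactor, coefB]
  field_simp
  ring

lemma SmoothSymb.mono (h : SmoothSymb N f f' f'') (hNM : N ≤ M) : SmoothSymb M f f' f'' := { h with
    adm := h.adm.mono le_rfl le_rfl hNM
    adm_deriv := h.adm_deriv.mono le_rfl le_rfl hNM
    adm_euler := h.adm_euler.mono le_rfl le_rfl hNM }

lemma ansatz_add_eq (h : SmoothCutoff χ C) (ε : ℝ) (A : ℂ) (z : ℝ → ℂ) :
    ansatz ε χ A + z = fun x => leadPart χ (coefa ε A) A x + refl (leadPart χ (coefa ε A) A) x +
      (fastPart χ (coefa ε A) (coefB ε A) x + refl (fastPart χ (coefa ε A) (coefB ε A)) x) + z x :=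
      by
  rw [ansatz_eq h]; rfl

/-- The size of the ansatz with a perturbation of size `ρ`. -/
def profileSize (C : ℝ) (A : ℂ) (ρ : ℝ) : ℝ := 80*C*(‖A‖ + ρ)

lemma coefa_le_one (hε : |ε| = 1) (hA : ‖A‖ ≤ 1) : |coefa ε A| ≤ 1 :=
  (abs_coefa_le hε A).trans (pow_le_one₀ (norm_nonneg _) hA)

lemma norm_coefB_le_norm (hε : |ε| = 1) (hA : ‖A‖ ≤ 1) : ‖coefB ε A‖ ≤ ‖A‖ :=
  (norm_coefB_le hε A).trans (pow_le_of_le_one (norm_nonneg _) hA three_ne_zero)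

lemma lead_smoothSymb (h : SmoothCutoff χ C) (hε : |ε| = 1) (hA : ‖A‖ ≤ 1) (hρ : 0 ≤ ρ) :
    ∃ f' f'', SmoothSymb (profileSize C A ρ) (fun x => leadPart χ (coefa ε A) A x + refl (leadPart χ
      (coefa ε A) A) x) f' f'' := by
  have h1 := smoothSymb_leadPart (A := A) h (coefa_le_one hε hA)
  have hC := h.one_le
  refine ⟨_, _, (h1.add h1.refl).mono ?_⟩
  have : 0 ≤ C*ρ := by positivity
  rw [profileSize]; linarith

lemma fast_adm (h : SmoothCutoff χ C) (hε : |ε| = 1) (hA : ‖A‖ ≤ 1) (hρ : 0 ≤ ρ) :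
    ∃ b', Adm 3 1 (profileSize C A ρ) (fun x => fastPart χ (coefa ε A) (coefB ε A) x + refl
      (fastPart χ (coefa ε A) (coefB ε A)) x) b' := by
  have h1 := adm_fastPart (B := coefB ε A) h (coefa_le_one hε hA)
  have hC := h.one_le
  refine ⟨_, (h1.add h1.refl).mono le_rfl le_rfl ?_⟩
  have : 0 ≤ C*ρ := by positivity
  have : C*‖coefB ε A‖ ≤ C*‖A‖ := by gcongr; exact norm_coefB_le_norm hε hA
  rw [profileSize]; linarith

lemma le_profileSize (h : SmoothCutoff χ C) (hρ : 0 ≤ ρ) : ρ ≤ profileSize C A ρ := by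
  have hC := h.one_le
  have : ρ ≤ C*ρ := le_mul_of_one_le_left hρ hC
  have : 0 ≤ C*‖A‖ := by positivity
  rw [profileSize]; linarith

lemma norm_leadPart'_sub_le (h : SmoothCutoff χ C) (a : ℝ) (hξ : 0 < ξ) :
    ‖leadPart' χ (deriv χ) a A ξ - A*deriv χ ξ‖ ≤ 2*C*‖A‖*|a| := by
  have hC := h.one_le
  rcases lt_or_ge ξ 1 with h1 | h1
  · rw [leadPart'_eq_zero h h1, h.zero' ξ h1]; simp; positivity
  have e : leadPart' χ (deriv χ) a A ξ - A*deriv χ ξ =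
      deriv χ ξ*A*(logOsc a 1 ξ - 1) + I*a/ξ*χ ξ*A*logOsc a 1 ξ := by
    rw [leadPart']; ring
  have t1 : ‖((deriv χ ξ : ℝ) : ℂ)*A*(logOsc a 1 ξ - 1)‖ ≤ C*‖A‖*|a| := by
    rcases lt_or_ge 2 ξ with h2 | h2
    · rw [h.one' ξ h2]; simp; positivity
    rw [norm_mul, norm_mul]
    gcongr
    · exact (h.norm_le h1).2.2.1
    · rw [logOsc, one_mul, mul_comm]
      refine (Real.norm_exp_I_mul_ofReal_sub_one_le).trans ?_
      rw [norm_eq_abs, abs_mul]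
      refine mul_le_of_le_one_right (abs_nonneg a) ?_
      rw [abs_of_pos hξ, abs_of_nonneg (Real.log_nonneg h1)]
      exact (Real.log_le_sub_one_of_pos hξ).trans (by linarith)
  have t2 : ‖I*a/ξ*χ ξ*A*logOsc a 1 ξ‖ ≤ C*‖A‖*|a| := by
    rw [norm_mul, norm_logOsc, mul_one, norm_mul, norm_mul, norm_div, norm_mul, norm_I,
      norm_real, one_mul, norm_eq_abs, norm_real, norm_eq_abs,
      abs_of_pos hξ]
    have : |a|/ξ ≤ |a| := div_le_self (abs_nonneg a) h1
    calc _ ≤ |a| * C*‖A‖ := by gcongr; exact (h.norm_le h1).1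
      _ = _ := by ring
  rw [e]
  linarith [norm_add_le_of_le t1 t2]

lemma norm_residual_add_le (h : SmoothCutoff χ C) (hε : |ε| = 1) (hA : ‖A‖ ≤ 1) (hk : 1/2 ≤ k)
    (hk1 : k ≤ 7/10) (hz : Adm k (1 + k) ρ z z') (ez : ConjEven z) (hξ : 0 < ξ) :
    ‖residual ε χ A z ξ + A*deriv χ ξ‖ ≤ 2000000000000000*profileSize C A ρ^3*(1 + |ξ|)^(-(1 + k))
      := by
  have hC := h.one_le
  have hρ := hz.nonneg
  obtain ⟨b', hb⟩ := fast_adm h hε hA hρ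
  obtain ⟨s', s'', hs⟩ := lead_smoothSymb h hε hA hρ
  have hle : ρ ≤ profileSize C A ρ := le_profileSize h hρ
  have hf := (smoothSymb_leadPart (A := A) h (coefa_le_one hε hA)).mono (M := profileSize C A ρ) (by
      have : 0 ≤ C*ρ := by positivity
      have : 0 ≤ C*‖A‖ := by positivity
      rw [profileSize]; linarith)
  set N := profileSize C A ρ with hN
  set a := coefa ε A with ha
  set B := coefB ε A with hB
  have hN0 : 0 ≤ N := hρ.trans hle
  have hA3 : C*‖A‖^3*512000 ≤ N^3 := by
    have h1 : (80*C*‖A‖)^3 ≤ N^3 := by rw [hN, profileSize]; gcongr; linarith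
    have h2 : C ≤ C^3 := le_self_pow₀ hC three_ne_zero
    calc _ ≤ C^3*‖A‖^3*512000 := by gcongr
      _ = (80*C*‖A‖)^3 := by ring
      _ ≤ _ := h1
  have hB3 : ‖B‖ ≤ ‖A‖^3 := norm_coefB_le hε A
  have hA0 : 0 ≤ ‖A‖^3 := by positivity
  have hCA : ‖A‖^3 ≤ C*‖A‖^3 := le_mul_of_one_le_left hA0 hC
  have hκ := norm_prefactor_le hε
  have key := norm_le_of_small_of_large (X := residual ε χ A z ξ + A*deriv χ ξ) (k := k)
    (c₁ := 10000000000002*N^3) (c₂ := 10000000000001*N^3) (by linarith)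
    (by linarith) hξ (by positivity) (by positivity) (fun h8 => ?_) fun h8 => ?_
  · have : 0 ≤ N^3*(1 + |ξ|)^(-(1 + k)) := by positivity
    nlinarith
  · have hp := adm_profile (by linarith) hs hb (hz.mono le_rfl le_rfl hle)
    have t1 := norm_triI_le_of_le_eight hp hp hp hξ h8
    have t2 := norm_leadPart'_sub_le (A := A) h a hξ
    have t3 : ‖fastPart' χ (deriv χ) a B ξ‖ ≤ 40*C*‖B‖ :=
      (adm_fastPart h (coefa_le_one hε hA)).le' zero_le_one hξ.ne'
    have e : residual ε χ A z ξ + A*deriv χ ξ = -(prefactor ε*cubicI (ansatz ε χ A + z) ξ) -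
        (leadPart' χ (deriv χ) a A ξ - A*deriv χ ξ) - fastPart' χ (deriv χ) a B ξ := by
      rw [residual]; ring
    rw [e, ansatz_add_eq h]
    refine norm_sub_le_of_le (norm_sub_le_of_le (r₁ := 96000*(3*N*(3*N)*(3*N))) ?_ t2) t3 |>.trans ?_
    · rw [norm_neg, norm_mul]
      exact (mul_le_of_le_one_left (norm_nonneg _) hκ).trans t1
    · have h1 : C*‖A‖*|a| ≤ C*‖A‖*‖A‖^2 := by gcongr; exact abs_coefa_le hε A
      have h2 : C*‖B‖ ≤ C*‖A‖^3 := by gcongr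
      linarith
  · have t1 := norm_cubicI_profile_sub_le hk hk1 hf (fun x hx => leadPart_eq_zero h hx) hb
      (conjEven_add_refl _) (hz.mono le_rfl le_rfl hle) ez h8
    set X : ℂ := (π/ξ : ℝ)*(leadPart χ a A ξ^2*conj (leadPart χ a A ξ)) +
      I*(π/(√3*ξ) : ℝ)*(cis(-(8/9)*ξ^3)*leadPart χ a A (ξ/3)^3) with hX
    have e1 : prefactor ε*X = -(I*a/ξ*A*logOsc a 1 ξ) + 8/3*I/ξ*B*fastOsc a ξ := by
      have l1 : logOsc a 1 ξ^2*conj (logOsc a 1 ξ) = logOsc a 1 ξ := by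
        have := mul_conj (logOsc a 1 ξ)
        rw [normSq_eq_norm_sq, norm_logOsc] at this
        rw [sq, mul_assoc, this]; simp
      have l2 : logOsc a 1 (ξ/3)^3 = logOsc a 3 ξ*logOsc a (-3) 3 := by
        rw [logOsc, logOsc, logOsc, ← Complex.exp_nat_mul, ← exp_add, abs_of_pos hξ,
          abs_of_pos (by linarith : 0 < ξ/3), Real.log_div hξ.ne' (by norm_num),
          abs_of_pos (by norm_num : (0 : ℝ) < 3)]
        congr 1; push_cast; ring
      have m1 : leadPart χ a A ξ = A*logOsc a 1 ξ := by rw [leadPart, h.one ξ (by linarith)]; simp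
      have m2 : leadPart χ a A (ξ/3) = A*logOsc a 1 (ξ/3) := by
        rw [leadPart, h.one (ξ/3) (by linarith)]; simp
      have c1 := prefactor_mul_coefE ε A
      have c2 := prefactor_mul_coefF ε A
      rw [coefF] at c2
      rw [hX, m1, m2, mul_pow A (logOsc a 1 (ξ/3)), l2, map_mul, fastOsc_eq]
      calc _ = prefactor ε*(π*(A^2*conj A))/ξ *
            (logOsc a 1 ξ^2*conj (logOsc a 1 ξ)) +
            prefactor ε*(I*π/(√3 : ℂ)*logOsc a (-3) 3*A^3)/ξ *
            (logOsc a 3 ξ*cis(-(8/9)*ξ^3)) := by push_cast; field_simp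
        _ = _ := by rw [l1, c1, c2]; ring
    have e2 : residual ε χ A z ξ + A*deriv χ ξ = -(prefactor ε*(cubicI (ansatz ε χ A + z) ξ - X)) -
        (3*I*a - 3)/ξ^4*B*fastOsc a ξ := by
      rw [residual, mul_sub, e1, leadPart', fastPart', h.one ξ (by linarith),
        h.one' ξ (by linarith)]
      push_cast; ring
    rw [e2, ansatz_add_eq h]
    refine norm_sub_le_of_le (r₁ := 10000000000000*N^3*ξ^(-1 - k))
      (r₂ := 6*‖B‖*ξ^(-1 - k)) ?_ ?_ |>.trans ?_
    · rw [norm_neg, norm_mul]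
      exact (mul_le_of_le_one_left (norm_nonneg _) hκ).trans t1
    · rw [norm_mul, norm_mul, norm_fastOsc, mul_one, norm_div, norm_pow, norm_real,
        norm_eq_abs, abs_of_pos hξ]
      have h1 : ‖3*I*a - 3‖ ≤ 6 := by
        refine (norm_sub_le _ _).trans ?_
        rw [norm_mul, norm_mul, norm_I, norm_real, norm_eq_abs, norm_ofNat]
        linarith [coefa_le_one (ε := ε) hε hA]
      have h2 : (ξ^4)⁻¹ ≤ ξ^(-1 - k) := by
        rw [← rpow_natCast, ← rpow_neg hξ.le]
        exact rpow_mono (by linarith) (by push_cast; linarith)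
      rw [div_eq_mul_inv]
      calc _ ≤ 6*ξ^(-1 - k)*‖B‖ := by gcongr
        _ = _ := by ring
    · have hw : 0 ≤ ξ^(-1 - k) := by positivity
      nlinarith

/-- The ansatz with a perturbation is admissible. -/
lemma adm_ansatz_add (h : SmoothCutoff χ C) (hε : |ε| = 1) (hA : ‖A‖ ≤ 1) (hk : 0 ≤ k)
    (hz : Adm k (1 + k) ρ z z') : ∃ v', Adm 0 1 (3*profileSize C A ρ) (ansatz ε χ A + z) v' := by
  have hρ := hz.nonneg
  obtain ⟨b', hb⟩ := fast_adm h hε hA hρ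
  obtain ⟨s', s'', hs⟩ := lead_smoothSymb h hε hA hρ
  rw [ansatz_add_eq h]
  exact ⟨_, adm_profile hk hs hb (hz.mono le_rfl le_rfl (le_profileSize h hρ))⟩

lemma norm_residual_sub_le (h : SmoothCutoff χ C) (hε : |ε| = 1) (hA : ‖A‖ ≤ 1) (hk : 1/2 ≤ k)
    (hk1 : k ≤ 7/10) {y : ℝ → ℂ} (hz : Adm k (1 + k) ρ z z') (ez : ConjEven z)
    (hy : Adm k (1 + k) ρ y y') (ey : ConjEven y) (hd : Adm k (1 + k) δ (fun x => z x - y x) d')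
    (hξ : 0 < ξ) : ‖residual ε χ A z ξ - residual ε χ A y ξ‖ ≤
    900000000000*(profileSize C A ρ^2*δ)*(1 + |ξ|)^(-(1 + k)) := by
  have hρ := hz.nonneg
  obtain ⟨b', hb⟩ := fast_adm h hε hA hρ
  obtain ⟨s', s'', hs⟩ := lead_smoothSymb h hε hA hρ
  have hle : ρ ≤ profileSize C A ρ := le_profileSize h hρ
  have hz' := hz.mono (N₁ := profileSize C A ρ) le_rfl le_rfl hle
  have hy' := hy.mono (N₁ := profileSize C A ρ) le_rfl le_rfl hle
  have es := conjEven_add_refl (leadPart χ (coefa ε A) A)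
  have eb := conjEven_add_refl (fastPart χ (coefa ε A) (coefB ε A))
  have ed := ez.sub ey
  have e : residual ε χ A z ξ - residual ε χ A y ξ = -(prefactor ε *
      (cubicI (ansatz ε χ A + z) ξ - cubicI (ansatz ε χ A + y) ξ)) := by
    rw [residual, residual]; ring
  have ezy : ansatz ε χ A + z = fun x => (ansatz ε χ A + y) x + (z x - y x) := by funext x; simp
  have ey' : ConjEven (ansatz ε χ A + y) := by rw [ansatz_add_eq h]; exact (es.add eb).add ey
  obtain ⟨v', hyp'⟩ := adm_ansatz_add h hε hA (by linarith) hy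
  have hd0 := hd.zero (by linarith)
  have sub := cubicI_sub ey' ed hyp' hd0 hξ
  rw [← ezy] at sub
  rw [e, sub, norm_neg, norm_mul]
  refine (mul_le_of_le_one_left (norm_nonneg _) (norm_prefactor_le hε)).trans ?_
  rw [ansatz_add_eq h, ansatz_add_eq h]
  have t1 := norm_triI_profile_le hk (by linarith) hs hb hz' hz' hd es eb ez ed hξ
  have t2 := norm_triI_profile_le hk (by linarith) hs hb hz' hy' hd es eb ey ed hξ
  have t3 := norm_triI_profile_le hk (by linarith) hs hb hy' hy' hd es eb ey ed hξ
  refine norm_add_le_of_le (norm_add_le_of_le t1 t2) t3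
    |>.trans_eq ?_
  ring

lemma continuousOn_cubicI (h : SmoothCutoff χ C) (hε : |ε| = 1) (hA : ‖A‖ ≤ 1) (hk : 0 ≤ k)
    (hz : Adm k (1 + k) ρ z z') : ContinuousOn (cubicI (ansatz ε χ A + z)) (Ioi 0) := by
  obtain ⟨v', hv⟩ := adm_ansatz_add h hε hA hk hz
  exact continuousOn_triI hv hv hv

lemma continuousOn_residual (h : SmoothCutoff χ C) (hε : |ε| = 1) (hA : ‖A‖ ≤ 1) (hk : 0 ≤ k)
    (hz : Adm k (1 + k) ρ z z') : ContinuousOn (residual ε χ A z) (Ioi 0) := by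
  refine ContinuousOn.sub (continuousOn_const.mul (continuousOn_cubicI h hε hA hk hz)).neg
    (ContinuousOn.add (fun x hx => ?_) (continuousOn_fastPart' h))
  exact (hasDerivAt_leadPart' h hx).continuousAt.continuousWithinAt

/-! ### Convergence, and the fixed-point map as a primitive -/

lemma abs_deriv_cutoff_le (h : SmoothCutoff χ C) (hk1 : k ≤ 1) (hξ : 0 < ξ) :
    |deriv χ ξ| ≤ 9*C*(1 + |ξ|)^(-(1 + k)) := by
  have hC := h.one_le
  rcases lt_or_ge 2 ξ with h2 | h2
  · rw [h.one' ξ h2, abs_zero]; positivity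
  have h1 : (1/9 : ℝ) ≤ (1 + |ξ|)^(-(1 + k)) := by
    calc (1/9 : ℝ) = 3^(-(2 : ℝ)) := by linarith
      _ ≤ (1 + |ξ|)^(-(2 : ℝ)) := by
          refine rpow_le_rpow_of_nonpos (by positivity) ?_ (by norm_num)
          grind
      _ ≤ _ := wt_mono (by linarith)
  calc |deriv χ ξ| ≤ C := h.bd' ξ
    _ = 9*C*(1/9) := by ring
    _ ≤ _ := by gcongr

lemma decay_residual (h : SmoothCutoff χ C) (hε : |ε| = 1) (hA : ‖A‖ ≤ 1) (hk : 1/2 ≤ k)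
    (hk1 : k ≤ 7/10) (hz : Adm k (1 + k) ρ z z') (ez : ConjEven z) :
    Decay k (9*C*‖A‖ + 2000000000000000*profileSize C A ρ^3) (residual ε χ A z) := by
  refine ⟨continuousOn_residual h hε hA (by linarith) hz, fun ξ hξ => ?_⟩
  have t1 := norm_residual_add_le h hε hA hk hk1 hz ez hξ
  have t2 : ‖A*deriv χ ξ‖ ≤ 9*C*‖A‖*(1 + |ξ|)^(-(1 + k)) := by
    rw [norm_mul, norm_real, norm_eq_abs]
    calc _ ≤ ‖A‖*(9*C*(1 + |ξ|)^(-(1 + k))) := by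
          gcongr; exact abs_deriv_cutoff_le h (by linarith) hξ
      _ = _ := by ring
  have t3 := norm_sub_le (residual ε χ A z ξ + A*deriv χ ξ) (A*deriv χ ξ)
  rw [add_sub_cancel_right] at t3
  linarith

/-- The ansatz on the positive half-line. -/
def ansatzPos (ε : ℝ) (χ : ℝ → ℝ) (A : ℂ) (x : ℝ) : ℂ :=
  leadPart χ (coefa ε A) A x + fastPart χ (coefa ε A) (coefB ε A) x

/-- The derivative of the ansatz on the positive half-line. -/
def ansatzPos' (ε : ℝ) (χ : ℝ → ℝ) (A : ℂ) (x : ℝ) : ℂ :=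
  leadPart' χ (deriv χ) (coefa ε A) A x + fastPart' χ (deriv χ) (coefa ε A) (coefB ε A) x

lemma ansatz_of_pos (h : SmoothCutoff χ C) (hξ : 0 < ξ) : ansatz ε χ A ξ = ansatzPos ε χ A ξ := by
  rw [ansatz_eq h, ansatzPos]
  simp [refl, leadPart_eq_zero h (by linarith : -ξ < 1), fastPart_eq_zero h (by linarith : -ξ < 1)]

lemma ansatz_neg (ε : ℝ) (χ : ℝ → ℝ) (A : ℂ) (hξ : 0 < ξ) :
    ansatz ε χ A (-ξ) = conj (ansatz ε χ A ξ) := by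
  simp only [ansatz]
  grind

lemma ansatzPos_eq_zero (h : SmoothCutoff χ C) (hξ : ξ < 1) : ansatzPos ε χ A ξ = 0 := by
  rw [ansatzPos, leadPart_eq_zero h hξ, fastPart_eq_zero h hξ, add_zero]

lemma hasDerivAt_ansatzPos (h : SmoothCutoff χ C) (ξ : ℝ) :
    HasDerivAt (ansatzPos ε χ A) (ansatzPos' ε χ A ξ) ξ :=
  hasDerivAt_of_cut (F' := ansatzPos' ε χ A) (fun x hx => ansatzPos_eq_zero h hx)
    (fun x hx => by rw [ansatzPos', leadPart'_eq_zero h hx, fastPart'_eq_zero h hx, add_zero])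
    (fun x hx => (hasDerivAt_leadPart h hx).add (hasDerivAt_fastPart h hx)) ξ

lemma continuous_ansatzPos' (h : SmoothCutoff χ C) : Continuous (ansatzPos' ε χ A) :=
  continuous_of_cut
    (fun x hx => by rw [ansatzPos', leadPart'_eq_zero h hx, fastPart'_eq_zero h hx, add_zero])
    (ContinuousOn.add (fun x hx => (hasDerivAt_leadPart' h hx).continuousAt.continuousWithinAt)
      (continuousOn_fastPart' h))

lemma prefactor_mul_cubicI (ε : ℝ) (χ : ℝ → ℝ) (A : ℂ) (z : ℝ → ℂ) (ξ : ℝ) :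
    prefactor ε*cubicI (ansatz ε χ A + z) ξ = -residual ε χ A z ξ - ansatzPos' ε χ A ξ := by
  rw [residual, ansatzPos']; ring

lemma Decay.intervalIntegrable {D : ℝ → ℂ} (hk : 0 < k) (h : Decay k N D) (hx : 0 ≤ x) (hxy : x ≤ y)
    : IntervalIntegrable D volume x y :=
  (intervalIntegrable_iff_integrableOn_Ioc_of_le hxy).2
    ((h.integrableOn hk hx).mono_set Ioc_subset_Ioi_self)

lemma intervalIntegrable_cubicI (h : SmoothCutoff χ C) (hε : |ε| = 1) (hA : ‖A‖ ≤ 1) (hk : 1/2 ≤ k)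
    (hk1 : k ≤ 7/10) (hz : Adm k (1 + k) ρ z z') (ez : ConjEven z) (hx : 0 ≤ x) (hxy : x ≤ y) :
    IntervalIntegrable (cubicI (ansatz ε χ A + z)) volume x y := by
  have hD := (decay_residual h hε hA hk hk1 hz ez).intervalIntegrable (by linarith) hx hxy
  have hS := (continuous_ansatzPos' (ε := ε) (A := A) h).intervalIntegrable (μ := volume) x y
  refine ((hD.neg.sub hS).const_mul (prefactor ε)⁻¹).congr fun t _ => ?_
  simp only [Pi.neg_apply]
  rw [inv_mul_eq_iff_eq_mul₀ (prefactor_ne_zero hε), prefactor_mul_cubicI]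

lemma prefactor_mul_integral_cubicI (h : SmoothCutoff χ C) (hε : |ε| = 1) (hA : ‖A‖ ≤ 1)
    (hk : 1/2 ≤ k) (hk1 : k ≤ 7/10) (hz : Adm k (1 + k) ρ z z') (ez : ConjEven z) (hx : 0 ≤ x)
    (hxy : x ≤ y) : prefactor ε*∫ t in x..y, cubicI (ansatz ε χ A + z) t =
    -(∫ t in x..y, residual ε χ A z t) - (ansatzPos ε χ A y - ansatzPos ε χ A x) := by
  have hD := (decay_residual h hε hA hk hk1 hz ez).intervalIntegrable (by linarith) hx hxy
  have hS := (continuous_ansatzPos' (ε := ε) (A := A) h).intervalIntegrable (μ := volume) x y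
  rw [← ii_const_mul]
  simp only [prefactor_mul_cubicI]
  have : ∫ t in x..y, (-residual ε χ A z t - ansatzPos' ε χ A t) =
      (∫ t in x..y, -residual ε χ A z t) - ∫ t in x..y, ansatzPos' ε χ A t :=
    ii_sub hD.neg hS
  rw [this, intervalIntegral.integral_neg,
    integral_eq_sub_of_hasDerivAt (fun t _ => hasDerivAt_ansatzPos h t) hS]

lemma prefactor_mul_coefE' (ε : ℝ) (A : ℂ) : prefactor ε*coefE A = -(I*coefa ε A*A) := by
  rw [← prefactor_mul_coefE, coefE]
  have h : A^2*conj A = ((‖A‖^2 : ℝ) : ℂ)*A := by rw [← normSq_eq_norm_sq, ← mul_conj]; ring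
  rw [h]; push_cast; ring

lemma intervalIntegrable_logOsc_div (a : ℝ) (hR : 1 ≤ R) :
    IntervalIntegrable (fun η : ℝ => logOsc a 1 η/(|η| : ℝ)) volume 1 R := by
  refine ContinuousOn.intervalIntegrable ?_
  rw [uIcc_of_le hR]
  intro x hx
  have hx0 : 0 < x := by linarith [hx.1]
  refine ((hasDerivAt_logOsc a hx0).continuousAt.div (by fun_prop) ?_).continuousWithinAt
  exact_mod_cast (abs_pos.2 hx0.ne').ne'

lemma integral_logOsc_div (a : ℝ) (hR : 1 ≤ R) :
    I*a*∫ η in (1 : ℝ)..R, logOsc a 1 η/(|η| : ℝ) = logOsc a 1 R - 1 := by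
  rw [← ii_const_mul]
  have h1 : logOsc a 1 1 = 1 := by simp [logOsc]
  have := integral_eq_sub_of_hasDerivAt (a := 1) (b := R) (f := logOsc a 1)
    (f' := fun η => I*a*(logOsc a 1 η/(|η| : ℝ))) (fun x hx => ?_)
    ((intervalIntegrable_logOsc_div a hR).const_mul _)
  · rw [this, h1]
  · rw [uIcc_of_le hR] at hx
    have hx0 : 0 < x := by linarith [hx.1]
    rw [abs_of_pos hx0]
    exact (hasDerivAt_logOsc a hx0).congr_deriv (by ring)

lemma tendsto_fastPart (h : SmoothCutoff χ C) (a : ℝ) (B : ℂ) :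
    Tendsto (fastPart χ a B) atTop (𝓝 0) := by
  have t : Tendsto (fun R : ℝ => ‖B‖*R⁻¹) atTop (𝓝 0) := by
    simpa using tendsto_inv_atTop_zero.const_mul ‖B‖
  refine squeeze_zero_norm' ?_ t
  filter_upwards [eventually_gt_atTop 2] with R hR
  rw [fastPart, h.one R hR, norm_mul, norm_mul, norm_fastOsc, mul_one, norm_div, norm_pow,
    norm_real, norm_real, norm_eq_abs R, abs_of_pos (by linarith : 0 < R),
    norm_one, mul_comm, one_div]
  gcongr
  exact le_self_pow₀ (by linarith) three_ne_zero

lemma prefactor_mul_integral_tail (h : SmoothCutoff χ C) (hε : |ε| = 1) (hA : ‖A‖ ≤ 1)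
    (hk : 1/2 ≤ k) (hk1 : k ≤ 7/10) (hz : Adm k (1 + k) ρ z z') (ez : ConjEven z) (hR : 2 < R) :
    prefactor ε*∫ t in (1 : ℝ)..R, integrandTail ε χ A z t =
      -(∫ t in (1 : ℝ)..R, residual ε χ A z t) + ansatzPos ε χ A 1 - A - fastPart χ (coefa ε A)
      (coefB ε A) R := by
  have i1 := intervalIntegrable_cubicI h hε hA hk hk1 hz ez zero_le_one (by linarith : 1 ≤ R)
  have i2 := (intervalIntegrable_logOsc_div (coefa ε A) (by linarith : 1 ≤ R)).const_mul (coefE A)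
  have e : ∫ t in (1 : ℝ)..R, integrandTail ε χ A z t =
      (∫ t in (1 : ℝ)..R, cubicI (ansatz ε χ A + z) t) -
        ∫ t in (1 : ℝ)..R, coefE A*(logOsc (coefa ε A) 1 t/(|t| : ℝ)) :=
    ii_sub i1 i2
  have l := integral_logOsc_div (coefa ε A) (by linarith : 1 ≤ R)
  have m : ansatzPos ε χ A R = A*logOsc (coefa ε A) 1 R + fastPart χ (coefa ε A) (coefB ε A) R := by
    rw [ansatzPos, leadPart, h.one R hR]; simp
  rw [e, mul_sub, prefactor_mul_integral_cubicI h hε hA hk hk1 hz ez zero_le_one (by linarith), m,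
    ii_const_mul, ← mul_assoc, prefactor_mul_coefE']
  linear_combination A*l

lemma tendsto_integral_tail (h : SmoothCutoff χ C) (hε : |ε| = 1) (hA : ‖A‖ ≤ 1) (hk : 1/2 ≤ k)
    (hk1 : k ≤ 7/10) (hz : Adm k (1 + k) ρ z z') (ez : ConjEven z) :
    Tendsto (fun R => ∫ t in (1 : ℝ)..R, integrandTail ε χ A z t) atTop
      (𝓝 ((prefactor ε)⁻¹*(-(∫ t in Ioi 1, residual ε χ A z t) + ansatzPos ε χ A 1 - A))) := by
  have hD := decay_residual h hε hA hk hk1 hz ez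
  have t1 := intervalIntegral_tendsto_integral_Ioi 1 (hD.integrableOn (by linarith) zero_le_one)
    tendsto_id
  have t2 := tendsto_fastPart h (coefa ε A) (coefB ε A)
  have t3 := ((((t1.neg.add_const (ansatzPos ε χ A 1)).sub_const A).sub t2)).const_mul
    (prefactor ε)⁻¹
  rw [sub_zero] at t3
  refine t3.congr' ?_
  filter_upwards [eventually_gt_atTop 2] with R hR
  rw [inv_mul_eq_iff_eq_mul₀ (prefactor_ne_zero hε),
    prefactor_mul_integral_tail h hε hA hk hk1 hz ez hR]
  rfl

lemma converges_of_adm (h : SmoothCutoff χ C) (hε : |ε| = 1) (hA : ‖A‖ ≤ 1) (hk : 1/2 ≤ k)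
    (hk1 : k ≤ 7/10) (hz : Adm k (1 + k) ρ z z') (ez : ConjEven z) : Converges ε χ A z := by
  obtain ⟨v', hv⟩ := adm_ansatz_add h hε hA (by linarith) hz
  refine ⟨fun η hη => improperConverges_integrandK hv hv hη,
    fun ξ hξ => improperConverges_integrandJ hv hv hv hξ,
    fun ξ hξ => intervalIntegrable_cubicI h hε hA hk hk1 hz ez le_rfl hξ.le, fun R hR => ?_,
    _, tendsto_integral_tail h hε hA hk hk1 hz ez⟩
  exact (intervalIntegrable_cubicI h hε hA hk hk1 hz ez zero_le_one hR).sub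
    ((intervalIntegrable_logOsc_div (coefa ε A) hR).const_mul (coefE A))

lemma constZero_eq (ε : ℝ) (χ : ℝ → ℝ) (A : ℂ) (z : ℝ → ℂ) :
    constZero ε χ A z = A + prefactor ε*calI ε χ A z := by
  have h1 := Complex.re_add_im A
  have h2 := Complex.re_add_im (calI ε χ A z)
  rw [constZero, constC, constAlpha, prefactor]
  set y := calI ε χ A z
  have e : A + 3*I*ε/(4*π^2)*y = (A.re + A.im*I) + 3*I*ε/(4*π^2)*(y.re + y.im*I) := by rw [h1, h2]
  rw [e]
  push_cast
  field_simp
  have := I_sq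
  grind

lemma constZero_eq_integral (h : SmoothCutoff χ C) (hε : |ε| = 1) (hA : ‖A‖ ≤ 1) (hk : 1/2 ≤ k)
    (hk1 : k ≤ 7/10) (hz : Adm k (1 + k) ρ z z') (ez : ConjEven z) :
    constZero ε χ A z = -∫ t in Ioi 0, residual ε χ A z t := by
  have hD := decay_residual h hε hA hk hk1 hz ez
  have t := (tendsto_integral_tail h hε hA hk hk1 hz ez).limUnder_eq
  have e0 : ansatzPos ε χ A 0 = 0 := ansatzPos_eq_zero h one_pos
  have e1 := integral_Ioi_sub_Ioi' (a := 0) (b := 1) (f := residual ε χ A z)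
    (hD.integrableOn (by linarith) le_rfl) (hD.integrableOn (by linarith) zero_le_one)
  rw [constZero_eq, calI, improperIntegralFrom, t, mul_add,
    prefactor_mul_integral_cubicI h hε hA hk hk1 hz ez le_rfl zero_le_one,
    mul_inv_cancel_left₀ (prefactor_ne_zero hε), e0]
  linear_combination e1

lemma Psi_of_pos (ε : ℝ) (χ : ℝ → ℝ) (A : ℂ) (z v : ℝ → ℂ) (hξ : 0 < ξ) :
    Psi ε (constC ε χ A z) (constAlpha ε χ A z) v ξ = constZero ε χ A z - prefactor ε*∫ η in
      (0 : ℝ)..ξ, cubicI v η := by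
  simp only [Psi]
  rw [if_pos hξ, constZero, prefactor]

lemma PsiTilde_eq_prim (h : SmoothCutoff χ C) (hε : |ε| = 1) (hA : ‖A‖ ≤ 1) (hk : 1/2 ≤ k)
    (hk1 : k ≤ 7/10) (hz : Adm k (1 + k) ρ z z') (ez : ConjEven z) (hξ : ξ ≠ 0) :
    PsiTilde ε χ A z ξ = prim (residual ε χ A z) ξ := by
  have hD := decay_residual h hε hA hk hk1 hz ez
  have pos : ∀ x, 0 < x → PsiTilde ε χ A z x = -∫ t in Ioi x, residual ε χ A z t := fun x hx => by
    have e0 : ansatzPos ε χ A 0 = 0 := ansatzPos_eq_zero h one_pos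
    have e1 := integral_Ioi_sub_Ioi' (a := 0) (b := x) (f := residual ε χ A z)
      (hD.integrableOn (by linarith) le_rfl) (hD.integrableOn (by linarith) hx.le)
    rw [PsiTilde, Psi_of_pos ε χ A z _ hx, constZero_eq_integral h hε hA hk hk1 hz ez,
      prefactor_mul_integral_cubicI h hε hA hk hk1 hz ez le_rfl hx.le, ansatz_of_pos h hx, e0]
    linear_combination -e1
  rcases lt_or_gt_of_ne hξ with h0 | h0
  · have e : PsiTilde ε χ A z ξ = conj (PsiTilde ε χ A z (-ξ)) := by
      have h1 : 0 < -ξ := by linarith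
      have := ansatz_neg ε χ A h1
      rw [neg_neg] at this
      simp only [PsiTilde, Psi]
      rw [if_neg (not_lt.2 h0.le), if_pos h1, this]
      simp only [map_sub]
    rw [e, pos _ (by linarith), prim, if_neg (not_lt.2 h0.le)]
  · rw [pos ξ h0, prim, if_pos h0]

/-! ### The space `Z^k` and admissible functions -/

lemma ae_norm_le_of_eLpNorm_top_le {μ : Measure ℝ} (hρ : 0 ≤ ρ)
    (h : eLpNorm f ⊤ μ ≤ ENNReal.ofReal ρ) : ∀ᵐ x ∂μ, ‖f x‖ ≤ ρ := by
  filter_upwards [ae_le_eLpNormEssSup (f := f) (μ := μ)] with x hx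
  have := hx.trans h
  rwa [← ofReal_norm, ENNReal.ofReal_le_ofReal_iff hρ] at this

lemma eLpNorm_top_le_mul_add {μ : Measure ℝ} (ha : 0 ≤ a) (h : ∀ᵐ x ∂μ, ‖f x‖ ≤ a*‖g x‖ + c) :
    eLpNorm f ⊤ μ ≤ ENNReal.ofReal a*eLpNorm g ⊤ μ + ENNReal.ofReal c := by
  rw [eLpNorm_exponent_top, eLpNorm_exponent_top]
  refine eLpNormEssSup_le_of_ae_enorm_bound ?_
  filter_upwards [h, ae_le_eLpNormEssSup (f := g) (μ := μ)] with x hx hg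
  calc ‖f x‖ₑ = ENNReal.ofReal ‖f x‖ := (ofReal_norm _).symm
    _ ≤ ENNReal.ofReal (a*‖g x‖ + c) := ENNReal.ofReal_le_ofReal hx
    _ ≤ ENNReal.ofReal (a*‖g x‖) + ENNReal.ofReal c := ENNReal.ofReal_add_le
    _ = ENNReal.ofReal a*‖g x‖ₑ + ENNReal.ofReal c := by rw [ENNReal.ofReal_mul ha, ofReal_norm]
    _ ≤ _ := by gcongr

lemma le_of_ae_le_of_continuousOn {g : ℝ → ℝ} {U : Set ℝ} (hU : IsOpen U) (hg : ContinuousOn g U)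
    (h : ∀ᵐ x, g x ≤ ρ) (hx : x ∈ U) : g x ≤ ρ := by
  by_contra hlt
  have ho : IsOpen (U ∩ g ⁻¹' Ioi ρ) := hg.isOpen_inter_preimage hU isOpen_Ioi
  have hpos := ho.measure_pos volume ⟨x, hx, not_le.1 hlt⟩
  refine hpos.ne' (measure_mono_null (fun y hy => ?_) h)
  grind

lemma one_add_rpow_le {s : ℝ} (hs : 0 ≤ s) (hs2 : s ≤ 2) (hx : 0 ≤ x) : (1 + x)^s ≤ 4*(1 + x^s) :=
    by
  have h2 : (2 : ℝ)^s ≤ 4 := by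
    calc (2 : ℝ)^s ≤ 2^(2 : ℝ) := rpow_mono one_le_two hs2
      _ = 4 := by linarith
  have hxs : 0 ≤ x^s := by positivity
  have h3 : (1 + x)^s ≤ (2*max 1 x)^s := rpow_le_rpow (by positivity) (by grind) hs
  rw [Real.mul_rpow zero_le_two (by positivity)] at h3
  have h4 : (max 1 x)^s ≤ 1 + x^s := by
    rcases max_cases 1 x with ⟨h, -⟩ | ⟨h, -⟩ <;> rw [h]
    · rw [Real.one_rpow]; linarith
    · linarith
  exact h3.trans (mul_le_mul h2 h4 (by positivity) (by norm_num))

lemma one_add_rpow_ge {s : ℝ} (hs : 0 ≤ s) (hx : 0 ≤ x) : 1 + x^s ≤ 2*(1 + x)^s := by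
  have h1 : 1 ≤ (1 + x)^s := one_le_rpow (by linarith) hs
  have h2 : x^s ≤ (1 + x)^s := rpow_le_rpow hx (by linarith) hs
  linarith

lemma acOn_of_locallyLipschitzOn [hs : OrdConnected s] (hz : LocallyLipschitzOn s z) :
    ACOn z (deriv z) s := by
  have key : ∀ x ∈ s, ∀ y ∈ s, x ≤ y → IntervalIntegrable (deriv z) volume x y ∧
      z y - z x = ∫ t in x..y, deriv z t := fun x hx y hy hxy => by
    have hsub : uIcc x y ⊆ s := by rw [uIcc_of_le hxy]; exact hs.out hx hy
    obtain ⟨K, hK⟩ := (hz.mono hsub).exists_lipschitzOnWith_of_compact isCompact_uIcc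
    have hre : AbsolutelyContinuousOnInterval (fun t => (z t).re) x y :=
      LipschitzOnWith.absolutelyContinuousOnInterval
        (Complex.reCLM.lipschitz.comp_lipschitzOnWith hK)
    have him : AbsolutelyContinuousOnInterval (fun t => (z t).im) x y :=
      LipschitzOnWith.absolutelyContinuousOnInterval
        (Complex.imCLM.lipschitz.comp_lipschitzOnWith hK)
    have hd : ∀ᵐ t, t ∈ uIoc x y → ((deriv (fun t => (z t).re) t : ℝ) : ℂ) +
        (deriv (fun t => (z t).im) t : ℝ)*I = deriv z t := by
      filter_upwards [hre.ae_differentiableAt, him.ae_differentiableAt] with t h1 h2 ht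
      have d1 := (h1 (uIoc_subset_uIcc ht)).hasDerivAt.ofReal_comp
      have d2 := ((h2 (uIoc_subset_uIcc ht)).hasDerivAt.ofReal_comp).mul_const I
      have d3 := d1.add d2
      have e : (fun t => ((z t).re : ℂ)) + (fun t => ((z t).im : ℂ)*I) = z := by funext t; simp
      rw [← d3.deriv]
      exact congrArg (fun f => deriv f t) e
    have i1 : IntervalIntegrable (fun t => ((deriv (fun t => (z t).re) t : ℝ) : ℂ)) volume x y :=
      ⟨hre.intervalIntegrable_deriv.1.ofReal, hre.intervalIntegrable_deriv.2.ofReal⟩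
    have i2 : IntervalIntegrable (fun t => ((deriv (fun t => (z t).im) t : ℝ) : ℂ)) volume x y :=
      ⟨him.intervalIntegrable_deriv.1.ofReal, him.intervalIntegrable_deriv.2.ofReal⟩
    refine ⟨(i1.add (i2.mul_const I)).congr_ae ?_, ?_⟩
    · exact (ae_restrict_iff' measurableSet_uIoc).2 hd
    · rw [← ii_congr_ae hd, ii_add i1
        (i2.mul_const _), ii_mul_const, intervalIntegral.integral_ofReal,
        intervalIntegral.integral_ofReal, hre.integral_deriv_eq_sub, him.integral_deriv_eq_sub]
      apply Complex.ext <;> simp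
  exact ⟨fun x hx y hy hxy => (key x hx y hy hxy).1, fun x hx y hy hxy => (key x hx y hy hxy).2⟩

lemma ACOn.congr_ae [hs : OrdConnected s] (h : ACOn f f' s) (hg : ∀ᵐ x, x ∈ s → f' x = g' x) :
    ACOn f g' s := by
  have key : ∀ x ∈ s, ∀ y ∈ s, x ≤ y → ∀ᵐ t, t ∈ uIoc x y → f' t = g' t := fun x hx y hy hxy => by
    filter_upwards [hg] with t ht h1
    refine ht (hs.out hx hy ?_)
    grind
  refine ⟨fun x hx y hy hxy => (h.int x hx y hy hxy).congr_ae
    ((ae_restrict_iff' measurableSet_uIoc).2 (key x hx y hy hxy)), fun x hx y hy hxy => ?_⟩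
  rw [h.ftc x hx y hy hxy]
  exact ii_congr_ae (key x hx y hy hxy)

lemma conjEven_of_mem_Zspace (hz : z ∈ Zspace k) : ConjEven z := by
  obtain ⟨-, -, h, -⟩ := hz
  intro x hx
  rcases lt_or_gt_of_ne hx with h0 | h0
  · rw [refl, ← h (-x) (by linarith), neg_neg]
  · rw [refl, h x h0, conj_conj]

lemma adm_of_mem_Zspace (hk : 0 ≤ k) (hk1 : k ≤ 1) (hz : z ∈ Zspace k) (hρ : 0 ≤ ρ)
    (hn : zNorm k z ≤ ENNReal.ofReal ρ) : ∃ z', Adm k (1 + k) (4*ρ) z z' := by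
  obtain ⟨lp, ln, -, -⟩ := hz
  have n0 := ae_norm_le_of_eLpNorm_top_le hρ
    ((le_self_add.trans le_self_add : _ ≤ zNorm k z).trans hn)
  have np := ae_norm_le_of_eLpNorm_top_le hρ
    (((le_add_left le_rfl).trans le_self_add : _ ≤ zNorm k z).trans hn)
  have nn := ae_norm_le_of_eLpNorm_top_le hρ ((le_add_left le_rfl : _ ≤ zNorm k z).trans hn)
  rw [ae_restrict_iff' measurableSet_Ioi] at np
  rw [ae_restrict_iff' measurableSet_Iio] at nn
  have cz : ContinuousOn z {0}ᶜ := fun x hx => by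
    rcases lt_or_gt_of_ne (show x ≠ 0 from hx) with h0 | h0
    · exact (ln.continuousOn.continuousAt (Iio_mem_nhds h0)).continuousWithinAt
    · exact (lp.continuousOn.continuousAt (Ioi_mem_nhds h0)).continuousWithinAt
  have conv : ∀ (s : ℝ) (x : ℝ) (w : ℂ), 0 ≤ s → s ≤ 2 → ‖(1 + |x|^s) • w‖ ≤ ρ →
      ‖w‖ ≤ 4*ρ*(1 + |x|)^(-s) := fun s x w h0 h2 h => by
    rw [norm_smul, norm_eq_abs, abs_of_nonneg (by positivity)] at h
    rw [rpow_neg (by positivity), ← div_eq_mul_inv, le_div_iff₀ (by positivity)]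
    calc ‖w‖*(1 + |x|)^s ≤ ‖w‖*(4*(1 + |x|^s)) := by
          gcongr; exact one_add_rpow_le h0 h2 (abs_nonneg x)
      _ = 4*((1 + |x|^s)*‖w‖) := by ring
      _ ≤ _ := by gcongr
  set S := {x : ℝ | ‖deriv z x‖ ≤ 4*ρ*(1 + |x|)^(-(1 + k))} with hS
  have mS : MeasurableSet S := measurableSet_le (measurable_deriv z).norm (by fun_prop)
  have bp : ∀ᵐ x, x ∈ Ioi (0 : ℝ) → deriv z x = S.indicator (deriv z) x := by
    filter_upwards [np] with x hx h0
    have hx' := hx h0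
    rw [add_comm k 1] at hx'
    rw [indicator_of_mem (show x ∈ S from conv (1 + k) x _ (by linarith) (by linarith) hx')]
  have bn : ∀ᵐ x, x ∈ Iio (0 : ℝ) → deriv z x = S.indicator (deriv z) x := by
    filter_upwards [nn] with x hx h0
    have hx' := hx h0
    rw [add_comm k 1] at hx'
    rw [indicator_of_mem (show x ∈ S from conv (1 + k) x _ (by linarith) (by linarith) hx')]
  refine ⟨S.indicator (deriv z), by positivity, measurable_of_continuousOn_compl_singleton 0 cz,
    (measurable_deriv z).indicator mS, fun x hx => conv k x _ hk (by linarith) ?_, fun x _ => ?_,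
    (acOn_of_locallyLipschitzOn lp).congr_ae bp, (acOn_of_locallyLipschitzOn ln).congr_ae bn⟩
  · refine le_of_ae_le_of_continuousOn (U := {0}ᶜ) (g := fun x => ‖(1 + |x|^k) • z x‖)
      isOpen_compl_singleton ?_ n0 hx
    have cw : Continuous fun x : ℝ => 1 + |x|^k :=
      continuous_const.add (continuous_abs.rpow_const fun _ => Or.inr hk)
    exact (cw.continuousOn.smul cz).norm
  · by_cases hx : x ∈ S
    · rw [indicator_of_mem hx]; exact hx
    · rw [indicator_of_notMem hx, norm_zero]; positivity

lemma zNorm_le_mul_add (hk : 0 ≤ k) (ha : 0 ≤ a) (hc : 0 ≤ c)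
    (h : ∀ x, x ≠ 0 → ‖z x‖ ≤ a*‖u x‖ + c*(1 + |x|)^(-k)) (h' : ∀ x, x ≠ 0 → ‖deriv z x‖ ≤ a*‖deriv
    u x‖ + c*(1 + |x|)^(-(1 + k))) :
    zNorm k z ≤ ENNReal.ofReal a*zNorm k u + ENNReal.ofReal (6*c) := by
  have conv : ∀ (s x : ℝ) (w v : ℂ), 0 ≤ s → ‖w‖ ≤ a*‖v‖ + c*(1 + |x|)^(-s) →
      ‖(1 + |x|^s) • w‖ ≤ a*‖(1 + |x|^s) • v‖ + 2*c := fun s x w v hs hw => by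
    have hp : 0 ≤ 1 + |x|^s := by positivity
    rw [norm_smul, norm_smul, norm_eq_abs, abs_of_nonneg hp]
    have e : (1 + |x|^s)*(1 + |x|)^(-s) ≤ 2 := by
      rw [rpow_neg (by positivity), ← div_eq_mul_inv, div_le_iff₀ (by positivity)]
      exact one_add_rpow_ge hs (abs_nonneg x)
    calc _ ≤ (1 + |x|^s)*(a*‖v‖ + c*(1 + |x|)^(-s)) := by gcongr
      _ = a*((1 + |x|^s)*‖v‖) + c*((1 + |x|^s)*(1 + |x|)^(-s)) := by ring
      _ ≤ a*((1 + |x|^s)*‖v‖) + c*2 := by gcongr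
      _ = _ := by ring
  have ne := Measure.ae_ne volume (0 : ℝ)
  have t1 := eLpNorm_top_le_mul_add (μ := volume) (f := fun x => (1 + |x|^k) • z x)
    (g := fun x => (1 + |x|^k) • u x) (c := 2*c) ha
    (by filter_upwards [ne] with x hx using conv k x _ _ hk (h x hx))
  have t2 : ∀ s : Set ℝ, _ := fun s => eLpNorm_top_le_mul_add (μ := volume.restrict s)
    (f := fun x => (1 + |x|^(k + 1)) • deriv z x)
    (g := fun x => (1 + |x|^(k + 1)) • deriv u x) (c := 2*c) ha
    (by
      refine ae_restrict_of_ae ?_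
      filter_upwards [ne] with x hx
      grind)
  refine (add_le_add (add_le_add t1 (t2 (Ioi 0))) (t2 (Iio 0))).trans_eq ?_
  have : ENNReal.ofReal (6*c) =
      ENNReal.ofReal (2*c) + ENNReal.ofReal (2*c) + ENNReal.ofReal (2*c) := by
    rw [← ENNReal.ofReal_add (by positivity) (by positivity),
      ← ENNReal.ofReal_add (by positivity) (by positivity)]
    congr 1; ring
  rw [zNorm, this]
  ring

lemma modNorm_le_mul_add {γ : ℂ} (hk : 0 ≤ k) (ha : 0 ≤ a) (hc : 0 ≤ c)
    (h0 : ∀ x, 0 < x → x < 1 → ‖z x - γ‖ ≤ c*x)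
    (h : ∀ x, 0 < x → ‖z x‖ ≤ a*‖u x‖ + c*(1 + |x|)^(-k)) (h' : ∀ x, 0 < x → ‖deriv z x‖ ≤ a*‖deriv
    u x‖ + c*(1 + |x|)^(-(1 + k))) :
    modNorm k γ z ≤ ENNReal.ofReal a*modNorm k 1 u + ENNReal.ofReal (4*c) := by
  have t0 := eLpNorm_top_le_mul_add (μ := volume.restrict (Ioo 0 1))
    (f := fun x => (|x|⁻¹ : ℝ) • (z x - γ)) (g := fun x => (|x|⁻¹ : ℝ) • (u x - 1)) (c := c) ha
    (by
      filter_upwards [ae_restrict_mem measurableSet_Ioo] with x hx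
      rw [norm_smul, norm_eq_abs, abs_of_nonneg (by positivity), abs_of_pos hx.1, inv_mul_eq_div]
      have : ‖z x - γ‖/x ≤ c := (div_le_iff₀ hx.1).2 (h0 x hx.1 hx.2)
      have : 0 ≤ a*‖(x⁻¹ : ℝ) • (u x - 1)‖ := by positivity
      linarith)
  have t1 := eLpNorm_top_le_mul_add (μ := volume.restrict (Ioi 1))
    (f := fun x => (|x|^k) • z x) (g := fun x => (|x|^k) • u x) (c := c) ha
    (by
      filter_upwards [ae_restrict_mem measurableSet_Ioi] with x hx
      have hx0 : 0 < x := one_pos.trans hx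
      have hp : 0 ≤ |x|^k := by positivity
      rw [norm_smul, norm_smul, norm_eq_abs, abs_of_nonneg hp]
      have e : |x|^k*(1 + |x|)^(-k) ≤ 1 := by
        rw [rpow_neg (by positivity), ← div_eq_mul_inv, div_le_one (by positivity)]
        exact rpow_le_rpow (abs_nonneg x) (by linarith) hk
      calc _ ≤ |x|^k*(a*‖u x‖ + c*(1 + |x|)^(-k)) := by gcongr; exact h x hx0
        _ = a*(|x|^k*‖u x‖) + c*(|x|^k*(1 + |x|)^(-k)) := by ring
        _ ≤ a*(|x|^k*‖u x‖) + c*1 := by gcongr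
        _ = _ := by ring)
  have t2 := eLpNorm_top_le_mul_add (μ := volume.restrict (Ioi 0))
    (f := fun x => (1 + |x|^(k + 1)) • deriv z x)
    (g := fun x => (1 + |x|^(k + 1)) • deriv u x) (c := 2*c) ha
    (by
      filter_upwards [ae_restrict_mem measurableSet_Ioi] with x hx
      have hp : 0 ≤ 1 + |x|^(k + 1) := by positivity
      rw [norm_smul, norm_smul, norm_eq_abs, abs_of_nonneg hp]
      have e : (1 + |x|^(k + 1))*(1 + |x|)^(-(1 + k)) ≤ 2 := by
        rw [rpow_neg (by positivity), ← div_eq_mul_inv, div_le_iff₀ (by positivity), add_comm k 1]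
        exact one_add_rpow_ge (by linarith) (abs_nonneg x)
      calc _ ≤ (1 + |x|^(k + 1))*(a*‖deriv u x‖ + c*(1 + |x|)^(-(1 + k))) := by
            gcongr; exact h' x hx
        _ = a*((1 + |x|^(k + 1))*‖deriv u x‖) +
            c*((1 + |x|^(k + 1))*(1 + |x|)^(-(1 + k))) := by ring
        _ ≤ a*((1 + |x|^(k + 1))*‖deriv u x‖) + c*2 := by gcongr
        _ = _ := by ring)
  refine (add_le_add (add_le_add t0 t1) t2).trans_eq ?_
  have : ENNReal.ofReal (4*c) = ENNReal.ofReal c + ENNReal.ofReal c + ENNReal.ofReal (2*c) := by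
    rw [← ENNReal.ofReal_add hc hc, ← ENNReal.ofReal_add (by positivity) (by positivity)]
    congr 1; ring
  rw [modNorm, this]
  ring

lemma Decay.prim_mem_Zspace {D : ℝ → ℂ} (hk : 1/2 ≤ k) (h : Decay k N D) : prim D ∈ Zspace k := by
  have hk0 : 0 < k := by linarith
  have ha := h.adm_prim hk
  have hN : 0 ≤ 2*N := ha.nonneg
  have hd : ∀ x, x ≠ 0 → HasDerivAt (prim D) (prim' D x) x := fun x hx => h.hasDerivAt_prim hk0 hx
  have hb : ∀ x, x ≠ 0 → ‖prim' D x‖₊ ≤ Real.toNNReal (2*N) := fun x hx => by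
    rw [← NNReal.coe_le_coe, Real.coe_toNNReal _ hN]
    exact ha.le' (by linarith) hx
  have loc : ∀ s : Set ℝ, Convex ℝ s → (∀ x ∈ s, x ≠ 0) → LocallyLipschitzOn s (prim D) :=
    fun s hs h0 => by
    have := hs.lipschitzOnWith_of_nnnorm_hasDerivWithin_le
      (fun x hx => (hd x (h0 x hx)).hasDerivWithinAt) (fun x hx => hb x (h0 x hx))
    exact fun x _ => ⟨_, s, self_mem_nhdsWithin, this⟩
  refine ⟨loc _ (convex_Ioi 0) fun x hx => ne_of_gt hx, loc _ (convex_Iio 0) fun x hx => ne_of_lt hx,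
    fun x hx => ?_, ?_⟩
  · rw [← conjEven_prim D (-x) (by linarith : -x ≠ 0), refl, neg_neg]
  · have := zNorm_le_mul_add (k := k) (z := prim D) (u := 0) (a := 0) (c := 2*N) (by linarith)
      le_rfl hN (fun x hx => by rw [zero_mul, zero_add]; exact ha.bd x hx) (fun x hx => by
        rw [zero_mul, zero_add, (hd x hx).deriv]; exact ha.bd' x hx)
    refine this.trans_lt ?_
    rw [ENNReal.ofReal_zero, zero_mul, zero_add]
    exact ENNReal.ofReal_lt_top

/-! ### The fixed point -/

lemma residual_congr {w : ℝ → ℂ} (h : ∀ x, x ≠ 0 → z x = w x) (ξ : ℝ) :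
    residual ε χ A z ξ = residual ε χ A w ξ := by
  have e : ∀ x, x ≠ 0 → (ansatz ε χ A + z) x = (ansatz ε χ A + w) x := fun x hx => by simp [h x hx]
  rw [residual, residual, cubicI, cubicI, triI_congr e e e]

lemma prim_congr (h : ∀ x, 0 < x → D₁ x = D₂ x) : prim D₁ = prim D₂ := by
  have e : ∀ y : ℝ, 0 ≤ y → ∫ t in Ioi y, D₁ t = ∫ t in Ioi y, D₂ t := fun y hy =>
    setIntegral_congr_fun measurableSet_Ioi fun t ht => h t (hy.trans_lt ht)
  funext x
  rcases lt_or_ge 0 x with h0 | h0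
  · simp only [prim, if_pos h0]; rw [e x h0.le]
  · simp only [prim, if_neg (not_lt.2 h0)]; grind

/-- The estimates on `residual` that make the fixed-point map a contraction. -/
structure ResidualBounds (k ε : ℝ) (χ : ℝ → ℝ) (Q : ℝ) : Prop where
  one_le : 1 ≤ Q
  cutoff : ∀ ξ, 0 < ξ → |deriv χ ξ| ≤ Q*(1 + |ξ|)^(-(1 + k))
  decay : ∀ A : ℂ, ‖A‖ ≤ 1 → ∀ (ρ : ℝ) (z z' : ℝ → ℂ), Adm k (1 + k) ρ z z' → ConjEven z →
    Decay k (Q*(‖A‖ + ρ)^3) (fun ξ => residual ε χ A z ξ + A*deriv χ ξ)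
  lip : ∀ A : ℂ, ‖A‖ ≤ 1 → ∀ (ρ δ : ℝ) (z z' y y' d' : ℝ → ℂ), Adm k (1 + k) ρ z z' →
    ConjEven z → Adm k (1 + k) ρ y y' → ConjEven y → Adm k (1 + k) δ (fun x => z x - y x) d' →
    Decay k (Q*(‖A‖ + ρ)^2*δ) (fun ξ => residual ε χ A z ξ - residual ε χ A y ξ)

section
variable {Q : ℝ}

lemma exists_residualBounds (h : SmoothCutoff χ C) (hε : |ε| = 1) (hk : 1/2 ≤ k) (hk1 : k ≤ 7/10) :
    ∃ Q, ResidualBounds k ε χ Q := by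
  have hC := h.one_le
  have hC3 : C ≤ C^3 := le_self_pow₀ hC three_ne_zero
  have hC2 : C^2 ≤ C^3 := pow_le_pow_right₀ hC (by norm_num)
  refine ⟨2000000000000000*(80*C)^3, by nlinarith, fun ξ hξ => ?_,
    fun A hA ρ z z' hz ez => ⟨?_, fun ξ hξ => ?_⟩,
    fun A hA ρ δ z z' y y' d' hz ez hy ey hd => ⟨?_, fun ξ hξ => ?_⟩⟩
  · refine (abs_deriv_cutoff_le (k := k) h (by linarith) hξ).trans ?_
    exact mul_le_mul_of_nonneg_right (by nlinarith) (wt_nonneg _ _)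
  · have c1 : ContinuousOn (deriv χ) (Ioi 0) := fun x _ =>
      (h.deriv' x).continuousAt.continuousWithinAt
    exact (continuousOn_residual h hε hA (by linarith) hz).add
      (continuousOn_const.mul (continuous_ofReal.comp_continuousOn c1))
  · refine (norm_residual_add_le h hε hA hk hk1 hz ez hξ).trans_eq ?_
    rw [profileSize]; ring
  · exact (continuousOn_residual h hε hA (by linarith) hz).sub
      (continuousOn_residual h hε hA (by linarith) hy)
  · refine (norm_residual_sub_le h hε hA hk hk1 hz ez hy ey hd hξ).trans ?_
    refine mul_le_mul_of_nonneg_right ?_ (wt_nonneg _ _)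
    have h0 : 0 ≤ (‖A‖ + ρ)^2*δ := mul_nonneg (sq_nonneg _) hd.nonneg
    rw [profileSize]
    calc 900000000000*((80*C*(‖A‖ + ρ))^2*δ)
        = (900000000000*6400*C^2)*((‖A‖ + ρ)^2*δ) := by ring
      _ ≤ (2000000000000000*(80*C)^3)*((‖A‖ + ρ)^2*δ) := by
          refine mul_le_mul_of_nonneg_right ?_ h0
          nlinarith
      _ = _ := by ring

lemma ResidualBounds.decay_residual (h : ResidualBounds k ε χ Q) (hA : ‖A‖ ≤ 1)
    (hz : Adm k (1 + k) ρ z z') (ez : ConjEven z) (c1 : ContinuousOn (deriv χ) (Ioi 0)) :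
    Decay k (Q*‖A‖ + Q*(‖A‖ + ρ)^3) (residual ε χ A z) := by
  have hd := h.decay A hA ρ z z' hz ez
  have hc : ContinuousOn (fun ξ : ℝ => A*((deriv χ ξ : ℝ) : ℂ)) (Ioi 0) :=
    continuousOn_const.mul (continuous_ofReal.comp_continuousOn c1)
  refine ⟨(hd.cont.sub hc).congr fun x _ => by simp, fun ξ hξ => ?_⟩
  have t1 := hd.bd ξ hξ
  have t2 : ‖A*((deriv χ ξ : ℝ) : ℂ)‖ ≤ Q*‖A‖*(1 + |ξ|)^(-(1 + k)) := by
    rw [norm_mul, norm_real, norm_eq_abs]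
    calc _ ≤ ‖A‖*(Q*(1 + |ξ|)^(-(1 + k))) := by gcongr; exact h.cutoff ξ hξ
      _ = _ := by ring
  have t3 := norm_sub_le (residual ε χ A z ξ + A*deriv χ ξ) (A*deriv χ ξ)
  rw [add_sub_cancel_right] at t3
  linarith

lemma ResidualBounds.contraction (h : ResidualBounds k ε χ Q) (hk : 1/2 ≤ k) (hA : ‖A‖ ≤ 1/(8*Q))
    (h1 : Decay k (1/(8*Q)) D₁) (h2 : Decay k (1/(8*Q)) D₂) (hd : Decay k δ (fun x => D₁ x - D₂ x))
    : Decay k (δ/2) (fun x => residual ε χ A (prim D₁) x - residual ε χ A (prim D₂) x) := by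
  have hQ := h.one_le
  have hA1 : ‖A‖ ≤ 1 := hA.trans (by rw [div_le_one (by positivity)]; linarith)
  have a3 := hd.adm_prim hk
  have hδ : 0 ≤ 2*δ := a3.nonneg
  have e : prim (fun x => D₁ x - D₂ x) = fun x => prim D₁ x - prim D₂ x := by
    funext x; rw [prim_sub (by linarith) h1 h2]
  rw [e] at a3
  refine (h.lip A hA1 _ _ _ _ _ _ _ (h1.adm_prim hk) (conjEven_prim _) (h2.adm_prim hk)
    (conjEven_prim _) a3).mono ?_
  have h3 : ‖A‖ + 2*(1/(8*Q)) ≤ 3*(1/(8*Q)) := by linarith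
  have h4 : Q*(3*(1/(8*Q)))^2 ≤ 1/4 := by
    have : Q*(3*(1/(8*Q)))^2 = 9/(64*Q) := by field_simp; norm_num
    rw [this, div_le_div_iff₀ (by positivity) (by norm_num)]
    linarith
  have h5 : Q*(‖A‖ + 2*(1/(8*Q)))^2 ≤ 1/4 := by
    refine le_trans ?_ h4
    gcongr
  calc _ ≤ 1/4*(2*δ) := by gcongr
    _ = _ := by ring

lemma ResidualBounds.exists_fixedPoint (h : ResidualBounds k ε χ Q) (hk : 1/2 ≤ k)
    (c1 : ContinuousOn (deriv χ) (Ioi 0)) (hA : ‖A‖ ≤ 1/(16*Q^2)) :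
    ∃ D, Decay k (2*Q*‖A‖) D ∧ ∀ x, 0 < x → residual ε χ A (prim D) x = D x := by
  have hQ := h.one_le
  have hQA : 16*Q^2*‖A‖ ≤ 1 := by rw [le_div_iff₀ (by positivity)] at hA; linarith
  have hA0 := norm_nonneg A
  have hA8 : ‖A‖ ≤ 1/(8*Q) := by rw [le_div_iff₀ (by positivity)]; nlinarith
  have hA1 : ‖A‖ ≤ 1 := by nlinarith
  have hle : 2*Q*‖A‖ ≤ 1/(8*Q) := by rw [le_div_iff₀ (by positivity)]; nlinarith
  refine exists_decay_fixedPoint (by linarith) (fun D => residual ε χ A (prim D)) (fun D hD => ?_)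
    (fun D₁ D₂ h1 h2 δ hδ => h.contraction hk hA8 (h1.mono hle) (h2.mono hle) hδ) (by positivity)
  refine (h.decay_residual hA1 (hD.adm_prim hk) (conjEven_prim D) c1).mono ?_
  have h1 : ‖A‖ + 2*(2*Q*‖A‖) ≤ 5*(Q*‖A‖) := by nlinarith
  have h2 : Q*(‖A‖ + 2*(2*Q*‖A‖))^3 ≤ Q*(5*(Q*‖A‖))^3 := by gcongr
  have h3 : (16*Q^2*‖A‖)^2 ≤ 1 := pow_le_one₀ (by positivity) hQA
  have h5 : (16*Q^2*‖A‖)^2*‖A‖ ≤ 1*(Q*‖A‖) := by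
    gcongr
    linarith
  linarith

lemma ResidualBounds.unique (h : ResidualBounds k ε χ Q) (hk : 1/2 ≤ k) (hA : ‖A‖ ≤ 1/(8*Q))
    (h1 : Decay k (1/(8*Q)) D₁) (h2 : Decay k (1/(8*Q)) D₂)
    (e1 : ∀ x, 0 < x → residual ε χ A (prim D₁) x = D₁ x)
    (e2 : ∀ x, 0 < x → residual ε χ A (prim D₂) x = D₂ x) (hx : 0 < x) : D₁ x = D₂ x := by
  have hd : Decay k (1/(8*Q) + 1/(8*Q)) (fun x => D₁ x - D₂ x) :=
    ⟨h1.cont.sub h2.cont, fun x hx => by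
      rw [add_mul]; exact norm_sub_le_of_le (h1.bd x hx) (h2.bd x hx)⟩
  refine eq_of_decay_half hd (fun δ hδ => ?_) hx
  have := h.contraction hk hA h1 h2 hδ
  exact ⟨hδ.cont, fun x hx => by
    have := this.bd x hx
    grind⟩

lemma integral_deriv_cutoff (h : SmoothCutoff χ C) (hk : 1/2 ≤ k) (hk1 : k ≤ 1) (A : ℂ) (hx : 0 ≤ x)
    : IntegrableOn (fun t => A*((deriv χ t : ℝ) : ℂ)) (Ioi x) ∧ ∫ t in Ioi x,
    A*((deriv χ t : ℝ) : ℂ) = A*((1 - χ x : ℝ) : ℂ) := by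
  have c1 : Continuous (deriv χ) := continuous_iff_continuousAt.2 fun x => (h.deriv' x).continuousAt
  have hd : Decay k (9*C*‖A‖) (fun t => A*((deriv χ t : ℝ) : ℂ)) := by
    refine ⟨by fun_prop, fun ξ hξ => ?_⟩
    rw [norm_mul, norm_real, norm_eq_abs]
    calc _ ≤ ‖A‖*(9*C*(1 + |ξ|)^(-(1 + k))) := by gcongr; exact abs_deriv_cutoff_le h hk1 hξ
      _ = _ := by ring
  have hi := hd.integrableOn (by linarith) hx
  refine ⟨hi, ?_⟩
  have lim : Tendsto (fun t => A*(χ t : ℂ)) atTop (𝓝 (A*((1 : ℝ) : ℂ))) := by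
    refine tendsto_const_nhds.congr' ?_
    filter_upwards [eventually_gt_atTop 2] with t ht
    rw [h.one t ht]
  rw [integral_Ioi_of_hasDerivAt_of_tendsto' (fun t _ => (h.deriv t).ofReal_comp.const_mul A) hi
    lim]
  push_cast; ring

lemma deriv_lowPart (h : SmoothCutoff χ C) (hx : x ≠ 0) : ‖deriv (lowPart χ) x‖ = |deriv χ (|x|)| :=
    by
  have h1 : HasDerivAt (fun y : ℝ => ((1 - χ |y| : ℝ) : ℂ))
      ((-(deriv χ |x| * SignType.sign x) : ℝ) : ℂ) x :=
    (((h.deriv |x|).comp x (hasDerivAt_abs hx)).const_sub 1).ofReal_comp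
  have h2 : HasDerivAt (lowPart χ) ((-(deriv χ |x| * SignType.sign x) : ℝ) : ℂ) x := h1
  rw [h2.deriv, norm_real, norm_eq_abs, abs_neg, abs_mul]
  rcases lt_or_gt_of_ne hx with h0 | h0
  · rw [sign_neg h0]; simp
  · rw [sign_pos h0]; simp

/-- The fixed point is the low-frequency correction `A (1 - χ)`, up to a cubic error. -/
lemma ResidualBounds.norm_prim_le (h : ResidualBounds k ε χ Q) (hχ : SmoothCutoff χ C)
    (hk : 1/2 ≤ k) (hk1 : k ≤ 1) (hA : ‖A‖ ≤ 1) {D : ℝ → ℂ} (hD : Decay k (2*Q*‖A‖) D)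
    (e : ∀ x, 0 < x → residual ε χ A (prim D) x = D x) : (∀ x, x ≠ 0 → ‖prim D x‖ ≤ ‖A‖*‖lowPart χ
    x‖ + 250*Q^4*‖A‖^3*(1 + |x|)^(-k)) ∧ (∀ x, x ≠ 0 → ‖deriv (prim D) x‖ ≤ ‖A‖*‖deriv (lowPart χ)
    x‖ + 250*Q^4*‖A‖^3*(1 + |x|)^(-(1 + k))) ∧ ∀ x, 0 < x → x < 1 → ‖prim D x - -∫ t in Ioi 0, D t‖
    ≤ 250*Q^4*‖A‖^3*x := by
  have hQ := h.one_le
  have hA0 := norm_nonneg A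
  have hk0 : 0 < k := by linarith
  have c4 : Q*(‖A‖ + 2*(2*Q*‖A‖))^3 ≤ 125*Q^4*‖A‖^3 := by
    have h1 : ‖A‖ + 2*(2*Q*‖A‖) ≤ 5*(Q*‖A‖) := by nlinarith
    calc _ ≤ Q*(5*(Q*‖A‖))^3 := by gcongr
      _ = _ := by ring
  have hR' := (h.decay A hA _ _ _ (hD.adm_prim hk) (conjEven_prim D)).mono c4
  have hR : Decay k (125*Q^4*‖A‖^3) (fun x => D x + A*((deriv χ x : ℝ) : ℂ)) :=
    ⟨hR'.cont.congr fun x hx => by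
      grind, fun x hx => by
      have := hR'.bd x hx
      rwa [e x hx] at this⟩
  set c := 125*Q^4*‖A‖^3 with hc
  have h2c : 250*Q^4*‖A‖^3 = 2*c := by rw [hc]; ring
  rw [h2c]
  have val : ∀ x : ℝ, 0 ≤ x → ‖∫ t in Ioi x, D t‖ ≤
      ‖A‖*‖lowPart χ x‖ + 2*c*(1 + |x|)^(-k) := fun x hx => by
    obtain ⟨hi, hv⟩ := integral_deriv_cutoff hχ hk hk1 A hx
    have e1 : ∫ t in Ioi x, D t = (∫ t in Ioi x, (D t + A*((deriv χ t : ℝ) : ℂ))) -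
        A*((1 - χ x : ℝ) : ℂ) := by
      rw [← hv, integral_add (hD.integrableOn hk0 hx) hi]; ring
    rw [e1]
    refine (norm_sub_le _ _).trans ?_
    rw [norm_mul, lowPart, abs_of_nonneg hx]
    have := hR.norm_integral_le hk hx
    rw [abs_of_nonneg hx] at this
    linarith
  have der : ∀ x : ℝ, 0 < x → ‖D x‖ ≤ ‖A‖*|deriv χ x| + 2*c*(1 + |x|)^(-(1 + k)) := fun x hx => by
    have t1 := hR.bd x hx
    have t2 := norm_sub_le (D x + A*((deriv χ x : ℝ) : ℂ)) (A*((deriv χ x : ℝ) : ℂ))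
    rw [add_sub_cancel_right, norm_mul, norm_real, norm_eq_abs] at t2
    have : 0 ≤ c*(1 + |x|)^(-(1 + k)) := by positivity
    linarith
  refine ⟨fun x hx => ?_, fun x hx => ?_, fun x hx hx1 => ?_⟩
  · rcases lt_or_gt_of_ne hx with h0 | h0
    · have := val (-x) (by linarith)
      rw [prim, if_neg (not_lt.2 h0.le), RCLike.norm_conj, norm_neg]
      rwa [abs_neg, lowPart, abs_neg, ← lowPart] at this
    · rw [prim, if_pos h0, norm_neg]; exact val x h0.le
  · rw [(hD.hasDerivAt_prim hk0 hx).deriv, deriv_lowPart hχ hx]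
    rcases lt_or_gt_of_ne hx with h0 | h0
    · have := der (-x) (by linarith)
      rw [prim', if_neg (not_lt.2 h0.le), norm_neg, RCLike.norm_conj, abs_of_neg h0]
      rwa [abs_neg, abs_of_neg h0] at this
    · rw [prim', if_pos h0, abs_of_pos h0]
      have := der x h0
      rwa [abs_of_pos h0] at this
  · have e1 := integral_Ioi_sub_Ioi' (a := 0) (b := x) (f := D)
      (hD.integrableOn hk0 le_rfl) (hD.integrableOn hk0 hx.le)
    have e2 : prim D x - -∫ t in Ioi 0, D t = ∫ t in (0 : ℝ)..x, D t := by
      rw [prim, if_pos hx, ← e1]; ring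
    rw [e2]
    have := norm_ii_le_const (a := 0) (b := x) (f := D) (C := 2*c) (fun t ht => by
        rw [uIoc_of_le hx.le] at ht
        have t1 := der t ht.1
        have t2 : (1 + |t|)^(-(1 + k)) ≤ 1 := wt_le_one (by linarith)
        rw [hχ.zero' t (by linarith [ht.2]), abs_zero, mul_zero, zero_add] at t1
        exact t1.trans (mul_le_of_le_one_right (by positivity) t2))
    rwa [sub_zero, abs_of_pos hx] at this

end
lemma ofReal_mul_add_le {N : ENNReal} (hN : N < ENNReal.ofReal M) (ha : 0 ≤ a) (hb : 0 ≤ b)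
    (h : b ≤ (M - N.toReal)*a) : ENNReal.ofReal a*N + ENNReal.ofReal b ≤ ENNReal.ofReal (M*a) := by
  have e : N = ENNReal.ofReal N.toReal := (ENNReal.ofReal_toReal hN.ne_top).symm
  rw [e, ← ENNReal.ofReal_mul ha, ← ENNReal.ofReal_add (by positivity) hb]
  exact ENNReal.ofReal_le_ofReal (by linarith)

lemma toReal_lt_of_lt_ofReal {N : ENNReal} (hN : N < ENNReal.ofReal M) : 0 < M ∧ N.toReal < M := by
  have hM : 0 < M := ENNReal.ofReal_pos.1 (pos_of_gt hN)
  refine ⟨hM, ?_⟩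
  have := (ENNReal.toReal_lt_toReal hN.ne_top ENNReal.ofReal_ne_top).2 hN
  rwa [ENNReal.toReal_ofReal hM.le] at this

end SelfSimilar

end

open SelfSimilar
theorem theorem2 (k : ℝ) (hk : k ∈ Set.Ioo (1 / 2 : ℝ) (4 / 7)) (χ : ℝ → ℝ) (hχ : IsCutoff χ)
    (ε : ℝ) (hε : ε = 1 ∨ ε = -1) :
    ∃ r : ℝ, 0 < r ∧
    ∀ M C : ℝ, zNorm k (lowPart χ) < ENNReal.ofReal M →
      modNorm k 1 (lowPart χ) < ENNReal.ofReal C →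
    ∃ ε₁ : ℝ, 0 < ε₁ ∧ ∀ A : ℂ, ‖A‖ < ε₁ →
      -- the map is well defined on the whole space
      (∀ w ∈ Zspace k, Converges ε χ A w) ∧
      ∃ z ∈ Zspace k,
        -- `z` is a fixed point in the ball of radius `r`, and even of radius `M |A|`
        (∀ ξ : ℝ, ξ ≠ 0 → PsiTilde ε χ A z ξ = z ξ) ∧
        zNorm k z ≤ ENNReal.ofReal r ∧
        zNorm k z ≤ ENNReal.ofReal (M * ‖A‖) ∧
        -- it is the only fixed point in the ball of radius `r`
        (∀ w ∈ Zspace k, zNorm k w ≤ ENNReal.ofReal r →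
          (∀ ξ : ℝ, ξ ≠ 0 → PsiTilde ε χ A w ξ = w ξ) → ∀ ξ : ℝ, ξ ≠ 0 → w ξ = z ξ) ∧
        -- the modified norm
        modNorm k (constZero ε χ A z) z ≤ ENNReal.ofReal (C * ‖A‖) ∧
        (A ≠ 0 → modNorm k (constZero ε χ A z) z < ENNReal.ofReal (C * ‖A‖)) ∧
        -- the integral equation for `v = S_A + z`
        (∀ ξ : ℝ, 0 < ξ →
          (ansatz ε χ A + z) ξ =
            (constC ε χ A z : ℂ) + 3 * Complex.I / (2 * Real.pi) * (constAlpha ε χ A z : ℂ)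
              - 3 * Complex.I * ε / (4 * Real.pi ^ 2) *
                ∫ η in (0 : ℝ)..ξ, cubicI (ansatz ε χ A + z) η) ∧
        (∀ ξ : ℝ, 0 < ξ → (ansatz ε χ A + z) (-ξ) = (starRingEnd ℂ) ((ansatz ε χ A + z) ξ)) := by
  classical
  have hk1 : (1/2 : ℝ) ≤ k := hk.1.le
  have hk2 : k ≤ 7/10 := hk.2.le.trans (by norm_num)
  have hk0 : 0 < k := by linarith
  have hεa : |ε| = 1 := by grind
  obtain ⟨C₀, hC⟩ := hχ.exists_data
  obtain ⟨Q, hQ⟩ := exists_residualBounds hC hεa hk1 hk2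
  have hQ1 := hQ.one_le
  have c1 : ContinuousOn (deriv χ) (Ioi 0) := fun x _ =>
    (hC.deriv' x).continuousAt.continuousWithinAt
  have hr : (0 : ℝ) < 1/(64*Q) := by positivity
  refine ⟨1/(64*Q), hr, fun M C hM hCm => ?_⟩
  obtain ⟨hM0, hM1⟩ := toReal_lt_of_lt_ofReal hM
  obtain ⟨hC0, hC1⟩ := toReal_lt_of_lt_ofReal hCm
  set m := (zNorm k (lowPart χ)).toReal with hm
  set m' := (modNorm k 1 (lowPart χ)).toReal with hm'
  have p1 : 0 < 1/(16*Q^2) := by positivity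
  have p2 : 0 < 1/(64*Q)/M := by positivity
  have p3 : 0 < (M - m)/(1500*Q^4) := div_pos (by linarith) (by positivity)
  have p4 : 0 < (C - m')/(2000*Q^4) := div_pos (by linarith) (by positivity)
  refine ⟨min (min (1/(16*Q^2)) (1/(64*Q)/M)) (min ((M - m)/(1500*Q^4)) ((C - m')/(2000*Q^4))),
    lt_min (lt_min p1 p2) (lt_min p3 p4), fun A hA => ?_⟩
  obtain ⟨hA12, hA34⟩ := lt_min_iff.1 hA
  obtain ⟨hA1, hA2⟩ := lt_min_iff.1 hA12
  obtain ⟨hA3, hA4⟩ := lt_min_iff.1 hA34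
  have hA0 := norm_nonneg A
  have hQA : ‖A‖*(16*Q^2) < 1 := (lt_div_iff₀ (by positivity)).1 hA1
  have hAQ : Q*‖A‖ ≤ 1/16 := by nlinarith
  have hAone : ‖A‖ ≤ 1 := by nlinarith
  have hA8 : ‖A‖ ≤ 1/(8*Q) := by rw [le_div_iff₀ (by positivity)]; linarith
  have hQA2 : 2*Q*‖A‖ ≤ 1/(8*Q) := by rw [le_div_iff₀ (by positivity)]; linarith
  obtain ⟨D, hD, hDe⟩ := hQ.exists_fixedPoint hk1 c1 hA1.le
  have hz := hD.adm_prim hk1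
  have ez := conjEven_prim D
  obtain ⟨b1, b2, b3⟩ := hQ.norm_prim_le hC hk1 (by linarith) hAone hD hDe
  have fixed : ∀ ξ : ℝ, ξ ≠ 0 → PsiTilde ε χ A (prim D) ξ = prim D ξ := fun ξ hξ => by
    rw [PsiTilde_eq_prim hC hεa hAone hk1 hk2 hz ez hξ, prim_congr hDe]
  have hA3' : 6*(250*Q^4*‖A‖^3) ≤ (M - m)*‖A‖ := by
    have h1 : ‖A‖*(1500*Q^4) ≤ M - m := ((lt_div_iff₀ (by positivity)).1 hA3).le
    calc _ = ‖A‖*(1500*Q^4)*(‖A‖*‖A‖) := by ring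
      _ ≤ (M - m)*(1*‖A‖) := by gcongr
      _ = _ := by ring
  have hA4' : 4*(250*Q^4*‖A‖^3) ≤ (C - m')/2*‖A‖ := by
    have h1 : ‖A‖*(2000*Q^4) ≤ C - m' := ((lt_div_iff₀ (by positivity)).1 hA4).le
    calc _ = ‖A‖*(2000*Q^4)/2*(‖A‖*‖A‖) := by ring
      _ ≤ (C - m')/2*(1*‖A‖) := by gcongr
      _ = _ := by ring
  have zn : zNorm k (prim D) ≤ ENNReal.ofReal (M*‖A‖) :=
    (zNorm_le_mul_add hk0.le hA0 (by positivity) b1 b2).trans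
      (ofReal_mul_add_le hM hA0 (by positivity) hA3')
  have hMr : M*‖A‖ ≤ 1/(64*Q) := by
    have := (lt_div_iff₀ hM0).1 hA2
    linarith
  have hγ : constZero ε χ A (prim D) = -∫ t in Ioi 0, D t := by
    rw [constZero_eq_integral hC hεa hAone hk1 hk2 hz ez]
    congr 1
    exact setIntegral_congr_fun measurableSet_Ioi fun t ht => hDe t ht
  have mn : modNorm k (constZero ε χ A (prim D)) (prim D) ≤ ENNReal.ofReal ((C + m')/2*‖A‖) := by
    rw [hγ]
    refine (modNorm_le_mul_add hk0.le hA0 (by positivity) b3 (fun x hx => b1 x hx.ne')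
      fun x hx => b2 x hx.ne').trans ?_
    rw [← ENNReal.ofReal_toReal hCm.ne_top, ← hm', ← ENNReal.ofReal_mul hA0,
      ← ENNReal.ofReal_add (by positivity) (by positivity)]
    exact ENNReal.ofReal_le_ofReal (by linarith)
  have mlt : (C + m')/2 < C := by linarith
  refine ⟨fun w hw => ?_, prim D, hD.prim_mem_Zspace hk1, fixed,
    zn.trans (ENNReal.ofReal_le_ofReal hMr), zn, fun w hw hwr hwf ξ hξ => ?_,
    mn.trans (ENNReal.ofReal_le_ofReal (by gcongr)), fun hA => mn.trans_lt ?_, fun ξ hξ => ?_,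
    fun ξ hξ => ?_⟩
  · obtain ⟨w', hw'⟩ := adm_of_mem_Zspace hk0.le (by linarith) hw
      (ρ := (zNorm k w).toReal) ENNReal.toReal_nonneg (ENNReal.ofReal_toReal hw.2.2.2.ne).ge
    exact converges_of_adm hC hεa hAone hk1 hk2 hw' (conjEven_of_mem_Zspace hw)
  · obtain ⟨w', hw'⟩ := adm_of_mem_Zspace hk0.le (by linarith) hw hr.le hwr
    have ew := conjEven_of_mem_Zspace hw
    have hprim : ∀ x, x ≠ 0 → w x = prim (residual ε χ A w) x := fun x hx => by
      rw [← PsiTilde_eq_prim hC hεa hAone hk1 hk2 hw' ew hx, hwf x hx]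
    have hdw : Decay k (1/(8*Q)) (residual ε χ A w) := by
      refine (hQ.decay_residual hAone hw' ew c1).mono ?_
      have h1 : ‖A‖ + 4*(1/(64*Q)) ≤ 1/(8*Q) := by
        have e1 : 4*(1/(64*Q)) = 1/(16*Q) := by field_simp; norm_num
        have e2 : 1/(8*Q) = 1/(16*Q) + 1/(16*Q) := by field_simp; norm_num
        have e3 : ‖A‖ ≤ 1/(16*Q) := by rw [le_div_iff₀ (by positivity)]; linarith
        linarith
      have h2 : Q*(‖A‖ + 4*(1/(64*Q)))^3 ≤ 1/(16*Q) := by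
        calc _ ≤ Q*(1/(8*Q))^3 := by gcongr
          _ = 1/(512*Q^2) := by field_simp; norm_num
          _ ≤ _ := by rw [div_le_div_iff₀ (by positivity) (by positivity)]; nlinarith
      have e2 : 1/(8*Q) = 1/(16*Q) + 1/(16*Q) := by field_simp; norm_num
      linarith
    have hfw : ∀ x, 0 < x → residual ε χ A (prim (residual ε χ A w)) x = residual ε χ A w x :=
      fun x _ => (residual_congr hprim x).symm
    rw [hprim ξ hξ, prim_congr fun x hx => hQ.unique hk1 hA8 hdw (hD.mono hQA2) hfw hDe hx]
  · exact (ENNReal.ofReal_lt_ofReal_iff (by positivity)).2 (by gcongr)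
  · have h1 := fixed ξ hξ.ne'
    rw [PsiTilde, Psi_of_pos ε χ A (prim D) _ hξ, constZero, prefactor] at h1
    rw [Pi.add_apply, ← h1]
    ring
  · rw [Pi.add_apply, Pi.add_apply, map_add, ansatz_neg ε χ A hξ, (hD.prim_mem_Zspace hk1).2.2.1 ξ hξ]
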